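/- **Setting.** Let $d\ge1$, $1<p\le q<\infty$, $q'=q/(q-1)$, $p'=p/(p-1)$, $0<\gamma<1$ and $\kappa>0$. A dyadic lattice is a collection $\mathscr D$ of half-open axis-parallel cubes of $\mathbb R^d$ such that: (i) all side lengths are of the form $2^k$, $k\in\mathbb Z$; (ii) dyadic subcubes of cubes in $\mathscr D$ are in $\mathscr D$; (iii) any two cubes in $\mathscr D$ are dyadic subcubes of a common cube in $\mathscr D$; (iv) every compact set is contained in a cube of $\mathscr D$. A family $\mathscr Q$ of cubes is $\gamma$-sparse if there are pairwise disjoint measurable sets $E_Q\subset Q$ $(Q\in\mathscr Q)$ with $|E_Q|\ge\gamma|Q|$. Fix a dyadic lattice $\mathscr D$ and real Banach spaces $B_1,B_2$. Let $S_B$ be the space of finite sums $\sum_i a_i\mathbb 1_{Q_i}$ with $a_i\in B$, $Q_i\in\mathscr D$. Write $\mathrm{Dil}_tf(x)=f(tx)$, $\mathrm{Dil}_tT=\mathrm{Dil}_t\circ T\circ\mathrm{Dil}_{1/t}$ and $\Delta_hf(x)=f(x+h)-f(x)$. **BRS operators.** For $j\in\mathbb Z$ let $T_j$ be a linear operator from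 $S_{B_1}$ to weakly measurable $B_2$-valued functions such that $x\mapsto\langle T_jf(x),\lambda\rangle$ is locally integrable for all $f\in S_{B_1}$, $\lambda\in B_2^*$. Suppose that there are constants $A(p),A(q),A_\circ,B\ge0$ with - (T1) $\operatorname{supp}(\mathrm{Dil}_{2^j}T_j)f\subset\{x:\operatorname{dist}(x,\operatorname{supp}f)\le1\}$ for all $j$ and all $f$ in the domain of $\mathrm{Dil}_{2^j}T_j$; - (T2) $\sup_j\|\mathrm{Dil}_{2^j}T_j\|_{L^p_{B_1}\to L^q_{B_2}}\le A_\circ$; - (T3) $\|(\mathrm{Dil}_{2^j}T_j)\circ\Delta_h\|_{L^p_{B_1}\to L^q_{B_2}}\le B|h|^{\kappa}$ for all $j$ and $|h|\le1$, where $T_j$ is extended to $L^p_{B_1}$ by continuity; - (T4) $\|(\mathrm{Dil}_{2^j}T_j^*)\circ\Delta_h\|_{L^{q'}_{B_2^*}\to L^{p'}_{B_1^*}}\le B|h|^\kappa$ for all $j$ and $|h|\le1$, where the norm of $(\mathrm{Dil}_{2^j}T_j^*)\Delta_hg$ is taken in $(L^p_{B_1})^*\supset L^{p'}_{B_1^*}$,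 that is, $|\langle(\mathrm{Dil}_{2^j}T_j)f,\Delta_hg\rangle|\le B|h|^\kappa\|f\|_{L^p_{B_1}}\|g\|_{L^{q'}_{B_2^*}}$; - (T5) $\big\|\sum_{j=M_1}^{M_2}T_j\big\|_{L^p_{B_1}\to L^{p,\infty}_{B_2}}\le A(p)$ for all integers $M_1\le M_2$; - (T6) $\big\|\sum_{j=M_1}^{M_2}T_j\big\|_{L^{q,1}_{B_1}\to L^{q}_{B_2}}\le A(q)$ for all integers $M_1\le M_2$. In (T2), (T5), (T6) the bounds are tested on functions on which the operators are defined. **Convex bodies.** For a real normed space $X$ and $\vec x\in X^n$ let $\langle\!\langle\vec x\rangle\!\rangle_X=\{(\langle x_i,x^*\rangle)_{i=1}^n:\|x^*\|_{X^*}\le1\}\subset\mathbb R^n$. For $\vec y\in Y^n$ the set $\{a\cdot b:a\in\langle\!\langle\vec x\rangle\!\rangle_X,\ b\in\langle\!\langle\vec y\rangle\!\rangle_Y\}$ is an interval $[-c,c]$, and $\langle\!\langle\vec x\rangle\!\rangle_X\cdot\langle\!\langle\vec y\rangle\!\rangle_Y$ denotes its right end point $c$. Let $Ł^p(Q,B)$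 be the $L^p$ space of $B$-valued functions on $Q$ with norm $\big(\frac1{|Q|}\int_Q|f|_B^p\,dx\big)^{1/p}$. **Theorem.** There is a constant $C>0$ depending only on $d,p,q,\gamma,\kappa$ such that the following holds. Let $B_1,B_2,\mathscr D$ and $(T_j)_{j\in\mathbb Z}$ be as above, let $N_1\le N_2$ be integers and $T=\sum_{j=N_1}^{N_2}T_j$. For all $n$ and all $\vec f\in (S_{B_1})^n$, $\vec g\in (S_{B_2^*})^n$ there is a $\gamma$-sparse family $\mathscr Q$ of cubes, contained in some dyadic lattice (which may depend on $\vec f,\vec g$), such that the sum below converges and $$\Big|\sum_{i=1}^n\int_{\mathbb R^d}\langle Tf_i(x),g_i(x)\rangle\,dx\Big|\le C\,\mathcal C\,n^{\frac32+\frac1p+\frac1{q'}}\sum_{Q\in\mathscr Q}|Q|\,\langle\!\langle\vec f\rangle\!\rangle_{Ł^p(Q,B_1)}\cdot\langle\!\langle\vec g\rangle\!\rangle_{Ł^{q'}(Q,B_2^*)},$$ where $\mathcal C=A(p)+A(q)+A_\circ\log\big(2+\tfrac{B}{A_\circ}\big)$ (the last term being $0$ if $A_\circ=0$). -/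

import Mathlib

open MeasureTheory
open scoped ENNReal NNReal

noncomputable section

/-- A half-open cube `∏ᵢ [aᵢ, aᵢ + ℓ)` in `ℝ^d`, given by its corner `a` and its side length
`ℓ > 0`. -/
structure Cube (d : ℕ) where
  corner : EuclideanSpace ℝ (Fin d)
  side : ℝ
  side_pos : 0 < side

/-- The set of points of a cube. -/
def Cube.toSet {d : ℕ} (Q : Cube d) : Set (EuclideanSpace ℝ (Fin d)) :=
  {x | ∀ i, Q.corner i ≤ x i ∧ x i < Q.corner i + Q.side}

/-- `𝒟(Q)`: the dyadic subcubes of `Q`, obtained by dividing each edge of `Q` into `2^k` equal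
parts, for `k = 0, 1, 2, …`. -/
def Cube.dyadicSubcubes {d : ℕ} (Q : Cube d) : Set (Cube d) :=
  {R | ∃ k : ℕ, R.side = Q.side / 2 ^ k ∧
    ∀ i, ∃ m : ℕ, m < 2 ^ k ∧ R.corner i = Q.corner i + m * (Q.side / 2 ^ k)}

/-- Dyadic lattices. -/
structure IsDyadicLattice {d : ℕ} (D : Set (Cube d)) : Prop where
  side_eq : ∀ Q ∈ D, ∃ k : ℤ, Q.side = (2 : ℝ) ^ k
  subcube_mem : ∀ Q ∈ D, Q.dyadicSubcubes ⊆ D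
  common_ancestor : ∀ Q' ∈ D, ∀ Q'' ∈ D,
    ∃ Q ∈ D, Q' ∈ Q.dyadicSubcubes ∧ Q'' ∈ Q.dyadicSubcubes
  compact_subset : ∀ K : Set (EuclideanSpace ℝ (Fin d)), IsCompact K → ∃ Q ∈ D, K ⊆ Q.toSet

/-- `γ`-sparse collections of cubes. -/
def IsSparse {d : ℕ} (γ : ℝ) (𝒬 : Set (Cube d)) : Prop :=
  ∃ E : Cube d → Set (EuclideanSpace ℝ (Fin d)),
    (∀ Q ∈ 𝒬, MeasurableSet (E Q) ∧ E Q ⊆ Q.toSet ∧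
      γ * volume.real Q.toSet ≤ volume.real (E Q)) ∧
    𝒬.PairwiseDisjoint E

/-- The space `S_B` of finite sums `∑ aᵢ 𝟙_{Qᵢ}` with `aᵢ ∈ B` and `Qᵢ` in the lattice `D`. -/
def simpleSpace {d : ℕ} (D : Set (Cube d)) (B : Type*) [NormedAddCommGroup B]
    [NormedSpace ℝ B] : Submodule ℝ (EuclideanSpace ℝ (Fin d) → B) :=
  Submodule.span ℝ {f | ∃ Q ∈ D, ∃ a : B, f = Q.toSet.indicator fun _ => a}

theorem Cube.measurableSet_toSet {d : ℕ} (Q : Cube d) : MeasurableSet Q.toSet := by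
  have h : Q.toSet = ⋂ i, {x : EuclideanSpace ℝ (Fin d) | Q.corner i ≤ x i} ∩
      {x | x i < Q.corner i + Q.side} := by
    ext x
    simp [Cube.toSet]
  rw [h]
  refine MeasurableSet.iInter fun i => MeasurableSet.inter ?_ ?_
  · exact measurableSet_le measurable_const (by fun_prop)
  · exact measurableSet_lt (by fun_prop) measurable_const

theorem simpleSpace_memLp {d : ℕ} {D : Set (Cube d)} {B : Type*} [NormedAddCommGroup B]
    [NormedSpace ℝ B] (f : simpleSpace D B) (p : ℝ≥0∞)
    (μ : Measure (EuclideanSpace ℝ (Fin d))) [IsFiniteMeasure μ] :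
    MemLp (f : EuclideanSpace ℝ (Fin d) → B) p μ := by
  obtain ⟨f, hf⟩ := f
  refine Submodule.span_induction ?_ ?_ ?_ ?_ hf
  · rintro _ ⟨Q, -, a, rfl⟩
    exact (memLp_const a).indicator Q.measurableSet_toSet
  · exact MemLp.zero
  · intro f g _ _ hf hg
    exact hf.add hg
  · intro c f _ hf
    exact hf.const_smul c

/-- The convex body `⟪x⟫_X = {(x*(xᵢ))ᵢ : ‖x*‖ ≤ 1} ⊆ ℝⁿ` of a vector `x ∈ Xⁿ`. -/
def convexBody {n : ℕ} {X : Type*} [NormedAddCommGroup X] [NormedSpace ℝ X] (x : Fin n → X) :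
    Set (Fin n → ℝ) :=
  {v | ∃ φ : StrongDual ℝ X, ‖φ‖ ≤ 1 ∧ v = fun i => φ (x i)}

/-- The Minkowski dot product `A · B = {a · b : a ∈ A, b ∈ B}`. -/
def minkowskiDot {n : ℕ} (A B : Set (Fin n → ℝ)) : Set ℝ :=
  {r | ∃ a ∈ A, ∃ b ∈ B, r = a ⬝ᵥ b}

/-- For convex bodies the Minkowski dot product is a compact interval `[-c, c]`, which is
identified with its right end point `c`. -/
def bodyDot {n : ℕ} (A B : Set (Fin n → ℝ)) : ℝ := sSup (minkowskiDot A B)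

/-- The convex body of `f ∈ (S_B)ⁿ` in the space `Ł^p(Q, B)` with norm `(⨍_Q |f|^p)^{1/p}`.
This is the Bochner `L^p` space of the normalized Lebesgue measure on `Q`. -/
def avgConvexBody {d n : ℕ} {D : Set (Cube d)} {B : Type*} [NormedAddCommGroup B]
    [NormedSpace ℝ B] {p : ℝ} (hp : 1 < p) (Q : Cube d) (f : Fin n → simpleSpace D B) :
    Set (Fin n → ℝ) :=
  haveI : Fact (1 ≤ ENNReal.ofReal p) := ⟨ENNReal.one_le_ofReal.2 hp.le⟩
  convexBody (X := Lp B (ENNReal.ofReal p) (ProbabilityTheory.cond volume Q.toSet))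
    fun i => (simpleSpace_memLp (f i) (ENNReal.ofReal p) _).toLp (f i)

theorem one_lt_conjExponent {q : ℝ} (hq : 1 < q) : 1 < q.conjExponent :=
  (Real.HolderConjugate.conjExponent hq).symm.lt

/-- The weak norm `‖f‖_{L^{p,∞}} = sup_{t>0} t |{|f| > t}|^{1/p}`. -/
def weakLpNorm {d : ℕ} {B : Type*} [NormedAddCommGroup B] (p : ℝ)
    (f : EuclideanSpace ℝ (Fin d) → B) : ℝ≥0∞ :=
  ⨆ t : ℝ≥0, (t : ℝ≥0∞) * volume {x | (t : ℝ≥0∞) < ‖f x‖ₑ} ^ (1 / p)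

/-- The Lorentz norm `‖f‖_{L^{q,1}} = q ∫₀^∞ |{|f| > t}|^{1/q} dt`. -/
def lorentzOneNorm {d : ℕ} {B : Type*} [NormedAddCommGroup B] (q : ℝ)
    (f : EuclideanSpace ℝ (Fin d) → B) : ℝ≥0∞ :=
  ENNReal.ofReal q *
    ∫⁻ t in Set.Ioi (0 : ℝ), volume {x | ENNReal.ofReal t < ‖f x‖ₑ} ^ (1 / q)

/-- `Dil_t f (x) = f (t x)`. -/
def dil {d : ℕ} {B : Type*} (t : ℝ) (f : EuclideanSpace ℝ (Fin d) → B) :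
    EuclideanSpace ℝ (Fin d) → B :=
  fun x => f (t • x)

/-- `Δ_h f (x) = f (x + h) - f (x)`. -/
def shiftDiff {d : ℕ} {B : Type*} [NormedAddCommGroup B] (h : EuclideanSpace ℝ (Fin d))
    (f : EuclideanSpace ℝ (Fin d) → B) : EuclideanSpace ℝ (Fin d) → B :=
  fun x => f (x + h) - f x

section Operators

variable {d : ℕ} {D : Set (Cube d)} {B₁ B₂ : Type*} [NormedAddCommGroup B₁] [NormedSpace ℝ B₁]
  [NormedAddCommGroup B₂] [NormedSpace ℝ B₂]

/-- The dilated operator `Dil_t T = Dil_t ∘ T ∘ Dil_{1/t}`, on its natural domain, the functions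
`f` with `Dil_{1/t} f` in the domain of `T`. -/
def dilOp (T : simpleSpace D B₁ →ₗ[ℝ] (EuclideanSpace ℝ (Fin d) → B₂)) (t : ℝ)
    (f : EuclideanSpace ℝ (Fin d) → B₁) (hf : dil t⁻¹ f ∈ simpleSpace D B₁) :
    EuclideanSpace ℝ (Fin d) → B₂ :=
  dil t (T ⟨dil t⁻¹ f, hf⟩)

/-- The pairing `⟨f, (Dil_t T*) g⟩`. As dilation commutes with passing to the adjoint, this is
`⟨(Dil_t T) f, g⟩ = ∫ ⟨(Dil_t T) f (x), g (x)⟩ dx`. -/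
def dilAdjointPairing (T : simpleSpace D B₁ →ₗ[ℝ] (EuclideanSpace ℝ (Fin d) → B₂)) (t : ℝ)
    (g : EuclideanSpace ℝ (Fin d) → StrongDual ℝ B₂)
    (f : EuclideanSpace ℝ (Fin d) → B₁) (hf : dil t⁻¹ f ∈ simpleSpace D B₁) : ℝ :=
  ∫ x, g x (dilOp T t f hf x)

/-- `u` is the value at `f ∈ L^p_{B₁}` of the extension of `T` by continuity to an operator
`L^p_{B₁} → L^q_{B₂}`: the pair `(f, u)` is a limit of pairs `(φ, T φ)` with `φ ∈ S_{B₁}`.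
If `T` is bounded, such a `u` exists and is unique up to null sets. -/
structure IsExtensionValue (T : simpleSpace D B₁ →ₗ[ℝ] (EuclideanSpace ℝ (Fin d) → B₂))
    (p q : ℝ) (f : EuclideanSpace ℝ (Fin d) → B₁) (u : EuclideanSpace ℝ (Fin d) → B₂) :
    Prop where
  memLp : MemLp u (ENNReal.ofReal q) volume
  approx : ∀ ε : ℝ≥0∞, 0 < ε → ∃ φ : simpleSpace D B₁,
    eLpNorm (f - (φ : EuclideanSpace ℝ (Fin d) → B₁)) (ENNReal.ofReal p) volume ≤ ε ∧
    eLpNorm (u - T φ) (ENNReal.ofReal q) volume ≤ ε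

/-- The conditions on a family `(T_j)` of single scale operators, with exponents `p, q`,
regularity parameter `κ`, and constants `Ap = A(p)`, `Aq = A(q)`, `A₀ = A_∘(p, q)` and `B`. -/
structure IsBRSFamily (T : ℤ → simpleSpace D B₁ →ₗ[ℝ] (EuclideanSpace ℝ (Fin d) → B₂))
    (p q κ : ℝ) (Ap Aq A₀ B : ℝ≥0) : Prop where
  /-- `T_j ∈ Op_{B₁, B₂}` -/
  locallyIntegrable : ∀ (j : ℤ) (f : simpleSpace D B₁) (l : StrongDual ℝ B₂),
    LocallyIntegrable (fun x => l (T j f x)) volume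
  /-- `(Dil_{2^j} T_j) f` is supported in the closed `1`-neighbourhood of `supp f`. -/
  support : ∀ (j : ℤ) (f : EuclideanSpace ℝ (Fin d) → B₁)
    (hf : dil ((2 : ℝ) ^ j)⁻¹ f ∈ simpleSpace D B₁),
    ∀ᵐ x, x ∉ Metric.cthickening 1 (tsupport f) → dilOp (T j) ((2 : ℝ) ^ j) f hf x = 0
  /-- `‖Dil_{2^j} T_j‖_{L^p → L^q} ≤ A₀` -/
  singleScale : ∀ (j : ℤ) (f : EuclideanSpace ℝ (Fin d) → B₁)
    (hf : dil ((2 : ℝ) ^ j)⁻¹ f ∈ simpleSpace D B₁),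
    AEStronglyMeasurable (dilOp (T j) ((2 : ℝ) ^ j) f hf) volume ∧
    eLpNorm (dilOp (T j) ((2 : ℝ) ^ j) f hf) (ENNReal.ofReal q) volume
      ≤ A₀ * eLpNorm f (ENNReal.ofReal p) volume
  /-- `‖(Dil_{2^j} T_j) ∘ Δ_h‖_{L^p → L^q} ≤ B |h|^κ` for `|h| ≤ 1`, where `T_j` is extended to
  `L^p` by continuity. -/
  regularity : ∀ (j : ℤ) (h : EuclideanSpace ℝ (Fin d)), ‖h‖ ≤ 1 →
    ∀ f : EuclideanSpace ℝ (Fin d) → B₁, MemLp f (ENNReal.ofReal p) volume →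
    ∃ u : EuclideanSpace ℝ (Fin d) → B₂,
      IsExtensionValue (T j) p q (dil ((2 : ℝ) ^ j)⁻¹ (shiftDiff h f)) u ∧
      eLpNorm (dil ((2 : ℝ) ^ j) u) (ENNReal.ofReal q) volume
        ≤ B * ENNReal.ofReal (‖h‖ ^ κ) * eLpNorm f (ENNReal.ofReal p) volume
  /-- `‖(Dil_{2^j} T_j*) ∘ Δ_h‖_{L^{q'} → L^{p'}} ≤ B |h|^κ` for `|h| ≤ 1`. The norm of
  `(Dil_{2^j} T_j*) Δ_h g` is that of a functional on `L^p_{B₁}`, tested on the dense subspace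
  where `Dil_{2^j} T_j` is defined; `L^{p'}_{B₁*}` embeds isometrically into this dual. -/
  adjointRegularity : ∀ (j : ℤ) (h : EuclideanSpace ℝ (Fin d)), ‖h‖ ≤ 1 →
    ∀ g : EuclideanSpace ℝ (Fin d) → StrongDual ℝ B₂,
    MemLp g (ENNReal.ofReal q.conjExponent) volume →
    ∀ (f : EuclideanSpace ℝ (Fin d) → B₁) (hf : dil ((2 : ℝ) ^ j)⁻¹ f ∈ simpleSpace D B₁),
      ‖dilAdjointPairing (T j) ((2 : ℝ) ^ j) (shiftDiff h g) f hf‖ₑ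
        ≤ B * ENNReal.ofReal (‖h‖ ^ κ) * eLpNorm g (ENNReal.ofReal q.conjExponent) volume
          * eLpNorm f (ENNReal.ofReal p) volume
  /-- `‖∑_{j=N₁}^{N₂} T_j‖_{L^p → L^{p,∞}} ≤ A(p)` -/
  weakType : ∀ N₁ N₂ : ℤ, N₁ ≤ N₂ → ∀ f : simpleSpace D B₁,
    weakLpNorm p (∑ j ∈ Finset.Icc N₁ N₂, T j f)
      ≤ Ap * eLpNorm (f : EuclideanSpace ℝ (Fin d) → B₁) (ENNReal.ofReal p) volume
  /-- `‖∑_{j=N₁}^{N₂} T_j‖_{L^{q,1} → L^q} ≤ A(q)` -/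
  restrictedStrongType : ∀ N₁ N₂ : ℤ, N₁ ≤ N₂ → ∀ f : simpleSpace D B₁,
    eLpNorm (∑ j ∈ Finset.Icc N₁ N₂, T j f) (ENNReal.ofReal q) volume
      ≤ Aq * lorentzOneNorm q (f : EuclideanSpace ℝ (Fin d) → B₁)

/-- `⟨T f, g⟩ = ∑ᵢ ∫ ⟨T fᵢ (x), gᵢ (x)⟩ dx` for `f ∈ (S_{B₁})ⁿ` and `g ∈ (S_{B₂*})ⁿ`. -/
def vectorForm {n : ℕ} (T : simpleSpace D B₁ →ₗ[ℝ] (EuclideanSpace ℝ (Fin d) → B₂))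
    (f : Fin n → simpleSpace D B₁) (g : Fin n → simpleSpace D (StrongDual ℝ B₂)) : ℝ :=
  ∑ i, ∫ x, (g i : EuclideanSpace ℝ (Fin d) → StrongDual ℝ B₂) x (T (f i) x)

end Operators

end

set_option linter.unusedSectionVars false
set_option linter.unusedVariables false

/-! ### Cubes and dyadic lattices -/

namespace Cube

variable {d : ℕ}

/-! The proof works with the bilinear forms `Λ_j(f, g) = ∫ ⟨T_j f, g⟩` on simple functions.
Rescaling, Hölder's inequality, Kolmogorov's inequality and the Lorentz norm of a bounded function
turn the hypotheses on `T_j` into `FormBounds` (`IsBRSFamily.exists_form`), with `r = q'`. After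
this the operators play no role.

The analytic core is the estimate `CoreData.abs_sum_le` for one stopping step, in the scalar case.
Let `f` live on a cube `Q` of side `2 ^ N` and `g` on its fivefold dilate, and let stopping cubes be
chosen so that the averages of `|f|^p` and `|g|^r` over cubes not inside a stopping cube are at most
`α^p` and `β^r`. At scale `j` the parts of `f` on stopping cubes of side at least `2 ^ j` are
removed; they are left to later steps. A Calderón–Zygmund decomposition of `f` and `g` leaves the
following terms. Good parts of `f`, and averages of `f` on stopping cubes, are bounded functions, so
the restricted strong type bound applies. Bad parts of `f` against the good part of `g` fall under
the weak type bound. Bad parts of `f` and `g` on levels below `j` have vanishing averages. A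
function with vanishing averages is a sum of small differences `Δ_h u`
(`IsRegularFunctional.abs_le`), so regularity gives exponential decay in the distance between level
and scale. The decay beats the quotient `B / A₀` after `ℓ ~ log (2 + B / A₀)` levels; on the `ℓ`
levels closest to the scale the single scale bound is used, and this produces the logarithm.
Finally, bad parts of `f` below `j` see bad parts of `g` on stopping cubes `W` of level `k ≥ j` only
in a boundary layer of `W` of relative volume about `2 ^ (j - k)`, which is summable over `j`.

For vectors, `exists_change_of_variables` uses an almost Auerbach basis of the convex body of `f` to
find dual changes of coordinates that preserve `∑ Λ (f_i, g_i)` and make each product of norms at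
most twice the pairing of the convex bodies. One common collection of stopping cubes serves all `2
n` new components. Its total volume is at most half of `|Q|` if the thresholds are a multiple of `n`
times the averages, which costs `n ^ (1/p + 1/r)`; the sum over components costs another `n`.

Iteration over the stopping cubes (`exists_carleson_of_children`) gives a family with the Carleson
property. The convex bodies are taken on cubes `P Q` with sixteen times the side length that contain
the dilate of `Q`. By the one third trick these lie in `2 ^ d` translates of the lattice. The
pigeonhole principle selects one translate and then, by nesting depth modulo a large `m`, a
`γ`-sparse subfamily carrying a fixed fraction of the sum. -/

theorem volume_toSet (Q : Cube d) : volume Q.toSet = ENNReal.ofReal (Q.side ^ d) := by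
  have h : Q.toSet = (WithLp.ofLp : EuclideanSpace ℝ (Fin d) → (Fin d → ℝ)) ⁻¹'
      (Set.univ.pi fun i => Set.Ico (Q.corner i) (Q.corner i + Q.side)) := by
    ext x
    simp [toSet]
  rw [h, (PiLp.volume_preserving_ofLp (Fin d)).measure_preimage
    (MeasurableSet.univ_pi fun i => measurableSet_Ico).nullMeasurableSet, Real.volume_pi_Ico]
  simp [ENNReal.ofReal_pow Q.side_pos.le]

theorem volume_ne_top (Q : Cube d) : volume Q.toSet ≠ ∞ := by
  rw [Q.volume_toSet]; exact ENNReal.ofReal_ne_top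

theorem volume_real (Q : Cube d) : volume.real Q.toSet = Q.side ^ d := by
  rw [Measure.real, Q.volume_toSet, ENNReal.toReal_ofReal (pow_nonneg Q.side_pos.le _)]

theorem volume_real_pos (Q : Cube d) : 0 < volume.real Q.toSet := by
  rw [volume_real]; exact pow_pos Q.side_pos _

theorem corner_mem (Q : Cube d) : Q.corner ∈ Q.toSet := fun i =>
  ⟨le_rfl, lt_add_of_pos_right _ Q.side_pos⟩

/-- The concentric cube with five times the side length. -/
def quintuple (Q : Cube d) : Cube d where
  corner := WithLp.toLp 2 fun i => Q.corner i - 2 * Q.side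
  side := 5 * Q.side
  side_pos := by have := Q.side_pos; positivity

theorem mem_quintuple {Q : Cube d} {x : EuclideanSpace ℝ (Fin d)} :
    x ∈ Q.quintuple.toSet ↔ ∀ i, Q.corner i - 2 * Q.side ≤ x i ∧ x i < Q.corner i + 3 * Q.side := by
  simp only [toSet, quintuple, Set.mem_ofPred_eq]
  refine forall_congr' fun i => and_congr_right fun _ => ?_
  rw [show Q.corner i - 2 * Q.side + 5 * Q.side = Q.corner i + 3 * Q.side by ring]

theorem subset_quintuple (Q : Cube d) : Q.toSet ⊆ Q.quintuple.toSet := fun x hx =>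
  mem_quintuple.2 fun i => ⟨by linarith [(hx i).1, Q.side_pos], by linarith [(hx i).2, Q.side_pos]⟩

theorem volume_real_quintuple (Q : Cube d) :
    volume.real Q.quintuple.toSet = 5 ^ d * Q.side ^ d := by
  rw [volume_real, quintuple, mul_pow]

theorem ext_iff' {Q R : Cube d} : Q = R ↔ Q.side = R.side ∧ ∀ i, Q.corner i = R.corner i := by
  constructor
  · rintro rfl; simp
  · rcases Q with ⟨c, s, hs⟩
    rcases R with ⟨c', s', hs'⟩
    rintro ⟨h1, h2⟩
    simp only at h1 h2
    subst h1
    have : c = c' := by ext i; exact h2 i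
    subst this
    rfl

/-- The volume determines the side because `d ≠ 0`, and each corner is a point of the other cube. -/
theorem eq_of_toSet_eq [NeZero d] {Q R : Cube d} (h : Q.toSet = R.toSet) : Q = R := by
  have hs : Q.side = R.side := by
    have := Q.volume_real
    rw [h, R.volume_real] at this
    exact (pow_left_inj₀ Q.side_pos.le R.side_pos.le (NeZero.ne d)).1 this.symm
  refine ext_iff'.2 ⟨hs, fun i => le_antisymm ?_ ?_⟩
  · have := R.corner_mem; rw [← h] at this; exact (this i).1
  · have := Q.corner_mem; rw [h] at this; exact (this i).1

theorem sub_mem_of_subset {Q : Cube d} {x y : EuclideanSpace ℝ (Fin d)} (hx : x ∈ Q.toSet)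
    (hy : y ∈ Q.toSet) (i : Fin d) : |x i - y i| < Q.side := by
  have h1 := hx i; have h2 := hy i
  rw [abs_lt]; constructor <;> linarith [h1.1, h1.2, h2.1, h2.2]

end Cube

namespace IsDyadicLattice

variable {d : ℕ} {D : Set (Cube d)} (hD : IsDyadicLattice D)
include hD

/-- Inside a common ancestor both corners lie on the grid whose mesh is the smaller side. Nesting
and disjointness thereby become statements about integers. -/
theorem aligned {Q R : Cube d} (hQ : Q ∈ D) (hR : R ∈ D) (h : Q.side ≤ R.side) :
    ∃ t : ℕ, R.side = 2 ^ t * Q.side ∧ ∀ i, ∃ m : ℤ, R.corner i = Q.corner i + m * Q.side := by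
  obtain ⟨P, hP, ⟨k, hk, hkc⟩, ⟨l, hl, hlc⟩⟩ := hD.common_ancestor Q hQ R hR
  have hPs := P.side_pos
  have hlk : l ≤ k := by
    rw [hk, hl] at h
    by_contra hc
    push Not at hc
    have : P.side / 2 ^ l < P.side / 2 ^ k :=
      div_lt_div_of_pos_left hPs (by positivity) (pow_lt_pow_right₀ (by norm_num) hc)
    linarith
  obtain ⟨t, rfl⟩ := Nat.exists_eq_add_of_le hlk
  have hPQ : P.side / 2 ^ l = 2 ^ t * Q.side := by rw [hk, pow_add]; field_simp
  refine ⟨t, by rw [hl, hPQ], fun i => ?_⟩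
  obtain ⟨m, -, hm⟩ := hkc i
  obtain ⟨n, -, hn⟩ := hlc i
  refine ⟨n * 2 ^ t - m, ?_⟩
  rw [hn, hm, ← hk, hPQ]
  push_cast
  ring

theorem eq_of_mem {Q R : Cube d} (hQ : Q ∈ D) (hR : R ∈ D) (h : Q.side = R.side)
    {x : EuclideanSpace ℝ (Fin d)} (hxQ : x ∈ Q.toSet) (hxR : x ∈ R.toSet) : Q = R := by
  obtain ⟨-, -, hc⟩ := hD.aligned hQ hR h.le
  refine Cube.ext_iff'.2 ⟨h, fun i => ?_⟩
  obtain ⟨m, hm⟩ := hc i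
  have h1 := hxQ i
  have h2 := hxR i
  have hs := Q.side_pos
  rw [hm, ← h] at h2
  have a1 : (m : ℝ) < 1 := by
    by_contra hcon; push Not at hcon; nlinarith [h1.2, h2.1]
  have a2 : (-1 : ℝ) < m := by
    by_contra hcon; push Not at hcon; nlinarith [h1.1, h2.2]
  have : m = 0 := by
    have b1 : m < 1 := by exact_mod_cast a1
    have b2 : -1 < m := by exact_mod_cast a2
    omega
  rw [hm, this]; simp

theorem subset_of_mem {Q R : Cube d} (hQ : Q ∈ D) (hR : R ∈ D) (h : Q.side ≤ R.side)
    {x : EuclideanSpace ℝ (Fin d)} (hxQ : x ∈ Q.toSet) (hxR : x ∈ R.toSet) :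
    Q.toSet ⊆ R.toSet := by
  obtain ⟨t, ht, hc⟩ := hD.aligned hQ hR h
  intro y hy i
  obtain ⟨m, hm⟩ := hc i
  have h1 := hxQ i
  have h2 := hxR i
  have h3 := hy i
  have hs := Q.side_pos
  rw [hm, ht] at h2 ⊢
  have a1 : (m : ℝ) < 1 := by
    by_contra hcon; push Not at hcon; nlinarith [h1.2, h2.1]
  have a2 : (0 : ℝ) < m + 2 ^ t := by
    by_contra hcon; push Not at hcon; nlinarith [h1.1, h2.2]
  -- The common point only gives `-2 ^ t < m < 1`; integrality sharpens this to the inequalities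
  -- that say containment.
  have b1 : m ≤ 0 := by
    have : m < 1 := by exact_mod_cast a1
    omega
  have b2 : 1 ≤ m + 2 ^ t := by
    have : 0 < m + 2 ^ t := by exact_mod_cast a2
    omega
  have c1 : (m : ℝ) ≤ 0 := by exact_mod_cast b1
  have c2 : (1 : ℝ) ≤ m + 2 ^ t := by exact_mod_cast b2
  constructor
  · nlinarith [h3.1]
  · nlinarith [h3.2]

theorem exists_mem [NeZero d] (k : ℤ) (x : EuclideanSpace ℝ (Fin d)) :
    ∃ Q ∈ D, Q.side = 2 ^ k ∧ x ∈ Q.toSet := by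
  have h2 : (0 : ℝ) < 2 ^ k := by positivity
  obtain ⟨P, hP, hPs⟩ := hD.compact_subset _ (isCompact_closedBall x ((2 : ℝ) ^ k))
  have hxP : x ∈ P.toSet := hPs (Metric.mem_closedBall_self h2.le)
  obtain ⟨l, hl⟩ := hD.side_eq P hP
  -- Since `d ≥ 1`, the ball contains a point at distance `2 ^ k` from `x` in a coordinate
  -- direction, so the half-open cube `P` has side larger than `2 ^ k`.
  have hkl : k ≤ l := by
    have i : Fin d := ⟨0, Nat.pos_of_ne_zero (NeZero.ne d)⟩
    have hy : x + EuclideanSpace.single i ((2 : ℝ) ^ k) ∈ P.toSet := hPs (by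
      simp [Metric.mem_closedBall, dist_eq_norm])
    have := Cube.sub_mem_of_subset hy hxP i
    simp only [PiLp.add_apply, PiLp.single_apply, if_true, add_sub_cancel_left,
      abs_of_pos h2, hl] at this
    exact (zpow_lt_zpow_iff_right₀ (by norm_num : (1 : ℝ) < 2)).1 this |>.le
  obtain ⟨t, rfl⟩ : ∃ t : ℕ, l = k + t := ⟨(l - k).toNat, by omega⟩
  have hside : P.side / 2 ^ t = 2 ^ k := by
    rw [hl, zpow_add₀ (by norm_num), zpow_natCast]; field_simp
  let m : Fin d → ℕ := fun i => ⌊(x i - P.corner i) / 2 ^ k⌋₊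
  have hnn : ∀ i, 0 ≤ (x i - P.corner i) / 2 ^ k := fun i =>
    div_nonneg (by linarith [(hxP i).1]) h2.le
  refine ⟨⟨WithLp.toLp 2 fun i => P.corner i + m i * 2 ^ k, 2 ^ k, h2⟩,
    hD.subcube_mem P hP ⟨t, hside.symm, fun i => ⟨m i, ?_, by rw [hside]⟩⟩, rfl, fun i => ?_⟩
  · refine (Nat.floor_lt (hnn i)).2 ?_
    rw [div_lt_iff₀ h2]
    have := (hxP i).2
    rw [← hside]
    push_cast
    field_simp
    linarith
  · have a := Nat.floor_le (hnn i)
    have b := Nat.lt_floor_add_one ((x i - P.corner i) / 2 ^ k)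
    rw [le_div_iff₀ h2] at a
    rw [div_lt_iff₀ h2] at b
    simp only [m]
    constructor <;> linarith

end IsDyadicLattice

/-! ### Cells of a lattice -/

section Cells

variable {d : ℕ} (D : Set (Cube d))

open Classical in
/-- The cube of `D` with side length `2 ^ k` that contains `x`. -/
noncomputable def cubeAt (k : ℤ) (x : EuclideanSpace ℝ (Fin d)) : Cube d :=
  -- The default cube is never met: in a dyadic lattice with `d ≥ 1` a cube as required exists.
  if h : ∃ Q ∈ D, Q.side = 2 ^ k ∧ x ∈ Q.toSet then h.choose else ⟨0, 1, one_pos⟩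

/-- The set of points of `cubeAt D k x`. -/
noncomputable def cell (k : ℤ) (x : EuclideanSpace ℝ (Fin d)) : Set (EuclideanSpace ℝ (Fin d)) :=
  (cubeAt D k x).toSet

/-- The fivefold dilate of `cell D k x`. -/
noncomputable def bigCell (k : ℤ) (x : EuclideanSpace ℝ (Fin d)) :
    Set (EuclideanSpace ℝ (Fin d)) :=
  (cubeAt D k x).quintuple.toSet

/-- The volume of a cube of side length `2 ^ k`. -/
noncomputable def cellVol (d : ℕ) (k : ℤ) : ℝ := ((2 : ℝ) ^ k) ^ d

/-- A set is saturated at level `k` if it is a union of cubes of `D` with side length `2 ^ k`. -/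
def Saturated (k : ℤ) (s : Set (EuclideanSpace ℝ (Fin d))) : Prop :=
  ∀ x ∈ s, cell D k x ⊆ s

theorem cellVol_pos (d : ℕ) (k : ℤ) : 0 < cellVol d k := by unfold cellVol; positivity

theorem cellVol_succ (d : ℕ) (k : ℤ) : cellVol d (k + 1) = 2 ^ d * cellVol d k := by
  rw [cellVol, cellVol, zpow_add₀ (by norm_num), zpow_one, mul_pow, mul_comm]

variable {D} [NeZero d] [hD : Fact (IsDyadicLattice D)]

theorem cubeAt_spec (k : ℤ) (x : EuclideanSpace ℝ (Fin d)) :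
    cubeAt D k x ∈ D ∧ (cubeAt D k x).side = 2 ^ k ∧ x ∈ (cubeAt D k x).toSet := by
  have h := hD.out.exists_mem k x
  rw [cubeAt, dif_pos h]
  exact h.choose_spec

theorem cubeAt_mem (k : ℤ) (x : EuclideanSpace ℝ (Fin d)) : cubeAt D k x ∈ D :=
  (cubeAt_spec k x).1

theorem side_cubeAt (k : ℤ) (x : EuclideanSpace ℝ (Fin d)) : (cubeAt D k x).side = 2 ^ k :=
  (cubeAt_spec k x).2.1

theorem mem_cell_self (k : ℤ) (x : EuclideanSpace ℝ (Fin d)) : x ∈ cell D k x :=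
  (cubeAt_spec k x).2.2

theorem cubeAt_eq_of_mem {Q : Cube d} (hQ : Q ∈ D) {k : ℤ} (hk : Q.side = 2 ^ k)
    {x : EuclideanSpace ℝ (Fin d)} (hx : x ∈ Q.toSet) : cubeAt D k x = Q :=
  hD.out.eq_of_mem (cubeAt_mem k x) hQ (by rw [hk, side_cubeAt]) (mem_cell_self k x) hx

theorem mem_cell_iff {k : ℤ} {x y : EuclideanSpace ℝ (Fin d)} :
    y ∈ cell D k x ↔ cubeAt D k y = cubeAt D k x := by
  constructor
  · intro h; exact cubeAt_eq_of_mem (cubeAt_mem k x) (side_cubeAt k x) h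
  · intro h; rw [cell, ← h]; exact mem_cell_self k y

theorem cell_eq {k : ℤ} {x y : EuclideanSpace ℝ (Fin d)} (h : y ∈ cell D k x) :
    cell D k y = cell D k x := by rw [cell, mem_cell_iff.1 h, cell]

theorem mem_cell_symm {k : ℤ} {x y : EuclideanSpace ℝ (Fin d)} (h : y ∈ cell D k x) :
    x ∈ cell D k y := mem_cell_iff.2 (mem_cell_iff.1 h).symm

theorem two_zpow_mono {k l : ℤ} (h : k ≤ l) : (2 : ℝ) ^ k ≤ 2 ^ l :=
  zpow_le_zpow_right₀ (by norm_num) h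

theorem cell_mono {k l : ℤ} (h : k ≤ l) (x : EuclideanSpace ℝ (Fin d)) :
    cell D k x ⊆ cell D l x :=
  hD.out.subset_of_mem (cubeAt_mem k x) (cubeAt_mem l x)
    (by rw [side_cubeAt, side_cubeAt]; exact two_zpow_mono h) (mem_cell_self k x) (mem_cell_self l x)

theorem bigCell_mono {k l : ℤ} (h : k ≤ l) (x : EuclideanSpace ℝ (Fin d)) :
    bigCell D k x ⊆ bigCell D l x := by
  obtain ⟨t, ht, -⟩ := hD.out.aligned (cubeAt_mem (D := D) k x) (cubeAt_mem l x)
    (by rw [side_cubeAt, side_cubeAt]; exact two_zpow_mono h)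
  have hc : (cubeAt D k x).toSet ⊆ (cubeAt D l x).toSet := cell_mono h x
  intro y hy
  rw [bigCell, Cube.mem_quintuple] at *
  intro i
  have h1 := (hc (cubeAt D k x).corner_mem i).1
  have hs := two_zpow_mono h
  have hs0 : (0 : ℝ) < 2 ^ k := by positivity
  have h2 : (cubeAt D k x).corner i + 2 ^ k ≤ (cubeAt D l x).corner i + 2 ^ l := by
    -- The upper corner does not belong to the half-open cell, so it is approached by points of the
    -- cell.
    have key : ∀ ε : ℝ, 0 < ε → (cubeAt D k x).corner i + 2 ^ k ≤
        (cubeAt D l x).corner i + 2 ^ l + ε := by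
      intro ε hε
      rcases le_or_gt ε (2 ^ k) with hle | hlt
      · have hm : WithLp.toLp 2 (fun i => (cubeAt D k x).corner i + 2 ^ k - ε) ∈
            (cubeAt D k x).toSet := by
          intro i
          simp only [side_cubeAt]
          constructor <;> linarith
        have := (hc hm i).2
        rw [side_cubeAt] at this
        simp only at this
        linarith
      · have := (hc (cubeAt D k x).corner_mem i).2
        rw [side_cubeAt] at this
        linarith
    exact le_of_forall_pos_le_add key
  have h3 := hy i
  rw [side_cubeAt] at *
  constructor
  · linarith
  · linarith

theorem measurableSet_cell (k : ℤ) (x : EuclideanSpace ℝ (Fin d)) : MeasurableSet (cell D k x) :=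
  Cube.measurableSet_toSet _

theorem measurableSet_bigCell (k : ℤ) (x : EuclideanSpace ℝ (Fin d)) :
    MeasurableSet (bigCell D k x) :=
  Cube.measurableSet_toSet _

theorem volume_cell_ne_top (k : ℤ) (x : EuclideanSpace ℝ (Fin d)) : volume (cell D k x) ≠ ∞ :=
  Cube.volume_ne_top _

theorem volume_bigCell_ne_top (k : ℤ) (x : EuclideanSpace ℝ (Fin d)) :
    volume (bigCell D k x) ≠ ∞ :=
  Cube.volume_ne_top _

theorem volume_cell (k : ℤ) (x : EuclideanSpace ℝ (Fin d)) :
    volume.real (cell D k x) = cellVol d k := by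
  rw [cell, Cube.volume_real, side_cubeAt, cellVol]

theorem volume_bigCell (k : ℤ) (x : EuclideanSpace ℝ (Fin d)) :
    volume.real (bigCell D k x) = 5 ^ d * cellVol d k := by
  rw [bigCell, Cube.volume_real_quintuple, side_cubeAt, cellVol]

theorem cell_subset_bigCell (k : ℤ) (x : EuclideanSpace ℝ (Fin d)) :
    cell D k x ⊆ bigCell D k x := Cube.subset_quintuple _

theorem bigCell_eq {k : ℤ} {x y : EuclideanSpace ℝ (Fin d)} (h : y ∈ cell D k x) :
    bigCell D k y = bigCell D k x := by rw [bigCell, mem_cell_iff.1 h, bigCell]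

namespace Saturated

omit [NeZero d] hD in
theorem inter {k : ℤ} {s t : Set (EuclideanSpace ℝ (Fin d))} (hs : Saturated D k s)
    (ht : Saturated D k t) : Saturated D k (s ∩ t) := fun x hx =>
  Set.subset_inter (hs x hx.1) (ht x hx.2)

omit [NeZero d] hD in
theorem iUnion {ι : Sort*} {k : ℤ} {s : ι → Set (EuclideanSpace ℝ (Fin d))}
    (hs : ∀ i, Saturated D k (s i)) : Saturated D k (⋃ i, s i) := fun x hx => by
  obtain ⟨i, hi⟩ := Set.mem_iUnion.1 hx
  exact (hs i x hi).trans (Set.subset_iUnion s i)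

theorem mono {k l : ℤ} (h : k ≤ l) {s : Set (EuclideanSpace ℝ (Fin d))} (hs : Saturated D l s) :
    Saturated D k s := fun x hx => (cell_mono h x).trans (hs x hx)

theorem mem_iff {k : ℤ} {s : Set (EuclideanSpace ℝ (Fin d))} (hs : Saturated D k s)
    {x y : EuclideanSpace ℝ (Fin d)} (h : y ∈ cell D k x) : y ∈ s ↔ x ∈ s :=
  ⟨fun hy => hs y hy (mem_cell_symm h), fun hx => hs x hx h⟩

end Saturated

theorem saturated_cell (k : ℤ) (x : EuclideanSpace ℝ (Fin d)) : Saturated D k (cell D k x) :=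
  fun y hy => (cell_eq hy).le

theorem saturated_of_mem {Q : Cube d} (hQ : Q ∈ D) {k : ℤ} (hk : Q.side = 2 ^ k) :
    Saturated D k Q.toSet := fun x hx => by
  rw [cell, cubeAt_eq_of_mem hQ hk hx]

/-- By alignment the multiple is an integer strictly between `-3` and `3`. Hence the fivefold dilate
of a cell is a union of cells. -/
theorem corner_of_mem_bigCell {k : ℤ} {x y : EuclideanSpace ℝ (Fin d)} (h : y ∈ bigCell D k x)
    (i : Fin d) : ∃ m : ℝ, -2 ≤ m ∧ m ≤ 2 ∧
      (cubeAt D k y).corner i = (cubeAt D k x).corner i + m * 2 ^ k := by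
  rw [bigCell, Cube.mem_quintuple] at h
  obtain ⟨-, -, hc⟩ := hD.out.aligned (cubeAt_mem (D := D) k x) (cubeAt_mem k y)
    (by rw [side_cubeAt, side_cubeAt])
  obtain ⟨m, hm⟩ := hc i
  have h1 := h i
  have h3 := mem_cell_self (D := D) k y i
  rw [hm] at h3
  simp only [side_cubeAt] at *
  have hs : (0 : ℝ) < 2 ^ k := by positivity
  have a1 : (m : ℝ) < 3 := by
    by_contra hcon; push Not at hcon; nlinarith [h1.2, h3.1]
  have a2 : (-3 : ℝ) < m := by
    by_contra hcon; push Not at hcon; nlinarith [h1.1, h3.2]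
  have b1 : m ≤ 2 := by
    have : m < 3 := by exact_mod_cast a1
    omega
  have b2 : -2 ≤ m := by
    have : -3 < m := by exact_mod_cast a2
    omega
  exact ⟨m, by exact_mod_cast b2, by exact_mod_cast b1, hm⟩

theorem saturated_bigCell (k : ℤ) (x : EuclideanSpace ℝ (Fin d)) :
    Saturated D k (bigCell D k x) := by
  intro y hy z hz
  rw [bigCell, Cube.mem_quintuple]
  intro i
  obtain ⟨m, h1, h2, hm⟩ := corner_of_mem_bigCell hy i
  have h3 := hz i
  rw [hm] at h3
  simp only [side_cubeAt] at *
  have hs : (0 : ℝ) < 2 ^ k := by positivity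
  constructor
  · nlinarith [h3.1]
  · nlinarith [h3.2]

/-- Both memberships say that in each coordinate the two cells are at most two steps of the grid
apart. -/
theorem bigCell_mem_comm {k : ℤ} {x y : EuclideanSpace ℝ (Fin d)} (h : y ∈ bigCell D k x) :
    x ∈ bigCell D k y := by
  rw [bigCell, Cube.mem_quintuple]
  intro i
  obtain ⟨m, h1, h2, hm⟩ := corner_of_mem_bigCell h i
  have h3 := mem_cell_self (D := D) k x i
  rw [hm]
  simp only [side_cubeAt] at *
  have hs : (0 : ℝ) < 2 ^ k := by positivity
  constructor
  · nlinarith [h3.1]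
  · nlinarith [h3.2]

end Cells

/-! ### Grids of cubes and step functions -/

section Grid

variable {d : ℕ} {D : Set (Cube d)} [NeZero d] [hD : Fact (IsDyadicLattice D)]

/-- These cubes are disjoint, have the same positive volume and lie in a set of finite volume. -/
theorem finite_grid (k : ℤ) {s : Set (EuclideanSpace ℝ (Fin d))} (hs : volume s ≠ ∞) :
    {R | R ∈ D ∧ R.side = 2 ^ k ∧ R.toSet ⊆ s}.Finite := by
  have h := Measure.finite_const_le_meas_of_disjoint_iUnion
    (ι := {R | R ∈ D ∧ R.side = 2 ^ k ∧ R.toSet ⊆ s}) volume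
    (ε := ENNReal.ofReal (cellVol d k)) (ENNReal.ofReal_pos.2 (cellVol_pos d k))
    (As := fun R => R.1.toSet) (fun R => R.1.measurableSet_toSet) ?_ ?_
  · have h2 : {i : {R | R ∈ D ∧ R.side = 2 ^ k ∧ R.toSet ⊆ s} |
        ENNReal.ofReal (cellVol d k) ≤ volume i.1.toSet} = Set.univ := by
      ext R
      simp [Cube.volume_toSet, cellVol, R.2.2.1]
    rw [h2] at h
    exact Set.finite_coe_iff.1 (Set.finite_univ_iff.1 h)
  · intro R R' hne
    refine Set.disjoint_left.2 fun x hx hx' => hne (Subtype.ext ?_)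
    exact hD.out.eq_of_mem R.2.1 R'.2.1 (by rw [R.2.2.1, R'.2.2.1]) hx hx'
  · exact ne_top_of_le_ne_top hs (measure_mono (Set.iUnion_subset fun R => R.2.2.2))

open Classical in
/-- The cubes of `D` with side length `2 ^ k` contained in `s` (for `s` of finite volume). -/
noncomputable def grid (D : Set (Cube d)) (k : ℤ) (s : Set (EuclideanSpace ℝ (Fin d))) :
    Finset (Cube d) :=
  if h : {R | R ∈ D ∧ R.side = 2 ^ k ∧ R.toSet ⊆ s}.Finite then h.toFinset else ∅

theorem mem_grid {k : ℤ} {s : Set (EuclideanSpace ℝ (Fin d))} (hs : volume s ≠ ∞) {R : Cube d} :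
    R ∈ grid D k s ↔ R ∈ D ∧ R.side = 2 ^ k ∧ R.toSet ⊆ s := by
  rw [grid, dif_pos (finite_grid k hs), Set.Finite.mem_toFinset]
  exact Iff.rfl

theorem of_mem_grid {k : ℤ} {s : Set (EuclideanSpace ℝ (Fin d))} {R : Cube d}
    (h : R ∈ grid D k s) : R ∈ D ∧ R.side = 2 ^ k ∧ R.toSet ⊆ s := by
  rw [grid] at h
  split_ifs at h with hf
  · exact (Set.Finite.mem_toFinset hf).1 h
  · simp at h

theorem cell_corner {k : ℤ} {R : Cube d} (hR : R ∈ D) (hk : R.side = 2 ^ k) :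
    cell D k R.corner = R.toSet := by rw [cell, cubeAt_eq_of_mem hR hk R.corner_mem]

theorem bigCell_corner {k : ℤ} {R : Cube d} (hR : R ∈ D) (hk : R.side = 2 ^ k) :
    bigCell D k R.corner = R.quintuple.toSet := by
  rw [bigCell, cubeAt_eq_of_mem hR hk R.corner_mem]

theorem cell_eq_of_mem {k : ℤ} {R : Cube d} (hR : R ∈ D) (hk : R.side = 2 ^ k)
    {x : EuclideanSpace ℝ (Fin d)} (hx : x ∈ R.toSet) : cell D k x = R.toSet := by
  rw [cell, cubeAt_eq_of_mem hR hk hx]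

theorem bigCell_eq_of_mem {k : ℤ} {R : Cube d} (hR : R ∈ D) (hk : R.side = 2 ^ k)
    {x : EuclideanSpace ℝ (Fin d)} (hx : x ∈ R.toSet) : bigCell D k x = R.quintuple.toSet := by
  rw [bigCell, cubeAt_eq_of_mem hR hk hx]

theorem pairwiseDisjoint_grid (k : ℤ) (s : Set (EuclideanSpace ℝ (Fin d))) :
    (grid D k s : Set (Cube d)).PairwiseDisjoint Cube.toSet := by
  intro R hR R' hR' hne
  have h := of_mem_grid hR
  have h' := of_mem_grid hR'
  refine Set.disjoint_left.2 fun x hx hx' => hne ?_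
  exact hD.out.eq_of_mem h.1 h'.1 (by rw [h.2.1, h'.2.1]) hx hx'

theorem biUnion_grid {k : ℤ} {s : Set (EuclideanSpace ℝ (Fin d))} (hs : volume s ≠ ∞)
    (hk : Saturated D k s) : ⋃ R ∈ grid D k s, R.toSet = s := by
  refine Set.Subset.antisymm (Set.iUnion₂_subset fun R hR => (of_mem_grid hR).2.2) fun x hx => ?_
  refine Set.mem_iUnion₂.2 ⟨cubeAt D k x, (mem_grid hs).2
    ⟨cubeAt_mem k x, side_cubeAt k x, hk x hx⟩, mem_cell_self k x⟩

theorem Saturated.measurableSet {k : ℤ} {s : Set (EuclideanSpace ℝ (Fin d))}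
    (hk : Saturated D k s) (hs : volume s ≠ ∞) : MeasurableSet s := by
  rw [← biUnion_grid hs hk]
  exact Finset.measurableSet_biUnion _ fun R _ => R.measurableSet_toSet

theorem sum_grid_integral {F : Type*} [NormedAddCommGroup F] [NormedSpace ℝ F]
    {k : ℤ} {s : Set (EuclideanSpace ℝ (Fin d))} (hs : volume s ≠ ∞)
    (hk : Saturated D k s) {φ : EuclideanSpace ℝ (Fin d) → F} (hφ : Integrable φ volume) :
    ∑ R ∈ grid D k s, ∫ x in R.toSet, φ x = ∫ x in s, φ x := by
  conv_rhs => rw [← biUnion_grid hs hk]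
  rw [integral_biUnion_finset _ (fun R _ => R.measurableSet_toSet) (pairwiseDisjoint_grid k s)
    fun R _ => hφ.integrableOn]

theorem sum_grid_volume {k : ℤ} {s : Set (EuclideanSpace ℝ (Fin d))} (hs : volume s ≠ ∞)
    (hk : Saturated D k s) : ∑ R ∈ grid D k s, cellVol d k = volume.real s := by
  conv_rhs => rw [← biUnion_grid hs hk]
  rw [measureReal_biUnion_finset (pairwiseDisjoint_grid k s) (fun R _ => R.measurableSet_toSet)
    (fun R _ => R.volume_ne_top)]
  refine Finset.sum_congr rfl fun R hR => ?_
  rw [Cube.volume_real, (of_mem_grid hR).2.1, cellVol]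

/-- By the symmetry of the relation `y ∈ bigCell D l x`, the hull is covered by the dilated cells of
the finitely many cubes of side `2 ^ k` that make up `s`. -/
theorem volume_bigHull_ne_top {k l : ℤ} (hkl : k ≤ l) {s : Set (EuclideanSpace ℝ (Fin d))}
    (hs : volume s ≠ ∞) (hk : Saturated D k s) :
    volume {x | (bigCell D l x ∩ s).Nonempty} ≠ ∞ := by
  refine ne_top_of_le_ne_top (b := ∑ R ∈ grid D k s, volume (bigCell D l R.corner)) ?_ ?_
  · exact (ENNReal.sum_lt_top.2 fun R _ => (volume_bigCell_ne_top l _).lt_top).ne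
  · refine (measure_mono ?_).trans (measure_biUnion_finset_le _ _)
    rintro x ⟨y, hy, hys⟩
    have hR : cubeAt D k y ∈ grid D k s :=
      (mem_grid hs).2 ⟨cubeAt_mem k y, side_cubeAt k y, hk y hys⟩
    refine Set.mem_iUnion₂.2 ⟨_, hR, ?_⟩
    have h1 : (cubeAt D k y).corner ∈ cell D l y := cell_mono hkl y (cubeAt D k y).corner_mem
    rw [bigCell_eq h1]
    exact bigCell_mem_comm hy

theorem volume_hull_ne_top {k l : ℤ} (hkl : k ≤ l) {s : Set (EuclideanSpace ℝ (Fin d))}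
    (hs : volume s ≠ ∞) (hk : Saturated D k s) :
    volume {x | (cell D l x ∩ s).Nonempty} ≠ ∞ :=
  ne_top_of_le_ne_top (volume_bigHull_ne_top hkl hs hk)
    (measure_mono fun x hx => hx.mono (Set.inter_subset_inter_left _ (cell_subset_bigCell l x)))

end Grid

/-! ### Step functions -/

section Step

variable {d : ℕ} {D : Set (Cube d)} {E : Type*} [NormedAddCommGroup E] [NormedSpace ℝ E]

/-- Functions that are constant on the cubes of side length `2 ^ k` and vanish off a set of
finite volume. -/
def IsStep (D : Set (Cube d)) (k : ℤ) (f : EuclideanSpace ℝ (Fin d) → E) : Prop :=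
  (∀ x, ∀ y ∈ cell D k x, f y = f x) ∧ volume (Function.support f) ≠ ∞

theorem memLp_of_mem_simpleSpace {f : EuclideanSpace ℝ (Fin d) → E} (hf : f ∈ simpleSpace D E)
    (p : ℝ≥0∞) : MemLp f p volume := by
  refine Submodule.span_induction ?_ ?_ ?_ ?_ hf
  · rintro _ ⟨Q, -, a, rfl⟩
    exact memLp_indicator_const p Q.measurableSet_toSet a (Or.inr Q.volume_ne_top)
  · exact MemLp.zero
  · intro f g _ _ hf hg
    exact hf.add hg
  · intro c f _ hf
    exact hf.const_smul c

instance : CoeFun (simpleSpace D E) fun _ => EuclideanSpace ℝ (Fin d) → E := ⟨Subtype.val⟩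

variable [NeZero d] [hD : Fact (IsDyadicLattice D)]

theorem IsStep.saturated_support {k : ℤ} {f : EuclideanSpace ℝ (Fin d) → E} (h : IsStep D k f) :
    Saturated D k (Function.support f) := fun x hx y hy => by
  rw [Function.mem_support, h.1 x y hy]; exact hx

theorem IsStep.mono {k l : ℤ} (hkl : k ≤ l) {f : EuclideanSpace ℝ (Fin d) → E}
    (h : IsStep D l f) : IsStep D k f :=
  ⟨fun x y hy => h.1 x y (cell_mono hkl x hy), h.2⟩

theorem IsStep.comp {k : ℤ} {F : Type*} [NormedAddCommGroup F]
    {f : EuclideanSpace ℝ (Fin d) → E} (h : IsStep D k f) (φ : E → F) (hφ : φ 0 = 0) :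
    IsStep D k fun x => φ (f x) :=
  ⟨fun x y hy => by simp only [h.1 x y hy],
    ne_top_of_le_ne_top h.2 (measure_mono fun x hx h0 => hx (by
      change φ (f x) = 0
      rw [h0, hφ]))⟩

theorem IsStep.indicator {k : ℤ} {f : EuclideanSpace ℝ (Fin d) → E} (h : IsStep D k f)
    {s : Set (EuclideanSpace ℝ (Fin d))} (hs : Saturated D k s) : IsStep D k (s.indicator f) := by
  classical
  refine ⟨fun x y hy => ?_, ne_top_of_le_ne_top h.2 (measure_mono ?_)⟩
  · simp only [Set.indicator_apply, hs.mem_iff hy, h.1 x y hy]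
  · rw [Set.support_indicator]; exact Set.inter_subset_right

theorem IsStep.mem_simpleSpace {k : ℤ} {f : EuclideanSpace ℝ (Fin d) → E} (h : IsStep D k f) :
    f ∈ simpleSpace D E := by
  classical
  have hf : f = ∑ R ∈ grid D k (Function.support f), R.toSet.indicator fun _ => f R.corner := by
    ext x
    rw [Finset.sum_apply]
    by_cases hx : f x = 0
    · rw [Finset.sum_eq_zero, hx]
      intro R hR
      refine Set.indicator_of_notMem (fun hxR => ?_) _
      exact (of_mem_grid hR).2.2 hxR hx
    · have hR : cubeAt D k x ∈ grid D k (Function.support f) :=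
        (mem_grid h.2).2 ⟨cubeAt_mem k x, side_cubeAt k x, h.saturated_support x hx⟩
      rw [Finset.sum_eq_single_of_mem _ hR]
      · rw [Set.indicator_of_mem (show x ∈ (cubeAt D k x).toSet from mem_cell_self k x)]
        exact (h.1 x _ (cubeAt D k x).corner_mem).symm
      · intro R hR' hne
        refine Set.indicator_of_notMem (fun hxR => hne ?_) _
        have := of_mem_grid hR'
        exact (cubeAt_eq_of_mem this.1 this.2.1 hxR).symm
  rw [hf]
  exact Submodule.sum_mem _ fun R hR =>
    Submodule.subset_span ⟨R, (of_mem_grid hR).1, _, rfl⟩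

theorem exists_isStep {f : EuclideanSpace ℝ (Fin d) → E} (hf : f ∈ simpleSpace D E) :
    ∃ k₀, ∀ k ≤ k₀, IsStep D k f := by
  classical
  refine Submodule.span_induction ?_ ?_ ?_ ?_ hf
  · rintro _ ⟨Q, hQ, a, rfl⟩
    obtain ⟨l, hl⟩ := hD.out.side_eq Q hQ
    refine ⟨l, fun k hk => ⟨fun x y hy => ?_, ?_⟩⟩
    · simp only [Set.indicator_apply, ((saturated_of_mem hQ hl).mono hk).mem_iff hy]
    · exact ne_top_of_le_ne_top Q.volume_ne_top (measure_mono Set.support_indicator_subset)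
  · exact ⟨0, fun k _ => ⟨fun _ _ _ => rfl, by simp⟩⟩
  · rintro f g - - ⟨k, hk⟩ ⟨l, hl⟩
    refine ⟨min k l, fun m hm => ?_⟩
    have h1 := hk m (hm.trans (min_le_left _ _))
    have h2 := hl m (hm.trans (min_le_right _ _))
    refine ⟨fun x y hy => ?_, ?_⟩
    · rw [Pi.add_apply, Pi.add_apply, h1.1 x y hy, h2.1 x y hy]
    · exact ne_top_of_le_ne_top (measure_union_lt_top h1.2.lt_top h2.2.lt_top).ne
        (measure_mono (Function.support_add f g))
  · rintro c f - ⟨k, hk⟩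
    exact ⟨k, fun m hm => (hk m hm).comp (fun a => c • a) (smul_zero c)⟩

theorem IsStep.integrable {k : ℤ} {f : EuclideanSpace ℝ (Fin d) → E} (h : IsStep D k f) :
    Integrable f volume := memLp_one_iff_integrable.1 (memLp_of_mem_simpleSpace h.mem_simpleSpace 1)

theorem simpleSpace_integrable (f : simpleSpace D E) : Integrable (fun x => f x) volume :=
  memLp_one_iff_integrable.1 (memLp_of_mem_simpleSpace f.2 1)

theorem IsStep.integrable_norm_rpow {k : ℤ} {f : EuclideanSpace ℝ (Fin d) → E}
    (h : IsStep D k f) {p : ℝ} (hp : 0 < p) : Integrable (fun x => ‖f x‖ ^ p) volume :=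
  (h.comp (fun a => ‖a‖ ^ p) (by simp [hp.ne'])).integrable

theorem integrable_norm_rpow (f : simpleSpace D E) {p : ℝ} (hp : 0 < p) :
    Integrable (fun x => ‖f x‖ ^ p) volume := by
  obtain ⟨k, hk⟩ := exists_isStep f.2
  exact (hk k le_rfl).integrable_norm_rpow hp

open Classical in
/-- Multiplication by the indicator of a saturated set, as a linear map of `simpleSpace D E`. -/
noncomputable def cut (D : Set (Cube d)) (E : Type*) [NormedAddCommGroup E] [NormedSpace ℝ E]
    (s : Set (EuclideanSpace ℝ (Fin d))) : simpleSpace D E →ₗ[ℝ] simpleSpace D E :=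
  -- The condition holds whenever `s` is saturated at some level; the value `0` for other sets only
  -- makes the definition total.
  if h : ∀ f ∈ simpleSpace D E, s.indicator f ∈ simpleSpace D E then
    { toFun := fun f => ⟨s.indicator f, h f f.2⟩
      map_add' := fun f g => Subtype.ext (Set.indicator_add' s (f : _ → E) g)
      map_smul' := fun c f => Subtype.ext (Set.indicator_const_smul s c (f : _ → E)) }
  else 0

theorem coe_cut {k : ℤ} {s : Set (EuclideanSpace ℝ (Fin d))} (hs : Saturated D k s)
    (f : simpleSpace D E) :
    (cut D E s f : EuclideanSpace ℝ (Fin d) → E) = s.indicator f := by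
  have h : ∀ f ∈ simpleSpace D E, s.indicator f ∈ simpleSpace D E := by
    intro f hf
    obtain ⟨l, hl⟩ := exists_isStep hf
    exact ((hl (min k l) (min_le_right _ _)).indicator
      (hs.mono (min_le_left _ _))).mem_simpleSpace
  rw [cut, dif_pos h]
  rfl

theorem isStep_average (k : ℤ) (f : simpleSpace D E) :
    IsStep D k (fun x => (cellVol d k)⁻¹ • ∫ y in cell D k x, f y) := by
  refine ⟨fun x y hy => by simp only [cell_eq hy], ?_⟩
  obtain ⟨l, hl⟩ := exists_isStep f.2
  have h := hl (min k l) (min_le_right _ _)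
  refine ne_top_of_le_ne_top (volume_hull_ne_top (min_le_left k l) h.2 h.saturated_support)
    (measure_mono fun x hx => ?_)
  by_contra hcon
  rw [Set.mem_ofPred_eq, Set.not_nonempty_iff_eq_empty] at hcon
  refine hx ?_
  simp only
  rw [setIntegral_eq_zero_of_forall_eq_zero, smul_zero]
  intro y hy
  by_contra h0
  have : y ∈ cell D k x ∩ Function.support f := ⟨hy, h0⟩
  rw [hcon] at this
  exact this

/-- The conditional expectation on the cubes of side length `2 ^ k`. -/
noncomputable def levelAvg (D : Set (Cube d)) (E : Type*) [NormedAddCommGroup E]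
    [NormedSpace ℝ E] [Fact (IsDyadicLattice D)] (k : ℤ) :
    simpleSpace D E →ₗ[ℝ] simpleSpace D E where
  toFun f := ⟨_, (isStep_average k f).mem_simpleSpace⟩
  map_add' f g := by
    ext x : 2
    simp only [Submodule.coe_add, Pi.add_apply]
    rw [integral_add (simpleSpace_integrable f).integrableOn
      (simpleSpace_integrable g).integrableOn, smul_add]
  map_smul' c f := by
    ext x : 2
    simp only [Submodule.coe_smul, Pi.smul_apply, RingHom.id_apply]
    rw [integral_smul, smul_comm]

theorem levelAvg_apply (k : ℤ) (f : simpleSpace D E) (x : EuclideanSpace ℝ (Fin d)) :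
    levelAvg D E k f x =
      (cellVol d k)⁻¹ • ∫ y in cell D k x, f y := rfl

theorem isStep_levelAvg (k : ℤ) (f : simpleSpace D E) : IsStep D k (levelAvg D E k f) :=
  isStep_average k f

theorem levelAvg_const (k : ℤ) (f : simpleSpace D E) {x y : EuclideanSpace ℝ (Fin d)}
    (hy : y ∈ cell D k x) : levelAvg D E k f y =
      levelAvg D E k f x := by
  rw [levelAvg_apply, levelAvg_apply, cell_eq hy]

/-- Jensen's inequality on a single cell. -/
theorem norm_levelAvg_rpow_le (k : ℤ) (f : simpleSpace D E) {p : ℝ} (hp : 1 ≤ p)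
    (x : EuclideanSpace ℝ (Fin d)) :
    cellVol d k * ‖levelAvg D E k f x‖ ^ p ≤
      ∫ y in cell D k x, ‖f y‖ ^ p := by
  have hv := cellVol_pos d k
  have hp0 : 0 < p := by linarith
  have hvol : volume (cell D k x) ≠ 0 := by
    intro h0
    have := volume_cell (D := D) k x
    rw [Measure.real, h0, ENNReal.toReal_zero] at this
    linarith
  have h1 := (convexOn_rpow hp).map_set_average_le (μ := volume) (t := cell D k x)
    (f := fun y => ‖f y‖)
    (Real.continuous_rpow_const hp0.le).continuousOn isClosed_Ici hvol (volume_cell_ne_top k x)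
    (ae_of_all _ fun y => norm_nonneg _) (simpleSpace_integrable f).norm.integrableOn
    (integrable_norm_rpow f hp0).integrableOn
  rw [setAverage_eq, setAverage_eq, volume_cell, smul_eq_mul, smul_eq_mul] at h1
  have h2 : ‖levelAvg D E k f x‖ ≤
      (cellVol d k)⁻¹ * ∫ y in cell D k x, ‖f y‖ := by
    rw [levelAvg_apply, norm_smul, Real.norm_of_nonneg (inv_nonneg.2 hv.le)]
    exact mul_le_mul_of_nonneg_left (norm_integral_le_integral_norm _) (inv_nonneg.2 hv.le)
  calc _ ≤ cellVol d k * ((cellVol d k)⁻¹ *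
        ∫ y in cell D k x, ‖f y‖ ^ p) := by
        refine mul_le_mul_of_nonneg_left (le_trans ?_ h1) hv.le
        exact Real.rpow_le_rpow (norm_nonneg _) h2 hp0.le
    _ = _ := by field_simp

theorem integral_levelAvg_rpow_le (k : ℤ) (f : simpleSpace D E) {p : ℝ} (hp : 1 ≤ p)
    {s : Set (EuclideanSpace ℝ (Fin d))} (hk : Saturated D k s) (hs : volume s ≠ ∞) :
    ∫ x in s, ‖levelAvg D E k f x‖ ^ p ≤
      ∫ x in s, ‖f x‖ ^ p := by
  have hp0 : 0 < p := by linarith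
  rw [← sum_grid_integral hs hk (integrable_norm_rpow f hp0),
    ← sum_grid_integral hs hk (integrable_norm_rpow _ hp0)]
  refine Finset.sum_le_sum fun R hR => ?_
  obtain ⟨h1, h2, -⟩ := of_mem_grid hR
  have h3 : ∀ x ∈ R.toSet, ‖levelAvg D E k f x‖ ^ p =
      ‖levelAvg D E k f R.corner‖ ^ p := by
    intro x hx
    rw [levelAvg_const (x := R.corner) k f (by rwa [cell_corner h1 h2])]
  rw [setIntegral_congr_fun R.measurableSet_toSet h3, setIntegral_const, smul_eq_mul,
    Cube.volume_real, h2]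
  have := norm_levelAvg_rpow_le k f hp R.corner
  rwa [cell_corner h1 h2] at this

theorem levelAvg_cut (k : ℤ) {s : Set (EuclideanSpace ℝ (Fin d))} (hs : Saturated D k s)
    (f : simpleSpace D E) : levelAvg D E k (cut D E s f) = cut D E s (levelAvg D E k f) := by
  classical
  ext x : 2
  rw [coe_cut hs, levelAvg_apply, coe_cut hs]
  by_cases hx : x ∈ s
  · rw [Set.indicator_of_mem hx, levelAvg_apply]
    congr 1
    exact setIntegral_congr_fun (measurableSet_cell k x)
      fun y hy => Set.indicator_of_mem (hs x hx hy) _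
  · rw [Set.indicator_of_notMem hx, setIntegral_eq_zero_of_forall_eq_zero, smul_zero]
    intro y hy
    exact Set.indicator_of_notMem (fun h => hx ((hs.mem_iff hy).1 h)) _

theorem levelAvg_eq_zero_iff {k : ℤ} {f : simpleSpace D E} :
    levelAvg D E k f = 0 ↔ ∀ x, ∫ y in cell D k x, f y = 0 := by
  constructor
  · intro h x
    have h1 : (levelAvg D E k f) x = 0 := by rw [h]; rfl
    rw [levelAvg_apply, smul_eq_zero] at h1
    exact h1.resolve_left (inv_ne_zero (cellVol_pos d k).ne')
  · intro h
    ext x : 2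
    rw [levelAvg_apply, h x, smul_zero]
    rfl

variable [CompleteSpace E]

/-- Completeness matters from here on: in an incomplete space the Bochner integral is `0` by
convention, and averages do not reproduce constants. -/
theorem levelAvg_of_isStep {k : ℤ} {f : simpleSpace D E} (hf : IsStep D k f) :
    levelAvg D E k f = f := by
  ext x : 2
  rw [levelAvg_apply, setIntegral_congr_fun (measurableSet_cell k x) (g := fun _ => f x)
    fun y hy => hf.1 x y hy, setIntegral_const, volume_cell, smul_smul,
    inv_mul_cancel₀ (cellVol_pos d k).ne', one_smul]

theorem integral_levelAvg (k : ℤ) (f : simpleSpace D E)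
    {s : Set (EuclideanSpace ℝ (Fin d))} (hk : Saturated D k s) (hs : volume s ≠ ∞) :
    ∫ x in s, levelAvg D E k f x = ∫ x in s, f x := by
  rw [← sum_grid_integral hs hk (simpleSpace_integrable f),
    ← sum_grid_integral hs hk (simpleSpace_integrable _)]
  refine Finset.sum_congr rfl fun R hR => ?_
  obtain ⟨h1, h2, -⟩ := of_mem_grid hR
  have h3 : ∀ x ∈ R.toSet, levelAvg D E k f x = levelAvg D E k f R.corner := by
    intro x hx
    rw [levelAvg_const (x := R.corner) k f (by rwa [cell_corner h1 h2])]
  rw [setIntegral_congr_fun R.measurableSet_toSet h3, setIntegral_const,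
    Cube.volume_real, h2, levelAvg_apply, cell_corner h1 h2, smul_smul, ← cellVol,
    mul_inv_cancel₀ (cellVol_pos d k).ne', one_smul]

theorem levelAvg_levelAvg {k l : ℤ} (hkl : k ≤ l) (f : simpleSpace D E) :
    levelAvg D E l (levelAvg D E k f) = levelAvg D E l f := by
  ext x : 2
  rw [levelAvg_apply, levelAvg_apply, integral_levelAvg k f ((saturated_cell l x).mono hkl)
    (volume_cell_ne_top l x)]

end Step

/-! ### Norms of simple functions and of their restrictions. -/

section Norm

variable {d : ℕ} {D : Set (Cube d)} {E : Type*} [NormedAddCommGroup E] [NormedSpace ℝ E]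
  [NeZero d] [hD : Fact (IsDyadicLattice D)]

/-- The `L^p` norm of a simple function. -/
noncomputable def lpn (p : ℝ) (f : EuclideanSpace ℝ (Fin d) → E) : ℝ :=
  (∫ x, ‖f x‖ ^ p) ^ (1 / p)

theorem integral_norm_rpow_nonneg (p : ℝ) (f : EuclideanSpace ℝ (Fin d) → E)
    (s : Set (EuclideanSpace ℝ (Fin d))) : 0 ≤ ∫ x in s, ‖f x‖ ^ p :=
  integral_nonneg fun x => Real.rpow_nonneg (norm_nonneg _) _

theorem lpn_nonneg (p : ℝ) (f : EuclideanSpace ℝ (Fin d) → E) : 0 ≤ lpn p f :=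
  Real.rpow_nonneg (integral_nonneg fun x => Real.rpow_nonneg (norm_nonneg _) _) _

theorem lpn_mono {p : ℝ} (hp : 0 < p) {F : Type*} [NormedAddCommGroup F] [NormedSpace ℝ F]
    {f : simpleSpace D E} {g : simpleSpace D F} (h : ∀ x, ‖f x‖ ≤ ‖g x‖) :
    lpn p f ≤ lpn p g :=
  Real.rpow_le_rpow (integral_nonneg fun x => Real.rpow_nonneg (norm_nonneg _) _)
    (integral_mono (integrable_norm_rpow f hp) (integrable_norm_rpow g hp)
      fun x => Real.rpow_le_rpow (norm_nonneg _) (h x) hp.le) (by positivity)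

theorem ofReal_lpn {p : ℝ} (hp : 0 < p) (f : simpleSpace D E) :
    ENNReal.ofReal (lpn p f) = eLpNorm f (ENNReal.ofReal p) volume := by
  rw [(memLp_of_mem_simpleSpace f.2 _).eLpNorm_eq_integral_rpow_norm
    (by simpa using hp) ENNReal.ofReal_ne_top, ENNReal.toReal_ofReal hp.le, lpn, one_div]

theorem lpn_add_le {p : ℝ} (hp : 1 ≤ p) (f g : simpleSpace D E) :
    lpn p (f + g : simpleSpace D E) ≤ lpn p f + lpn p g := by
  have hp0 : 0 < p := by linarith
  rw [← ENNReal.ofReal_le_ofReal_iff (add_nonneg (lpn_nonneg _ _) (lpn_nonneg _ _)),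
    ENNReal.ofReal_add (lpn_nonneg _ _) (lpn_nonneg _ _), ofReal_lpn hp0, ofReal_lpn hp0,
    ofReal_lpn hp0]
  exact eLpNorm_add_le (memLp_of_mem_simpleSpace f.2 1).aestronglyMeasurable
    (memLp_of_mem_simpleSpace g.2 1).aestronglyMeasurable (by simpa using hp)

theorem lpn_neg {p : ℝ} (f : EuclideanSpace ℝ (Fin d) → E) : lpn p (-f) = lpn p f := by
  simp [lpn]

theorem lpn_sub_le {p : ℝ} (hp : 1 ≤ p) (f g : simpleSpace D E) :
    lpn p (f - g : simpleSpace D E) ≤ lpn p f + lpn p g := by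
  rw [sub_eq_add_neg]
  refine (lpn_add_le hp f (-g)).trans ?_
  rw [Submodule.coe_neg, lpn_neg]

theorem lpn_rpow {p : ℝ} (hp : 0 < p) (f : EuclideanSpace ℝ (Fin d) → E) :
    lpn p f ^ p = ∫ x, ‖f x‖ ^ p := by
  rw [lpn, ← Real.rpow_mul (integral_nonneg fun x => Real.rpow_nonneg (norm_nonneg _) _),
    one_div, inv_mul_cancel₀ hp.ne', Real.rpow_one]

theorem lpn_levelAvg_le {p : ℝ} (hp : 1 ≤ p) (k : ℤ) (f : simpleSpace D E) :
    lpn p (levelAvg D E k f) ≤ lpn p f := by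
  have hp0 : 0 < p := by linarith
  refine Real.rpow_le_rpow (integral_nonneg fun x => Real.rpow_nonneg (norm_nonneg _) _) ?_
    (by positivity)
  have h := isStep_levelAvg k f
  rw [← setIntegral_eq_integral_of_forall_compl_eq_zero (s := Function.support (levelAvg D E k f))
    (fun x hx => by
      rw [Function.notMem_support.1 hx, norm_zero, Real.zero_rpow hp0.ne'])]
  exact (integral_levelAvg_rpow_le k f hp h.saturated_support h.2).trans
    (setIntegral_le_integral (integrable_norm_rpow f hp0)
      (ae_of_all _ fun x => Real.rpow_nonneg (norm_nonneg _) _))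

theorem lpn_cut {p : ℝ} (hp : 0 < p) {k : ℤ} {s : Set (EuclideanSpace ℝ (Fin d))}
    (hs : Saturated D k s) (hms : MeasurableSet s) (f : simpleSpace D E) :
    lpn p (cut D E s f) = (∫ x in s, ‖f x‖ ^ p) ^ (1 / p) := by
  rw [lpn, coe_cut hs, ← integral_indicator hms]
  congr 2
  ext x
  by_cases hx : x ∈ s
  · simp [hx]
  · simp [hx, hp.ne']

theorem lpn_cut_le {p : ℝ} (hp : 0 < p) {k : ℤ} {s : Set (EuclideanSpace ℝ (Fin d))}
    (hs : Saturated D k s) (f : simpleSpace D E) : lpn p (cut D E s f) ≤ lpn p f :=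
  lpn_mono hp fun x => by rw [coe_cut hs]; exact norm_indicator_le_norm_self _ _

/-- Decomposition of a simple function along the cubes of a grid. -/
theorem sum_cut_grid {k : ℤ} {s : Set (EuclideanSpace ℝ (Fin d))} (hk : Saturated D k s)
    (hs : volume s ≠ ∞) (f : simpleSpace D E) :
    ∑ R ∈ grid D k s, cut D E R.toSet f = cut D E s f := by
  classical
  ext x : 2
  rw [AddSubmonoidClass.coe_finsetSum, Finset.sum_apply, coe_cut hk]
  have hc : ∀ R ∈ grid D k s, (cut D E R.toSet f) x = R.toSet.indicator f x := fun R hR => by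
    rw [coe_cut (saturated_of_mem (of_mem_grid hR).1 (of_mem_grid hR).2.1)]
  rw [Finset.sum_congr rfl hc]
  by_cases hx : x ∈ s
  · have hR : cubeAt D k x ∈ grid D k s :=
      (mem_grid hs).2 ⟨cubeAt_mem k x, side_cubeAt k x, hk x hx⟩
    rw [Finset.sum_eq_single_of_mem _ hR, Set.indicator_of_mem hx,
      Set.indicator_of_mem (show x ∈ (cubeAt D k x).toSet from mem_cell_self k x)]
    intro R hR' hne
    refine Set.indicator_of_notMem (fun hxR => hne ?_) _
    have := of_mem_grid hR'
    exact (cubeAt_eq_of_mem this.1 this.2.1 hxR).symm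
  · rw [Set.indicator_of_notMem hx, Finset.sum_eq_zero]
    intro R hR
    exact Set.indicator_of_notMem (fun hxR => hx ((of_mem_grid hR).2.2 hxR)) _

theorem cut_eq_self {k : ℤ} {s : Set (EuclideanSpace ℝ (Fin d))} (hk : Saturated D k s)
    {f : simpleSpace D E} (h : ∀ x, x ∉ s → f x = 0) : cut D E s f = f := by
  ext x : 2
  rw [coe_cut hk]
  by_cases hx : x ∈ s
  · rw [Set.indicator_of_mem hx]
  · rw [Set.indicator_of_notMem hx, h x hx]

theorem cut_eq_zero {k : ℤ} {s : Set (EuclideanSpace ℝ (Fin d))} (hk : Saturated D k s)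
    {f : simpleSpace D E} (h : ∀ x ∈ s, f x = 0) : cut D E s f = 0 := by
  ext x : 2
  rw [coe_cut hk]
  by_cases hx : x ∈ s
  · rw [Set.indicator_of_mem hx, h x hx]; rfl
  · rw [Set.indicator_of_notMem hx]; rfl

end Norm

/-! ### Functionals applied to functions with vanishing averages -/

section MeanZero

variable {d : ℕ} {D : Set (Cube d)} [NeZero d] [hD : Fact (IsDyadicLattice D)]

/-- The position of `x` in the grid of mesh `2 ^ k` that is aligned with the cubes of `D` of side
length `2 ^ l`. -/
noncomputable def gridPos (D : Set (Cube d)) (l k : ℤ) (x : EuclideanSpace ℝ (Fin d)) (i : Fin d) :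
    ℤ := ⌊(x i - (cubeAt D l 0).corner i) / 2 ^ k⌋

/-- As `k ≤ l`, the corner of the reference cube lies on the grid of mesh `2 ^ k`, so the integer
parts enumerate the cells. -/
theorem mem_cell_iff_gridPos {k l : ℤ} (hkl : k ≤ l) {x y : EuclideanSpace ℝ (Fin d)} :
    y ∈ cell D k x ↔ ∀ i, gridPos D l k y i = gridPos D l k x i := by
  obtain ⟨-, -, hc⟩ := hD.out.aligned (cubeAt_mem (D := D) k x) (cubeAt_mem l 0)
    (by rw [side_cubeAt, side_cubeAt]; exact two_zpow_mono hkl)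
  have hs : (0 : ℝ) < 2 ^ k := by positivity
  refine forall_congr' fun i => ?_
  obtain ⟨m, hm⟩ := hc i
  have hx := mem_cell_self (D := D) k x i
  rw [side_cubeAt] at hx hm
  have hn : gridPos D l k x i = -m := by
    rw [gridPos, Int.floor_eq_iff, le_div_iff₀ hs, div_lt_iff₀ hs, hm]
    push_cast
    constructor <;> nlinarith [hx.1, hx.2]
  rw [hn, gridPos, Int.floor_eq_iff, le_div_iff₀ hs, div_lt_iff₀ hs, hm, side_cubeAt]
  push_cast
  constructor <;> rintro ⟨h1, h2⟩ <;> constructor <;> nlinarith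

/-- Positions are halved in the passage to the parent cell; the parities of the coordinates thus
tell which of the `2 ^ d` children contains the point. -/
theorem gridPos_succ (l k : ℤ) (x : EuclideanSpace ℝ (Fin d)) (i : Fin d) :
    gridPos D l (k + 1) x i = gridPos D l k x i / 2 := by
  have h : (x i - (cubeAt D l 0).corner i) / 2 ^ (k + 1) =
      (x i - (cubeAt D l 0).corner i) / 2 ^ k / ((2 : ℕ) : ℝ) := by
    rw [zpow_add₀ (by norm_num)]; push_cast; field_simp
  rw [gridPos, gridPos, h, Int.floor_div_natCast]
  rfl

open Classical in
/-- The vector with coordinates `s` in the positions in `T` and `0` elsewhere. -/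
noncomputable def cornerShift (s : ℝ) (T : Finset (Fin d)) : EuclideanSpace ℝ (Fin d) :=
  WithLp.toLp 2 fun i => if i ∈ T then s else 0

theorem norm_cornerShift_le {s : ℝ} (hs : 0 ≤ s) (T : Finset (Fin d)) :
    ‖cornerShift s T‖ ≤ d * s := by
  classical
  have h : cornerShift s T = ∑ i ∈ T, EuclideanSpace.single i s := by
    ext j
    simp [cornerShift]
  rw [h]
  refine (norm_sum_le _ _).trans ?_
  simp only [PiLp.norm_single, Real.norm_of_nonneg hs, Finset.sum_const, nsmul_eq_mul]
  refine mul_le_mul_of_nonneg_right ?_ hs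
  exact_mod_cast (Finset.card_le_univ T).trans (by simp)

theorem gridPos_add_cornerShift (l k : ℤ) (T : Finset (Fin d)) (x : EuclideanSpace ℝ (Fin d))
    (i : Fin d) [Decidable (i ∈ T)] :
    gridPos D l k (x + cornerShift (2 ^ k) T) i = gridPos D l k x i + if i ∈ T then 1 else 0 := by
  have hs : (0 : ℝ) < 2 ^ k := by positivity
  by_cases h : i ∈ T
  · simp only [gridPos, cornerShift, PiLp.add_apply, h, if_true]
    rw [← Int.floor_add_one]
    congr 1
    field_simp
    ring
  · simp [gridPos, cornerShift, h]

/-- The points whose grid position is odd exactly in the coordinates in `T`. -/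
def parityClass (D : Set (Cube d)) (k : ℤ) (T : Finset (Fin d)) : Set (EuclideanSpace ℝ (Fin d)) :=
  {x | ∀ i, i ∈ T ↔ Odd (gridPos D (k + 1) k x i)}

theorem saturated_parityClass (k : ℤ) (T : Finset (Fin d)) :
    Saturated D k (parityClass D k T) := fun x hx y hy i => by
  rw [(mem_cell_iff_gridPos (by omega : k ≤ k + 1)).1 hy i]
  exact hx i

theorem sum_indicator_parityClass {E : Type*} [AddCommMonoid E] (k : ℤ)
    (e : EuclideanSpace ℝ (Fin d) → E) (x : EuclideanSpace ℝ (Fin d)) :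
    ∑ T : Finset (Fin d), (parityClass D k T).indicator e x = e x := by
  classical
  rw [Finset.sum_eq_single (Finset.univ.filter fun i => Odd (gridPos D (k + 1) k x i))]
  · exact Set.indicator_of_mem (fun i => by simp) _
  · intro T _ hT
    refine Set.indicator_of_notMem (fun h => hT ?_) _
    ext i
    simpa using h i
  · simp

/-- Starting from the child with all positions even, the shifts by `cornerShift (2 ^ k) T` reach
every child of the same parent exactly once. -/
theorem cell_inter_parityClass {k : ℤ} {x : EuclideanSpace ℝ (Fin d)}
    (hx : x ∈ parityClass D k ∅) (T : Finset (Fin d)) :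
    cell D (k + 1) x ∩ parityClass D k T = cell D k (x + cornerShift (2 ^ k) T) := by
  classical
  ext y
  rw [Set.mem_inter_iff, mem_cell_iff_gridPos (le_refl (k + 1)),
    mem_cell_iff_gridPos (by omega : k ≤ k + 1)]
  simp only [parityClass, Set.mem_ofPred_eq, ← forall_and]
  refine forall_congr' fun i => ?_
  have h1 := hx i
  rw [gridPos_succ, gridPos_succ, gridPos_add_cornerShift]
  simp only [Finset.notMem_empty, false_iff, Int.not_odd_iff_even, Int.even_iff] at h1
  by_cases hi : i ∈ T
  · simp only [hi, true_iff, if_true, Int.odd_iff]; omega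
  · simp only [hi, false_iff, if_false, Int.odd_iff]; omega

theorem mem_parityClass_shift {k : ℤ} {x : EuclideanSpace ℝ (Fin d)} {T : Finset (Fin d)} :
    x + cornerShift (2 ^ k) T ∈ parityClass D k T ↔ x ∈ parityClass D k ∅ := by
  classical
  refine forall_congr' fun i => ?_
  rw [gridPos_add_cornerShift]
  by_cases hi : i ∈ T
  · simp only [hi, true_iff, if_true, Int.odd_iff, Finset.notMem_empty, false_iff]; omega
  · simp only [hi, false_iff, if_false, Int.odd_iff, Finset.notMem_empty]; omega

variable {E : Type*} [NormedAddCommGroup E] [NormedSpace ℝ E] [CompleteSpace E]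

/-- For `x` in an all-even cell the shifted points run through the children of one parent, on each
of which `e` is constant, so the sum is a multiple of the integral of `e` over the parent. For other
`x` every shifted point misses its parity class. -/
theorem sum_shift_eq_zero {k : ℤ} {e : simpleSpace D E} (he : IsStep D k e)
    (h0 : levelAvg D E (k + 1) e = 0) (x : EuclideanSpace ℝ (Fin d)) :
    ∑ T : Finset (Fin d), (parityClass D k T).indicator e (x + cornerShift (2 ^ k) T) = 0 := by
  classical
  by_cases hx : x ∈ parityClass D k ∅
  · have h1 := levelAvg_eq_zero_iff.1 h0 x
    have h2 : ∫ y in cell D (k + 1) x, e y =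
        ∑ T : Finset (Fin d), ∫ y in cell D (k + 1) x, (cut D E (parityClass D k T) e) y := by
      rw [← integral_finsetSum _ fun T _ => (simpleSpace_integrable _).integrableOn]
      refine integral_congr_ae (ae_of_all _ fun y => ?_)
      simp only [coe_cut (saturated_parityClass k _)]
      exact (sum_indicator_parityClass k e y).symm
    rw [h2] at h1
    have h3 : ∀ T : Finset (Fin d), ∫ y in cell D (k + 1) x, (cut D E (parityClass D k T) e) y =
        cellVol d k • (parityClass D k T).indicator e (x + cornerShift (2 ^ k) T) := by
      intro T
      rw [coe_cut (saturated_parityClass k T),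
        Set.indicator_of_mem (mem_parityClass_shift.2 hx), ← volume_cell (D := D) k
          (x + cornerShift (2 ^ k) T), ← setIntegral_const]
      have hms : MeasurableSet (cell D k (x + cornerShift (2 ^ k) T)) := measurableSet_cell _ _
      rw [← integral_indicator (measurableSet_cell _ _), ← integral_indicator hms]
      congr 1
      ext y
      rw [Set.indicator_indicator, cell_inter_parityClass hx]
      by_cases hy : y ∈ cell D k (x + cornerShift (2 ^ k) T)
      · rw [Set.indicator_of_mem hy, Set.indicator_of_mem hy, he.1 _ _ hy]
      · rw [Set.indicator_of_notMem hy, Set.indicator_of_notMem hy]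
    simp only [h3, ← Finset.smul_sum] at h1
    exact (smul_eq_zero.1 h1).resolve_left (cellVol_pos d k).ne'
  · refine Finset.sum_eq_zero fun T _ => Set.indicator_of_notMem (fun h => hx ?_) _
    exact mem_parityClass_shift.1 h

/-- `L` is `κ`-regular at scale `j` if it is small on the differences `Δ_h u`. -/
def IsRegularFunctional (L : simpleSpace D E →ₗ[ℝ] ℝ) (p κ : ℝ) (j : ℤ) (M : ℝ) : Prop :=
  ∀ h : EuclideanSpace ℝ (Fin d), ‖h‖ ≤ 2 ^ j → ∀ u f : simpleSpace D E,
    (∀ x, f x = u (x + h) - u x) → |L f| ≤ M * (‖h‖ / 2 ^ j) ^ κ * lpn p u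

/-- Let `u T` be the part of `e` on the parity class `T` and `h T` the corresponding corner shift.
The functions `u T` add up to `e`, and their shifts add up to `0`, hence `e = -∑ Δ_{h T} (u T)`:
vanishing averages over parents make `e` a sum of `2 ^ d` differences with steps of length at most
`d * 2 ^ k`. -/
theorem IsRegularFunctional.abs_le_of_step {L : simpleSpace D E →ₗ[ℝ] ℝ} {p κ : ℝ} {j : ℤ} {M : ℝ}
    (hL : IsRegularFunctional L p κ j M) (hp : 1 ≤ p) (hκ : 0 < κ) (hM : 0 ≤ M) {k : ℤ}
    (hk : k + d ≤ j) {e : simpleSpace D E} (he : IsStep D k e)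
    (h0 : levelAvg D E (k + 1) e = 0) :
    |L e| ≤ 2 ^ d * (M * (d * 2 ^ k / 2 ^ j) ^ κ * lpn p e) := by
  classical
  have hs : (0 : ℝ) ≤ 2 ^ k := by positivity
  let u : Finset (Fin d) → simpleSpace D E := fun T => cut D E (parityClass D k T) e
  have hu : ∀ T x, u T x = (parityClass D k T).indicator e x := fun T x => by
    simp only [u]
    rw [coe_cut (saturated_parityClass k T)]
  have hmem : ∀ T : Finset (Fin d),
      (fun x => u T (x + cornerShift (2 ^ k) T) - u T x) ∈ simpleSpace D E := by
    intro T
    refine Submodule.sub_mem (x := fun x => u T (x + cornerShift (2 ^ k) T)) _ ?_ (u T).2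
    have hst : IsStep D k (u T) := by
      simp only [u]
      rw [coe_cut (saturated_parityClass k T)]
      exact he.indicator (saturated_parityClass k T)
    refine IsStep.mem_simpleSpace (k := k) ⟨fun x y hy => hst.1 _ _ ?_, ?_⟩
    · rw [mem_cell_iff_gridPos (by omega : k ≤ k + 1)] at hy ⊢
      intro i
      rw [gridPos_add_cornerShift, gridPos_add_cornerShift, hy i]
    · have : Function.support (fun x => u T (x + cornerShift (2 ^ k) T)) =
          (fun x => x + cornerShift (2 ^ k) T) ⁻¹' Function.support (u T) := rfl
      rw [this, measure_preimage_add_right]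
      exact hst.2
  let f : Finset (Fin d) → simpleSpace D E := fun T => ⟨_, hmem T⟩
  have hsum : e = -∑ T, f T := by
    ext x : 2
    rw [Submodule.coe_neg, AddSubmonoidClass.coe_finsetSum, Pi.neg_apply, Finset.sum_apply]
    simp only [f]
    rw [Finset.sum_sub_distrib]
    simp only [hu]
    rw [sum_shift_eq_zero he h0, sum_indicator_parityClass]
    simp
  have hnorm : ∀ T : Finset (Fin d), ‖cornerShift ((2 : ℝ) ^ k) T‖ ≤ d * 2 ^ k :=
    fun T => norm_cornerShift_le hs T
  -- Regularity is only available for steps of length at most `2 ^ j`; the gap of `d` levels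
  -- suffices because `d ≤ 2 ^ d`.
  have hd2 : (d : ℝ) * 2 ^ k ≤ 2 ^ j := by
    have h1 : (d : ℝ) ≤ 2 ^ (d : ℤ) := by
      rw [zpow_natCast]; exact_mod_cast (Nat.lt_two_pow_self).le
    calc (d : ℝ) * 2 ^ k ≤ 2 ^ (d : ℤ) * 2 ^ k := mul_le_mul_of_nonneg_right h1 hs
      _ = 2 ^ (k + d) := by rw [← zpow_add₀ (by norm_num), add_comm]
      _ ≤ 2 ^ j := two_zpow_mono hk
  calc |L e| = |∑ T, L (f T)| := by rw [hsum, map_neg, abs_neg, map_sum]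
    _ ≤ ∑ T : Finset (Fin d), |L (f T)| := Finset.abs_sum_le_sum_abs _ _
    _ ≤ ∑ T : Finset (Fin d), M * (d * 2 ^ k / 2 ^ j) ^ κ * lpn p e := by
        refine Finset.sum_le_sum fun T _ => ?_
        refine (hL _ ((hnorm T).trans hd2) (u T) (f T) fun x => rfl).trans ?_
        have h2 : (‖cornerShift ((2 : ℝ) ^ k) T‖ / 2 ^ j) ^ κ ≤ (d * 2 ^ k / 2 ^ j) ^ κ := by
          refine Real.rpow_le_rpow (by positivity) ?_ hκ.le
          gcongr
          exact hnorm T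
        have h3 : lpn p (u T) ≤ lpn p e := lpn_cut_le (by linarith) (saturated_parityClass k T) e
        have := lpn_nonneg p (u T)
        gcongr
    _ = _ := by simp

theorem sum_geometric_le {θ : ℝ} (h0 : 0 ≤ θ) (h1 : θ < 1) (s : Finset ℕ) :
    ∑ t ∈ s, θ ^ t ≤ (1 - θ)⁻¹ := by
  rw [← tsum_geometric_of_lt_one h0 h1]
  exact (summable_geometric_of_lt_one h0 h1).sum_le_tsum _ fun _ _ => by positivity

/-- The constant in `IsRegularFunctional.abs_le`. -/
noncomputable def meanZeroConst (d : ℕ) (κ : ℝ) : ℝ :=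
  2 ^ d * 2 * (d : ℝ) ^ κ * (1 - (2 : ℝ) ^ (-κ))⁻¹

theorem two_rpow_neg_lt_one {κ : ℝ} (hκ : 0 < κ) : (2 : ℝ) ^ (-κ) < 1 :=
  Real.rpow_lt_one_of_one_lt_of_neg (by norm_num) (by linarith)

theorem meanZeroConst_nonneg (d : ℕ) {κ : ℝ} (hκ : 0 < κ) : 0 ≤ meanZeroConst d κ := by
  have := two_rpow_neg_lt_one hκ
  have : 0 < (1 - (2 : ℝ) ^ (-κ))⁻¹ := inv_pos.2 (by linarith)
  unfold meanZeroConst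
  positivity

/-- Telescoping over the averages of `b` from a level where `b` is constant up to level `m`, where
they vanish. The increments have vanishing averages on the next level, so the previous lemma applies
to each, with bounds that form a geometric series dominated by the coarsest level. -/
theorem IsRegularFunctional.abs_le {L : simpleSpace D E →ₗ[ℝ] ℝ} {p κ : ℝ} {j : ℤ} {M : ℝ}
    (hL : IsRegularFunctional L p κ j M) (hp : 1 ≤ p) (hκ : 0 < κ) (hM : 0 ≤ M) {m : ℤ}
    (hm : m + d ≤ j) {b : simpleSpace D E} (h0 : levelAvg D E m b = 0) :
    |L b| ≤ meanZeroConst d κ * M * (2 : ℝ) ^ (-κ * (j - m)) * lpn p b := by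
  obtain ⟨k₀, hk₀⟩ := exists_isStep b.2
  -- The starting level `m - n` is so fine that averaging does not change `b`.
  obtain ⟨n, hn⟩ : ∃ n : ℕ, m - n ≤ k₀ := ⟨(m - k₀).toNat, by omega⟩
  let e : ℕ → simpleSpace D E := fun t => levelAvg D E (m - n + t) b
  have hb : b = -∑ t ∈ Finset.range n, (e (t + 1) - e t) := by
    rw [Finset.sum_range_sub]
    simp only [e, Nat.cast_zero, add_zero, sub_add_cancel, h0,
      levelAvg_of_isStep (hk₀ _ hn)]
    simp
  have hterm : ∀ t ∈ Finset.range n, |L (e (t + 1) - e t)| ≤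
      2 ^ d * 2 * (d : ℝ) ^ κ * M * (2 : ℝ) ^ (-κ * (j - m)) * lpn p b *
        ((2 : ℝ) ^ (-κ)) ^ (n - 1 - t) := by
    intro t ht
    have htn := Finset.mem_range.1 ht
    have hE : ((t + 1 : ℕ) : ℤ) = t + 1 := by push_cast; ring
    have h1 : IsStep D (m - n + t) (e t - e (t + 1) : simpleSpace D E) := by
      have a1 := isStep_levelAvg (m - n + t) b
      have a2 := (isStep_levelAvg (m - n + (t + 1 : ℕ)) b).mono
        (by push_cast; omega : m - n + (t : ℤ) ≤ m - n + (t + 1 : ℕ))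
      refine ⟨fun x y hy => ?_, ?_⟩
      · rw [Submodule.coe_sub, Pi.sub_apply, Pi.sub_apply]
        simp only [e]
        rw [a1.1 x y hy, a2.1 x y hy]
      · refine ne_top_of_le_ne_top (measure_union_lt_top a1.2.lt_top a2.2.lt_top).ne
          (measure_mono ?_)
        exact Function.support_sub _ _
    have h2 : levelAvg D E (m - n + t + 1) (e t - e (t + 1)) = 0 := by
      rw [map_sub]
      simp only [e]
      rw [levelAvg_levelAvg (by omega), levelAvg_levelAvg (by push_cast; omega), sub_self]
    have h3 := hL.abs_le_of_step hp hκ hM (by omega : m - n + (t : ℤ) + d ≤ j) h1 h2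
    rw [← neg_sub, map_neg, abs_neg]
    refine h3.trans ?_
    have h4 : lpn p (e t - e (t + 1) : simpleSpace D E) ≤ 2 * lpn p b := by
      refine (lpn_sub_le hp _ _).trans ?_
      have := lpn_levelAvg_le hp (m - n + t) b
      have := lpn_levelAvg_le hp (m - n + (t + 1 : ℕ)) b
      simp only [e]
      linarith
    have h5 : ((d : ℝ) * 2 ^ (m - n + (t : ℤ)) / 2 ^ j) ^ κ ≤
        (d : ℝ) ^ κ * ((2 : ℝ) ^ (-κ * (j - m)) * ((2 : ℝ) ^ (-κ)) ^ (n - 1 - t)) := by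
      rw [mul_div_assoc, Real.mul_rpow (by positivity) (by positivity), ← zpow_sub₀ (by norm_num)]
      -- The exact exponent has a further `-κ`, as the increment with index `t` lives on level `m -
      -- 1 - (n - 1 - t)`; this gain is dropped.
      refine mul_le_mul_of_nonneg_left (le_of_eq_of_le ?_ (Real.rpow_le_rpow_of_exponent_le
        (x := 2) (by norm_num) (y := -κ * (j - m) + -κ * ((n - 1 - t : ℕ) : ℝ) - κ)
        (z := -κ * (j - m) + -κ * ((n - 1 - t : ℕ) : ℝ)) (by linarith)) |>.trans ?_) (by positivity)
      · rw [← Real.rpow_intCast, ← Real.rpow_mul (by norm_num)]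
        congr 1
        have : ((n - 1 - t : ℕ) : ℝ) = n - 1 - t := by
          rw [Nat.cast_sub (by omega), Nat.cast_sub (by omega)]; simp
        rw [this]
        push_cast
        ring
      · rw [Real.rpow_add (by norm_num), Real.rpow_mul_natCast (by norm_num)]
    have := lpn_nonneg p b
    have := lpn_nonneg p (e t - e (t + 1) : simpleSpace D E)
    calc _ ≤ 2 ^ d * (M * ((d : ℝ) ^ κ * ((2 : ℝ) ^ (-κ * (j - m)) *
          ((2 : ℝ) ^ (-κ)) ^ (n - 1 - t))) * (2 * lpn p b)) := by gcongr
      _ = _ := by ring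
  have hθ := two_rpow_neg_lt_one hκ
  have hgeom : ∑ t ∈ Finset.range n, ((2 : ℝ) ^ (-κ)) ^ (n - 1 - t) ≤
      (1 - (2 : ℝ) ^ (-κ))⁻¹ := by
    rw [Finset.sum_range_reflect (fun t => ((2 : ℝ) ^ (-κ)) ^ t) n]
    exact sum_geometric_le (by positivity) hθ _
  have hnn := lpn_nonneg p b
  calc |L b| = |∑ t ∈ Finset.range n, L (e (t + 1) - e t)| := by
        conv_lhs => rw [hb, map_neg, abs_neg, map_sum]
    _ ≤ ∑ t ∈ Finset.range n, |L (e (t + 1) - e t)| := Finset.abs_sum_le_sum_abs _ _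
    _ ≤ _ := Finset.sum_le_sum hterm
    _ ≤ 2 ^ d * 2 * (d : ℝ) ^ κ * M * (2 : ℝ) ^ (-κ * (j - m)) * lpn p b *
          (1 - (2 : ℝ) ^ (-κ))⁻¹ := by
        rw [← Finset.mul_sum]
        exact mul_le_mul_of_nonneg_left hgeom (by positivity)
    _ = _ := by rw [meanZeroConst]; ring

end MeanZero

/-! ### The bilinear forms of a family of single scale operators -/

section Forms

variable {d : ℕ} {D : Set (Cube d)}

/-- The bounds on the bilinear forms `Λ_j (f, g) = ∫ ⟨T_j f, g⟩` on simple functions that are used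
in the proof of sparse domination. Here `r` plays the role of `q'`. -/
structure FormBounds {E₁ E₂ : Type*} [NormedAddCommGroup E₁] [NormedSpace ℝ E₁]
    [NormedAddCommGroup E₂] [NormedSpace ℝ E₂]
    (Λ : ℤ → simpleSpace D E₁ →ₗ[ℝ] simpleSpace D E₂ →ₗ[ℝ] ℝ) (p r κ a₁ a₂ a₀ b : ℝ) : Prop where
  local_zero : ∀ j k, j ≤ k → ∀ x (f : simpleSpace D E₁) (g : simpleSpace D E₂),
    (∀ y, y ∉ cell D k x → f y = 0) → (∀ y ∈ bigCell D k x, g y = 0) → Λ j f g = 0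
  single : ∀ j f g, |Λ j f g| ≤ a₀ * cellVol d j ^ (1 - 1 / p - 1 / r) * lpn p f * lpn r g
  regular : ∀ j (h : EuclideanSpace ℝ (Fin d)), ‖h‖ ≤ 2 ^ j → ∀ u f : simpleSpace D E₁, ∀ g,
    (∀ x, f x = u (x + h) - u x) →
    |Λ j f g| ≤ b * cellVol d j ^ (1 - 1 / p - 1 / r) * lpn r g * (‖h‖ / 2 ^ j) ^ κ * lpn p u
  adjoint_regular : ∀ j (h : EuclideanSpace ℝ (Fin d)), ‖h‖ ≤ 2 ^ j → ∀ f,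
    ∀ u g : simpleSpace D E₂, (∀ x, g x = u (x + h) - u x) →
    |Λ j f g| ≤ b * cellVol d j ^ (1 - 1 / p - 1 / r) * lpn p f * (‖h‖ / 2 ^ j) ^ κ * lpn r u
  weak : ∀ M₁ M₂ : ℤ, ∀ (f : simpleSpace D E₁) (g : simpleSpace D E₂) (c : ℝ)
    (s : Set (EuclideanSpace ℝ (Fin d))), MeasurableSet s → volume s ≠ ∞ → 0 ≤ c →
    (∀ x, ‖g x‖ ≤ c) → (∀ x, x ∉ s → g x = 0) →
    |∑ j ∈ Finset.Icc M₁ M₂, Λ j f g| ≤ a₁ * lpn p f * (c * volume.real s ^ (1 - 1 / p))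
  strong : ∀ M₁ M₂ : ℤ, ∀ (f : simpleSpace D E₁) (g : simpleSpace D E₂) (c : ℝ)
    (s : Set (EuclideanSpace ℝ (Fin d))), MeasurableSet s → volume s ≠ ∞ → 0 ≤ c →
    (∀ x, ‖f x‖ ≤ c) → (∀ x, x ∉ s → f x = 0) →
    |∑ j ∈ Finset.Icc M₁ M₂, Λ j f g| ≤ a₂ * (c * volume.real s ^ (1 - 1 / r)) * lpn r g

/-! ### Behaviour of norms under dilations. -/

section Dilation

variable {E : Type*} [NormedAddCommGroup E]

theorem dil_inv_dil {t : ℝ} (ht : t ≠ 0) (f : EuclideanSpace ℝ (Fin d) → E) :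
    dil t⁻¹ (dil t f) = f := by
  ext x
  simp [dil, smul_smul, mul_inv_cancel₀ ht]

theorem measurableEmbedding_smul {t : ℝ} (ht : t ≠ 0) :
    MeasurableEmbedding fun x : EuclideanSpace ℝ (Fin d) => t • x :=
  (Homeomorph.smulOfNeZero t ht).measurableEmbedding

theorem map_smul_volume {t : ℝ} (ht : 0 < t) :
    Measure.map (fun x : EuclideanSpace ℝ (Fin d) => t • x) volume =
      ENNReal.ofReal (t ^ d)⁻¹ • volume := by
  rw [Measure.map_addHaar_smul _ ht.ne', finrank_euclideanSpace_fin, abs_of_pos (by positivity)]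

theorem eLpNorm_dil {t : ℝ} (ht : 0 < t) {p : ℝ} (hp : 0 < p)
    (f : EuclideanSpace ℝ (Fin d) → E) :
    eLpNorm (dil t f) (ENNReal.ofReal p) volume =
      ENNReal.ofReal ((t ^ d) ^ (-(1 / p))) * eLpNorm f (ENNReal.ofReal p) volume := by
  have h := (measurableEmbedding_smul (d := d) ht.ne').eLpNorm_map_measure (g := f)
    (p := ENNReal.ofReal p) (μ := volume)
  rw [map_smul_volume ht, eLpNorm_smul_measure_of_ne_top ENNReal.ofReal_ne_top, one_div,
    ENNReal.toReal_inv, ENNReal.toReal_ofReal hp.le, smul_eq_mul,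
    ENNReal.ofReal_rpow_of_pos (by positivity)] at h
  rw [show dil t f = f ∘ fun x => t • x from rfl, ← h, Real.rpow_neg (by positivity),
    Real.inv_rpow (by positivity), one_div]

theorem aestronglyMeasurable_of_dil {t : ℝ} (ht : 0 < t) {f : EuclideanSpace ℝ (Fin d) → E}
    (h : AEStronglyMeasurable (dil t f) volume) : AEStronglyMeasurable f volume := by
  have h1 := (measurableEmbedding_smul (d := d) ht.ne').aestronglyMeasurable_map_iff.2
    (show AEStronglyMeasurable (f ∘ fun x => t • x) volume from h)
  rw [map_smul_volume ht] at h1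
  exact h1.mono_ac (Measure.absolutelyContinuous_smul (ENNReal.ofReal_pos.2 (by positivity)).ne')

end Dilation

/-- Kolmogorov's inequality. -/
theorem lintegral_le_of_weakLpNorm_le {E : Type*} [NormedAddCommGroup E] {p : ℝ} (hp : 1 < p)
    {F : EuclideanSpace ℝ (Fin d) → E} (hF : AEStronglyMeasurable F volume) {w : ℝ} (hw : 0 ≤ w)
    (h : weakLpNorm p F ≤ ENNReal.ofReal w) {s : Set (EuclideanSpace ℝ (Fin d))}
    (hs : volume s ≠ ∞) :
    ∫⁻ x in s, ‖F x‖ₑ ≤ ENNReal.ofReal (p / (p - 1) * (w * volume.real s ^ (1 - 1 / p))) := by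
  have hp0 : 0 < p := by linarith
  have hlayer : ∫⁻ x in s, ‖F x‖ₑ =
      ∫⁻ t in Set.Ioi (0 : ℝ), volume.restrict s {x | t < ‖F x‖} := by
    rw [← lintegral_eq_lintegral_meas_lt (volume.restrict s) (ae_of_all _ fun x => norm_nonneg _)
      hF.restrict.norm.aemeasurable]
    simp only [ofReal_norm]
  -- The weak norm bound rewritten as a bound for the distribution function.
  have hmeas : ∀ t : ℝ, 0 < t → volume {x | t < ‖F x‖} ≤ ENNReal.ofReal (w ^ p * t ^ (-p)) := by
    intro t ht
    have h1 := (le_iSup (fun t : ℝ≥0 => (t : ℝ≥0∞) *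
      volume {x | (t : ℝ≥0∞) < ‖F x‖ₑ} ^ (1 / p)) t.toNNReal).trans h
    have h2 : {x | ((t.toNNReal : ℝ≥0) : ℝ≥0∞) < ‖F x‖ₑ} = {x | t < ‖F x‖} := by
      ext x
      simp only [Set.mem_ofPred_eq]
      rw [← ofReal_norm]
      exact ENNReal.ofReal_lt_ofReal_iff_of_nonneg ht.le
    simp only [h2] at h1
    have h3 : volume {x | t < ‖F x‖} ^ (1 / p) ≤ ENNReal.ofReal (w / t) := by
      rw [ENNReal.ofReal_div_of_pos ht, ENNReal.le_div_iff_mul_le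
        (Or.inl (ENNReal.ofReal_pos.2 ht).ne') (Or.inl ENNReal.ofReal_ne_top), mul_comm]
      exact h1
    have h4 := ENNReal.rpow_le_rpow h3 hp0.le
    rw [← ENNReal.rpow_mul, one_div, inv_mul_cancel₀ hp0.ne', ENNReal.rpow_one,
      ENNReal.ofReal_rpow_of_nonneg (by positivity) hp0.le, Real.div_rpow hw ht.le,
      div_eq_mul_inv, ← Real.rpow_neg ht.le] at h4
    exact h4
  set v := volume.real s with hv
  have hvE : volume s = ENNReal.ofReal v := by rw [hv, ofReal_measureReal hs]
  have hv0 : 0 ≤ v := measureReal_nonneg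
  have hres : ∀ t, volume.restrict s {x | t < ‖F x‖} ≤ volume {x | t < ‖F x‖} :=
    fun t => Measure.restrict_apply_le _ _
  rcases hw.eq_or_lt with rfl | hwpos
  · rw [hlayer]
    refine le_of_eq_of_le ?_ zero_le
    refine setLIntegral_eq_zero measurableSet_Ioi fun t ht => ?_
    have := (hres t).trans (hmeas t ht)
    rw [Real.zero_rpow hp0.ne', zero_mul, ENNReal.ofReal_zero] at this
    exact le_antisymm this zero_le
  rcases hv0.eq_or_lt with hv0' | hvpos
  · rw [Measure.restrict_eq_zero.2 (by rw [hvE, ← hv0', ENNReal.ofReal_zero])]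
    simp
  -- At the level `τ` the trivial bound `v` and the weak type bound `w ^ p * τ ^ (-p)` for the
  -- distribution function coincide. The contributions below and above `τ` are `1` and `1 / (p - 1)`
  -- times `w * v ^ (1 - 1 / p)`.
  set τ := w * v ^ (-(1 / p)) with hτ
  have hτpos : 0 < τ := by positivity
  have hsplit : Set.Ioi (0 : ℝ) = Set.Ioc 0 τ ∪ Set.Ioi τ :=
    (Set.Ioc_union_Ioi_eq_Ioi hτpos.le).symm
  rw [hlayer, hsplit]
  refine (lintegral_union_le _ _ _).trans ?_
  have hA : ∫⁻ t in Set.Ioc 0 τ, volume.restrict s {x | t < ‖F x‖} ≤ ENNReal.ofReal (v * τ) := by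
    refine (setLIntegral_mono (g := fun _ => ENNReal.ofReal v) measurable_const fun t _ => ?_).trans ?_
    · exact (measure_mono (Set.subset_univ _)).trans (by rw [Measure.restrict_apply_univ, hvE])
    · rw [setLIntegral_const, Real.volume_Ioc, sub_zero, ENNReal.ofReal_mul hv0]
  have hB : ∫⁻ t in Set.Ioi τ, volume.restrict s {x | t < ‖F x‖} ≤
      ENNReal.ofReal (w ^ p * (τ ^ (1 - p) / (p - 1))) := by
    have hint : IntegrableOn (fun t : ℝ => w ^ p * t ^ (-p)) (Set.Ioi τ) volume :=
      (integrableOn_Ioi_rpow_of_lt (by linarith) hτpos).const_mul _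
    refine (setLIntegral_mono' measurableSet_Ioi fun t ht =>
      (hres t).trans (hmeas t (hτpos.trans ht))).trans ?_
    rw [← ofReal_integral_eq_lintegral_ofReal hint ((ae_restrict_iff' measurableSet_Ioi).2
      (ae_of_all _ fun t ht => ?_)), integral_const_mul, integral_Ioi_rpow_of_lt (by linarith) hτpos]
    · refine ENNReal.ofReal_le_ofReal (le_of_eq ?_)
      rw [show -p + 1 = 1 - p by ring, neg_div, ← div_neg, neg_sub]
    · have : (0 : ℝ) < t := hτpos.trans ht
      simp only [Pi.zero_apply]
      positivity
  refine (add_le_add hA hB).trans ?_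
  rw [← ENNReal.ofReal_add (by positivity)
    (mul_nonneg (by positivity) (div_nonneg (by positivity) (by linarith)))]
  refine ENNReal.ofReal_le_ofReal (le_of_eq ?_)
  have e1 : v * τ = w * v ^ (1 - 1 / p) := by
    rw [hτ, sub_eq_add_neg, Real.rpow_add hvpos, Real.rpow_one]; ring
  have e2 : w ^ p * τ ^ (1 - p) = w * v ^ (1 - 1 / p) := by
    rw [hτ, Real.mul_rpow hwpos.le (by positivity), ← mul_assoc, ← Real.rpow_add hwpos,
      ← Real.rpow_mul hv0]
    congr 2
    · rw [add_sub_cancel, Real.rpow_one]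
    · field_simp; ring
  rw [e1, ← mul_div_assoc, e2]
  have : p - 1 ≠ 0 := by linarith
  field_simp
  ring

/-- The distribution function is at most the volume of `s` up to the level `c` and vanishes beyond
it. -/
theorem lorentzOneNorm_le {E : Type*} [NormedAddCommGroup E] {q : ℝ} (hq : 0 < q)
    {f : EuclideanSpace ℝ (Fin d) → E} {c : ℝ} (hc : 0 ≤ c) (hf : ∀ x, ‖f x‖ ≤ c)
    {s : Set (EuclideanSpace ℝ (Fin d))} (hs : volume s ≠ ∞) (hfs : ∀ x, x ∉ s → f x = 0) :
    lorentzOneNorm q f ≤ ENNReal.ofReal (q * (c * volume.real s ^ (1 / q))) := by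
  rw [lorentzOneNorm, ENNReal.ofReal_mul hq.le]
  refine mul_le_mul_right ?_ _
  have h1 : ∀ t ∈ Set.Ioi (0 : ℝ), volume {x | ENNReal.ofReal t < ‖f x‖ₑ} ^ (1 / q) ≤
      (Set.Ioc 0 c).indicator (fun _ => ENNReal.ofReal (volume.real s ^ (1 / q))) t := by
    intro t ht
    have hset : {x | ENNReal.ofReal t < ‖f x‖ₑ} = {x | t < ‖f x‖} := by
      ext x
      simp only [Set.mem_ofPred_eq]
      rw [← ofReal_norm]
      exact ENNReal.ofReal_lt_ofReal_iff_of_nonneg (le_of_lt ht)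
    rw [hset]
    by_cases htc : t ≤ c
    · rw [Set.indicator_of_mem (show t ∈ Set.Ioc 0 c from ⟨ht, htc⟩), ← ENNReal.ofReal_rpow_of_nonneg measureReal_nonneg
        (by positivity), ofReal_measureReal hs]
      refine ENNReal.rpow_le_rpow (measure_mono fun x hx => ?_) (by positivity)
      by_contra hxs
      rw [Set.mem_ofPred_eq, hfs x hxs, norm_zero] at hx
      exact lt_asymm ht hx
    · rw [Set.indicator_of_notMem (fun h => htc h.2)]
      have : {x | t < ‖f x‖} = ∅ := by
        ext x
        simp only [Set.mem_ofPred_eq, Set.mem_empty_iff_false, iff_false, not_lt]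
        exact (hf x).trans (not_le.1 htc).le
      rw [this, measure_empty, ENNReal.zero_rpow_of_pos (by positivity)]
  refine (setLIntegral_mono' measurableSet_Ioi h1).trans ?_
  rw [setLIntegral_indicator measurableSet_Ioc, setLIntegral_const,
    Set.inter_eq_left.2 Set.Ioc_subset_Ioi_self, Real.volume_Ioc, sub_zero, mul_comm,
    ENNReal.ofReal_mul hc]

end Forms

/-! ### From the single scale operators to bilinear forms. -/

section BRS

variable {d : ℕ} {D : Set (Cube d)} [NeZero d] [hD : Fact (IsDyadicLattice D)]
  {B₁ B₂ : Type*} [NormedAddCommGroup B₁] [NormedSpace ℝ B₁]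
  [NormedAddCommGroup B₂] [NormedSpace ℝ B₂]
  {T : ℤ → simpleSpace D B₁ →ₗ[ℝ] (EuclideanSpace ℝ (Fin d) → B₂)} {p q κ : ℝ}
  {Ap Aq A₀ B : ℝ≥0}

theorem dil_dil_mem (j : ℤ) (F : simpleSpace D B₁) :
    dil ((2 : ℝ) ^ j)⁻¹ (dil ((2 : ℝ) ^ j) F) ∈ simpleSpace D B₁ := by
  rw [dil_inv_dil (by positivity)]; exact F.2

theorem dilOp_dil (S : simpleSpace D B₁ →ₗ[ℝ] (EuclideanSpace ℝ (Fin d) → B₂)) (j : ℤ)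
    (F : simpleSpace D B₁) :
    dilOp S ((2 : ℝ) ^ j) (dil ((2 : ℝ) ^ j) F) (dil_dil_mem j F) = dil ((2 : ℝ) ^ j) (S F) := by
  rw [dilOp]
  congr 2
  exact Subtype.ext (dil_inv_dil (by positivity) _)

theorem ENNReal.le_of_ofReal_mul_le {a b : ℝ} (ha : 0 < a) {x y : ℝ≥0∞}
    (h : ENNReal.ofReal a * x ≤ ENNReal.ofReal b * y) : x ≤ ENNReal.ofReal (a⁻¹ * b) * y := by
  have h1 : ENNReal.ofReal a⁻¹ * (ENNReal.ofReal a * x) = x := by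
    rw [← mul_assoc, ← ENNReal.ofReal_mul (by positivity), inv_mul_cancel₀ ha.ne',
      ENNReal.ofReal_one, one_mul]
  rw [← h1, ENNReal.ofReal_mul (by positivity), mul_assoc]
  exact mul_le_mul_right h _

/-- The power of the cell volume that appears when the dilation by `2 ^ j` is undone: `1 / q - 1 / p
= 1 - 1 / p - 1 / r`. -/
theorem cellVol_rpow_aux (j : ℤ) {r : ℝ} (hqr : q.HolderConjugate r) :
    (cellVol d j ^ (-(1 / q)))⁻¹ * cellVol d j ^ (-(1 / p)) =
      cellVol d j ^ (1 - 1 / p - 1 / r) := by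
  have hv := cellVol_pos d j
  rw [← Real.rpow_neg hv.le, ← Real.rpow_add hv]
  congr 1
  have := hqr.inv_add_inv_eq_one
  rw [one_div, one_div, one_div]
  linarith

namespace IsBRSFamily

variable (h : IsBRSFamily T p q κ Ap Aq A₀ B)
include h

theorem aestronglyMeasurable (j : ℤ) (F : simpleSpace D B₁) :
    AEStronglyMeasurable (T j F) volume := by
  have := (h.singleScale j _ (dil_dil_mem j F)).1
  rw [dilOp_dil] at this
  exact aestronglyMeasurable_of_dil (by positivity) this

theorem eLpNorm_le (hp : 1 < p) (hq : 1 < q) (j : ℤ) (F : simpleSpace D B₁) :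
    eLpNorm (T j F) (ENNReal.ofReal q) volume ≤
      ENNReal.ofReal (A₀ * cellVol d j ^ (1 - 1 / p - 1 / q.conjExponent)) *
        eLpNorm F (ENNReal.ofReal p) volume := by
  have h1 := (h.singleScale j _ (dil_dil_mem j F)).2
  rw [dilOp_dil, eLpNorm_dil (by positivity) (by linarith), eLpNorm_dil (by positivity)
    (by linarith), ← mul_assoc, ← ENNReal.ofReal_coe_nnreal, ← ENNReal.ofReal_mul (by positivity)]
    at h1
  refine (ENNReal.le_of_ofReal_mul_le (by positivity) h1).trans (le_of_eq ?_)
  rw [← cellVol_rpow_aux j (Real.HolderConjugate.conjExponent hq), cellVol]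
  congr 2
  ring

theorem memLp (hp : 1 < p) (hq : 1 < q) (j : ℤ) (F : simpleSpace D B₁) :
    MemLp (T j F) (ENNReal.ofReal q) volume :=
  ⟨h.aestronglyMeasurable j F, (h.eLpNorm_le hp hq j F).trans_lt
    (ENNReal.mul_lt_top ENNReal.ofReal_lt_top (memLp_of_mem_simpleSpace F.2 _).2)⟩

/-- The hypothesis (T3) bounds some value `w` of the extension of `T j` at the simple function `F`.
Single scale boundedness shows that `w` and `T j F` have comparable norms, and the rest is
rescaling. -/
theorem eLpNorm_shiftDiff_le (hp : 1 < p) (hq : 1 < q) (j : ℤ) {v : EuclideanSpace ℝ (Fin d)}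
    (hv : ‖v‖ ≤ 2 ^ j) (u F : simpleSpace D B₁) (hF : ∀ x, F x = u (x + v) - u x) :
    eLpNorm (T j F) (ENNReal.ofReal q) volume ≤
      ENNReal.ofReal (B * (‖v‖ / 2 ^ j) ^ κ * cellVol d j ^ (1 - 1 / p - 1 / q.conjExponent)) *
        eLpNorm u (ENNReal.ofReal p) volume := by
  have ht : (0 : ℝ) < 2 ^ j := by positivity
  have hnorm : ‖((2 : ℝ) ^ j)⁻¹ • v‖ = ‖v‖ / 2 ^ j := by
    rw [norm_smul, norm_inv, Real.norm_of_nonneg ht.le]; field_simp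
  have hmem : MemLp (dil ((2 : ℝ) ^ j) u) (ENNReal.ofReal p) volume := by
    refine ⟨?_, ?_⟩
    · exact (memLp_of_mem_simpleSpace u.2 1).aestronglyMeasurable.comp_quasiMeasurePreserving
        (Measure.quasiMeasurePreserving_smul volume ht.ne')
    · rw [eLpNorm_dil ht (by linarith)]
      exact ENNReal.mul_lt_top ENNReal.ofReal_lt_top (memLp_of_mem_simpleSpace u.2 _).2
  obtain ⟨w, hw, hwn⟩ := h.regularity j (((2 : ℝ) ^ j)⁻¹ • v)
    (by rw [hnorm, div_le_one ht]; exact hv) (dil ((2 : ℝ) ^ j) u) hmem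
  have hFd : dil ((2 : ℝ) ^ j)⁻¹ (shiftDiff (((2 : ℝ) ^ j)⁻¹ • v) (dil ((2 : ℝ) ^ j) u)) = F := by
    ext x
    simp only [dil, shiftDiff, smul_add, smul_smul, mul_inv_cancel₀ ht.ne', one_smul, hF]
  rw [hFd] at hw
  have hle : eLpNorm (T j F) (ENNReal.ofReal q) volume ≤ eLpNorm w (ENNReal.ofReal q) volume := by
    have hq1 : 1 ≤ ENNReal.ofReal q := by simpa using hq.le
    set C : ℝ≥0 := (A₀ * cellVol d j ^ (1 - 1 / p - 1 / q.conjExponent)).toNNReal with hC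
    refine ENNReal.le_of_forall_pos_le_add fun ε hε _ => ?_
    -- The error `T j (F - φ) - (w - T j φ)` has norm at most `C + 1` times the tolerance, which is
    -- therefore taken to be `ε / (1 + C)`.
    obtain ⟨φ, hφ1, hφ2⟩ := hw.approx ((ε / (1 + C) : ℝ≥0) : ℝ≥0∞) (by
      rw [ENNReal.coe_pos]; positivity)
    have hm1 := h.aestronglyMeasurable j
    have e1 : T j F = w + ((T j (F - φ)) - (w - T j φ)) := by
      rw [map_sub]; abel
    have e2 := h.eLpNorm_le hp hq j (F - φ)
    rw [Submodule.coe_sub] at e2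
    calc eLpNorm (T j F) (ENNReal.ofReal q) volume
        ≤ eLpNorm w (ENNReal.ofReal q) volume +
          eLpNorm ((T j (F - φ)) - (w - T j φ)) (ENNReal.ofReal q) volume := by
          conv_lhs => rw [e1]
          exact eLpNorm_add_le hw.memLp.1 ((hm1 _).sub (hw.memLp.1.sub (hm1 _))) hq1
      _ ≤ eLpNorm w (ENNReal.ofReal q) volume +
          (eLpNorm (T j (F - φ)) (ENNReal.ofReal q) volume +
            eLpNorm (w - T j φ) (ENNReal.ofReal q) volume) := by
          gcongr
          exact eLpNorm_sub_le (hm1 _) (hw.memLp.1.sub (hm1 _)) hq1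
      _ ≤ eLpNorm w (ENNReal.ofReal q) volume +
          (C * ((ε / (1 + C) : ℝ≥0) : ℝ≥0∞) + ((ε / (1 + C) : ℝ≥0) : ℝ≥0∞)) := by
          gcongr
          refine e2.trans ?_
          exact mul_le_mul_right hφ1 _
      _ = eLpNorm w (ENNReal.ofReal q) volume + ε := by
          congr 1
          rw [← ENNReal.coe_mul, ← ENNReal.coe_add, ENNReal.coe_inj]
          have : (1 + C) ≠ 0 := by positivity
          field_simp
          ring
  rw [eLpNorm_dil ht (by linarith), eLpNorm_dil ht (by linarith), hnorm, ← mul_assoc,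
    ← ENNReal.ofReal_coe_nnreal, ← ENNReal.ofReal_mul (by positivity),
    ← ENNReal.ofReal_mul (by positivity)] at hwn
  refine hle.trans ((ENNReal.le_of_ofReal_mul_le (by positivity) hwn).trans (le_of_eq ?_))
  rw [← cellVol_rpow_aux j (Real.HolderConjugate.conjExponent hq), cellVol]
  congr 2
  ring

end IsBRSFamily

/-! ### The pairing of functions with values in a space and in its dual. -/

section Pairing

theorem aestronglyMeasurable_pairing {g : EuclideanSpace ℝ (Fin d) → StrongDual ℝ B₂}
    {u : EuclideanSpace ℝ (Fin d) → B₂} (hg : AEStronglyMeasurable g volume)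
    (hu : AEStronglyMeasurable u volume) : AEStronglyMeasurable (fun x => g x (u x)) volume :=
  (ContinuousLinearMap.id ℝ (StrongDual ℝ B₂)).aestronglyMeasurable_comp₂ hg hu

theorem eLpNorm_pairing_le {q r : ℝ} (hqr : q.HolderConjugate r)
    {g : EuclideanSpace ℝ (Fin d) → StrongDual ℝ B₂}
    {u : EuclideanSpace ℝ (Fin d) → B₂} (hg : AEStronglyMeasurable g volume)
    (hu : AEStronglyMeasurable u volume) :
    eLpNorm (fun x => g x (u x)) 1 volume ≤
      eLpNorm g (ENNReal.ofReal r) volume * eLpNorm u (ENNReal.ofReal q) volume := by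
  have := hqr.symm.ennrealOfReal
  have := eLpNorm_le_eLpNorm_mul_eLpNorm'_of_norm (p := ENNReal.ofReal r) (q := ENNReal.ofReal q)
    (r := 1) hg hu (fun l v => l v) 1 (ae_of_all _ fun x => by
      simpa using (g x).le_opNorm (u x))
  simpa using this

theorem integrable_pairing {q r : ℝ} (hqr : q.HolderConjugate r)
    {g : EuclideanSpace ℝ (Fin d) → StrongDual ℝ B₂}
    {u : EuclideanSpace ℝ (Fin d) → B₂} (hg : MemLp g (ENNReal.ofReal r) volume)
    (hu : MemLp u (ENNReal.ofReal q) volume) : Integrable (fun x => g x (u x)) volume :=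
  memLp_one_iff_integrable.1 ⟨aestronglyMeasurable_pairing hg.1 hu.1,
    (eLpNorm_pairing_le hqr hg.1 hu.1).trans_lt (ENNReal.mul_lt_top hg.2 hu.2)⟩

theorem abs_integral_pairing_le {q r : ℝ} (hqr : q.HolderConjugate r)
    (g : simpleSpace D (StrongDual ℝ B₂)) {u : EuclideanSpace ℝ (Fin d) → B₂}
    (hu : AEStronglyMeasurable u volume) {c : ℝ} (hc : 0 ≤ c)
    (huc : eLpNorm u (ENNReal.ofReal q) volume ≤ ENNReal.ofReal c) :
    |∫ x, g x (u x)| ≤ c * lpn r g := by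
  have hr : 0 < r := hqr.symm.pos
  rw [← ENNReal.ofReal_le_ofReal_iff (mul_nonneg hc (lpn_nonneg _ _)), ← Real.enorm_eq_ofReal_abs,
    mul_comm, ENNReal.ofReal_mul (lpn_nonneg _ _), ofReal_lpn hr]
  refine (enorm_integral_le_lintegral_enorm _).trans ?_
  rw [← eLpNorm_one_eq_lintegral_enorm]
  exact (eLpNorm_pairing_le hqr (memLp_of_mem_simpleSpace g.2 1).1 hu).trans
    (mul_le_mul_right huc _)

end Pairing

variable (h : IsBRSFamily T p q κ Ap Aq A₀ B)
include h

/-- `T j f` lives within distance `2 ^ j ≤ 2 ^ k` of the closure of the cell, whereas the fivefold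
dilate leaves a margin of `2 * 2 ^ k`. -/
theorem IsBRSFamily.integral_eq_zero_of_local {j k : ℤ} (hjk : j ≤ k)
    (x : EuclideanSpace ℝ (Fin d)) (f : simpleSpace D B₁) (g : simpleSpace D (StrongDual ℝ B₂))
    (hf : ∀ y, y ∉ cell D k x → f y = 0) (hg : ∀ y ∈ bigCell D k x, g y = 0) :
    ∫ y, g y (T j f y) = 0 := by
  have ht : (0 : ℝ) < 2 ^ j := by positivity
  have h1 := h.support j _ (dil_dil_mem j f)
  rw [dilOp_dil] at h1
  have h2 := (Measure.quasiMeasurePreserving_smul (volume : Measure (EuclideanSpace ℝ (Fin d)))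
    (inv_ne_zero ht.ne')).ae h1
  refine integral_eq_zero_of_ae ?_
  filter_upwards [h2] with z hz
  by_cases hzg : z ∈ bigCell D k x
  · rw [hg z hzg]; rfl
  · have h3 : T j f z = 0 := by
      have h4 := hz ?_
      · simpa [dil, smul_smul, mul_inv_cancel₀ ht.ne'] using h4
      · intro hmem
        refine hzg ?_
        -- A radius between `1` and `2` passes from the closed to an open neighbourhood and still
        -- keeps strict inequality at the open faces of the dilate.
        obtain ⟨y, hy, hdist⟩ := Metric.mem_thickening_iff.1
          (Metric.cthickening_subset_thickening' (by norm_num : (0 : ℝ) < 3 / 2) (by norm_num) _ hmem)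
        have hcl : IsClosed {y : EuclideanSpace ℝ (Fin d) | ∀ i, (cubeAt D k x).corner i ≤
            2 ^ j * y i ∧ 2 ^ j * y i ≤ (cubeAt D k x).corner i + 2 ^ k} := by
          simp only [Set.ofPred_forall]
          have hc : ∀ i, Continuous fun y : EuclideanSpace ℝ (Fin d) => (2 : ℝ) ^ j * y i :=
            fun i => by fun_prop
          exact isClosed_iInter fun i => (isClosed_le continuous_const (hc i)).inter
            (isClosed_le (hc i) continuous_const)
        have hsub : tsupport (dil ((2 : ℝ) ^ j) f) ⊆ {y : EuclideanSpace ℝ (Fin d) |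
            ∀ i, (cubeAt D k x).corner i ≤ 2 ^ j * y i ∧
              2 ^ j * y i ≤ (cubeAt D k x).corner i + 2 ^ k} := by
          refine closure_minimal (fun y hy i => ?_) hcl
          have hyc : (2 : ℝ) ^ j • y ∈ cell D k x := by
            by_contra hcon
            exact hy (hf _ hcon)
          have := hyc i
          rw [side_cubeAt] at this
          exact ⟨this.1, this.2.le⟩
        rw [bigCell, Cube.mem_quintuple]
        intro i
        have hyi := hsub hy i
        have hd1 : |((2 : ℝ) ^ j)⁻¹ * z i - y i| ≤ 3 / 2 := by
          have h5 := PiLp.norm_apply_le (((2 : ℝ) ^ j)⁻¹ • z - y) i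
          rw [← dist_eq_norm] at h5
          simpa using h5.trans hdist.le
        have hd2 : |z i - 2 ^ j * y i| ≤ 3 / 2 * 2 ^ j := by
          have e : z i - 2 ^ j * y i = 2 ^ j * (((2 : ℝ) ^ j)⁻¹ * z i - y i) := by
            field_simp
          rw [e, abs_mul, abs_of_pos ht, mul_comm]
          exact mul_le_mul_of_nonneg_right hd1 ht.le
        have hjk' := two_zpow_mono hjk
        rw [side_cubeAt]
        rw [abs_le] at hd2
        constructor <;> linarith [hyi.1, hyi.2, hd2.1, hd2.2]
    rw [h3, map_zero]; rfl

/-- The substitution `x ↦ 2 ^ j • x` produces one power of the cell volume in the pairing and the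
powers `-(1 / r)` and `-(1 / p)` in the norms, which together give the exponent `1 - 1 / p - 1 / r`.
-/
theorem IsBRSFamily.abs_adjoint_shiftDiff_le (hp : 1 < p) (hq : 1 < q) (j : ℤ)
    {v : EuclideanSpace ℝ (Fin d)} (hv : ‖v‖ ≤ 2 ^ j) (f : simpleSpace D B₁)
    (u g : simpleSpace D (StrongDual ℝ B₂)) (hg : ∀ x, g x = u (x + v) - u x) :
    |∫ x, g x (T j f x)| ≤ B * cellVol d j ^ (1 - 1 / p - 1 / q.conjExponent) * lpn p f *
      (‖v‖ / 2 ^ j) ^ κ * lpn q.conjExponent u := by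
  have ht : (0 : ℝ) < 2 ^ j := by positivity
  have hqr := Real.HolderConjugate.conjExponent hq
  have hr : 0 < q.conjExponent := hqr.symm.pos
  have hnorm : ‖((2 : ℝ) ^ j)⁻¹ • v‖ = ‖v‖ / 2 ^ j := by
    rw [norm_smul, norm_inv, Real.norm_of_nonneg ht.le]; field_simp
  have hmem : MemLp (dil ((2 : ℝ) ^ j) u) (ENNReal.ofReal q.conjExponent) volume := by
    refine ⟨?_, ?_⟩
    · exact (memLp_of_mem_simpleSpace u.2 1).aestronglyMeasurable.comp_quasiMeasurePreserving
        (Measure.quasiMeasurePreserving_smul volume ht.ne')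
    · rw [eLpNorm_dil ht hr]
      exact ENNReal.mul_lt_top ENNReal.ofReal_lt_top (memLp_of_mem_simpleSpace u.2 _).2
  have h1 := h.adjointRegularity j (((2 : ℝ) ^ j)⁻¹ • v)
    (by rw [hnorm, div_le_one ht]; exact hv) (dil ((2 : ℝ) ^ j) u) hmem _ (dil_dil_mem j f)
  have hpair : dilAdjointPairing (T j) ((2 : ℝ) ^ j)
      (shiftDiff (((2 : ℝ) ^ j)⁻¹ • v) (dil ((2 : ℝ) ^ j) u)) (dil ((2 : ℝ) ^ j) f)
      (dil_dil_mem j f) = (cellVol d j)⁻¹ * ∫ x, g x (T j f x) := by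
    rw [dilAdjointPairing, dilOp_dil]
    have := Measure.integral_comp_smul (volume : Measure (EuclideanSpace ℝ (Fin d)))
      (fun x => g x (T j f x)) ((2 : ℝ) ^ j)
    rw [finrank_euclideanSpace_fin, abs_of_pos (by positivity), smul_eq_mul] at this
    rw [cellVol, ← this]
    refine integral_congr_ae (ae_of_all _ fun x => ?_)
    simp only [dil, shiftDiff, smul_add, smul_smul, mul_inv_cancel₀ ht.ne', one_smul, hg]
  have hv0 := cellVol_pos d j
  rw [hpair, eLpNorm_dil ht hr, eLpNorm_dil ht (by linarith), ← ofReal_lpn hr,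
    ← ofReal_lpn (by linarith : 0 < p), hnorm, Real.enorm_eq_ofReal_abs,
    ← ENNReal.ofReal_coe_nnreal, ← ENNReal.ofReal_mul (by positivity),
    ← ENNReal.ofReal_mul (by positivity), ← ENNReal.ofReal_mul (by positivity),
    ← ENNReal.ofReal_mul (by positivity), ← ENNReal.ofReal_mul
      (by have := lpn_nonneg q.conjExponent u; positivity),
    ENNReal.ofReal_le_ofReal_iff (by
      have := lpn_nonneg q.conjExponent u
      have := lpn_nonneg p f
      positivity), abs_mul, abs_of_pos (inv_pos.2 hv0), inv_mul_le_iff₀ hv0] at h1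
  refine h1.trans (le_of_eq ?_)
  have hexp : cellVol d j ^ (1 - 1 / p - 1 / q.conjExponent) = cellVol d j *
      (cellVol d j ^ (-(1 / q.conjExponent)) * cellVol d j ^ (-(1 / p))) := by
    rw [← Real.rpow_add hv0]
    nth_rewrite 2 [← Real.rpow_one (cellVol d j)]
    rw [← Real.rpow_add hv0]
    congr 1
    ring
  rw [hexp, ← cellVol]
  ring

/-- The factor `p / (p - 1)` is that of Kolmogorov's inequality, by which the weak type bound is
tested on bounded `g`. The factor `q` comes from the Lorentz norm of a bounded function of finite
support. Hölder's inequality with exponents `q` and `q'` does the rest. -/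
theorem IsBRSFamily.exists_form (hp : 1 < p) (hq : 1 < q) :
    ∃ Λ : ℤ → simpleSpace D B₁ →ₗ[ℝ] simpleSpace D (StrongDual ℝ B₂) →ₗ[ℝ] ℝ,
      (∀ j f g, Λ j f g = ∫ x, g x (T j f x)) ∧
      (∀ j f (g : simpleSpace D (StrongDual ℝ B₂)), Integrable (fun x => g x (T j f x)) volume) ∧
      FormBounds Λ p q.conjExponent κ (p / (p - 1) * Ap) (q * Aq) A₀ B := by
  have hqr := Real.HolderConjugate.conjExponent hq
  have hr : 0 < q.conjExponent := hqr.symm.pos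
  have hp0 : 0 < p := by linarith
  have hq0 : 0 < q := by linarith
  have hint : ∀ j f (g : simpleSpace D (StrongDual ℝ B₂)),
      Integrable (fun x => g x (T j f x)) volume := fun j f g =>
    integrable_pairing hqr (memLp_of_mem_simpleSpace g.2 _) (h.memLp hp hq j f)
  let Λ : ℤ → simpleSpace D B₁ →ₗ[ℝ] simpleSpace D (StrongDual ℝ B₂) →ₗ[ℝ] ℝ := fun j =>
    LinearMap.mk₂ ℝ (fun f g => ∫ x, g x (T j f x))
      (fun f f' g => by
        rw [← integral_add (hint j f g) (hint j f' g)]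
        simp only [map_add, Pi.add_apply])
      (fun c f g => by
        rw [smul_eq_mul, ← integral_const_mul]
        simp only [map_smul, Pi.smul_apply, smul_eq_mul])
      (fun f g g' => by
        rw [← integral_add (hint j f g) (hint j f g')]
        rfl)
      (fun c f g => by
        rw [smul_eq_mul, ← integral_const_mul]
        rfl)
  have hΛ : ∀ j f g, Λ j f g = ∫ x, g x (T j f x) := fun j f g => rfl
  have hsum : ∀ M₁ M₂ f g, ∑ j ∈ Finset.Icc M₁ M₂, Λ j f g =
      ∫ x, g x ((∑ j ∈ Finset.Icc M₁ M₂, T j f) x) := by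
    intro M₁ M₂ f g
    simp only [hΛ, Finset.sum_apply, map_sum]
    rw [integral_finsetSum _ fun j _ => hint j f g]
  have hsm : ∀ M₁ M₂ f, AEStronglyMeasurable (∑ j ∈ Finset.Icc M₁ M₂, T j f) volume :=
    fun M₁ M₂ f => Finset.aestronglyMeasurable_sum _ fun j _ => h.aestronglyMeasurable j f
  refine ⟨Λ, hΛ, hint, ?_, ?_, ?_, ?_, ?_, ?_⟩
  · intro j k hjk x f g hf hg
    exact h.integral_eq_zero_of_local hjk x f g hf hg
  · intro j f g
    have hv := cellVol_pos d j
    have := lpn_nonneg p f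
    rw [hΛ]
    refine abs_integral_pairing_le hqr g (h.aestronglyMeasurable j f) (by positivity) ?_
    rw [ENNReal.ofReal_mul (by positivity), ofReal_lpn hp0]
    exact h.eLpNorm_le hp hq j f
  · intro j v hv u f g hf
    have hv0 := cellVol_pos d j
    have := lpn_nonneg p u
    rw [hΛ]
    refine (abs_integral_pairing_le hqr g (h.aestronglyMeasurable j f) (c := B * (‖v‖ / 2 ^ j) ^ κ *
      cellVol d j ^ (1 - 1 / p - 1 / q.conjExponent) * lpn p u) (by positivity) ?_).trans
      (le_of_eq (by ring))
    rw [ENNReal.ofReal_mul (by positivity), ofReal_lpn hp0]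
    exact h.eLpNorm_shiftDiff_le hp hq j hv u f hf
  · intro j v hv f u g hg
    rw [hΛ]
    exact h.abs_adjoint_shiftDiff_le hp hq j hv f u g hg
  · intro M₁ M₂ f g c s hs hsf hc hg hgs
    -- The hypotheses (T5) and (T6) concern nonempty ranges of scales; for empty ranges the form is
    -- `0`.
    rcases lt_or_ge M₂ M₁ with hM | hM
    · have := lpn_nonneg p f
      rw [Finset.Icc_eq_empty (by omega), Finset.sum_empty, abs_zero]
      have : 0 < p - 1 := by linarith
      positivity
    have := lpn_nonneg p f
    have hp1 : 0 < p - 1 := by linarith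
    have h1 := lintegral_le_of_weakLpNorm_le hp (hsm M₁ M₂ f) (w := Ap * lpn p f) (by positivity)
      (by
        rw [ENNReal.ofReal_mul (by positivity), ofReal_lpn hp0, ENNReal.ofReal_coe_nnreal]
        exact h.weakType M₁ M₂ hM f) hsf
    rw [hsum, ← ENNReal.ofReal_le_ofReal_iff (by positivity), ← Real.enorm_eq_ofReal_abs]
    refine (enorm_integral_le_lintegral_enorm _).trans ?_
    calc ∫⁻ x, ‖g x ((∑ j ∈ Finset.Icc M₁ M₂, T j f) x)‖ₑ
        ≤ ∫⁻ x, s.indicator (fun x => ENNReal.ofReal c *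
            ‖(∑ j ∈ Finset.Icc M₁ M₂, T j f) x‖ₑ) x := by
          refine lintegral_mono fun x => ?_
          by_cases hx : x ∈ s
          · rw [Set.indicator_of_mem hx, ← ofReal_norm, ← ofReal_norm, ← ENNReal.ofReal_mul hc]
            refine ENNReal.ofReal_le_ofReal ((ContinuousLinearMap.le_opNorm _ _).trans ?_)
            exact mul_le_mul_of_nonneg_right (hg x) (norm_nonneg _)
          · rw [hgs x hx]
            simp
      _ = ENNReal.ofReal c * ∫⁻ x in s, ‖(∑ j ∈ Finset.Icc M₁ M₂, T j f) x‖ₑ := by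
          rw [lintegral_indicator hs, lintegral_const_mul' _ _ ENNReal.ofReal_ne_top]
      _ ≤ _ := by
          refine (mul_le_mul_right h1 _).trans ?_
          rw [← ENNReal.ofReal_mul hc]
          exact ENNReal.ofReal_le_ofReal (le_of_eq (by ring))
  · intro M₁ M₂ f g c s hs hsf hc hf hfs
    rcases lt_or_ge M₂ M₁ with hM | hM
    · have := lpn_nonneg q.conjExponent g
      rw [Finset.Icc_eq_empty (by omega), Finset.sum_empty, abs_zero]
      positivity
    rw [hsum]
    refine abs_integral_pairing_le hqr g (hsm M₁ M₂ f) (by positivity) ?_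
    refine (h.restrictedStrongType M₁ M₂ hM f).trans ?_
    refine (mul_le_mul_right (lorentzOneNorm_le hq0 hc hf hsf hfs) _).trans ?_
    rw [← ENNReal.ofReal_coe_nnreal, ← ENNReal.ofReal_mul (by positivity)]
    refine ENNReal.ofReal_le_ofReal (le_of_eq ?_)
    have : 1 - 1 / q.conjExponent = 1 / q := by
      have := hqr.inv_add_inv_eq_one
      rw [one_div, one_div]; linarith
    rw [this]
    ring

end BRS

/-! ### Stopping sets and the good and bad parts of a function -/

section Stopping

variable {d : ℕ} {D : Set (Cube d)} {E : Type*} [NormedAddCommGroup E] [NormedSpace ℝ E]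

/-- Disjoint sets `U k`, for `k₀ ≤ k < N`, which are unions of cubes of `D` of side length
`2 ^ k`. -/
structure StoppingSets (D : Set (Cube d)) (k₀ N : ℤ)
    (U : ℤ → Set (EuclideanSpace ℝ (Fin d))) : Prop where
  le : k₀ ≤ N
  saturated : ∀ k, Saturated D k (U k)
  volume_ne_top : ∀ k, volume (U k) ≠ ∞
  disjoint : ∀ k l, k ≠ l → Disjoint (U k) (U l)
  mem_Ico : ∀ k x, x ∈ U k → k ∈ Finset.Ico k₀ N

/-- The averages of `‖f‖ ^ p` over cubes that are not contained in a stopping cube are at most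
`α ^ p`. -/
structure Controlled (D : Set (Cube d)) (k₀ N : ℤ) (U : ℤ → Set (EuclideanSpace ℝ (Fin d)))
    (p : ℝ) (f : EuclideanSpace ℝ (Fin d) → E) (α : ℝ) : Prop where
  nonneg : 0 ≤ α
  isStep : IsStep D k₀ f
  average_le : ∀ j, k₀ ≤ j → j ≤ N → ∀ x, (∀ k, j ≤ k → x ∉ U k) →
    ∫ y in cell D j x, ‖f y‖ ^ p ≤ α ^ p * cellVol d j

variable [NeZero d] [hD : Fact (IsDyadicLattice D)]

/-- The part of the function on `U k` with vanishing averages. -/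
noncomputable def badPart (D : Set (Cube d)) (E : Type*) [NormedAddCommGroup E] [NormedSpace ℝ E]
    [Fact (IsDyadicLattice D)] (U : ℤ → Set (EuclideanSpace ℝ (Fin d))) (k : ℤ) :
    simpleSpace D E →ₗ[ℝ] simpleSpace D E :=
  cut D E (U k) ∘ₗ (LinearMap.id - levelAvg D E k)

/-- The sum of the bad parts on the levels in `X`. -/
noncomputable def badSum (D : Set (Cube d)) (E : Type*) [NormedAddCommGroup E] [NormedSpace ℝ E]
    [Fact (IsDyadicLattice D)] (U : ℤ → Set (EuclideanSpace ℝ (Fin d))) (X : Finset ℤ) :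
    simpleSpace D E →ₗ[ℝ] simpleSpace D E :=
  ∑ k ∈ X, badPart D E U k

/-- The good part of a function. -/
noncomputable def goodPart (D : Set (Cube d)) (E : Type*) [NormedAddCommGroup E] [NormedSpace ℝ E]
    [Fact (IsDyadicLattice D)] (k₀ N : ℤ) (U : ℤ → Set (EuclideanSpace ℝ (Fin d))) :
    simpleSpace D E →ₗ[ℝ] simpleSpace D E :=
  LinearMap.id - badSum D E U (Finset.Ico k₀ N)

theorem rpow_norm_sub_le {p : ℝ} (hp : 0 < p) (a b : E) :
    ‖a - b‖ ^ p ≤ 2 ^ p * (‖a‖ ^ p + ‖b‖ ^ p) := by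
  have h1 : ‖a - b‖ ≤ 2 * max ‖a‖ ‖b‖ := by
    have := norm_sub_le a b
    have := le_max_left ‖a‖ ‖b‖
    have := le_max_right ‖a‖ ‖b‖
    linarith
  calc ‖a - b‖ ^ p ≤ (2 * max ‖a‖ ‖b‖) ^ p := Real.rpow_le_rpow (norm_nonneg _) h1 hp.le
    _ = 2 ^ p * (max ‖a‖ ‖b‖) ^ p := Real.mul_rpow (by norm_num) (by positivity)
    _ ≤ _ := by
        refine mul_le_mul_of_nonneg_left ?_ (by positivity)
        rcases max_choice ‖a‖ ‖b‖ with h | h <;> rw [h]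
        · exact le_add_of_nonneg_right (by positivity)
        · exact le_add_of_nonneg_left (by positivity)

theorem rpow_inv_le_of_le {p K α a I : ℝ} (hp : 1 ≤ p) (hK : 1 ≤ K) (hα : 0 ≤ α) (ha : 0 ≤ a)
    (hI : 0 ≤ I) (h : I ≤ K * α ^ p * a) : I ^ (1 / p) ≤ K * α * a ^ (1 / p) := by
  have hp0 : 0 < p := by linarith
  have hK0 : 0 ≤ K := by linarith
  calc I ^ (1 / p) ≤ (K * α ^ p * a) ^ (1 / p) := Real.rpow_le_rpow hI h (by positivity)
    _ = K ^ (1 / p) * α * a ^ (1 / p) := by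
        rw [Real.mul_rpow (by positivity) ha, Real.mul_rpow hK0 (by positivity),
          ← Real.rpow_mul hα, mul_one_div_cancel hp0.ne', Real.rpow_one]
    _ ≤ _ := by
        have : K ^ (1 / p) ≤ K := by
          conv_rhs => rw [← Real.rpow_one K]
          exact Real.rpow_le_rpow_of_exponent_le hK (by rw [div_le_one hp0]; exact hp)
        gcongr

/-- The constant in the bounds for bad parts. -/
noncomputable def badConst (d : ℕ) (p : ℝ) : ℝ := (2 : ℝ) ^ p * (2 * 2 ^ d)

theorem one_le_two_rpow {p : ℝ} (hp : 0 ≤ p) : (1 : ℝ) ≤ 2 ^ p :=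
  Real.one_le_rpow (by norm_num) hp

theorem one_le_badConst (d : ℕ) {p : ℝ} (hp : 0 ≤ p) : 1 ≤ badConst d p := by
  have h1 := one_le_two_rpow hp
  have h2 : (1 : ℝ) ≤ 2 ^ d := one_le_pow₀ (by norm_num)
  unfold badConst
  nlinarith

namespace StoppingSets

variable {k₀ N : ℤ} {U : ℤ → Set (EuclideanSpace ℝ (Fin d))} (hU : StoppingSets D k₀ N U)
include hU

theorem measurableSet (k : ℤ) : MeasurableSet (U k) :=
  (hU.saturated k).measurableSet (hU.volume_ne_top k)

theorem coe_badPart (k : ℤ) (f : simpleSpace D E) :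
    (badPart D E U k f : EuclideanSpace ℝ (Fin d) → E) =
      (U k).indicator fun x => f x - levelAvg D E k f x := by
  rw [badPart, LinearMap.comp_apply, coe_cut (hU.saturated k)]
  rfl

theorem badPart_apply_of_mem {k : ℤ} (f : simpleSpace D E) {x : EuclideanSpace ℝ (Fin d)}
    (hx : x ∈ U k) : badPart D E U k f x = f x - levelAvg D E k f x := by
  rw [hU.coe_badPart, Set.indicator_of_mem hx]

theorem badPart_apply_of_notMem {k : ℤ} (f : simpleSpace D E) {x : EuclideanSpace ℝ (Fin d)}
    (hx : x ∉ U k) : badPart D E U k f x = 0 := by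
  rw [hU.coe_badPart, Set.indicator_of_notMem hx]

omit hU in
theorem badSum_apply (X : Finset ℤ) (f : simpleSpace D E) (x : EuclideanSpace ℝ (Fin d)) :
    badSum D E U X f x = ∑ k ∈ X, badPart D E U k f x := by
  rw [badSum, LinearMap.sum_apply, AddSubmonoidClass.coe_finsetSum, Finset.sum_apply]

theorem notMem_of_mem {k l : ℤ} {x : EuclideanSpace ℝ (Fin d)} (hx : x ∈ U k) (hkl : l ≠ k) :
    x ∉ U l := fun h => Set.disjoint_left.1 (hU.disjoint l k hkl) h hx

theorem badSum_apply_of_mem {X : Finset ℤ} {k : ℤ} (hk : k ∈ X) (f : simpleSpace D E)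
    {x : EuclideanSpace ℝ (Fin d)} (hx : x ∈ U k) :
    badSum D E U X f x = f x - levelAvg D E k f x := by
  rw [badSum_apply, Finset.sum_eq_single_of_mem k hk, hU.badPart_apply_of_mem f hx]
  intro l _ hl
  exact hU.badPart_apply_of_notMem f (hU.notMem_of_mem hx hl)

theorem badSum_apply_of_notMem {X : Finset ℤ} (f : simpleSpace D E)
    {x : EuclideanSpace ℝ (Fin d)} (hx : ∀ k ∈ X, x ∉ U k) :
    badSum D E U X f x = 0 := by
  rw [badSum_apply]
  exact Finset.sum_eq_zero fun k hk => hU.badPart_apply_of_notMem f (hx k hk)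

theorem goodPart_apply_of_mem {k : ℤ} (f : simpleSpace D E)
    {x : EuclideanSpace ℝ (Fin d)} (hx : x ∈ U k) :
    goodPart D E k₀ N U f x = levelAvg D E k f x := by
  have : goodPart D E k₀ N U f x = f x - badSum D E U (Finset.Ico k₀ N) f x := rfl
  rw [this, hU.badSum_apply_of_mem (hU.mem_Ico k x hx) f hx, sub_sub_cancel]

theorem goodPart_apply_of_notMem (f : simpleSpace D E)
    {x : EuclideanSpace ℝ (Fin d)} (hx : ∀ k, x ∉ U k) :
    goodPart D E k₀ N U f x = f x := by
  have : goodPart D E k₀ N U f x = f x - badSum D E U (Finset.Ico k₀ N) f x := rfl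
  rw [this, hU.badSum_apply_of_notMem f (fun k _ => hx k), sub_zero]

omit hU in
theorem levelAvg_eq_zero_of_support {k : ℤ} {s : Set (EuclideanSpace ℝ (Fin d))}
    (hs : Saturated D k s) {f : simpleSpace D E} (hf : ∀ x, x ∉ s → f x = 0)
    {x : EuclideanSpace ℝ (Fin d)} (hx : x ∉ s) : levelAvg D E k f x = 0 := by
  rw [levelAvg_apply, setIntegral_eq_zero_of_forall_eq_zero, smul_zero]
  intro y hy
  exact hf y fun h => hx ((hs.mem_iff hy).1 h)

theorem badSum_eq_zero_of_support {s : Set (EuclideanSpace ℝ (Fin d))}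
    (hs : Saturated D N s) {f : simpleSpace D E} (hf : ∀ x, x ∉ s → f x = 0) (X : Finset ℤ)
    {x : EuclideanSpace ℝ (Fin d)} (hx : x ∉ s) : badSum D E U X f x = 0 := by
  rw [badSum_apply]
  refine Finset.sum_eq_zero fun k _ => ?_
  by_cases hxU : x ∈ U k
  · have hk := (Finset.mem_Ico.1 (hU.mem_Ico k x hxU)).2
    rw [hU.badPart_apply_of_mem f hxU, hf x hx,
      levelAvg_eq_zero_of_support (hs.mono hk.le) hf hx, sub_zero]
  · exact hU.badPart_apply_of_notMem f hxU

theorem goodPart_eq_zero_of_support {s : Set (EuclideanSpace ℝ (Fin d))}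
    (hs : Saturated D N s) {f : simpleSpace D E} (hf : ∀ x, x ∉ s → f x = 0)
    {x : EuclideanSpace ℝ (Fin d)} (hx : x ∉ s) : goodPart D E k₀ N U f x = 0 := by
  have : goodPart D E k₀ N U f x = f x - badSum D E U (Finset.Ico k₀ N) f x := rfl
  rw [this, hU.badSum_eq_zero_of_support hs hf _ hx, hf x hx, sub_zero]

theorem levelAvg_badPart [CompleteSpace E] (k : ℤ) (f : simpleSpace D E) :
    levelAvg D E k (badPart D E U k f) = 0 := by
  rw [badPart, LinearMap.comp_apply, levelAvg_cut k (hU.saturated k), LinearMap.sub_apply,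
    LinearMap.id_apply, map_sub, levelAvg_levelAvg le_rfl, sub_self, map_zero]

theorem sum_volume_inter_le (X : Finset ℤ) {s : Set (EuclideanSpace ℝ (Fin d))}
    (hs : volume s ≠ ∞) (hms : MeasurableSet s) :
    ∑ k ∈ X, volume.real (s ∩ U k) ≤ volume.real s := by
  rw [← measureReal_biUnion_finset (f := fun k => s ∩ U k)]
  · exact measureReal_mono (Set.iUnion₂_subset fun k _ => Set.inter_subset_left) hs
  · intro k _ l _ hkl
    exact (hU.disjoint k l hkl).mono Set.inter_subset_right Set.inter_subset_right
  · exact fun k _ => hms.inter (hU.measurableSet k)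

end StoppingSets

namespace Controlled

variable {k₀ N : ℤ} {U : ℤ → Set (EuclideanSpace ℝ (Fin d))} (hU : StoppingSets D k₀ N U)
  {p α : ℝ} {f : simpleSpace D E} (hf : Controlled D k₀ N U p f α)
include hU hf

/-- The parent of a stopping cell is not contained in a stopping cube, so its average is controlled;
restricting to the child costs `2 ^ d`. -/
theorem integral_cell_le (hp : 1 ≤ p) {k : ℤ} {x : EuclideanSpace ℝ (Fin d)} (hx : x ∈ U k) :
    ∫ y in cell D k x, ‖f y‖ ^ p ≤ 2 ^ d * α ^ p * cellVol d k := by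
  have hk := Finset.mem_Ico.1 (hU.mem_Ico k x hx)
  have h1 := hf.average_le (k + 1) (by omega) (by omega) x fun l hl =>
    hU.notMem_of_mem hx (by omega)
  rw [cellVol_succ] at h1
  refine (setIntegral_mono_set (integrable_norm_rpow f (by linarith)).integrableOn
    (ae_of_all _ fun y => Real.rpow_nonneg (norm_nonneg _) _)
    (cell_mono (by omega : k ≤ k + 1) x).eventuallyLE).trans (h1.trans (le_of_eq (by ring)))

theorem integral_le (hp : 1 ≤ p) {k : ℤ} {s : Set (EuclideanSpace ℝ (Fin d))}
    (hs : Saturated D k s) (hsU : s ⊆ U k) :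
    ∫ y in s, ‖f y‖ ^ p ≤ 2 ^ d * α ^ p * volume.real s := by
  have hsv : volume s ≠ ∞ := ne_top_of_le_ne_top (hU.volume_ne_top k) (measure_mono hsU)
  rw [← sum_grid_integral hsv hs (integrable_norm_rpow f (by linarith)),
    ← sum_grid_volume hsv hs, Finset.mul_sum]
  refine Finset.sum_le_sum fun R hR => ?_
  obtain ⟨h1, h2, h3⟩ := of_mem_grid hR
  rw [← cell_corner h1 h2]
  exact hf.integral_cell_le hU hp (hsU (h3 R.corner_mem))

theorem norm_levelAvg_rpow_le (hp : 1 ≤ p) {k : ℤ} {x : EuclideanSpace ℝ (Fin d)} (hx : x ∈ U k) :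
    ‖levelAvg D E k f x‖ ^ p ≤ 2 ^ d * α ^ p := by
  have h1 := (_root_.norm_levelAvg_rpow_le k f hp x).trans (hf.integral_cell_le hU hp hx)
  have hv := cellVol_pos d k
  rw [mul_comm] at h1
  exact le_of_mul_le_mul_right h1 hv

/-- Outside all stopping sets the average over the finest cell is controlled, and there `f` is
constant. -/
theorem norm_rpow_le {x : EuclideanSpace ℝ (Fin d)} (hx : ∀ k, x ∉ U k) : ‖f x‖ ^ p ≤ α ^ p := by
  have h1 := hf.average_le k₀ le_rfl hU.le x fun k _ => hx k
  rw [setIntegral_congr_fun (measurableSet_cell k₀ x) (g := fun _ => ‖f x‖ ^ p)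
    fun y hy => by simp only [hf.isStep.1 x y hy], setIntegral_const, volume_cell, smul_eq_mul,
    mul_comm] at h1
  exact le_of_mul_le_mul_right h1 (cellVol_pos d k₀)

theorem norm_goodPart_le (hp : 1 ≤ p) (x : EuclideanSpace ℝ (Fin d)) :
    ‖goodPart D E k₀ N U f x‖ ≤ 2 ^ d * α := by
  have hp0 : 0 < p := by linarith
  have hα := hf.nonneg
  have h2 : (1 : ℝ) ≤ 2 ^ d := one_le_pow₀ (by norm_num)
  have key : ‖goodPart D E k₀ N U f x‖ ^ p ≤ 2 ^ d * α ^ p := by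
    by_cases hx : ∃ k, x ∈ U k
    · obtain ⟨k, hk⟩ := hx
      rw [hU.goodPart_apply_of_mem f hk]
      exact hf.norm_levelAvg_rpow_le hU hp hk
    · push Not at hx
      rw [hU.goodPart_apply_of_notMem f hx]
      have := hf.norm_rpow_le hU hx
      have : 0 ≤ α ^ p := by positivity
      nlinarith
  have := rpow_inv_le_of_le hp h2 hα zero_le_one
    (Real.rpow_nonneg (norm_nonneg (goodPart D E k₀ N U f x)) p) (by rw [mul_one]; exact key)
  rwa [← Real.rpow_mul (norm_nonneg _), mul_one_div_cancel hp0.ne', Real.rpow_one, Real.one_rpow,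
    mul_one] at this

theorem norm_levelAvg_le (hp : 1 ≤ p) {k : ℤ} {x : EuclideanSpace ℝ (Fin d)} (hx : x ∈ U k) :
    ‖levelAvg D E k f x‖ ≤ 2 ^ d * α := by
  rw [← hU.goodPart_apply_of_mem f hx]
  exact hf.norm_goodPart_le hU hp x

theorem norm_badSum_rpow_le (hp : 1 ≤ p) (X : Finset ℤ) (x : EuclideanSpace ℝ (Fin d)) :
    ‖badSum D E U X f x‖ ^ p ≤ 2 ^ p * (‖f x‖ ^ p + 2 ^ d * α ^ p) := by
  have hp0 : 0 < p := by linarith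
  have hα := hf.nonneg
  by_cases hx : ∃ k ∈ X, x ∈ U k
  · obtain ⟨k, hkX, hk⟩ := hx
    rw [hU.badSum_apply_of_mem hkX f hk]
    refine (rpow_norm_sub_le hp0 _ _).trans ?_
    have := hf.norm_levelAvg_rpow_le hU hp hk
    gcongr
  · push Not at hx
    rw [hU.badSum_apply_of_notMem f hx, norm_zero, Real.zero_rpow hp0.ne']
    positivity

/-- For a set such as the dilate of a cell, which may cut through the larger stopping cubes. Then
averages of `f` cannot be compared with `f` on `s` itself, and their pointwise bound is used. Here
`c` plays the role of the volume of the cell. -/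
theorem integral_badSum_le_of_integral_le (hp : 1 ≤ p) (X : Finset ℤ)
    {s : Set (EuclideanSpace ℝ (Fin d))} (hs : volume s ≠ ∞) (hms : MeasurableSet s) {c : ℝ}
    (hc : ∫ y in s, ‖f y‖ ^ p ≤ α ^ p * c) (hsc : volume.real s ≤ 5 ^ d * c) (hc0 : 0 ≤ c) :
    ∫ y in s, ‖badSum D E U X f y‖ ^ p ≤ 5 ^ d * badConst d p * α ^ p * c := by
  have hp0 : 0 < p := by linarith
  have hα := hf.nonneg
  have hif := (integrable_norm_rpow f hp0).integrableOn (s := s)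
  have hic : IntegrableOn (fun _ : EuclideanSpace ℝ (Fin d) => (2 : ℝ) ^ d * α ^ p) s volume :=
    integrableOn_const hs
  have h1 : ∫ y in s, ‖badSum D E U X f y‖ ^ p ≤
      ∫ y in s, 2 ^ p * (‖f y‖ ^ p + 2 ^ d * α ^ p) :=
    integral_mono (integrable_norm_rpow _ hp0).integrableOn ((hif.add hic).const_mul _)
      fun y => hf.norm_badSum_rpow_le hU hp X y
  rw [integral_const_mul, integral_add hif hic, setIntegral_const, smul_eq_mul] at h1
  refine h1.trans ?_
  have h2 : (1 : ℝ) ≤ 2 ^ d := one_le_pow₀ (by norm_num)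
  have h5 : (1 : ℝ) ≤ 5 ^ d := one_le_pow₀ (by norm_num)
  have hαp : 0 ≤ α ^ p := by positivity
  have h3 : α ^ p * c ≤ 5 ^ d * 2 ^ d * α ^ p * c := by
    have h25 : (1 : ℝ) ≤ 5 ^ d * 2 ^ d := by nlinarith
    have : 0 ≤ α ^ p * c := by positivity
    nlinarith
  have h4 : volume.real s * (2 ^ d * α ^ p) ≤ 5 ^ d * 2 ^ d * α ^ p * c := by
    have : 0 ≤ 2 ^ d * α ^ p := by positivity
    nlinarith
  calc _ ≤ 2 ^ p * (5 ^ d * 2 ^ d * α ^ p * c + 5 ^ d * 2 ^ d * α ^ p * c) := by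
        refine mul_le_mul_of_nonneg_left ?_ (by positivity)
        linarith
    _ = _ := by rw [badConst]; ring

theorem integral_badPart_le (hp : 1 ≤ p) {k : ℤ} {s : Set (EuclideanSpace ℝ (Fin d))}
    (hs : Saturated D k s) (hsv : volume s ≠ ∞) :
    ∫ y in s, ‖badPart D E U k f y‖ ^ p ≤ badConst d p * α ^ p * volume.real (s ∩ U k) := by
  have hp0 : 0 < p := by linarith
  have hα := hf.nonneg
  have hms := hs.measurableSet hsv
  have hsat : Saturated D k (s ∩ U k) := hs.inter (hU.saturated k)
  have hsv' : volume (s ∩ U k) ≠ ∞ := ne_top_of_le_ne_top hsv (measure_mono Set.inter_subset_left)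
  have h0 : ∫ y in s, ‖badPart D E U k f y‖ ^ p =
      ∫ y in s ∩ U k, ‖badPart D E U k f y‖ ^ p := by
    rw [← setIntegral_eq_of_subset_of_forall_sdiff_eq_zero hms Set.inter_subset_left]
    intro y hy
    rw [hU.badPart_apply_of_notMem f (fun h => hy.2 ⟨hy.1, h⟩), norm_zero, Real.zero_rpow hp0.ne']
  have hif := (integrable_norm_rpow f hp0).integrableOn (s := s ∩ U k)
  have hia := (integrable_norm_rpow (levelAvg D E k f) hp0).integrableOn (s := s ∩ U k)
  have h1 : ∫ y in s ∩ U k, ‖badPart D E U k f y‖ ^ p ≤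
      ∫ y in s ∩ U k, 2 ^ p * (‖f y‖ ^ p + ‖levelAvg D E k f y‖ ^ p) := by
    refine setIntegral_mono_on (integrable_norm_rpow _ hp0).integrableOn
      ((hif.add hia).const_mul _) (hms.inter (hU.measurableSet k)) fun y hy => ?_
    rw [hU.badPart_apply_of_mem f hy.2]
    exact rpow_norm_sub_le hp0 _ _
  rw [integral_const_mul, integral_add hif hia] at h1
  have h2 := integral_levelAvg_rpow_le k f hp hsat hsv'
  have h3 := hf.integral_le hU hp hsat Set.inter_subset_right
  rw [h0]
  refine h1.trans ?_
  calc _ ≤ 2 ^ p * (2 ^ d * α ^ p * volume.real (s ∩ U k) +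
        2 ^ d * α ^ p * volume.real (s ∩ U k)) := by
        refine mul_le_mul_of_nonneg_left ?_ (by positivity)
        linarith
    _ = _ := by rw [badConst]; ring

/-- The bad parts have disjoint supports, and `s` is a union of cells on every level in `X`, so that
only the part of the stopping sets inside `s` is charged. -/
theorem integral_badSum_le (hp : 1 ≤ p) {X : Finset ℤ} {s : Set (EuclideanSpace ℝ (Fin d))}
    {j : ℤ} (hs : Saturated D j s) (hX : ∀ k ∈ X, k ≤ j) (hsv : volume s ≠ ∞) :
    ∫ y in s, ‖badSum D E U X f y‖ ^ p ≤
      badConst d p * α ^ p * ∑ k ∈ X, volume.real (s ∩ U k) := by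
  have hp0 : 0 < p := by linarith
  have h1 : ∀ y, ‖badSum D E U X f y‖ ^ p ≤ ∑ k ∈ X, ‖badPart D E U k f y‖ ^ p := by
    intro y
    by_cases hy : ∃ k ∈ X, y ∈ U k
    · obtain ⟨k, hkX, hk⟩ := hy
      rw [hU.badSum_apply_of_mem hkX f hk, ← hU.badPart_apply_of_mem f hk]
      exact Finset.single_le_sum (f := fun k => ‖badPart D E U k f y‖ ^ p)
        (fun l _ => Real.rpow_nonneg (norm_nonneg _) _) hkX
    · push Not at hy
      rw [hU.badSum_apply_of_notMem f hy, norm_zero, Real.zero_rpow hp0.ne']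
      exact Finset.sum_nonneg fun k _ => Real.rpow_nonneg (norm_nonneg _) _
  calc ∫ y in s, ‖badSum D E U X f y‖ ^ p
      ≤ ∫ y in s, ∑ k ∈ X, ‖badPart D E U k f y‖ ^ p :=
        integral_mono (integrable_norm_rpow _ hp0).integrableOn
          (integrable_finsetSum _ fun k _ => (integrable_norm_rpow _ hp0).integrableOn) h1
    _ = ∑ k ∈ X, ∫ y in s, ‖badPart D E U k f y‖ ^ p :=
        integral_finsetSum _ fun k _ => (integrable_norm_rpow _ hp0).integrableOn
    _ ≤ ∑ k ∈ X, badConst d p * α ^ p * volume.real (s ∩ U k) :=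
        Finset.sum_le_sum fun k hk => hf.integral_badPart_le hU hp (hs.mono (hX k hk)) hsv
    _ = _ := by rw [Finset.mul_sum]

theorem lpn_cut_badSum_le (hp : 1 ≤ p) {X : Finset ℤ} {s : Set (EuclideanSpace ℝ (Fin d))}
    {j : ℤ} (hs : Saturated D j s) (hX : ∀ k ∈ X, k ≤ j) (hsv : volume s ≠ ∞) :
    lpn p (cut D E s (badSum D E U X f)) ≤
      badConst d p * α * (∑ k ∈ X, volume.real (s ∩ U k)) ^ (1 / p) := by
  have hp0 : 0 < p := by linarith
  rw [lpn_cut hp0 hs (hs.measurableSet hsv)]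
  exact rpow_inv_le_of_le hp (one_le_badConst d hp0.le) hf.nonneg
    (Finset.sum_nonneg fun k _ => measureReal_nonneg) (integral_norm_rpow_nonneg _ _ _)
    (hf.integral_badSum_le hU hp hs hX hsv)

end Controlled

end Stopping

/-! ### Localization, and the terms involving good parts -/

section Core

variable {d : ℕ} {D : Set (Cube d)} [NeZero d] [hD : Fact (IsDyadicLattice D)]
  {E₁ E₂ : Type*} [NormedAddCommGroup E₁] [NormedSpace ℝ E₁] [NormedAddCommGroup E₂]
  [NormedSpace ℝ E₂]
  {Λ : ℤ → simpleSpace D E₁ →ₗ[ℝ] simpleSpace D E₂ →ₗ[ℝ] ℝ} {p r κ a₁ a₂ a₀ b : ℝ}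

theorem saturated_quintuple {k : ℤ} {s : Set (EuclideanSpace ℝ (Fin d))} {R : Cube d}
    (hR : R ∈ grid D k s) : Saturated D k R.quintuple.toSet := by
  obtain ⟨h1, h2, -⟩ := of_mem_grid hR
  rw [← bigCell_corner h1 h2]
  exact saturated_bigCell k _

theorem saturated_of_mem_grid {k : ℤ} {s : Set (EuclideanSpace ℝ (Fin d))} {R : Cube d}
    (hR : R ∈ grid D k s) : Saturated D k R.toSet :=
  saturated_of_mem (of_mem_grid hR).1 (of_mem_grid hR).2.1

theorem volume_real_of_mem_grid {k : ℤ} {s : Set (EuclideanSpace ℝ (Fin d))} {R : Cube d}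
    (hR : R ∈ grid D k s) : volume.real R.toSet = cellVol d k := by
  rw [Cube.volume_real, (of_mem_grid hR).2.1, cellVol]

theorem volume_real_quintuple_of_mem_grid {k : ℤ} {s : Set (EuclideanSpace ℝ (Fin d))}
    {R : Cube d} (hR : R ∈ grid D k s) :
    volume.real R.quintuple.toSet = 5 ^ d * cellVol d k := by
  rw [Cube.volume_real_quintuple, (of_mem_grid hR).2.1, cellVol]

/-- The part of `u` on a cube of side `2 ^ k ≥ 2 ^ j` interacts with `v` only on the dilate of this
cube. -/
theorem FormBounds.localize (h : FormBounds Λ p r κ a₁ a₂ a₀ b) {j k : ℤ} (hjk : j ≤ k)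
    {s : Set (EuclideanSpace ℝ (Fin d))} (hs : Saturated D k s) (hsv : volume s ≠ ∞)
    {u : simpleSpace D E₁} (hu : ∀ x, x ∉ s → u x = 0) (v : simpleSpace D E₂) :
    Λ j u v = ∑ R ∈ grid D k s, Λ j (cut D E₁ R.toSet u) (cut D E₂ R.quintuple.toSet v) := by
  conv_lhs => rw [← cut_eq_self hs hu, ← sum_cut_grid hs hsv, map_sum, LinearMap.sum_apply]
  refine Finset.sum_congr rfl fun R hR => ?_
  obtain ⟨h1, h2, -⟩ := of_mem_grid hR
  have h5 := saturated_quintuple hR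
  rw [← sub_eq_zero, ← map_sub]
  refine h.local_zero j k hjk R.corner _ _ (fun y hy => ?_) (fun y hy => ?_)
  · rw [cell_corner h1 h2] at hy
    rw [coe_cut (saturated_of_mem_grid hR), Set.indicator_of_notMem hy]
  · rw [bigCell_corner h1 h2] at hy
    rw [Submodule.coe_sub, Pi.sub_apply, coe_cut h5, Set.indicator_of_mem hy, sub_self]

theorem FormBounds.sum_localize (h : FormBounds Λ p r κ a₁ a₂ a₀ b) (N₁ k : ℤ)
    {s : Set (EuclideanSpace ℝ (Fin d))} (hs : Saturated D k s) (hsv : volume s ≠ ∞)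
    {u : simpleSpace D E₁} (hu : ∀ x, x ∉ s → u x = 0) (v : simpleSpace D E₂) :
    ∑ j ∈ Finset.Icc N₁ k, Λ j u v = ∑ R ∈ grid D k s, ∑ j ∈ Finset.Icc N₁ k,
      Λ j (cut D E₁ R.toSet u) (cut D E₂ R.quintuple.toSet v) := by
  rw [Finset.sum_comm]
  exact Finset.sum_congr rfl fun j hj => h.localize (Finset.mem_Icc.1 hj).2 hs hsv hu v

/-- The hypotheses of the estimate for one stopping step. -/
structure CoreData (Λ : ℤ → simpleSpace D E₁ →ₗ[ℝ] simpleSpace D E₂ →ₗ[ℝ] ℝ)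
    (p r κ a₁ a₂ a₀ b : ℝ) (k₀ N : ℤ) (U : ℤ → Set (EuclideanSpace ℝ (Fin d)))
    (x₀ : EuclideanSpace ℝ (Fin d)) (f : simpleSpace D E₁) (g : simpleSpace D E₂) (α β : ℝ) :
    Prop where
  forms : FormBounds Λ p r κ a₁ a₂ a₀ b
  one_lt_p : 1 < p
  one_lt_r : 1 < r
  one_le_add : 1 ≤ 1 / p + 1 / r
  κ_pos : 0 < κ
  a₁_nonneg : 0 ≤ a₁
  a₂_nonneg : 0 ≤ a₂
  a₀_nonneg : 0 ≤ a₀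
  b_nonneg : 0 ≤ b
  sets : StoppingSets D k₀ N U
  left : Controlled D k₀ N U p f α
  right : Controlled D k₀ N U r g β
  -- Localizing `f` to a cell leaves `g` on the fivefold dilate, so for `g` also the integrals over
  -- dilates have to be controlled.
  bigAverage_le : ∀ j, k₀ ≤ j → j ≤ N → ∀ x, (∀ k, j ≤ k → x ∉ U k) →
    ∫ y in bigCell D j x, ‖g y‖ ^ r ≤ β ^ r * cellVol d j
  support_left : ∀ x, x ∉ cell D N x₀ → f x = 0
  support_right : ∀ x, x ∉ bigCell D N x₀ → g x = 0

/-- The total volume of the stopping sets. -/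
noncomputable def stopVol (k₀ N : ℤ) (U : ℤ → Set (EuclideanSpace ℝ (Fin d))) : ℝ :=
  ∑ k ∈ Finset.Ico k₀ N, volume.real (U k)

theorem stopVol_nonneg (k₀ N : ℤ) (U : ℤ → Set (EuclideanSpace ℝ (Fin d))) :
    0 ≤ stopVol k₀ N U := Finset.sum_nonneg fun _ _ => measureReal_nonneg

theorem rpow_mul_rpow_one_sub {v t : ℝ} (hv : 0 < v) : v ^ (1 - t) * v ^ t = v := by
  rw [← Real.rpow_add hv, sub_add_cancel, Real.rpow_one]

theorem five_pow_mul_rpow_le (d : ℕ) {v t : ℝ} (hv : 0 ≤ v) (ht : 0 ≤ t) (ht1 : t ≤ 1) :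
    (5 ^ d * v) ^ t ≤ 5 ^ d * v ^ t := by
  rw [Real.mul_rpow (by positivity) hv]
  refine mul_le_mul_of_nonneg_right ?_ (by positivity)
  conv_rhs => rw [← Real.rpow_one ((5 : ℝ) ^ d)]
  exact Real.rpow_le_rpow_of_exponent_le (one_le_pow₀ (by norm_num)) ht1

namespace CoreData

variable {k₀ N : ℤ} {U : ℤ → Set (EuclideanSpace ℝ (Fin d))} {x₀ : EuclideanSpace ℝ (Fin d)}
  {f : simpleSpace D E₁} {g : simpleSpace D E₂} {α β : ℝ}
  (h : CoreData Λ p r κ a₁ a₂ a₀ b k₀ N U x₀ f g α β)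
include h

theorem free_top (x : EuclideanSpace ℝ (Fin d)) : ∀ k, N ≤ k → x ∉ U k := fun k hk hx => by
  have := Finset.mem_Ico.1 (h.sets.mem_Ico k x hx)
  omega

theorem lpn_right_le : lpn r g ≤ β * cellVol d N ^ (1 / r) := by
  have hr0 : 0 < r := by linarith [h.one_lt_r]
  have h1 := h.bigAverage_le N h.sets.le le_rfl x₀ (h.free_top x₀)
  rw [setIntegral_eq_integral_of_forall_compl_eq_zero (fun x hx => by
    rw [h.support_right x hx, norm_zero, Real.zero_rpow hr0.ne'])] at h1
  have := rpow_inv_le_of_le (K := 1) h.one_lt_r.le le_rfl h.right.nonneg (cellVol_pos d N).le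
    (integral_nonneg fun x => Real.rpow_nonneg (norm_nonneg _) _) (by rw [one_mul]; exact h1)
  rwa [one_mul] at this

/-- The good part of `f` against `g`. -/
theorem abs_good_left_le (N₁ : ℤ) :
    |∑ j ∈ Finset.Icc N₁ N, Λ j (goodPart D E₁ k₀ N U f) g| ≤
      a₂ * 2 ^ d * (α * β) * cellVol d N := by
  have hα := h.left.nonneg
  have hβ := h.right.nonneg
  have ha₂ := h.a₂_nonneg
  have hv := cellVol_pos d N
  have h1 := h.forms.strong N₁ N (goodPart D E₁ k₀ N U f) g (2 ^ d * α) (cell D N x₀)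
    (measurableSet_cell _ _) (volume_cell_ne_top _ _) (by positivity)
    (h.left.norm_goodPart_le h.sets h.one_lt_p.le)
    (fun x hx => h.sets.goodPart_eq_zero_of_support (saturated_cell N x₀) h.support_left hx)
  rw [volume_cell] at h1
  refine h1.trans ?_
  calc _ ≤ a₂ * (2 ^ d * α * cellVol d N ^ (1 - 1 / r)) * (β * cellVol d N ^ (1 / r)) := by
        have := h.lpn_right_le
        gcongr
    _ = a₂ * 2 ^ d * (α * β) * (cellVol d N ^ (1 - 1 / r) * cellVol d N ^ (1 / r)) := by ring
    _ = _ := by rw [rpow_mul_rpow_one_sub hv]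

/-- The dilate of a stopping cube is contained in the dilate of its parent, where the integral of
`|g|^r` is controlled. -/
theorem lpn_cut_quintuple_right_le {k : ℤ} {R : Cube d} (hR : R ∈ grid D k (U k)) :
    lpn r (cut D E₂ R.quintuple.toSet g) ≤ 2 ^ d * β * cellVol d k ^ (1 / r) := by
  have hr0 : 0 < r := by linarith [h.one_lt_r]
  obtain ⟨h1, h2, h3⟩ := of_mem_grid hR
  have hx := h3 R.corner_mem
  have hk := Finset.mem_Ico.1 (h.sets.mem_Ico k _ hx)
  rw [lpn_cut hr0 (saturated_quintuple hR) (Cube.measurableSet_toSet _)]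
  refine rpow_inv_le_of_le h.one_lt_r.le (one_le_pow₀ (by norm_num)) h.right.nonneg
    (cellVol_pos d k).le (integral_norm_rpow_nonneg _ _ _) ?_
  have h4 := h.bigAverage_le (k + 1) (by omega) (by omega) R.corner fun l hl =>
    h.sets.notMem_of_mem hx (by omega)
  rw [cellVol_succ] at h4
  rw [← bigCell_corner h1 h2]
  refine (setIntegral_mono_set (integrable_norm_rpow g hr0).integrableOn
    (ae_of_all _ fun y => Real.rpow_nonneg (norm_nonneg _) _)
    (bigCell_mono (by omega : k ≤ k + 1) R.corner).eventuallyLE).trans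
    (h4.trans (le_of_eq (by ring)))

/-- The averages of `f` on the stopping cubes against `g`. -/
theorem abs_average_left_le (N₁ k : ℤ) :
    |∑ j ∈ Finset.Icc N₁ k, Λ j (cut D E₁ (U k) (levelAvg D E₁ k f)) g| ≤
      a₂ * (2 ^ d * 2 ^ d) * (α * β) * volume.real (U k) := by
  have hα := h.left.nonneg
  have hβ := h.right.nonneg
  have ha₂ := h.a₂_nonneg
  have hv := cellVol_pos d k
  have hs := h.sets.saturated k
  -- Only scales up to the level of the stopping cubes occur, so the form splits into the stopping
  -- cubes `R`. On each of them the restricted strong type bound applies to a function bounded by `2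
  -- ^ d * α`.
  rw [h.forms.sum_localize N₁ k hs (h.sets.volume_ne_top k)
    (fun x hx => by rw [coe_cut hs, Set.indicator_of_notMem hx]),
    ← sum_grid_volume (h.sets.volume_ne_top k) hs, Finset.mul_sum]
  refine (Finset.abs_sum_le_sum_abs _ _).trans (Finset.sum_le_sum fun R hR => ?_)
  have hsR := saturated_of_mem_grid hR
  have h1 := h.forms.strong N₁ k (cut D E₁ R.toSet (cut D E₁ (U k) (levelAvg D E₁ k f)))
    (cut D E₂ R.quintuple.toSet g) (2 ^ d * α) R.toSet R.measurableSet_toSet R.volume_ne_top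
    (by positivity) (fun x => by
      rw [coe_cut hsR, coe_cut hs]
      by_cases hx : x ∈ U k
      · refine (norm_indicator_le_norm_self _ _).trans ?_
        rw [Set.indicator_of_mem hx]
        exact h.left.norm_levelAvg_le h.sets h.one_lt_p.le hx
      · refine (norm_indicator_le_norm_self _ _).trans ?_
        rw [Set.indicator_of_notMem hx, norm_zero]
        positivity)
    (fun x hx => by rw [coe_cut hsR, Set.indicator_of_notMem hx])
  rw [volume_real_of_mem_grid hR] at h1
  refine h1.trans ?_
  calc _ ≤ a₂ * (2 ^ d * α * cellVol d k ^ (1 - 1 / r)) *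
        (2 ^ d * β * cellVol d k ^ (1 / r)) := by
        have := h.lpn_cut_quintuple_right_le hR
        gcongr
    _ = a₂ * (2 ^ d * 2 ^ d) * (α * β) *
        (cellVol d k ^ (1 - 1 / r) * cellVol d k ^ (1 / r)) := by ring
    _ = _ := by rw [rpow_mul_rpow_one_sub hv]

/-- The bad part of `f` against the good part of `g`. -/
theorem abs_bad_good_le (N₁ : ℤ) :
    |∑ j ∈ Finset.Icc N₁ N, Λ j (badSum D E₁ U (Finset.Ico k₀ N) f) (goodPart D E₂ k₀ N U g)| ≤
      a₁ * badConst d p * (2 ^ d * 5 ^ d) * (α * β) * cellVol d N := by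
  have hα := h.left.nonneg
  have hβ := h.right.nonneg
  have ha₁ := h.a₁_nonneg
  have hp0 : 0 < p := by linarith [h.one_lt_p]
  have hv := cellVol_pos d N
  have hpinv : 1 / p ≤ 1 := by rw [div_le_one hp0]; exact h.one_lt_p.le
  have hpinv0 : 0 ≤ 1 / p := by positivity
  have hbc : 0 ≤ badConst d p := zero_le_one.trans (one_le_badConst d hp0.le)
  have hcell := saturated_cell (D := D) N x₀
  have h0 : lpn p (badSum D E₁ U (Finset.Ico k₀ N) f) ≤
      badConst d p * α * cellVol d N ^ (1 / p) := by
    rw [← cut_eq_self hcell fun x hx =>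
      h.sets.badSum_eq_zero_of_support hcell h.support_left (Finset.Ico k₀ N) hx]
    refine (h.left.lpn_cut_badSum_le h.sets h.one_lt_p.le hcell
      (fun k hk => (Finset.mem_Ico.1 hk).2.le) (volume_cell_ne_top _ _)).trans ?_
    refine mul_le_mul_of_nonneg_left (Real.rpow_le_rpow
      (Finset.sum_nonneg fun _ _ => measureReal_nonneg) ?_ hpinv0) (by positivity)
    rw [← volume_cell (D := D) N x₀]
    exact h.sets.sum_volume_inter_le _ (volume_cell_ne_top _ _) (measurableSet_cell _ _)
  have h1 := h.forms.weak N₁ N (badSum D E₁ U (Finset.Ico k₀ N) f) (goodPart D E₂ k₀ N U g)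
    (2 ^ d * β) (bigCell D N x₀) (measurableSet_bigCell _ _) (volume_bigCell_ne_top _ _)
    (by positivity) (h.right.norm_goodPart_le h.sets h.one_lt_r.le)
    (fun x hx => h.sets.goodPart_eq_zero_of_support (saturated_bigCell N x₀) h.support_right hx)
  rw [volume_bigCell] at h1
  refine h1.trans ?_
  have h2 := five_pow_mul_rpow_le d hv.le (by linarith : 0 ≤ 1 - 1 / p) (by linarith)
  calc _ ≤ a₁ * (badConst d p * α * cellVol d N ^ (1 / p)) *
        (2 ^ d * β * (5 ^ d * cellVol d N ^ (1 - 1 / p))) := by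
        gcongr
    _ = a₁ * badConst d p * (2 ^ d * 5 ^ d) * (α * β) *
        (cellVol d N ^ (1 - 1 / p) * cellVol d N ^ (1 / p)) := by ring
    _ = _ := by rw [rpow_mul_rpow_one_sub hv]

/-- The weak type bound on each stopping cube of level `k` separately. It serves to take the levels
`k ≥ j` out of the full bad part. -/
theorem abs_badPart_good_le (N₁ k : ℤ) :
    |∑ j ∈ Finset.Icc N₁ k, Λ j (badPart D E₁ U k f) (goodPart D E₂ k₀ N U g)| ≤
      a₁ * badConst d p * (2 ^ d * 5 ^ d) * (α * β) * volume.real (U k) := by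
  have hα := h.left.nonneg
  have hβ := h.right.nonneg
  have ha₁ := h.a₁_nonneg
  have hp0 : 0 < p := by linarith [h.one_lt_p]
  have hv := cellVol_pos d k
  have hpinv : 1 / p ≤ 1 := by rw [div_le_one hp0]; exact h.one_lt_p.le
  have hpinv0 : 0 ≤ 1 / p := by positivity
  have hbc : 0 ≤ badConst d p := zero_le_one.trans (one_le_badConst d hp0.le)
  have hs := h.sets.saturated k
  rw [h.forms.sum_localize N₁ k hs (h.sets.volume_ne_top k)
    (fun x hx => h.sets.badPart_apply_of_notMem f hx),
    ← sum_grid_volume (h.sets.volume_ne_top k) hs, Finset.mul_sum]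
  refine (Finset.abs_sum_le_sum_abs _ _).trans (Finset.sum_le_sum fun R hR => ?_)
  have hsR := saturated_of_mem_grid hR
  have h0 : lpn p (cut D E₁ R.toSet (badPart D E₁ U k f)) ≤
      badConst d p * α * cellVol d k ^ (1 / p) := by
    have e : badPart D E₁ U k f = badSum D E₁ U {k} f := by simp [badSum]
    rw [e]
    refine (h.left.lpn_cut_badSum_le h.sets h.one_lt_p.le hsR
      (fun l hl => (Finset.mem_singleton.1 hl).le) R.volume_ne_top).trans ?_
    refine mul_le_mul_of_nonneg_left (Real.rpow_le_rpow
      (Finset.sum_nonneg fun _ _ => measureReal_nonneg) ?_ hpinv0) (by positivity)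
    rw [← volume_real_of_mem_grid hR]
    exact h.sets.sum_volume_inter_le _ R.volume_ne_top R.measurableSet_toSet
  have h1 := h.forms.weak N₁ k (cut D E₁ R.toSet (badPart D E₁ U k f))
    (cut D E₂ R.quintuple.toSet (goodPart D E₂ k₀ N U g))
    (2 ^ d * β) R.quintuple.toSet (Cube.measurableSet_toSet _) (Cube.volume_ne_top _)
    (by positivity) (fun x => by
      rw [coe_cut (saturated_quintuple hR)]
      exact (norm_indicator_le_norm_self _ _).trans
        (h.right.norm_goodPart_le h.sets h.one_lt_r.le x))
    (fun x hx => by rw [coe_cut (saturated_quintuple hR), Set.indicator_of_notMem hx])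
  rw [volume_real_quintuple_of_mem_grid hR] at h1
  refine h1.trans ?_
  have h2 := five_pow_mul_rpow_le d hv.le (by linarith : 0 ≤ 1 - 1 / p) (by linarith)
  calc _ ≤ a₁ * (badConst d p * α * cellVol d k ^ (1 / p)) *
        (2 ^ d * β * (5 ^ d * cellVol d k ^ (1 - 1 / p))) := by
        gcongr
    _ = a₁ * badConst d p * (2 ^ d * 5 ^ d) * (α * β) *
        (cellVol d k ^ (1 - 1 / p) * cellVol d k ^ (1 / p)) := by ring
    _ = _ := by rw [rpow_mul_rpow_one_sub hv]

end CoreData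

end Core

/-! ### Bad parts against bad parts at a fixed scale -/

section BadBad

variable {d : ℕ} {D : Set (Cube d)} [NeZero d] [hD : Fact (IsDyadicLattice D)]

/-- Bounded overlap of the dilates: a cell whose dilate contains `x` is one of the `5 ^ d` cells in
the dilated cell of `x`. -/
theorem card_filter_quintuple_le (j : ℤ) (s : Set (EuclideanSpace ℝ (Fin d)))
    (x : EuclideanSpace ℝ (Fin d)) [DecidablePred fun R : Cube d => x ∈ R.quintuple.toSet] :
    (((grid D j s).filter fun R => x ∈ R.quintuple.toSet).card : ℝ) ≤ 5 ^ d := by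
  have hv := cellVol_pos d j
  have hfin := volume_bigCell_ne_top (D := D) j x
  have hsub : ((grid D j s).filter fun R => x ∈ R.quintuple.toSet) ⊆ grid D j (bigCell D j x) := by
    intro R hR
    obtain ⟨hR, hx⟩ := Finset.mem_filter.1 hR
    obtain ⟨h1, h2, -⟩ := of_mem_grid hR
    refine (mem_grid hfin).2 ⟨h1, h2, ?_⟩
    rw [← bigCell_corner h1 h2] at hx
    have := saturated_bigCell j x _ (bigCell_mem_comm hx)
    rwa [cell_corner h1 h2] at this
  have h1 := sum_grid_volume hfin (saturated_bigCell (D := D) j x)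
  rw [Finset.sum_const, nsmul_eq_mul, volume_bigCell] at h1
  have h2 := mul_right_cancel₀ hv.ne' h1
  rw [← h2]
  exact_mod_cast Finset.card_le_card hsub

theorem sum_volume_quintuple_inter_le (j : ℤ) (s : Set (EuclideanSpace ℝ (Fin d)))
    {A : Set (EuclideanSpace ℝ (Fin d))} (hA : MeasurableSet A) (hAv : volume A ≠ ∞) :
    ∑ R ∈ grid D j s, volume.real (R.quintuple.toSet ∩ A) ≤ 5 ^ d * volume.real A := by
  classical
  have h1 : ∀ R ∈ grid D j s, volume.real (R.quintuple.toSet ∩ A) =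
      ∫ x in A, R.quintuple.toSet.indicator (fun _ => (1 : ℝ)) x := by
    intro R _
    rw [integral_indicator R.quintuple.measurableSet_toSet, setIntegral_const, smul_eq_mul, mul_one,
      measureReal_restrict_apply R.quintuple.measurableSet_toSet]
  have hint : ∀ R ∈ grid D j s,
      IntegrableOn (R.quintuple.toSet.indicator fun _ => (1 : ℝ)) A volume := fun R _ =>
    IntegrableOn.indicator (integrableOn_const hAv) R.quintuple.measurableSet_toSet
  rw [Finset.sum_congr rfl h1, ← integral_finsetSum _ hint]
  have h2 : ∫ x in A, ∑ R ∈ grid D j s, R.quintuple.toSet.indicator (fun _ => (1 : ℝ)) x ≤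
      ∫ x in A, (5 : ℝ) ^ d := by
    refine integral_mono (integrable_finsetSum _ hint) (integrableOn_const hAv) fun x => ?_
    simp only [Set.indicator_apply, Finset.sum_boole]
    exact card_filter_quintuple_le j s x
  refine h2.trans (le_of_eq ?_)
  rw [setIntegral_const, smul_eq_mul, mul_comm]

/-- Replacing `a` and `b` by their maximum `m` leaves the power `1 / p + 1 / r ≥ 1` of `m`. One
factor `m` is at most `a + b`, and the excess is absorbed by `m ≤ 5 ^ d * v`. This makes the
products of norms over different cells summable. -/
theorem rpow_mul_rpow_le_add (d : ℕ) {p r a b v : ℝ} (hp : 1 < p) (hr : 1 < r)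
    (hpr : 1 ≤ 1 / p + 1 / r) (hv : 0 < v) (ha : 0 ≤ a) (hb : 0 ≤ b) (hav : a ≤ v)
    (hbv : b ≤ 5 ^ d * v) :
    v ^ (1 - 1 / p - 1 / r) * a ^ (1 / p) * b ^ (1 / r) ≤ 5 ^ d * (a + b) := by
  have hp0 : 0 < p := by linarith
  have hr0 : 0 < r := by linarith
  have hp1 : 1 / p < 1 := by rw [div_lt_one hp0]; exact hp
  have hr1 : 1 / r < 1 := by rw [div_lt_one hr0]; exact hr
  have h5 : (1 : ℝ) ≤ 5 ^ d := one_le_pow₀ (by norm_num)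
  set m := max a b with hm
  have hma : a ≤ m := le_max_left _ _
  have hmb : b ≤ m := le_max_right _ _
  have hm0 : 0 ≤ m := ha.trans hma
  have hmv : m ≤ 5 ^ d * v := max_le (by nlinarith) hbv
  have hmab : m ≤ a + b := max_le (by linarith) (by linarith)
  rcases hm0.eq_or_lt with h0 | hmpos
  · have : a = 0 := le_antisymm (by linarith) ha
    rw [this, Real.zero_rpow (by positivity)]
    simp only [mul_zero, zero_mul]
    positivity
  calc v ^ (1 - 1 / p - 1 / r) * a ^ (1 / p) * b ^ (1 / r)
      ≤ v ^ (1 - 1 / p - 1 / r) * m ^ (1 / p) * m ^ (1 / r) := by gcongr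
    _ = v ^ (1 - 1 / p - 1 / r) * (m ^ (1 / p + 1 / r - 1) * m) := by
        rw [mul_assoc, ← Real.rpow_add hmpos]
        congr 1
        nth_rewrite 3 [← Real.rpow_one m]
        rw [← Real.rpow_add hmpos]
        congr 1
        ring
    _ ≤ v ^ (1 - 1 / p - 1 / r) * (5 ^ d * v ^ (1 / p + 1 / r - 1) * (a + b)) := by
        have h1 : m ^ (1 / p + 1 / r - 1) ≤ 5 ^ d * v ^ (1 / p + 1 / r - 1) :=
          (Real.rpow_le_rpow hm0 hmv (by linarith)).trans
            (five_pow_mul_rpow_le d hv.le (by linarith) (by linarith))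
        gcongr
    _ = 5 ^ d * (a + b) * (v ^ (1 - 1 / p - 1 / r) * v ^ (1 / p + 1 / r - 1)) := by ring
    _ = _ := by
        rw [← Real.rpow_add hv, show 1 - 1 / p - 1 / r + (1 / p + 1 / r - 1) = 0 by ring,
          Real.rpow_zero, mul_one]

/-- A convex function lies below its chord over `[0, 1]`. -/
theorem one_add_six_mul_pow_le {x : ℝ} (h0 : 0 ≤ x) (h1 : x ≤ 1) (n : ℕ) :
    (1 + 6 * x) ^ n ≤ 1 + (7 ^ n - 1) * x := by
  induction n with
  | zero => simp
  | succ n ih =>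
    have h7 : (0 : ℝ) ≤ 7 ^ n - 1 := by
      have : (1 : ℝ) ≤ 7 ^ n := one_le_pow₀ (by norm_num)
      linarith
    calc (1 + 6 * x) ^ (n + 1) = (1 + 6 * x) ^ n * (1 + 6 * x) := pow_succ _ _
      _ ≤ (1 + (7 ^ n - 1) * x) * (1 + 6 * x) := by gcongr
      _ ≤ _ := by rw [pow_succ]; nlinarith [mul_nonneg h7 (mul_nonneg h0 (sub_nonneg.2 h1))]

/-- `R` is disjoint from `W`, but its fivefold dilate is not. -/
def Neighbouring (R W : Cube d) : Prop :=
  Disjoint R.toSet W.toSet ∧ (R.quintuple.toSet ∩ W.toSet).Nonempty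

/-- These disjoint cubes lie outside `W`, but within three side lengths `2 ^ j` of it: they fill
part of the difference of a cube with side `2 ^ k + 6 * 2 ^ j` and `W`. -/
theorem sum_neighbouring_le {j k : ℤ} (hjk : j ≤ k) (s : Set (EuclideanSpace ℝ (Fin d)))
    {W : Cube d} (hW : W.side = 2 ^ k) [DecidablePred fun R : Cube d => Neighbouring R W] :
    ∑ R ∈ (grid D j s).filter fun R => Neighbouring R W, cellVol d j ≤
      7 ^ d * ((2 : ℝ) ^ (j - k) * cellVol d k) := by
  have hj : (0 : ℝ) < 2 ^ j := by positivity
  have hk : (0 : ℝ) < 2 ^ k := by positivity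
  let P : Cube d := ⟨WithLp.toLp 2 fun i => W.corner i - 3 * 2 ^ j, 2 ^ k + 6 * 2 ^ j, by positivity⟩
  set F := (grid D j s).filter fun R => Neighbouring R W with hF
  have hFg : F ⊆ grid D j s := Finset.filter_subset _ _
  have hsub : ⋃ R ∈ F, R.toSet ⊆ P.toSet \ W.toSet := by
    refine Set.iUnion₂_subset fun R hR y hy => ?_
    obtain ⟨hRg, hdis, z, hz5, hzW⟩ := Finset.mem_filter.1 hR
    refine ⟨fun i => ?_, Set.disjoint_left.1 hdis hy⟩
    have h1 := Cube.mem_quintuple.1 hz5 i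
    have h2 := hy i
    have h3 := hzW i
    rw [(of_mem_grid hRg).2.1] at h1 h2
    rw [hW] at h3
    simp only [P]
    constructor <;> linarith [h1.1, h1.2, h2.1, h2.2, h3.1, h3.2]
  have hWP : W.toSet ⊆ P.toSet := by
    intro y hy i
    have h3 := hy i
    rw [hW] at h3
    simp only [P]
    constructor <;> linarith [h3.1, h3.2]
  have h1 : ∑ R ∈ F, cellVol d j = volume.real (⋃ R ∈ F, R.toSet) := by
    rw [measureReal_biUnion_finset ((pairwiseDisjoint_grid j s).subset (by exact_mod_cast hFg))
      (fun R _ => R.measurableSet_toSet) (fun R _ => R.volume_ne_top)]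
    exact Finset.sum_congr rfl fun R hR => (volume_real_of_mem_grid (hFg hR)).symm
  have h2 : volume.real (P.toSet \ W.toSet) = P.side ^ d - cellVol d k := by
    rw [measureReal_sdiff hWP W.measurableSet_toSet P.volume_ne_top, P.volume_real,
      W.volume_real, hW, cellVol]
  have hx : (2 : ℝ) ^ (j - k) ≤ 1 := zpow_le_one_of_nonpos₀ (by norm_num) (by omega)
  have hx0 : (0 : ℝ) ≤ 2 ^ (j - k) := by positivity
  have h3 : P.side = 2 ^ k * (1 + 6 * 2 ^ (j - k)) := by
    simp only [P]
    rw [zpow_sub₀ (by norm_num)]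
    field_simp
  rw [h1]
  refine (measureReal_mono hsub (ne_top_of_le_ne_top P.volume_ne_top
    (measure_mono Set.sdiff_subset))).trans ?_
  rw [h2, h3, mul_pow, ← cellVol]
  have h4 := one_add_six_mul_pow_le hx0 hx d
  have hv := cellVol_pos d k
  nlinarith [mul_nonneg hv.le hx0]

variable {E₁ E₂ : Type*} [NormedAddCommGroup E₁] [NormedSpace ℝ E₁] [NormedAddCommGroup E₂]
  [NormedSpace ℝ E₂]
  {Λ : ℤ → simpleSpace D E₁ →ₗ[ℝ] simpleSpace D E₂ →ₗ[ℝ] ℝ} {p r κ a₁ a₂ a₀ b : ℝ}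

/-- The `j`-th form is bounded with constant `M` on the localizations of `u` and `v`. -/
def LocalBound (Λ : ℤ → simpleSpace D E₁ →ₗ[ℝ] simpleSpace D E₂ →ₗ[ℝ] ℝ) (p r : ℝ) (j : ℤ)
    (u : simpleSpace D E₁) (v : simpleSpace D E₂) (M : ℝ) : Prop :=
  ∀ s : Set (EuclideanSpace ℝ (Fin d)), ∀ R ∈ grid D j s,
    |Λ j (cut D E₁ R.toSet u) (cut D E₂ R.quintuple.toSet v)| ≤
      M * cellVol d j ^ (1 - 1 / p - 1 / r) * lpn p (cut D E₁ R.toSet u) *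
        lpn r (cut D E₂ R.quintuple.toSet v)

theorem FormBounds.localBound (h : FormBounds Λ p r κ a₁ a₂ a₀ b) (j : ℤ)
    (u : simpleSpace D E₁) (v : simpleSpace D E₂) : LocalBound Λ p r j u v a₀ :=
  fun _ _ _ => h.single j _ _

/-- Cutting to cubes of level `j ≥ k` preserves vanishing averages on level `k`, so cancellation can
be exploited in each localized form. -/
theorem FormBounds.localBound_left [CompleteSpace E₁] (h : FormBounds Λ p r κ a₁ a₂ a₀ b)
    (hp : 1 ≤ p) (hκ : 0 < κ) (hb : 0 ≤ b) {j k : ℤ} (hkj : k + d ≤ j)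
    {u : simpleSpace D E₁} (hu : levelAvg D E₁ k u = 0) (v : simpleSpace D E₂) :
    LocalBound Λ p r j u v (meanZeroConst d κ * b * (2 : ℝ) ^ (-κ * (j - k))) := by
  intro s R hR
  have hv := cellVol_pos d j
  have hl := lpn_nonneg r (cut D E₂ R.quintuple.toSet v)
  have hreg : IsRegularFunctional ((Λ j).flip (cut D E₂ R.quintuple.toSet v)) p κ j
      (b * cellVol d j ^ (1 - 1 / p - 1 / r) * lpn r (cut D E₂ R.quintuple.toSet v)) :=
    fun t ht w f hf => h.regular j t ht w f _ hf
  have h0 : levelAvg D E₁ k (cut D E₁ R.toSet u) = 0 := by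
    rw [levelAvg_cut k ((saturated_of_mem_grid hR).mono (by omega)), hu, map_zero]
  refine (hreg.abs_le hp hκ (by positivity) hkj h0).trans (le_of_eq ?_)
  ring

theorem FormBounds.localBound_right [CompleteSpace E₂] (h : FormBounds Λ p r κ a₁ a₂ a₀ b)
    (hr : 1 ≤ r) (hκ : 0 < κ) (hb : 0 ≤ b) {j k : ℤ} (hkj : k + d ≤ j)
    (u : simpleSpace D E₁) {v : simpleSpace D E₂} (hv : levelAvg D E₂ k v = 0) :
    LocalBound Λ p r j u v (meanZeroConst d κ * b * (2 : ℝ) ^ (-κ * (j - k))) := by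
  intro s R hR
  have hv0 := cellVol_pos d j
  have hl := lpn_nonneg p (cut D E₁ R.toSet u)
  have hreg : IsRegularFunctional (Λ j (cut D E₁ R.toSet u)) r κ j
      (b * cellVol d j ^ (1 - 1 / p - 1 / r) * lpn p (cut D E₁ R.toSet u)) :=
    fun t ht w f hf => h.adjoint_regular j t ht _ w f hf
  have h0 : levelAvg D E₂ k (cut D E₂ R.quintuple.toSet v) = 0 := by
    rw [levelAvg_cut k ((saturated_quintuple hR).mono (by omega)), hv, map_zero]
  refine (hreg.abs_le hr hκ (by positivity) hkj h0).trans (le_of_eq ?_)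
  ring

namespace CoreData

variable {k₀ N : ℤ} {U : ℤ → Set (EuclideanSpace ℝ (Fin d))} {x₀ : EuclideanSpace ℝ (Fin d)}
  {f : simpleSpace D E₁} {g : simpleSpace D E₂} {α β : ℝ}
  (h : CoreData Λ p r κ a₁ a₂ a₀ b k₀ N U x₀ f g α β)
include h

/-- Bad parts on levels below the scale `j`. -/
theorem abs_bad_bad_le {j : ℤ} (hj : j ≤ N) {X Y : Finset ℤ} (hX : ∀ k ∈ X, k ≤ j)
    (hY : ∀ k ∈ Y, k ≤ j) {M : ℝ} (hM0 : 0 ≤ M)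
    (hM : LocalBound Λ p r j (badSum D E₁ U X f) (badSum D E₂ U Y g) M) :
    |Λ j (badSum D E₁ U X f) (badSum D E₂ U Y g)| ≤
      M * (badConst d p * badConst d r * (5 ^ d * 5 ^ d)) * (α * β) *
        (∑ k ∈ X, volume.real (U k) + ∑ k ∈ Y, volume.real (U k)) := by
  have hα := h.left.nonneg
  have hβ := h.right.nonneg
  have hp0 : 0 < p := by linarith [h.one_lt_p]
  have hr0 : 0 < r := by linarith [h.one_lt_r]
  have hbp : 0 ≤ badConst d p := zero_le_one.trans (one_le_badConst d hp0.le)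
  have hbr : 0 ≤ badConst d r := zero_le_one.trans (one_le_badConst d hr0.le)
  have hv := cellVol_pos d j
  have hcell := saturated_cell (D := D) N x₀
  have hs := hcell.mono hj
  rw [h.forms.localize le_rfl hs (volume_cell_ne_top _ _)
    (fun x hx => h.sets.badSum_eq_zero_of_support hcell h.support_left X hx)]
  refine (Finset.abs_sum_le_sum_abs _ _).trans ?_
  have hterm : ∀ R ∈ grid D j (cell D N x₀),
      |Λ j (cut D E₁ R.toSet (badSum D E₁ U X f))
        (cut D E₂ R.quintuple.toSet (badSum D E₂ U Y g))| ≤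
      M * (badConst d p * badConst d r * 5 ^ d) * (α * β) *
        (∑ k ∈ X, volume.real (R.quintuple.toSet ∩ U k) +
          ∑ k ∈ Y, volume.real (R.quintuple.toSet ∩ U k)) := by
    intro R hR
    have hsR := saturated_of_mem_grid hR
    have hsR5 := saturated_quintuple hR
    have h1 := h.left.lpn_cut_badSum_le h.sets h.one_lt_p.le hsR hX R.volume_ne_top
    have h2 := h.right.lpn_cut_badSum_le h.sets h.one_lt_r.le hsR5 hY (Cube.volume_ne_top _)
    have hA : ∑ k ∈ X, volume.real (R.toSet ∩ U k) ≤ cellVol d j := by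
      rw [← volume_real_of_mem_grid hR]
      exact h.sets.sum_volume_inter_le _ R.volume_ne_top R.measurableSet_toSet
    have hB : ∑ k ∈ Y, volume.real (R.quintuple.toSet ∩ U k) ≤ 5 ^ d * cellVol d j := by
      rw [← volume_real_quintuple_of_mem_grid hR]
      exact h.sets.sum_volume_inter_le _ (Cube.volume_ne_top _) (Cube.measurableSet_toSet _)
    have hA0 : 0 ≤ ∑ k ∈ X, volume.real (R.toSet ∩ U k) :=
      Finset.sum_nonneg fun _ _ => measureReal_nonneg
    have hB0 : 0 ≤ ∑ k ∈ Y, volume.real (R.quintuple.toSet ∩ U k) :=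
      Finset.sum_nonneg fun _ _ => measureReal_nonneg
    -- Enlarging `R` to its dilate lets both sums be treated by the same overlap bound.
    have hAA : ∑ k ∈ X, volume.real (R.toSet ∩ U k) ≤
        ∑ k ∈ X, volume.real (R.quintuple.toSet ∩ U k) :=
      Finset.sum_le_sum fun k _ => measureReal_mono
        (Set.inter_subset_inter_left _ R.subset_quintuple)
        (ne_top_of_le_ne_top (Cube.volume_ne_top _) (measure_mono Set.inter_subset_left))
    have h3 := rpow_mul_rpow_le_add d h.one_lt_p h.one_lt_r h.one_le_add hv hA0 hB0 hA hB
    have l1 := lpn_nonneg p (cut D E₁ R.toSet (badSum D E₁ U X f))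
    have l2 := lpn_nonneg r (cut D E₂ R.quintuple.toSet (badSum D E₂ U Y g))
    refine (hM _ R hR).trans ?_
    calc _ ≤ M * cellVol d j ^ (1 - 1 / p - 1 / r) *
          (badConst d p * α * (∑ k ∈ X, volume.real (R.toSet ∩ U k)) ^ (1 / p)) *
          (badConst d r * β *
            (∑ k ∈ Y, volume.real (R.quintuple.toSet ∩ U k)) ^ (1 / r)) := by gcongr
      _ = M * (badConst d p * badConst d r) * (α * β) * (cellVol d j ^ (1 - 1 / p - 1 / r) *
          (∑ k ∈ X, volume.real (R.toSet ∩ U k)) ^ (1 / p) *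
          (∑ k ∈ Y, volume.real (R.quintuple.toSet ∩ U k)) ^ (1 / r)) := by ring
      _ ≤ M * (badConst d p * badConst d r) * (α * β) * (5 ^ d *
          (∑ k ∈ X, volume.real (R.toSet ∩ U k) +
            ∑ k ∈ Y, volume.real (R.quintuple.toSet ∩ U k))) := by gcongr
      _ ≤ M * (badConst d p * badConst d r) * (α * β) * (5 ^ d *
          (∑ k ∈ X, volume.real (R.quintuple.toSet ∩ U k) +
            ∑ k ∈ Y, volume.real (R.quintuple.toSet ∩ U k))) := by gcongr
      _ = _ := by ring
  have hsum : ∀ Z : Finset ℤ, ∑ R ∈ grid D j (cell D N x₀),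
      ∑ k ∈ Z, volume.real (R.quintuple.toSet ∩ U k) ≤ 5 ^ d * ∑ k ∈ Z, volume.real (U k) := by
    intro Z
    rw [Finset.sum_comm, Finset.mul_sum]
    exact Finset.sum_le_sum fun k _ =>
      sum_volume_quintuple_inter_le j _ (h.sets.measurableSet k) (h.sets.volume_ne_top k)
  refine (Finset.sum_le_sum hterm).trans ?_
  rw [← Finset.mul_sum, Finset.sum_add_distrib]
  have h1 := hsum X
  have h2 := hsum Y
  calc _ ≤ M * (badConst d p * badConst d r * 5 ^ d) * (α * β) *
        (5 ^ d * ∑ k ∈ X, volume.real (U k) + 5 ^ d * ∑ k ∈ Y, volume.real (U k)) := by gcongr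
    _ = _ := by ring

/-- Bad parts of `f` on levels below `j` against bad parts of `g` on levels from `j` on. -/
theorem abs_bad_bad_boundary_le {j : ℤ} (hj : j ≤ N) {X Y : Finset ℤ}
    (hX : ∀ k ∈ X, k < j) (hY : ∀ k ∈ Y, j ≤ k) {M : ℝ} (hM0 : 0 ≤ M)
    (hM : LocalBound Λ p r j (badSum D E₁ U X f) (badSum D E₂ U Y g) M) :
    |Λ j (badSum D E₁ U X f) (badSum D E₂ U Y g)| ≤
      M * (badConst d p * badConst d r * (5 ^ d * 7 ^ d)) * (α * β) *
        ∑ k ∈ Y, (2 : ℝ) ^ (j - k) * volume.real (U k) := by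
  classical
  have hα := h.left.nonneg
  have hβ := h.right.nonneg
  have hp0 : 0 < p := by linarith [h.one_lt_p]
  have hr0 : 0 < r := by linarith [h.one_lt_r]
  have hbp : 0 ≤ badConst d p := zero_le_one.trans (one_le_badConst d hp0.le)
  have hbr1 := one_le_badConst d hr0.le
  have hbr : 0 ≤ badConst d r := zero_le_one.trans hbr1
  have hv := cellVol_pos d j
  have h51 : (1 : ℝ) ≤ 5 ^ d := one_le_pow₀ (by norm_num)
  have hcell := saturated_cell (D := D) N x₀
  have hs := hcell.mono hj
  rw [h.forms.localize le_rfl hs (volume_cell_ne_top _ _)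
    (fun x hx => h.sets.badSum_eq_zero_of_support hcell h.support_left X hx)]
  refine (Finset.abs_sum_le_sum_abs _ _).trans ?_
  have hterm : ∀ R ∈ grid D j (cell D N x₀),
      |Λ j (cut D E₁ R.toSet (badSum D E₁ U X f))
        (cut D E₂ R.quintuple.toSet (badSum D E₂ U Y g))| ≤
      M * (badConst d p * badConst d r * 5 ^ d) * (α * β) *
        ∑ k ∈ Y, ∑ W ∈ grid D k (U k), if Neighbouring R W then cellVol d j else 0 := by
    intro R hR
    have hsR := saturated_of_mem_grid hR
    have hsR5 := saturated_quintuple hR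
    obtain ⟨hR1, hR2, -⟩ := of_mem_grid hR
    have hrhs : 0 ≤ M * (badConst d p * badConst d r * 5 ^ d) * (α * β) *
        ∑ k ∈ Y, ∑ W ∈ grid D k (U k), if Neighbouring R W then cellVol d j else 0 := by
      refine mul_nonneg (by positivity) (Finset.sum_nonneg fun k _ =>
        Finset.sum_nonneg fun W _ => ?_)
      split_ifs
      exacts [hv.le, le_rfl]
    by_cases hXR : ∃ x ∈ R.toSet, ∃ k ∈ X, x ∈ U k
    swap
    · push Not at hXR
      rw [cut_eq_zero hsR fun x hx => h.sets.badSum_apply_of_notMem f fun k hk => hXR x hx k hk,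
        map_zero, LinearMap.zero_apply, abs_zero]
      exact hrhs
    by_cases hYR : ∃ x ∈ R.quintuple.toSet, ∃ k ∈ Y, x ∈ U k
    swap
    · push Not at hYR
      rw [cut_eq_zero (f := badSum D E₂ U Y g) hsR5 fun x hx =>
        h.sets.badSum_apply_of_notMem g fun k hk => hYR x hx k hk, map_zero, abs_zero]
      exact hrhs
    obtain ⟨x, hxR, k, hkX, hxk⟩ := hXR
    obtain ⟨y, hyR, l, hlY, hyl⟩ := hYR
    have hkj := hX k hkX
    have hjl := hY l hlY
    have hk := Finset.mem_Ico.1 (h.sets.mem_Ico k x hxk)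
    have hfree : ∀ m, j ≤ m → x ∉ U m := fun m hm => h.sets.notMem_of_mem hxk (by omega)
    -- `R` contains a point of a stopping cube of level below `j`, so it meets no stopping set of
    -- level at least `j`. Its dilate does meet one, hence `R` touches the boundary layer of a
    -- stopping cube.
    have hnb : Neighbouring R (cubeAt D l y) := by
      refine ⟨Set.disjoint_left.2 fun z hzR hzW => hfree l hjl ?_, y, hyR, mem_cell_self l y⟩
      have h1 : z ∈ U l := h.sets.saturated l y hyl hzW
      refine (((h.sets.saturated l).mono hjl).mem_iff (x := z) ?_).2 h1
      rw [cell_eq_of_mem hR1 hR2 hzR]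
      exact hxR
    -- A cell with nonzero contribution has at least one neighbouring stopping cube, to which its
    -- volume is charged.
    have hone : cellVol d j ≤
        ∑ k ∈ Y, ∑ W ∈ grid D k (U k), if Neighbouring R W then cellVol d j else 0 := by
      have hnn : ∀ k ∈ Y, 0 ≤ ∑ W ∈ grid D k (U k), if Neighbouring R W then cellVol d j else 0 :=
        fun k _ => Finset.sum_nonneg fun W _ => by split_ifs; exacts [hv.le, le_rfl]
      refine le_trans ?_ (Finset.single_le_sum hnn hlY)
      have hW : cubeAt D l y ∈ grid D l (U l) := (mem_grid (h.sets.volume_ne_top l)).2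
        ⟨cubeAt_mem l y, side_cubeAt l y, h.sets.saturated l y hyl⟩
      refine le_trans (le_of_eq ?_) (Finset.single_le_sum
        (f := fun W => if Neighbouring R W then cellVol d j else 0)
        (fun W _ => by split_ifs; exacts [hv.le, le_rfl]) hW)
      simp only [hnb, if_true]
    have h1 : lpn p (cut D E₁ R.toSet (badSum D E₁ U X f)) ≤
        badConst d p * α * cellVol d j ^ (1 / p) := by
      refine (h.left.lpn_cut_badSum_le h.sets h.one_lt_p.le hsR (fun k hk => (hX k hk).le)
        R.volume_ne_top).trans ?_
      refine mul_le_mul_of_nonneg_left (Real.rpow_le_rpow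
        (Finset.sum_nonneg fun _ _ => measureReal_nonneg) ?_ (by positivity)) (by positivity)
      rw [← volume_real_of_mem_grid hR]
      exact h.sets.sum_volume_inter_le _ R.volume_ne_top R.measurableSet_toSet
    -- The levels in `Y` are coarse, so the dilate of `R` need not be saturated; the integral of
    -- `|g|^r` over it is controlled because `x ∈ R` lies in no stopping set of level at least `j`.
    have h2 : lpn r (cut D E₂ R.quintuple.toSet (badSum D E₂ U Y g)) ≤
        5 ^ d * badConst d r * β * cellVol d j ^ (1 / r) := by
      rw [lpn_cut hr0 hsR5 (Cube.measurableSet_toSet _)]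
      refine rpow_inv_le_of_le h.one_lt_r.le (by nlinarith) hβ hv.le
        (integral_norm_rpow_nonneg _ _ _) ?_
      refine h.right.integral_badSum_le_of_integral_le h.sets h.one_lt_r.le Y
        (Cube.volume_ne_top _) (Cube.measurableSet_toSet _) ?_
        (volume_real_quintuple_of_mem_grid hR).le hv.le
      rw [← bigCell_eq_of_mem hR1 hR2 hxR]
      exact h.bigAverage_le j (by omega) hj x hfree
    have l1 := lpn_nonneg p (cut D E₁ R.toSet (badSum D E₁ U X f))
    have l2 := lpn_nonneg r (cut D E₂ R.quintuple.toSet (badSum D E₂ U Y g))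
    refine (hM _ R hR).trans ?_
    calc _ ≤ M * cellVol d j ^ (1 - 1 / p - 1 / r) *
          (badConst d p * α * cellVol d j ^ (1 / p)) *
          (5 ^ d * badConst d r * β * cellVol d j ^ (1 / r)) := by gcongr
      _ = M * (badConst d p * badConst d r * 5 ^ d) * (α * β) * (cellVol d j ^ (1 - 1 / p - 1 / r) *
          cellVol d j ^ (1 / p) * cellVol d j ^ (1 / r)) := by ring
      _ = M * (badConst d p * badConst d r * 5 ^ d) * (α * β) * cellVol d j := by
          rw [← Real.rpow_add hv, ← Real.rpow_add hv,
            show 1 - 1 / p - 1 / r + 1 / p + 1 / r = 1 by ring, Real.rpow_one]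
      _ ≤ _ := by gcongr
  refine (Finset.sum_le_sum hterm).trans ?_
  rw [← Finset.mul_sum, Finset.sum_comm]
  have hlayer : ∀ k ∈ Y, ∑ R ∈ grid D j (cell D N x₀),
      ∑ W ∈ grid D k (U k), (if Neighbouring R W then cellVol d j else 0) ≤
      7 ^ d * ((2 : ℝ) ^ (j - k) * volume.real (U k)) := by
    intro k hk
    rw [Finset.sum_comm, ← sum_grid_volume (h.sets.volume_ne_top k) (h.sets.saturated k),
      Finset.mul_sum, Finset.mul_sum]
    refine Finset.sum_le_sum fun W hW => ?_
    rw [← Finset.sum_filter]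
    exact sum_neighbouring_le (hY k hk) _ (of_mem_grid hW).2.1
  calc _ ≤ M * (badConst d p * badConst d r * 5 ^ d) * (α * β) *
        ∑ k ∈ Y, 7 ^ d * ((2 : ℝ) ^ (j - k) * volume.real (U k)) := by
        refine mul_le_mul_of_nonneg_left (Finset.sum_le_sum hlayer) (by positivity)
    _ = _ := by rw [← Finset.mul_sum]; ring

end CoreData

end BadBad

/-! ### The estimate for one stopping step -/

section CoreSum

theorem sum_two_rpow_le {c : ℝ} (hc : 0 < c) (s : Finset ℤ) (φ : ℤ → ℤ) (hφ : Function.Injective φ)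
    (h0 : ∀ i ∈ s, 0 ≤ φ i) : ∑ i ∈ s, (2 : ℝ) ^ (-c * φ i) ≤ (1 - 2 ^ (-c))⁻¹ := by
  have h1 : ∀ i ∈ s, (2 : ℝ) ^ (-c * φ i) = ((2 : ℝ) ^ (-c)) ^ (φ i).toNat := by
    intro i hi
    rw [← Real.rpow_natCast, ← Real.rpow_mul (by norm_num)]
    congr 2
    exact_mod_cast (Int.toNat_of_nonneg (h0 i hi)).symm
  rw [Finset.sum_congr rfl h1, ← Finset.sum_image (s := s) (g := fun i => (φ i).toNat)
    (f := fun t => ((2 : ℝ) ^ (-c)) ^ t)]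
  · exact sum_geometric_le (by positivity) (two_rpow_neg_lt_one hc) _
  · intro i hi j hj hij
    refine hφ ?_
    have := h0 i hi
    have := h0 j hj
    simp only at hij
    omega

variable {d : ℕ} {D : Set (Cube d)} [NeZero d] [hD : Fact (IsDyadicLattice D)]
  {E₁ E₂ : Type*} [NormedAddCommGroup E₁] [NormedSpace ℝ E₁] [NormedAddCommGroup E₂]
  [NormedSpace ℝ E₂]
  {Λ : ℤ → simpleSpace D E₁ →ₗ[ℝ] simpleSpace D E₂ →ₗ[ℝ] ℝ} {p r κ a₁ a₂ a₀ b : ℝ}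

theorem badSum_singleton {E : Type*} [NormedAddCommGroup E] [NormedSpace ℝ E]
    (U : ℤ → Set (EuclideanSpace ℝ (Fin d))) (k : ℤ) (f : simpleSpace D E) :
    badSum D E U {k} f = badPart D E U k f := by simp [badSum]

theorem badSum_eq_sum {E : Type*} [NormedAddCommGroup E] [NormedSpace ℝ E]
    (U : ℤ → Set (EuclideanSpace ℝ (Fin d))) (X : Finset ℤ) (f : simpleSpace D E) :
    badSum D E U X f = ∑ k ∈ X, badSum D E U {k} f := by
  simp_rw [badSum_singleton]
  rw [badSum, LinearMap.sum_apply]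

theorem badSum_filter_add {E : Type*} [NormedAddCommGroup E] [NormedSpace ℝ E]
    (U : ℤ → Set (EuclideanSpace ℝ (Fin d))) (X : Finset ℤ) (q : ℤ → Prop) [DecidablePred q]
    (f : simpleSpace D E) :
    badSum D E U (X.filter q) f + badSum D E U (X.filter fun k => ¬ q k) f = badSum D E U X f := by
  rw [badSum_eq_sum, badSum_eq_sum U (X.filter fun k => ¬ q k), badSum_eq_sum U X,
    Finset.sum_filter_add_sum_filter_not]

/-- Interchanging the order of summation over scales and stopping levels. -/
theorem sum_scale_level_comm (N₁ : ℤ) {k₀ N : ℤ} (F : ℤ → ℤ → ℝ) :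
    ∑ j ∈ Finset.Icc N₁ N, ∑ k ∈ (Finset.Ico k₀ N).filter (j ≤ ·), F j k =
      ∑ k ∈ Finset.Ico k₀ N, ∑ j ∈ Finset.Icc N₁ k, F j k := by
  refine Finset.sum_comm' fun j k => ?_
  simp only [Finset.mem_Icc, Finset.mem_filter, Finset.mem_Ico]
  constructor
  · rintro ⟨⟨h1, h2⟩, ⟨h3, h4⟩, h5⟩
    exact ⟨⟨h1, h5⟩, h3, h4⟩
  · rintro ⟨⟨h1, h5⟩, h3, h4⟩
    exact ⟨⟨h1, by omega⟩, ⟨h3, h4⟩, h5⟩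

/-- The function from which the parts on the stopping cubes of size at least `2 ^ j` are removed. -/
noncomputable def aboveScale (D : Set (Cube d)) (E : Type*) [NormedAddCommGroup E]
    [NormedSpace ℝ E] [Fact (IsDyadicLattice D)] (k₀ N : ℤ)
    (U : ℤ → Set (EuclideanSpace ℝ (Fin d))) (j : ℤ) : simpleSpace D E →ₗ[ℝ] simpleSpace D E :=
  LinearMap.id - ∑ k ∈ (Finset.Ico k₀ N).filter (j ≤ ·), cut D E (U k)

/-- On a stopping cube of level `k ≥ j` the bad part is `f` minus its average; removing `f` there
leaves minus the average. -/
theorem aboveScale_eq {E : Type*} [NormedAddCommGroup E] [NormedSpace ℝ E] (k₀ N : ℤ)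
    (U : ℤ → Set (EuclideanSpace ℝ (Fin d))) (j : ℤ) (f : simpleSpace D E) :
    aboveScale D E k₀ N U j f = goodPart D E k₀ N U f +
      badSum D E U ((Finset.Ico k₀ N).filter fun k => ¬ j ≤ k) f -
      ∑ k ∈ (Finset.Ico k₀ N).filter (j ≤ ·), cut D E (U k) (levelAvg D E k f) := by
  have h1 := badSum_filter_add U (Finset.Ico k₀ N) (j ≤ ·) f
  have h2 : badSum D E U ((Finset.Ico k₀ N).filter (j ≤ ·)) f =
      ∑ k ∈ (Finset.Ico k₀ N).filter (j ≤ ·), cut D E (U k) f -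
      ∑ k ∈ (Finset.Ico k₀ N).filter (j ≤ ·), cut D E (U k) (levelAvg D E k f) := by
    rw [badSum, LinearMap.sum_apply, ← Finset.sum_sub_distrib]
    refine Finset.sum_congr rfl fun k _ => ?_
    rw [badPart, LinearMap.comp_apply, LinearMap.sub_apply, map_sub, LinearMap.id_apply]
  have h3 : aboveScale D E k₀ N U j f =
      f - ∑ k ∈ (Finset.Ico k₀ N).filter (j ≤ ·), cut D E (U k) f := by
    rw [aboveScale, LinearMap.sub_apply, LinearMap.sum_apply, LinearMap.id_apply]
  have h4 : goodPart D E k₀ N U f = f - badSum D E U (Finset.Ico k₀ N) f := rfl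
  rw [h3, h4, ← h1, h2]
  abel

/-- The geometric series appearing in the estimate for bad parts. -/
noncomputable def decayConst (κ : ℝ) : ℝ := (1 - (2 : ℝ) ^ (-(κ / 4)))⁻¹

theorem decayConst_nonneg {κ : ℝ} (hκ : 0 < κ) : 0 ≤ decayConst κ :=
  inv_nonneg.2 (sub_nonneg.2 (two_rpow_neg_lt_one (by positivity)).le)

/-- One half of the decay `2 ^ (-κ * m)` beats the quotient `b / a` because `m ≥ ℓ`, and the other
half is kept. With `t` the sum of the two distances between levels and scale, `t ≤ 2 * m` for the
larger distance `m`. -/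
theorem mul_two_rpow_le {κ b a : ℝ} (hκ : 0 < κ) (ha : 0 ≤ a) {ℓ : ℕ} (hb0 : 0 ≤ b)
    (hb : b * 2 ^ (-κ * ℓ / 2) ≤ a) {m t : ℝ} (hm : ℓ ≤ m) (ht : t ≤ 2 * m) :
    b * (2 : ℝ) ^ (-κ * m) ≤ a * 2 ^ (-(κ / 4) * t) := by
  have h1 : (2 : ℝ) ^ (-κ * m) = 2 ^ (-κ * m / 2) * 2 ^ (-κ * m / 2) := by
    rw [← Real.rpow_add (by norm_num)]
    congr 1
    ring
  have h2 : (2 : ℝ) ^ (-κ * m / 2) ≤ 2 ^ (-κ * ℓ / 2) :=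
    Real.rpow_le_rpow_of_exponent_le (by norm_num) (by nlinarith)
  have h3 : (2 : ℝ) ^ (-κ * m / 2) ≤ 2 ^ (-(κ / 4) * t) :=
    Real.rpow_le_rpow_of_exponent_le (by norm_num) (by nlinarith)
  calc b * (2 : ℝ) ^ (-κ * m) = b * 2 ^ (-κ * m / 2) * 2 ^ (-κ * m / 2) := by rw [h1]; ring
    _ ≤ b * 2 ^ (-κ * ℓ / 2) * 2 ^ (-(κ / 4) * t) := by gcongr
    _ ≤ _ := by gcongr

namespace CoreData

variable {k₀ N : ℤ} {U : ℤ → Set (EuclideanSpace ℝ (Fin d))} {x₀ : EuclideanSpace ℝ (Fin d)}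
  {f : simpleSpace D E₁} {g : simpleSpace D E₂} {α β : ℝ}
  (h : CoreData Λ p r κ a₁ a₂ a₀ b k₀ N U x₀ f g α β)
include h

theorem abs_sum_average_left_le (N₁ : ℤ) :
    |∑ j ∈ Finset.Icc N₁ N, ∑ k ∈ (Finset.Ico k₀ N).filter (j ≤ ·),
      Λ j (cut D E₁ (U k) (levelAvg D E₁ k f)) g| ≤
      a₂ * (2 ^ d * 2 ^ d) * (α * β) * stopVol k₀ N U := by
  rw [sum_scale_level_comm, stopVol, Finset.mul_sum]
  exact (Finset.abs_sum_le_sum_abs _ _).trans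
    (Finset.sum_le_sum fun k _ => h.abs_average_left_le N₁ k)

/-- The weak type bound needs a function independent of the scale. So the bad levels below `j` are
written as all levels minus those from `j` on, and the latter are resummed over the stopping levels.
-/
theorem abs_sum_bad_good_le (N₁ : ℤ) :
    |∑ j ∈ Finset.Icc N₁ N, Λ j (badSum D E₁ U ((Finset.Ico k₀ N).filter fun k => ¬ j ≤ k) f)
      (goodPart D E₂ k₀ N U g)| ≤
      a₁ * badConst d p * (2 ^ d * 5 ^ d) * (α * β) * (cellVol d N + stopVol k₀ N U) := by
  have h1 : ∀ j ∈ Finset.Icc N₁ N,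
      Λ j (badSum D E₁ U ((Finset.Ico k₀ N).filter fun k => ¬ j ≤ k) f)
        (goodPart D E₂ k₀ N U g) =
      Λ j (badSum D E₁ U (Finset.Ico k₀ N) f) (goodPart D E₂ k₀ N U g) -
      ∑ k ∈ (Finset.Ico k₀ N).filter (j ≤ ·),
        Λ j (badPart D E₁ U k f) (goodPart D E₂ k₀ N U g) := by
    intro j _
    have e : Λ j (badSum D E₁ U ((Finset.Ico k₀ N).filter (j ≤ ·)) f) (goodPart D E₂ k₀ N U g) =
        ∑ k ∈ (Finset.Ico k₀ N).filter (j ≤ ·),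
          Λ j (badPart D E₁ U k f) (goodPart D E₂ k₀ N U g) := by
      rw [badSum, LinearMap.sum_apply, map_sum, LinearMap.sum_apply]
    rw [← e, ← badSum_filter_add U (Finset.Ico k₀ N) (j ≤ ·) f, map_add, LinearMap.add_apply]
    ring
  rw [Finset.sum_congr rfl h1, Finset.sum_sub_distrib, sum_scale_level_comm, mul_add]
  refine (abs_sub _ _).trans (add_le_add (h.abs_bad_good_le N₁) ?_)
  rw [stopVol, Finset.mul_sum]
  exact (Finset.abs_sum_le_sum_abs _ _).trans
    (Finset.sum_le_sum fun k _ => h.abs_badPart_good_le N₁ k)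

variable [CompleteSpace E₁] [CompleteSpace E₂]

/-- The localized bounds for bad parts on levels far below the scale. -/
theorem localBound_decay {ℓ : ℕ} (hℓ : d ≤ ℓ) (hb : b * 2 ^ (-κ * ℓ / 2) ≤ a₀) {j k l : ℤ}
    (hk : k ≤ j) (hl : l ≤ j) (hkl : k < j - ℓ ∨ l < j - ℓ) :
    LocalBound Λ p r j (badSum D E₁ U {k} f) (badSum D E₂ U {l} g)
      (meanZeroConst d κ * (a₀ * 2 ^ (-(κ / 4) * ((j - k : ℤ) + (j - l : ℤ))))) := by
  have hmc := meanZeroConst_nonneg d h.κ_pos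
  have key : ∀ (m : ℤ) (M : ℝ), m < j - ℓ → m ≤ k → m ≤ l →
      meanZeroConst d κ * b * (2 : ℝ) ^ (-κ * ((j : ℝ) - m)) ≤
      meanZeroConst d κ * (a₀ * 2 ^ (-(κ / 4) * ((j - k : ℤ) + (j - l : ℤ)))) := by
    intro m M hm hmk hml
    rw [mul_assoc]
    refine mul_le_mul_of_nonneg_left (mul_two_rpow_le h.κ_pos h.a₀_nonneg h.b_nonneg hb ?_ ?_) hmc
    · have : (ℓ : ℤ) ≤ j - m := by omega
      exact_mod_cast this
    · have : (j - k : ℤ) + (j - l : ℤ) ≤ 2 * (j - m) := by omega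
      exact_mod_cast this
  have wk : ∀ {M M' : ℝ}, M ≤ M' →
      LocalBound Λ p r j (badSum D E₁ U {k} f) (badSum D E₂ U {l} g) M →
      LocalBound Λ p r j (badSum D E₁ U {k} f) (badSum D E₂ U {l} g) M' := by
    intro M M' hM hL s R hR
    refine (hL s R hR).trans ?_
    have := lpn_nonneg p (cut D E₁ R.toSet (badSum D E₁ U {k} f))
    have := lpn_nonneg r (cut D E₂ R.quintuple.toSet (badSum D E₂ U {l} g))
    have := cellVol_pos d j
    gcongr
  -- Cancellation is used for the function on the finer of the two levels, which is the one far
  -- below the scale.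
  rcases le_total k l with hkl' | hkl'
  · have hk' : k < j - ℓ := by omega
    refine wk (key k 0 hk' le_rfl hkl') (h.forms.localBound_left h.one_lt_p.le h.κ_pos h.b_nonneg
      (by omega) ?_ _)
    rw [badSum_singleton]
    exact h.sets.levelAvg_badPart k f
  · have hk' : l < j - ℓ := by omega
    refine wk (key l 0 hk' hkl' le_rfl) (h.forms.localBound_right h.one_lt_r.le h.κ_pos h.b_nonneg
      (by omega) _ ?_)
    rw [badSum_singleton]
    exact h.sets.levelAvg_badPart l g

theorem localBound_decay_left {ℓ : ℕ} (hℓ : d ≤ ℓ) (hb : b * 2 ^ (-κ * ℓ / 2) ≤ a₀) {j k : ℤ}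
    (hk : k < j - ℓ) (v : simpleSpace D E₂) :
    LocalBound Λ p r j (badSum D E₁ U {k} f) v
      (meanZeroConst d κ * (a₀ * 2 ^ (-(κ / 4) * (j - k : ℤ)))) := by
  have hmc := meanZeroConst_nonneg d h.κ_pos
  have hL := h.forms.localBound_left (u := badSum D E₁ U {k} f) h.one_lt_p.le h.κ_pos h.b_nonneg
    (show k + d ≤ j by omega) (by rw [badSum_singleton]; exact h.sets.levelAvg_badPart k f) v
  intro s R hR
  refine (hL s R hR).trans ?_
  have := lpn_nonneg p (cut D E₁ R.toSet (badSum D E₁ U {k} f))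
  have := lpn_nonneg r (cut D E₂ R.quintuple.toSet v)
  have := cellVol_pos d j
  have hle : meanZeroConst d κ * b * (2 : ℝ) ^ (-κ * ((j : ℝ) - k)) ≤
      meanZeroConst d κ * (a₀ * 2 ^ (-(κ / 4) * (j - k : ℤ))) := by
    rw [mul_assoc]
    refine mul_le_mul_of_nonneg_left (mul_two_rpow_le h.κ_pos h.a₀_nonneg h.b_nonneg hb ?_ ?_) hmc
    · have : (ℓ : ℤ) ≤ j - k := by omega
      exact_mod_cast this
    · have : (j - k : ℤ) ≤ 2 * (j - k) := by omega
      exact_mod_cast this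
  gcongr

/-- Bad parts on levels below a fixed scale. -/
theorem abs_bad_bad_scale_le {ℓ : ℕ} (hℓ : d ≤ ℓ) (hb : b * 2 ^ (-κ * ℓ / 2) ≤ a₀) {j : ℤ}
    (hj : j ≤ N) {X : Finset ℤ} (hX : ∀ k ∈ X, k < j) :
    |Λ j (badSum D E₁ U X f) (badSum D E₂ U X g)| ≤
      a₀ * (badConst d p * badConst d r * (5 ^ d * 5 ^ d)) * (α * β) *
        (2 * ∑ k ∈ X.filter (j - ℓ ≤ ·), volume.real (U k) +
          meanZeroConst d κ * (2 * decayConst κ *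
            ∑ k ∈ X, 2 ^ (-(κ / 4) * (j - k : ℤ)) * volume.real (U k))) := by
  classical
  have hα := h.left.nonneg
  have hβ := h.right.nonneg
  have ha₀ := h.a₀_nonneg
  have hp0 : 0 < p := by linarith [h.one_lt_p]
  have hr0 : 0 < r := by linarith [h.one_lt_r]
  have hbp : 0 ≤ badConst d p := zero_le_one.trans (one_le_badConst d hp0.le)
  have hbr : 0 ≤ badConst d r := zero_le_one.trans (one_le_badConst d hr0.le)
  have hmc := meanZeroConst_nonneg d h.κ_pos
  have hG := decayConst_nonneg h.κ_pos
  set W := X.filter (j - ℓ ≤ ·) with hW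
  set K := badConst d p * badConst d r * (5 ^ d * 5 ^ d) with hK
  have hK0 : 0 ≤ K := by positivity
  -- Pairs with both levels among the `ℓ` below the scale stay together and get the single scale
  -- bound. All other pairs are estimated one by one, with decay.
  have hsplit : Λ j (badSum D E₁ U X f) (badSum D E₂ U X g) =
      Λ j (badSum D E₁ U W f) (badSum D E₂ U W g) +
      ∑ k ∈ X, ∑ l ∈ X, if j - ℓ ≤ k ∧ j - ℓ ≤ l then 0 else
        Λ j (badSum D E₁ U {k} f) (badSum D E₂ U {l} g) := by
    have e1 : ∀ Y : Finset ℤ, Λ j (badSum D E₁ U Y f) (badSum D E₂ U Y g) =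
        ∑ k ∈ Y, ∑ l ∈ Y, Λ j (badSum D E₁ U {k} f) (badSum D E₂ U {l} g) := by
      intro Y
      rw [badSum_eq_sum U Y f, badSum_eq_sum U Y g, map_sum (Λ j), LinearMap.sum_apply]
      simp_rw [map_sum]
    rw [e1 X, e1 W, hW, Finset.sum_filter, ← Finset.sum_add_distrib]
    refine Finset.sum_congr rfl fun k _ => ?_
    rw [Finset.sum_filter]
    split_ifs with hk
    · rw [← Finset.sum_add_distrib]
      refine Finset.sum_congr rfl fun l _ => ?_
      by_cases hl : j - ℓ ≤ l <;> simp [hk, hl]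
    · simp [hk]
  have hwin : |Λ j (badSum D E₁ U W f) (badSum D E₂ U W g)| ≤
      a₀ * K * (α * β) * (2 * ∑ k ∈ W, volume.real (U k)) := by
    refine (h.abs_bad_bad_le hj (fun k hk => (hX k (Finset.filter_subset _ _ hk)).le)
      (fun k hk => (hX k (Finset.filter_subset _ _ hk)).le) ha₀
      (h.forms.localBound j _ _)).trans (le_of_eq ?_)
    rw [two_mul]
  have hterm : ∀ k ∈ X, ∀ l ∈ X, |if j - ℓ ≤ k ∧ j - ℓ ≤ l then 0 else
        Λ j (badSum D E₁ U {k} f) (badSum D E₂ U {l} g)| ≤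
      a₀ * K * (α * β) * (meanZeroConst d κ *
        (2 ^ (-(κ / 4) * (j - l : ℤ)) * (2 ^ (-(κ / 4) * (j - k : ℤ)) * volume.real (U k)) +
         2 ^ (-(κ / 4) * (j - k : ℤ)) * (2 ^ (-(κ / 4) * (j - l : ℤ)) * volume.real (U l)))) := by
    intro k hk l hl
    split_ifs with hkl
    · rw [abs_zero]
      positivity
    · have h1 := h.abs_bad_bad_le hj (X := {k}) (Y := {l})
        (fun m hm => by rw [Finset.mem_singleton.1 hm]; exact (hX k hk).le)
        (fun m hm => by rw [Finset.mem_singleton.1 hm]; exact (hX l hl).le) (by positivity)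
        (h.localBound_decay hℓ hb (hX k hk).le (hX l hl).le (by omega))
      refine h1.trans (le_of_eq ?_)
      -- The decay is a product of one factor for each level, so one factor can be summed freely
      -- while the other stays with a volume.
      rw [Finset.sum_singleton, Finset.sum_singleton, mul_add (-(κ / 4)),
        Real.rpow_add (by norm_num)]
      ring
  have hgeo : ∑ k ∈ X, (2 : ℝ) ^ (-(κ / 4) * (j - k : ℤ)) ≤ decayConst κ :=
    sum_two_rpow_le (by linarith [h.κ_pos]) X (fun k => j - k) (fun a b hab => by
      simp only at hab; omega) (fun k hk => by have := hX k hk; omega)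
  rw [hsplit, mul_add]
  refine (abs_add_le _ _).trans (add_le_add hwin ?_)
  refine (Finset.abs_sum_le_sum_abs _ _).trans ((Finset.sum_le_sum fun k hk =>
    (Finset.abs_sum_le_sum_abs _ _).trans (Finset.sum_le_sum fun l hl => hterm k hk l hl)).trans ?_)
  simp_rw [← Finset.mul_sum]
  refine mul_le_mul_of_nonneg_left (mul_le_mul_of_nonneg_left ?_ hmc) (by positivity)
  have h0 : 0 ≤ ∑ k ∈ X, (2 : ℝ) ^ (-(κ / 4) * (j - k : ℤ)) * volume.real (U k) :=
    Finset.sum_nonneg fun _ _ => by positivity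
  simp_rw [Finset.sum_add_distrib, ← Finset.mul_sum, ← Finset.sum_mul]
  rw [← Finset.mul_sum]
  nlinarith

/-- Bad parts of `f` on levels below a fixed scale against the other bad parts of `g`. -/
theorem abs_bad_bad_boundary_scale_le {ℓ : ℕ} (hℓ : d ≤ ℓ) (hb : b * 2 ^ (-κ * ℓ / 2) ≤ a₀)
    {j : ℤ} (hj : j ≤ N) {X Y : Finset ℤ} (hX : ∀ k ∈ X, k < j) (hY : ∀ k ∈ Y, j ≤ k) :
    |Λ j (badSum D E₁ U X f) (badSum D E₂ U Y g)| ≤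
      a₀ * (badConst d p * badConst d r * (5 ^ d * 7 ^ d)) * (α * β) *
        ((1 + meanZeroConst d κ * decayConst κ) *
          ∑ k ∈ Y, (2 : ℝ) ^ (j - k) * volume.real (U k)) := by
  classical
  have hα := h.left.nonneg
  have hβ := h.right.nonneg
  have ha₀ := h.a₀_nonneg
  have hp0 : 0 < p := by linarith [h.one_lt_p]
  have hr0 : 0 < r := by linarith [h.one_lt_r]
  have hbp : 0 ≤ badConst d p := zero_le_one.trans (one_le_badConst d hp0.le)
  have hbr : 0 ≤ badConst d r := zero_le_one.trans (one_le_badConst d hr0.le)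
  have hmc := meanZeroConst_nonneg d h.κ_pos
  set V := ∑ k ∈ Y, (2 : ℝ) ^ (j - k) * volume.real (U k) with hV
  have hV0 : 0 ≤ V := Finset.sum_nonneg fun _ _ => by positivity
  set K := badConst d p * badConst d r * (5 ^ d * 7 ^ d) with hK
  have hK0 : 0 ≤ K := by positivity
  have hgeo : ∑ k ∈ X.filter fun k => ¬ j - ℓ ≤ k, (2 : ℝ) ^ (-(κ / 4) * (j - k : ℤ)) ≤
      decayConst κ :=
    sum_two_rpow_le (by linarith [h.κ_pos]) _ (fun k => j - k) (fun a b hab => by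
      simp only at hab; omega) (fun k hk => by have := hX k (Finset.filter_subset _ _ hk); omega)
  rw [← badSum_filter_add U X (j - ℓ ≤ ·) f, badSum_eq_sum U (X.filter fun k => ¬ j - ℓ ≤ k),
    map_add, LinearMap.add_apply, map_sum, LinearMap.sum_apply]
  refine (abs_add_le _ _).trans ?_
  -- Levels close to the scale are again kept together. No factor `ℓ` arises later because the
  -- boundary volumes already decay in `j`.
  have h1 := h.abs_bad_bad_boundary_le hj (X := X.filter (j - ℓ ≤ ·)) (Y := Y)
    (fun k hk => hX k (Finset.filter_subset _ _ hk)) hY ha₀ (h.forms.localBound j _ _)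
  have h2 : |∑ k ∈ X.filter fun k => ¬ j - ℓ ≤ k,
      Λ j (badSum D E₁ U {k} f) (badSum D E₂ U Y g)| ≤
      a₀ * K * (α * β) * (meanZeroConst d κ * decayConst κ * V) := by
    refine (Finset.abs_sum_le_sum_abs _ _).trans ?_
    calc _ ≤ ∑ k ∈ X.filter fun k => ¬ j - ℓ ≤ k,
          (2 : ℝ) ^ (-(κ / 4) * (j - k : ℤ)) * (a₀ * K * (α * β) * (meanZeroConst d κ * V)) := by
          refine Finset.sum_le_sum fun k hk => ?_
          have hk' := Finset.mem_filter.1 hk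
          refine (h.abs_bad_bad_boundary_le hj (X := {k}) (Y := Y)
            (fun m hm => by rw [Finset.mem_singleton.1 hm]; exact hX k hk'.1) hY (by positivity)
            (h.localBound_decay_left hℓ hb (by omega) _)).trans (le_of_eq ?_)
          ring
      _ ≤ decayConst κ * (a₀ * K * (α * β) * (meanZeroConst d κ * V)) := by
          rw [← Finset.sum_mul]
          gcongr
      _ = _ := by ring
  refine (add_le_add h1 h2).trans (le_of_eq ?_)
  ring

omit h [CompleteSpace E₁] [CompleteSpace E₂] in
-- A stopping level is close to at most `ℓ` scales above it. This is the source of the logarithm in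
-- the final constant.
theorem card_window_le (N₁ N k : ℤ) (ℓ : ℕ) :
    (((Finset.Icc N₁ N).filter fun j => ¬ j ≤ k ∧ j - ℓ ≤ k).card : ℝ) ≤ ℓ := by
  have : ((Finset.Icc N₁ N).filter fun j => ¬ j ≤ k ∧ j - ℓ ≤ k) ⊆ Finset.Ioc k (k + ℓ) := by
    intro j hj
    have := (Finset.mem_filter.1 hj).2
    rw [Finset.mem_Ioc]
    omega
  have := Finset.card_le_card this
  rw [Int.card_Ioc] at this
  have h2 : (k + (ℓ : ℤ) - k).toNat = ℓ := by omega
  rw [h2] at this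
  exact_mod_cast this

/-- Each stopping level is charged without decay by at most `ℓ` scales. The remaining contributions
form two geometric series, one over the other level and one over the scales. -/
theorem abs_sum_bad_bad_le {ℓ : ℕ} (hℓ : d ≤ ℓ) (hb : b * 2 ^ (-κ * ℓ / 2) ≤ a₀) (N₁ : ℤ) :
    |∑ j ∈ Finset.Icc N₁ N, Λ j (badSum D E₁ U ((Finset.Ico k₀ N).filter fun k => ¬ j ≤ k) f)
      (badSum D E₂ U ((Finset.Ico k₀ N).filter fun k => ¬ j ≤ k) g)| ≤
      a₀ * (badConst d p * badConst d r * (5 ^ d * 5 ^ d)) * (α * β) *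
        (2 * (ℓ * stopVol k₀ N U) +
          meanZeroConst d κ * (2 * decayConst κ * (decayConst κ * stopVol k₀ N U))) := by
  have hα := h.left.nonneg
  have hβ := h.right.nonneg
  have ha₀ := h.a₀_nonneg
  have hp0 : 0 < p := by linarith [h.one_lt_p]
  have hr0 : 0 < r := by linarith [h.one_lt_r]
  have hbp : 0 ≤ badConst d p := zero_le_one.trans (one_le_badConst d hp0.le)
  have hbr : 0 ≤ badConst d r := zero_le_one.trans (one_le_badConst d hr0.le)
  have hmc := meanZeroConst_nonneg d h.κ_pos
  have hG := decayConst_nonneg h.κ_pos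
  refine (Finset.abs_sum_le_sum_abs _ _).trans ((Finset.sum_le_sum fun j hj =>
    h.abs_bad_bad_scale_le hℓ hb (Finset.mem_Icc.1 hj).2 fun k hk => by
      have := (Finset.mem_filter.1 hk).2; omega).trans ?_)
  rw [← Finset.mul_sum, Finset.sum_add_distrib, ← Finset.mul_sum, ← Finset.mul_sum,
    ← Finset.mul_sum]
  have hA : ∑ j ∈ Finset.Icc N₁ N, ∑ k ∈ ((Finset.Ico k₀ N).filter fun k => ¬ j ≤ k).filter
      (j - ℓ ≤ ·), volume.real (U k) ≤ ℓ * stopVol k₀ N U := by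
    simp_rw [Finset.filter_filter, Finset.sum_filter]
    rw [Finset.sum_comm, stopVol, Finset.mul_sum]
    refine Finset.sum_le_sum fun k _ => ?_
    rw [← Finset.sum_filter, Finset.sum_const, nsmul_eq_mul]
    exact mul_le_mul_of_nonneg_right (card_window_le N₁ N k ℓ) measureReal_nonneg
  have hB : ∑ j ∈ Finset.Icc N₁ N, ∑ k ∈ (Finset.Ico k₀ N).filter (fun k => ¬ j ≤ k),
      (2 : ℝ) ^ (-(κ / 4) * (j - k : ℤ)) * volume.real (U k) ≤ decayConst κ * stopVol k₀ N U := by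
    simp_rw [Finset.sum_filter]
    rw [Finset.sum_comm, stopVol, Finset.mul_sum]
    refine Finset.sum_le_sum fun k _ => ?_
    rw [← Finset.sum_filter, ← Finset.sum_mul]
    refine mul_le_mul_of_nonneg_right ?_ measureReal_nonneg
    exact sum_two_rpow_le (by linarith [h.κ_pos]) _ (fun j => j - k) (fun a b hab => by
      simp only at hab; omega) (fun j hj => by have := (Finset.mem_filter.1 hj).2; omega)
  gcongr

/-- The relative volumes `2 ^ (j - k)` of the boundary layers sum to at most `2` over the scales `j
≤ k`. -/
theorem abs_sum_bad_bad_boundary_le {ℓ : ℕ} (hℓ : d ≤ ℓ) (hb : b * 2 ^ (-κ * ℓ / 2) ≤ a₀)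
    (N₁ : ℤ) :
    |∑ j ∈ Finset.Icc N₁ N, Λ j (badSum D E₁ U ((Finset.Ico k₀ N).filter fun k => ¬ j ≤ k) f)
      (badSum D E₂ U ((Finset.Ico k₀ N).filter (j ≤ ·)) g)| ≤
      a₀ * (badConst d p * badConst d r * (5 ^ d * 7 ^ d)) * (α * β) *
        ((1 + meanZeroConst d κ * decayConst κ) * (2 * stopVol k₀ N U)) := by
  have hα := h.left.nonneg
  have hβ := h.right.nonneg
  have ha₀ := h.a₀_nonneg
  have hp0 : 0 < p := by linarith [h.one_lt_p]
  have hr0 : 0 < r := by linarith [h.one_lt_r]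
  have hbp : 0 ≤ badConst d p := zero_le_one.trans (one_le_badConst d hp0.le)
  have hbr : 0 ≤ badConst d r := zero_le_one.trans (one_le_badConst d hr0.le)
  have hmc := meanZeroConst_nonneg d h.κ_pos
  have hG := decayConst_nonneg h.κ_pos
  refine (Finset.abs_sum_le_sum_abs _ _).trans ((Finset.sum_le_sum fun j hj =>
    h.abs_bad_bad_boundary_scale_le hℓ hb (Finset.mem_Icc.1 hj).2 (fun k hk => by
      have := (Finset.mem_filter.1 hk).2; omega)
      (fun k hk => (Finset.mem_filter.1 hk).2)).trans ?_)
  rw [← Finset.mul_sum, ← Finset.mul_sum]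
  have hB : ∑ j ∈ Finset.Icc N₁ N, ∑ k ∈ (Finset.Ico k₀ N).filter (j ≤ ·),
      (2 : ℝ) ^ (j - k) * volume.real (U k) ≤ 2 * stopVol k₀ N U := by
    rw [sum_scale_level_comm, stopVol, Finset.mul_sum]
    refine Finset.sum_le_sum fun k _ => ?_
    rw [← Finset.sum_mul]
    refine mul_le_mul_of_nonneg_right ?_ measureReal_nonneg
    have h1 := sum_two_rpow_le one_pos (Finset.Icc N₁ k) (fun j => k - j) (fun a b hab => by
      simp only at hab; omega) (fun j hj => by have := (Finset.mem_Icc.1 hj).2; omega)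
    refine (le_of_eq (Finset.sum_congr rfl fun j _ => ?_)).trans (h1.trans (le_of_eq ?_))
    · rw [← Real.rpow_intCast]
      congr 1
      push_cast
      ring
    · rw [Real.rpow_neg_one]
      norm_num
  gcongr

end CoreData

/-- The constant in the estimate for one stopping step. -/
noncomputable def coreConst (d : ℕ) (p r κ : ℝ) : ℝ :=
  2 ^ d * 2 ^ d + badConst d p * (2 ^ d * 5 ^ d) +
    badConst d p * badConst d r * (5 ^ d * 7 ^ d) *
      (2 + 2 * (meanZeroConst d κ * decayConst κ * decayConst κ) +
        2 * (1 + meanZeroConst d κ * decayConst κ))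

theorem coreConst_nonneg (d : ℕ) {p r κ : ℝ} (hp : 0 ≤ p) (hr : 0 ≤ r) (hκ : 0 < κ) :
    0 ≤ coreConst d p r κ := by
  have hbp : 0 ≤ badConst d p := zero_le_one.trans (one_le_badConst d hp)
  have hbr : 0 ≤ badConst d r := zero_le_one.trans (one_le_badConst d hr)
  have hmc := meanZeroConst_nonneg d hκ
  have hG := decayConst_nonneg hκ
  unfold coreConst
  positivity

/-- Expanding `f` by `aboveScale_eq`, and then `g` where `f` is bad, gives five sums: good against
`g`, averages against `g`, bad against good, bad against bad below the scale, and the boundary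
terms. The single scale constant enters only through the last two, and `ℓ` only through the fourth.
-/
theorem CoreData.abs_sum_le {k₀ N : ℤ} {U : ℤ → Set (EuclideanSpace ℝ (Fin d))}
    {x₀ : EuclideanSpace ℝ (Fin d)} {f : simpleSpace D E₁} {g : simpleSpace D E₂} {α β : ℝ}
    (h : CoreData Λ p r κ a₁ a₂ a₀ b k₀ N U x₀ f g α β) [CompleteSpace E₁] [CompleteSpace E₂]
    {ℓ : ℕ} (hℓ : d ≤ ℓ) (hb : b * 2 ^ (-κ * ℓ / 2) ≤ a₀) (N₁ : ℤ) :
    |∑ j ∈ Finset.Icc N₁ N, Λ j (aboveScale D E₁ k₀ N U j f) g| ≤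
      coreConst d p r κ * (a₁ + a₂ + a₀ * (1 + ℓ)) * (α * β) *
        (cellVol d N + stopVol k₀ N U) := by
  have hα := h.left.nonneg
  have hβ := h.right.nonneg
  have ha₀ := h.a₀_nonneg
  have ha₁ := h.a₁_nonneg
  have ha₂ := h.a₂_nonneg
  have hp0 : 0 < p := by linarith [h.one_lt_p]
  have hr0 : 0 < r := by linarith [h.one_lt_r]
  have hbp : 0 ≤ badConst d p := zero_le_one.trans (one_le_badConst d hp0.le)
  have hbr : 0 ≤ badConst d r := zero_le_one.trans (one_le_badConst d hr0.le)
  have hmc := meanZeroConst_nonneg d h.κ_pos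
  have hG := decayConst_nonneg h.κ_pos
  have hv := cellVol_pos d N
  have hs := stopVol_nonneg k₀ N U
  have hsplit : ∑ j ∈ Finset.Icc N₁ N, Λ j (aboveScale D E₁ k₀ N U j f) g =
      ∑ j ∈ Finset.Icc N₁ N, Λ j (goodPart D E₁ k₀ N U f) g -
      ∑ j ∈ Finset.Icc N₁ N, ∑ k ∈ (Finset.Ico k₀ N).filter (j ≤ ·),
        Λ j (cut D E₁ (U k) (levelAvg D E₁ k f)) g +
      ∑ j ∈ Finset.Icc N₁ N, Λ j (badSum D E₁ U ((Finset.Ico k₀ N).filter fun k => ¬ j ≤ k) f)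
        (goodPart D E₂ k₀ N U g) +
      ∑ j ∈ Finset.Icc N₁ N, Λ j (badSum D E₁ U ((Finset.Ico k₀ N).filter fun k => ¬ j ≤ k) f)
        (badSum D E₂ U ((Finset.Ico k₀ N).filter fun k => ¬ j ≤ k) g) +
      ∑ j ∈ Finset.Icc N₁ N, Λ j (badSum D E₁ U ((Finset.Ico k₀ N).filter fun k => ¬ j ≤ k) f)
        (badSum D E₂ U ((Finset.Ico k₀ N).filter (j ≤ ·)) g) := by
    rw [← Finset.sum_sub_distrib, ← Finset.sum_add_distrib, ← Finset.sum_add_distrib,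
      ← Finset.sum_add_distrib]
    refine Finset.sum_congr rfl fun j _ => ?_
    have hg : g = goodPart D E₂ k₀ N U g +
        badSum D E₂ U ((Finset.Ico k₀ N).filter fun k => ¬ j ≤ k) g +
        badSum D E₂ U ((Finset.Ico k₀ N).filter (j ≤ ·)) g := by
      have : goodPart D E₂ k₀ N U g = g - badSum D E₂ U (Finset.Ico k₀ N) g := rfl
      rw [this, ← badSum_filter_add U (Finset.Ico k₀ N) (j ≤ ·) g]
      abel
    have e : Λ j (badSum D E₁ U ((Finset.Ico k₀ N).filter fun k => ¬ j ≤ k) f) g = _ :=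
      congrArg (Λ j (badSum D E₁ U ((Finset.Ico k₀ N).filter fun k => ¬ j ≤ k) f)) hg
    rw [map_add, map_add] at e
    rw [aboveScale_eq, map_sub, map_add, LinearMap.sub_apply, LinearMap.add_apply, map_sum,
      LinearMap.sum_apply, e]
    ring
  have h1 := h.abs_good_left_le N₁
  have h2 := h.abs_sum_average_left_le N₁
  have h3 := h.abs_sum_bad_good_le N₁
  have h4 := h.abs_sum_bad_bad_le hℓ hb N₁
  have h5 := h.abs_sum_bad_bad_boundary_le hℓ hb N₁
  rw [hsplit]
  refine (abs_add_le _ _).trans ((add_le_add ((abs_add_le _ _).trans (add_le_add ((abs_add_le _ _).trans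
    (add_le_add ((abs_sub _ _).trans (add_le_add h1 h2)) h3)) h4)) h5).trans ?_)
  have h57 : (5 : ℝ) ^ d * 5 ^ d ≤ 5 ^ d * 7 ^ d := by gcongr; norm_num
  have h22 : (2 : ℝ) ^ d ≤ 2 ^ d * 2 ^ d :=
    le_mul_of_one_le_left (by positivity) (one_le_pow₀ (by norm_num))
  set V := cellVol d N
  set S := stopVol k₀ N U
  set K := badConst d p * badConst d r * (5 ^ d * 7 ^ d) with hK
  have hK0 : 0 ≤ K := by positivity
  have hK5 : badConst d p * badConst d r * (5 ^ d * 5 ^ d) ≤ K := by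
    rw [hK]; gcongr
  set m := meanZeroConst d κ
  set G := decayConst κ
  set A := a₁ + a₂ + a₀ * (1 + ℓ) with hA
  have hA0 : 0 ≤ A := by positivity
  have hA1 : a₁ ≤ A := by have : 0 ≤ a₀ * (1 + ℓ) := by positivity
                          linarith
  have hA2 : a₂ ≤ A := by have : 0 ≤ a₀ * (1 + ℓ) := by positivity
                          linarith
  have hA3 : a₀ ≤ A := by have : 0 ≤ a₀ * ℓ := by positivity
                          linarith [mul_add a₀ 1 (ℓ : ℝ)]
  have hA4 : a₀ * ℓ ≤ A := by linarith [mul_add a₀ 1 (ℓ : ℝ)]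
  calc _ ≤ A * (2 ^ d * 2 ^ d) * (α * β) * V + A * (2 ^ d * 2 ^ d) * (α * β) * S +
        A * badConst d p * (2 ^ d * 5 ^ d) * (α * β) * (V + S) +
        (A * (K * 2) * (α * β) * S + A * K * (α * β) * (m * (2 * G * (G * S)))) +
        A * K * (α * β) * ((1 + m * G) * (2 * S)) := by
        have e4 : a₀ * (badConst d p * badConst d r * (5 ^ d * 5 ^ d)) * (α * β) *
            (2 * (ℓ * S) + m * (2 * G * (G * S))) ≤
            A * (K * 2) * (α * β) * S + A * K * (α * β) * (m * (2 * G * (G * S))) := by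
          calc _ ≤ a₀ * K * (α * β) * (2 * (ℓ * S) + m * (2 * G * (G * S))) := by gcongr
            _ = (a₀ * ℓ) * (K * 2) * (α * β) * S + a₀ * K * (α * β) * (m * (2 * G * (G * S))) := by
                ring
            _ ≤ _ := by gcongr
        gcongr
    _ ≤ A * (2 ^ d * 2 ^ d) * (α * β) * V + A * (2 ^ d * 2 ^ d) * (α * β) * S +
        A * badConst d p * (2 ^ d * 5 ^ d) * (α * β) * (V + S) +
        (A * (K * 2) * (α * β) * (V + S) + A * K * (α * β) * (m * (2 * G * (G * (V + S))))) +
        A * K * (α * β) * ((1 + m * G) * (2 * (V + S))) := by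
        have : S ≤ V + S := by linarith
        gcongr
    _ = _ := by
        rw [coreConst]
        ring

end CoreSum

/-! ### Construction of the stopping sets -/

section FirstStop

variable {d : ℕ} {D : Set (Cube d)}

/-- The points at which `k` is the largest level below `N` with the property `bad`. -/
def firstStop (k₀ N : ℤ) (bad : ℤ → EuclideanSpace ℝ (Fin d) → Prop) (k : ℤ) :
    Set (EuclideanSpace ℝ (Fin d)) :=
  {x | k ∈ Finset.Ico k₀ N ∧ bad k x ∧ ∀ j, k < j → j < N → ¬ bad j x}

theorem exists_mem_firstStop {k₀ N : ℤ} {bad : ℤ → EuclideanSpace ℝ (Fin d) → Prop} {j : ℤ}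
    {x : EuclideanSpace ℝ (Fin d)} (hj : k₀ ≤ j) (hjN : j < N) (h : bad j x) :
    ∃ m, j ≤ m ∧ x ∈ firstStop k₀ N bad m := by
  classical
  have hne : ((Finset.Ico j N).filter (bad · x)).Nonempty :=
    ⟨j, Finset.mem_filter.2 ⟨Finset.mem_Ico.2 ⟨le_rfl, hjN⟩, h⟩⟩
  have hm := Finset.max'_mem _ hne
  rw [Finset.mem_filter, Finset.mem_Ico] at hm
  refine ⟨_, hm.1.1, Finset.mem_Ico.2 ⟨hj.trans hm.1.1, hm.1.2⟩, hm.2, fun i hi hiN hb => ?_⟩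
  have := Finset.le_max' ((Finset.Ico j N).filter (bad · x)) i
    (Finset.mem_filter.2 ⟨Finset.mem_Ico.2 ⟨hm.1.1.trans hi.le, hiN⟩, hb⟩)
  omega

variable [NeZero d] [hD : Fact (IsDyadicLattice D)]

/-- Maximality makes the levels disjoint. Saturation holds because the coarser properties are
constant on the coarser cells, hence on the finer ones. -/
theorem stoppingSets_firstStop {k₀ N : ℤ} (hle : k₀ ≤ N)
    {bad : ℤ → EuclideanSpace ℝ (Fin d) → Prop}
    (hbad : ∀ k x y, y ∈ cell D k x → (bad k y ↔ bad k x))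
    (hfin : ∀ k ∈ Finset.Ico k₀ N, volume {x | bad k x} ≠ ∞) :
    StoppingSets D k₀ N (firstStop k₀ N bad) where
  le := hle
  saturated k x hx y hy := ⟨hx.1, (hbad k x y hy).2 hx.2.1, fun j hj hjN h =>
    hx.2.2 j hj hjN ((hbad j x y (cell_mono hj.le x hy)).1 h)⟩
  volume_ne_top k := by
    by_cases hk : k ∈ Finset.Ico k₀ N
    · exact ne_top_of_le_ne_top (hfin k hk) (measure_mono fun x hx => hx.2.1)
    · have : firstStop k₀ N bad k = ∅ := Set.eq_empty_of_forall_notMem fun x hx => hk hx.1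
      rw [this, measure_empty]
      exact ENNReal.zero_ne_top
  disjoint k l hkl := Set.disjoint_left.2 fun x hx hy => by
    have h1 := Finset.mem_Ico.1 hx.1
    have h2 := Finset.mem_Ico.1 hy.1
    rcases lt_or_gt_of_ne hkl with h | h
    · exact hx.2.2 l h h2.2 hy.2.1
    · exact hy.2.2 k h h1.2 hx.2.1
  mem_Ico k x hx := hx.1

/-- The dyadic maximal theorem for level sets. -/
theorem mul_sum_volume_firstStop_le {k₀ N : ℤ} (hle : k₀ ≤ N)
    {φ : EuclideanSpace ℝ (Fin d) → ℝ} (hφ : IsStep D k₀ φ) (h0 : ∀ x, 0 ≤ φ x) {c : ℝ}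
    (hc : 0 < c) :
    StoppingSets D k₀ N (firstStop k₀ N fun k x => c * cellVol d k < ∫ y in cell D k x, φ y) ∧
    c * stopVol k₀ N (firstStop k₀ N fun k x => c * cellVol d k < ∫ y in cell D k x, φ y) ≤
      ∫ x, φ x := by
  set V := firstStop k₀ N fun k x => c * cellVol d k < ∫ y in cell D k x, φ y with hV
  have hS : StoppingSets D k₀ N V := by
    refine stoppingSets_firstStop hle (fun k x y hy => by simp only [cell_eq hy]) fun k hk => ?_
    -- A cell with positive integral meets the support of `φ`.
    refine ne_top_of_le_ne_top (volume_hull_ne_top (Finset.mem_Ico.1 hk).1 hφ.2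
      hφ.saturated_support) (measure_mono fun x hx => ?_)
    by_contra hcon
    rw [Set.mem_ofPred_eq, Set.not_nonempty_iff_eq_empty] at hcon
    have hx' : c * cellVol d k < ∫ y in cell D k x, φ y := hx
    rw [setIntegral_eq_zero_of_forall_eq_zero] at hx'
    · have := cellVol_pos d k
      have : 0 < c * cellVol d k := by positivity
      linarith
    · intro y hy
      by_contra h
      have : y ∈ cell D k x ∩ Function.support φ := ⟨hy, h⟩
      rw [hcon] at this
      exact this
  refine ⟨hS, ?_⟩
  have h1 : ∀ k ∈ Finset.Ico k₀ N, c * volume.real (V k) ≤ ∫ x in V k, φ x := by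
    intro k _
    rw [← sum_grid_volume (hS.volume_ne_top k) (hS.saturated k),
      ← sum_grid_integral (hS.volume_ne_top k) (hS.saturated k) hφ.integrable, Finset.mul_sum]
    refine Finset.sum_le_sum fun R hR => ?_
    obtain ⟨e1, e2, e3⟩ := of_mem_grid hR
    have := (e3 R.corner_mem).2.1
    simp only at this
    rw [cell_corner e1 e2] at this
    exact this.le
  rw [stopVol, Finset.mul_sum]
  refine (Finset.sum_le_sum h1).trans ?_
  rw [← integral_biUnion_finset _ (fun k _ => hS.measurableSet k)
    (fun k _ l _ hkl => hS.disjoint k l hkl) fun k _ => hφ.integrable.integrableOn]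
  exact setIntegral_le_integral hφ.integrable (ae_of_all _ h0)

/-- The weak type bound for the maximal function over fivefold dilates of dyadic cubes. -/
theorem volume_maximal_le {k₀ N : ℤ} (hle : k₀ ≤ N)
    {φ : EuclideanSpace ℝ (Fin d) → ℝ} (hφ : IsStep D k₀ φ) (h0 : ∀ x, 0 ≤ φ x) {c : ℝ}
    (hc : 0 < c) :
    volume {x | ∃ k ∈ Finset.Ico k₀ N, c * cellVol d k < ∫ y in bigCell D k x, φ y} ≤
      ENNReal.ofReal (25 ^ d / c * ∫ x, φ x) := by
  have hc5 : 0 < c / 5 ^ d := by positivity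
  obtain ⟨hS, hvol⟩ := mul_sum_volume_firstStop_le hle hφ h0 hc5
  set V := firstStop k₀ N fun k x => c / 5 ^ d * cellVol d k < ∫ y in cell D k x, φ y with hV
  have hsub : {x | ∃ k ∈ Finset.Ico k₀ N, c * cellVol d k < ∫ y in bigCell D k x, φ y} ⊆
      ⋃ m ∈ Finset.Ico k₀ N, ⋃ R ∈ grid D m (V m), R.quintuple.toSet := by
    rintro x ⟨k, hk, hx⟩
    -- The dilate consists of `5 ^ d` cells, one of which carries at least its share of the
    -- integral.
    obtain ⟨R, hR, hRk⟩ : ∃ R ∈ grid D k (bigCell D k x),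
        c / 5 ^ d * cellVol d k < ∫ y in R.toSet, φ y := by
      by_contra! hcon
      have h1 := sum_grid_integral (volume_bigCell_ne_top k x) (saturated_bigCell (D := D) k x)
        hφ.integrable
      have h2 := sum_grid_volume (volume_bigCell_ne_top k x) (saturated_bigCell (D := D) k x)
      have h3 := Finset.sum_le_sum hcon
      rw [h1, ← Finset.mul_sum] at h3
      rw [h2, volume_bigCell] at h3
      have : c / 5 ^ d * (5 ^ d * cellVol d k) = c * cellVol d k := by field_simp
      linarith
    obtain ⟨e1, e2, e3⟩ := of_mem_grid hR
    rw [← cell_corner e1 e2] at hRk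
    obtain ⟨h1, h2⟩ := Finset.mem_Ico.1 hk
    -- The maximal cell containing `R` has `x` in its dilate. Covering by dilates costs a second
    -- factor `5 ^ d`.
    obtain ⟨m, hkm, hm⟩ := exists_mem_firstStop (k₀ := k₀) (N := N)
      (bad := fun k x => c / 5 ^ d * cellVol d k < ∫ y in cell D k x, φ y) h1 h2 hRk
    refine Set.mem_iUnion₂.2 ⟨m, hS.mem_Ico m _ hm, Set.mem_iUnion₂.2
      ⟨cubeAt D m R.corner, (mem_grid (hS.volume_ne_top m)).2
        ⟨cubeAt_mem _ _, side_cubeAt _ _, hS.saturated m _ hm⟩, ?_⟩⟩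
    exact bigCell_mono hkm R.corner (bigCell_mem_comm (e3 R.corner_mem))
  refine (measure_mono hsub).trans ?_
  refine (measure_biUnion_finset_le _ _).trans ((Finset.sum_le_sum fun m _ =>
    measure_biUnion_finset_le _ _).trans ?_)
  have h5 : ∀ m, ∑ R ∈ grid D m (V m), volume R.quintuple.toSet =
      ENNReal.ofReal (5 ^ d * volume.real (V m)) := by
    intro m
    rw [← sum_grid_volume (hS.volume_ne_top m) (hS.saturated m), Finset.mul_sum,
      ENNReal.ofReal_sum_of_nonneg fun R hR => by have := cellVol_pos d m; positivity]
    refine Finset.sum_congr rfl fun R hR => ?_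
    rw [← ENNReal.ofReal_toReal (Cube.volume_ne_top R.quintuple)]
    congr 1
    exact volume_real_quintuple_of_mem_grid hR
  simp_rw [h5]
  rw [← ENNReal.ofReal_sum_of_nonneg fun m _ => by positivity, ← Finset.mul_sum]
  refine ENNReal.ofReal_le_ofReal ?_
  change 5 ^ d * stopVol k₀ N V ≤ _
  have h25 : (25 : ℝ) ^ d = 5 ^ d * 5 ^ d := by rw [← mul_pow]; norm_num
  have : stopVol k₀ N V ≤ 5 ^ d / c * ∫ x, φ x := by
    rw [div_mul_eq_mul_div, le_div_iff₀ hc]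
    have h6 : c / 5 ^ d * stopVol k₀ N V * 5 ^ d ≤ (∫ x, φ x) * 5 ^ d := by gcongr
    have h7 : c / 5 ^ d * stopVol k₀ N V * 5 ^ d = stopVol k₀ N V * c := by field_simp
    linarith
  calc 5 ^ d * stopVol k₀ N V ≤ 5 ^ d * (5 ^ d / c * ∫ x, φ x) := by gcongr
    _ = _ := by rw [h25]; ring

/-- The thresholds `c i` are so high that each of the maximal functions exceeds its own on at most
`1 / (2 * card ι)` of the volume of the top cell. The stopping sets collect the points where some
average is too large, on the largest such level. -/
theorem exists_stoppingSets {ι : Type*} [Fintype ι] {k₀ N : ℤ} (hle : k₀ ≤ N)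
    {φ : ι → EuclideanSpace ℝ (Fin d) → ℝ} (hφ : ∀ i, IsStep D k₀ (φ i)) (h0 : ∀ i x, 0 ≤ φ i x)
    {c : ι → ℝ} (hc0 : ∀ i, 0 ≤ c i)
    (hc : ∀ i, Fintype.card ι * (2 * 25 ^ d) * ∫ x, φ i x ≤ c i * cellVol d N) :
    ∃ U, StoppingSets D k₀ N U ∧ 2 * stopVol k₀ N U ≤ cellVol d N ∧
      ∀ i j, k₀ ≤ j → j ≤ N → ∀ x, (∀ k, j ≤ k → x ∉ U k) →
        ∫ y in bigCell D j x, φ i y ≤ c i * cellVol d j := by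
  have hv := cellVol_pos d N
  have hint : ∀ i, 0 ≤ ∫ x, φ i x := fun i => integral_nonneg (h0 i)
  have hle' : ∀ i k x, ∫ y in bigCell D k x, φ i y ≤ ∫ y, φ i y := fun i k x =>
    setIntegral_le_integral (hφ i).integrable (ae_of_all _ (h0 i))
  have hcard : ∀ i : ι, (1 : ℝ) ≤ Fintype.card ι := fun i => by
    have := Fintype.card_pos_iff.2 ⟨i⟩
    exact_mod_cast this
  have h25 : (1 : ℝ) ≤ 25 ^ d := one_le_pow₀ (by norm_num)
  have htop : ∀ i, ∫ y, φ i y ≤ c i * cellVol d N := fun i => by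
    refine le_trans ?_ (hc i)
    have : (1 : ℝ) ≤ Fintype.card ι * (2 * 25 ^ d) := by nlinarith [hcard i]
    exact le_mul_of_one_le_left (hint i) this
  let bad : ℤ → EuclideanSpace ℝ (Fin d) → Prop := fun k x =>
    ∃ i, c i * cellVol d k < ∫ y in bigCell D k x, φ i y
  have hbadi : ∀ i, volume {x | ∃ k ∈ Finset.Ico k₀ N,
      c i * cellVol d k < ∫ y in bigCell D k x, φ i y} ≤
      ENNReal.ofReal (cellVol d N / (2 * Fintype.card ι)) := by
    intro i
    have hci := hcard i
    -- If the threshold is `0`, then `φ i` has integral `0` and its averages never exceed it.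
    rcases (hc0 i).eq_or_lt with h | h
    · have : {x | ∃ k ∈ Finset.Ico k₀ N,
          c i * cellVol d k < ∫ y in bigCell D k x, φ i y} = ∅ := by
        refine Set.eq_empty_of_forall_notMem ?_
        rintro x ⟨k, -, hk⟩
        have h1 := hle' i k x
        have h2 := htop i
        rw [← h, zero_mul] at h2 hk
        linarith
      rw [this, measure_empty]
      exact zero_le
    · refine (volume_maximal_le hle (hφ i) (h0 i) h).trans (ENNReal.ofReal_le_ofReal ?_)
      rw [div_mul_eq_mul_div, div_le_div_iff₀ h (by positivity)]
      have := hc i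
      linarith
  have hall : volume {x | ∃ k ∈ Finset.Ico k₀ N, bad k x} ≤ ENNReal.ofReal (cellVol d N / 2) := by
    have hsub : {x | ∃ k ∈ Finset.Ico k₀ N, bad k x} ⊆ ⋃ i ∈ (Finset.univ : Finset ι),
        {x | ∃ k ∈ Finset.Ico k₀ N, c i * cellVol d k < ∫ y in bigCell D k x, φ i y} := by
      rintro x ⟨k, hk, i, hi⟩
      exact Set.mem_iUnion₂.2 ⟨i, Finset.mem_univ i, k, hk, hi⟩
    refine (measure_mono hsub).trans ((measure_biUnion_finset_le _ _).trans
      ((Finset.sum_le_sum fun i _ => hbadi i).trans ?_))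
    rw [← ENNReal.ofReal_sum_of_nonneg fun i _ => by positivity, Finset.sum_const, nsmul_eq_mul,
      Finset.card_univ]
    refine ENNReal.ofReal_le_ofReal ?_
    rcases Nat.eq_zero_or_pos (Fintype.card ι) with h | h
    · rw [h, Nat.cast_zero, zero_mul]
      positivity
    · have : (0 : ℝ) < Fintype.card ι := by exact_mod_cast h
      refine le_of_eq ?_
      field_simp
  have hfin : volume {x | ∃ k ∈ Finset.Ico k₀ N, bad k x} ≠ ∞ :=
    ne_top_of_le_ne_top ENNReal.ofReal_ne_top hall
  have hS : StoppingSets D k₀ N (firstStop k₀ N bad) := by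
    refine stoppingSets_firstStop hle (fun k x y hy => by simp only [bad, bigCell_eq hy])
      fun k hk => ne_top_of_le_ne_top hfin (measure_mono fun x hx => ⟨k, hk, hx⟩)
  refine ⟨firstStop k₀ N bad, hS, ?_, ?_⟩
  · have h1 : stopVol k₀ N (firstStop k₀ N bad) =
        volume.real (⋃ k ∈ Finset.Ico k₀ N, firstStop k₀ N bad k) := by
      rw [stopVol, measureReal_biUnion_finset (fun k _ l _ hkl => hS.disjoint k l hkl)
        (fun k _ => hS.measurableSet k) fun k _ => hS.volume_ne_top k]
    have h2 : volume.real (⋃ k ∈ Finset.Ico k₀ N, firstStop k₀ N bad k) ≤ cellVol d N / 2 := by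
      refine ENNReal.toReal_le_of_le_ofReal (by positivity) ((measure_mono ?_).trans hall)
      refine Set.iUnion₂_subset fun k hk x hx => ⟨k, hk, hx.2.1⟩
    rw [h1]
    linarith
  · intro i j hj hjN x hx
    -- There is no stopping on level `N`; there the bound is the hypothesis on the total integral.
    rcases hjN.eq_or_lt with rfl | hlt
    · exact (hle' i j x).trans (htop i)
    · by_contra! hcon
      obtain ⟨m, hm, hxm⟩ := exists_mem_firstStop (k₀ := k₀) (N := N) (bad := bad) hj hlt ⟨i, hcon⟩
      exact hx m hm hxm

end FirstStop

/-! ### Almost Auerbach bases for convex bodies -/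

section Auerbach

variable {n : ℕ}

/-- A set spans a coordinate subspace with respect to some basis consisting of elements of the set
and vectors of a complement. -/
theorem exists_basis_adapted (K : Set (Fin n → ℝ)) :
    ∃ (G : Set (Fin n)) (w : Module.Basis (Fin n) ℝ (Fin n → ℝ)), (∀ a ∈ G, w a ∈ K) ∧
      K ⊆ Submodule.span ℝ (w '' G) := by
  obtain ⟨b, hbK, -, hKb, hb⟩ := exists_linearIndepOn_id_extension (K := ℝ)
    (linearIndepOn_empty ℝ (id : (Fin n → ℝ) → _)) (Set.empty_subset K)
  obtain ⟨c, -, hbc, hc, hci⟩ := exists_linearIndepOn_id_extension hb (Set.subset_univ b)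
  let e := Module.Basis.mk (v := fun x : c => (x : Fin n → ℝ)) hci (by
    rw [Subtype.range_coe]
    exact fun x _ => hc (Set.mem_univ x))
  let φ := e.indexEquiv (Pi.basisFun ℝ (Fin n))
  have hw : ∀ a, (e.reindex φ) a = (φ.symm a : Fin n → ℝ) := fun a => by
    rw [Module.Basis.reindex_apply]
    exact Module.Basis.mk_apply _ _ _
  refine ⟨{a | (φ.symm a : Fin n → ℝ) ∈ b}, e.reindex φ, fun a ha => ?_, ?_⟩
  · rw [hw]
    exact hbK ha
  · refine hKb.trans (Submodule.span_mono fun x hx => ?_)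
    refine ⟨φ ⟨x, hbc hx⟩, ?_, ?_⟩
    · change (φ.symm (φ ⟨x, hbc hx⟩) : Fin n → ℝ) ∈ b
      rwa [Equiv.symm_apply_apply]
    · rw [hw, Equiv.symm_apply_apply]

/-- Cramer's rule: both sides are linear in `v` and agree on the basis `u`. -/
theorem det_update_eq_coord_mul (w u : Module.Basis (Fin n) ℝ (Fin n → ℝ)) (a : Fin n)
    (v : Fin n → ℝ) : w.det (Function.update u a v) = u.coord a v * w.det u := by
  have h : w.det.toMultilinearMap.toLinearMap u a = (w.det u) • u.coord a := by
    refine u.ext fun b => ?_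
    rw [MultilinearMap.toLinearMap_apply, LinearMap.smul_apply, Module.Basis.coord_apply,
      Module.Basis.repr_self, smul_eq_mul]
    by_cases hab : a = b
    · subst hab
      rw [Finsupp.single_eq_same, mul_one, Function.update_eq_self]
      rfl
    · rw [Finsupp.single_eq_of_ne hab, mul_zero]
      exact w.det.map_update_self u hab
  have h2 := congrArg (fun L => L v) h
  simp only [MultilinearMap.toLinearMap_apply, LinearMap.smul_apply, smul_eq_mul] at h2
  rw [mul_comm]
  exact h2

/-- Almost Auerbach bases for bounded sets, which may have empty interior. -/
theorem exists_almost_auerbach_basis {K : Set (Fin n → ℝ)} (hK : Bornology.IsBounded K) :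
    ∃ u : Module.Basis (Fin n) ℝ (Fin n → ℝ), ∀ a,
      (u a ∈ K ∧ ∀ v ∈ K, |u.coord a v| ≤ 2) ∨ ∀ v ∈ K, u.coord a v = 0 := by
  classical
  obtain ⟨G, w, hG, hspan⟩ := exists_basis_adapted K
  -- The competitors in the maximization of the determinant: the entries in `G` vary in `K`, those
  -- in a complement of its span are fixed.
  let 𝓕 : Set (Fin n → Fin n → ℝ) := {u | ∀ a, (a ∈ G → u a ∈ K) ∧ (a ∉ G → u a = w a)}
  have hw : (w : Fin n → Fin n → ℝ) ∈ 𝓕 := fun a => ⟨hG a, fun _ => rfl⟩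
  obtain ⟨R, hR⟩ : ∃ R : ℝ, ∀ v ∈ K ∪ Set.range w, ‖v‖ ≤ R := by
    obtain ⟨R, hR⟩ := (hK.union (Set.finite_range w).isBounded).exists_norm_le
    exact ⟨R, hR⟩
  have hmem : ∀ u ∈ 𝓕, ∀ a, ‖u a‖ ≤ R := by
    intro u hu a
    by_cases ha : a ∈ G
    · exact hR _ (Or.inl ((hu a).1 ha))
    · rw [(hu a).2 ha]
      exact hR _ (Or.inr ⟨a, rfl⟩)
  let L : (Fin n → ℝ) →L[ℝ] (Fin n → ℝ) := w.equivFun.toLinearMap.toContinuousLinearMap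
  have hbdd : BddAbove ((fun u => |w.det u|) '' 𝓕) := by
    refine ⟨Nat.factorial (Fintype.card (Fin n)) • (‖L‖ * R) ^ Fintype.card (Fin n), ?_⟩
    rintro _ ⟨u, hu, rfl⟩
    simp only [Module.Basis.det_apply]
    refine Matrix.det_le (abv := AbsoluteValue.abs) fun i j => ?_
    change |w.toMatrix u i j| ≤ _
    rw [Module.Basis.toMatrix_apply]
    have h1 := norm_le_pi_norm (L (u j)) i
    have h2 := (L.le_opNorm (u j)).trans
      (mul_le_mul_of_nonneg_left (hmem u hu j) (norm_nonneg L))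
    exact h1.trans h2
  set S := sSup ((fun u => |w.det u|) '' 𝓕) with hS
  have hS1 : 1 ≤ S := by
    refine le_csSup hbdd ⟨w, hw, ?_⟩
    simp only [Module.Basis.det_self, abs_one]
  -- A maximizer up to the factor `2` is enough, so compactness of `K` is not needed; this is the
  -- origin of the bound `2` for the coordinates.
  obtain ⟨_, ⟨u, hu, rfl⟩, hlt⟩ := exists_lt_of_lt_csSup
    (Set.Nonempty.image (fun u => |w.det u|) ⟨w, hw⟩)
    (show S / 2 < sSup ((fun u => |w.det u|) '' 𝓕) by rw [← hS]; linarith)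
  simp only at hlt
  have hu0 : w.det u ≠ 0 := by
    intro h0
    rw [h0, abs_zero] at hlt
    linarith
  obtain ⟨hli, hsp⟩ := (Module.Basis.is_basis_iff_det w).2 (isUnit_iff_ne_zero.2 hu0)
  let B := Module.Basis.mk hli hsp.ge
  have hB : (B : Fin n → Fin n → ℝ) = u := Module.Basis.coe_mk hli hsp.ge
  have hmul : ∀ a ∈ G, ∀ v ∈ K, |B.coord a v| ≤ 2 := by
    intro a ha v hv
    have h1 := det_update_eq_coord_mul w B a v
    rw [hB] at h1
    -- Replacing an entry in `G` by another vector of `K` gives again a competitor.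
    have h2 : |w.det (Function.update u a v)| ≤ S := by
      refine le_csSup hbdd ⟨_, fun b => ?_, rfl⟩
      by_cases hab : b = a
      · subst hab
        rw [Function.update_self]
        exact ⟨fun _ => hv, fun h => absurd ha h⟩
      · rw [Function.update_of_ne hab]
        exact hu b
    rw [h1, abs_mul] at h2
    have h3 : 0 < |w.det u| := abs_pos.2 hu0
    have h4 : |B.coord a v| * |w.det u| ≤ 2 * |w.det u| := by linarith
    exact le_of_mul_le_mul_right h4 h3
  refine ⟨B, fun a => ?_⟩
  by_cases ha : a ∈ G
  · exact Or.inl ⟨by rw [hB]; exact (hu a).1 ha, hmul a ha⟩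
  · refine Or.inr fun v hv => ?_
    -- By dimension count the entries in `G` span the same space as `K`, so the other coordinates
    -- vanish on `K`.
    have hcard : Submodule.span ℝ (w '' G) = Submodule.span ℝ (u '' G) := by
      symm
      refine Submodule.eq_of_le_of_finrank_le ?_ ?_
      · rw [Submodule.span_le]
        rintro _ ⟨b, hb, rfl⟩
        exact hspan ((hu b).1 hb)
      · rw [Set.image_eq_range, Set.image_eq_range]
        have e1 := finrank_span_eq_card (hli.comp (Subtype.val : G → Fin n) Subtype.val_injective)
        have e2 := finrank_span_eq_card
          (w.linearIndependent.comp (Subtype.val : G → Fin n) Subtype.val_injective)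
        exact (e2.trans e1.symm).le
    have h1 : v ∈ Submodule.span ℝ (u '' G) := hcard ▸ hspan hv
    refine Submodule.span_induction (p := fun x _ => B.coord a x = 0) ?_ (map_zero _)
      (fun x y _ _ hx hy => by rw [map_add, hx, hy, add_zero])
      (fun c x _ hx => by rw [map_smul, hx, smul_zero]) h1
    rintro _ ⟨b, hb, rfl⟩
    have hab : b ≠ a := fun h => ha (h ▸ hb)
    rw [← hB, Module.Basis.coord_apply, Module.Basis.repr_self, Finsupp.single_eq_of_ne hab.symm]

/-! ### Pairings of convex bodies and products of norms. -/

section Body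

variable {X Y : Type*} [NormedAddCommGroup X] [NormedSpace ℝ X] [NormedAddCommGroup Y]
  [NormedSpace ℝ Y]

theorem isBounded_convexBody (x : Fin n → X) : Bornology.IsBounded (convexBody x) := by
  refine isBounded_iff_forall_norm_le.2 ⟨‖fun i => ‖x i‖‖, ?_⟩
  rintro _ ⟨φ, hφ, rfl⟩
  refine (pi_norm_le_iff_of_nonneg (norm_nonneg _)).2 fun i => ?_
  refine (φ.le_opNorm _).trans ((mul_le_of_le_one_left (norm_nonneg _) hφ).trans ?_)
  have := norm_le_pi_norm (fun i => ‖x i‖) i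
  rwa [norm_norm] at this

theorem bddAbove_minkowskiDot (x : Fin n → X) (y : Fin n → Y) :
    BddAbove (minkowskiDot (convexBody x) (convexBody y)) := by
  refine ⟨∑ i, ‖x i‖ * ‖y i‖, ?_⟩
  rintro _ ⟨_, ⟨φ, hφ, rfl⟩, _, ⟨ψ, hψ, rfl⟩, rfl⟩
  refine Finset.sum_le_sum fun i _ => (le_abs_self _).trans ?_
  rw [abs_mul]
  exact mul_le_mul ((φ.le_opNorm _).trans (mul_le_of_le_one_left (norm_nonneg _) hφ))
    ((ψ.le_opNorm _).trans (mul_le_of_le_one_left (norm_nonneg _) hψ)) (abs_nonneg _)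
    (norm_nonneg _)

theorem bodyDot_nonneg (x : Fin n → X) (y : Fin n → Y) :
    0 ≤ bodyDot (convexBody x) (convexBody y) := by
  refine le_csSup (bddAbove_minkowskiDot x y) ⟨0, ⟨0, by simp, ?_⟩, 0, ⟨0, by simp, ?_⟩, by simp⟩
  · ext i; simp
  · ext i; simp

/-- A change of variables with which the pairing of convex bodies controls products of norms. -/
theorem exists_change_of_variables (x : Fin n → X) (y : Fin n → Y) :
    ∃ E F : Fin n → Fin n → ℝ, (∀ i j, ∑ a, E a i * F a j = if i = j then 1 else 0) ∧
      ∀ a, ‖∑ i, E a i • x i‖ * ‖∑ i, F a i • y i‖ ≤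
        2 * bodyDot (convexBody x) (convexBody y) := by
  obtain ⟨u, hu⟩ := exists_almost_auerbach_basis (isBounded_convexBody x)
  -- The matrices of the dual basis and of the basis itself.
  refine ⟨fun a i => u.coord a (Pi.single i 1), fun a => u a, fun i j => ?_, fun a => ?_⟩
  · have h1 := congrFun (u.sum_repr (Pi.single i (1 : ℝ))) j
    rw [Finset.sum_apply] at h1
    simp only [Pi.smul_apply, smul_eq_mul] at h1
    simp only [Module.Basis.coord_apply]
    rw [h1, Pi.single_apply]
    simp [eq_comm]
  · obtain ⟨φ, hφ, hφx⟩ := exists_dual_vector'' ℝ (∑ i, u.coord a (Pi.single i 1) • x i)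
    obtain ⟨ψ, hψ, hψy⟩ := exists_dual_vector'' ℝ (∑ i, u a i • y i)
    -- A norming functional `φ` turns the norm of the new component into a coordinate of the point
    -- `(φ (x i))ᵢ` of the convex body.
    have h1 : ‖∑ i, u.coord a (Pi.single i 1) • x i‖ = u.coord a fun i => φ (x i) := by
      have h2 : (fun i => φ (x i)) = ∑ i, φ (x i) • Pi.single (M := fun _ => ℝ) i (1 : ℝ) := by
        ext j
        simp [Finset.sum_apply, Pi.single_apply]
      rw [h2, map_sum]
      have h3 : φ (∑ i, u.coord a (Pi.single i 1) • x i) =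
          ‖∑ i, u.coord a (Pi.single i 1) • x i‖ := hφx
      rw [← h3, map_sum]
      refine Finset.sum_congr rfl fun i _ => ?_
      rw [map_smul, map_smul, smul_eq_mul, smul_eq_mul, mul_comm]
    have hb := bodyDot_nonneg x y
    rcases hu a with ⟨hua, hle⟩ | h0
    · have h3 : ‖∑ i, u.coord a (Pi.single i 1) • x i‖ ≤ 2 := by
        rw [h1]
        exact (le_abs_self _).trans (hle _ ⟨φ, hφ, rfl⟩)
      -- The norm of the dual component is the dot product of `u a`, a point of the first body, with
      -- a point of the second.
      have h4 : ‖∑ i, u a i • y i‖ ≤ bodyDot (convexBody x) (convexBody y) := by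
        refine le_csSup (bddAbove_minkowskiDot x y) ⟨u a, hua, _, ⟨ψ, hψ, rfl⟩, ?_⟩
        have h5 : ψ (∑ i, u a i • y i) = ‖∑ i, u a i • y i‖ := hψy
        rw [← h5, map_sum]
        exact Finset.sum_congr rfl fun i _ => by rw [map_smul, smul_eq_mul]
      exact mul_le_mul h3 h4 (norm_nonneg _) (by norm_num)
    · rw [h1, h0 _ ⟨φ, hφ, rfl⟩, zero_mul]
      positivity

end Body

end Auerbach

/-! ### Convex bodies in normalized spaces on a cube. -/

section AverageBody

variable {d : ℕ} {D : Set (Cube d)} {E F : Type*} [NormedAddCommGroup E] [NormedSpace ℝ E]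
  [NormedAddCommGroup F] [NormedSpace ℝ F]

theorem norm_toLp_cond {p : ℝ} (hp : 1 ≤ p) (Q : Cube d) (f : simpleSpace D E) :
    ‖(simpleSpace_memLp f (ENNReal.ofReal p)
      (ProbabilityTheory.cond volume Q.toSet)).toLp (f : EuclideanSpace ℝ (Fin d) → E)‖ =
      ((volume.real Q.toSet)⁻¹ * ∫ x in Q.toSet, ‖(f : EuclideanSpace ℝ (Fin d) → E) x‖ ^ p) ^
        (1 / p) := by
  have hp0 : 0 < p := by linarith
  rw [Lp.norm_toLp, (simpleSpace_memLp f _ _).eLpNorm_eq_integral_rpow_norm (by simpa using hp0)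
    ENNReal.ofReal_ne_top, ENNReal.toReal_ofReal hp0.le, one_div, ProbabilityTheory.cond,
    integral_smul_measure, ENNReal.toReal_inv, smul_eq_mul]
  refine ENNReal.toReal_ofReal (Real.rpow_nonneg (mul_nonneg (inv_nonneg.2 ENNReal.toReal_nonneg)
    (integral_nonneg fun x => Real.rpow_nonneg (norm_nonneg _) _)) _)

theorem toLp_sum_smul {n : ℕ} (s : ℝ≥0∞) [Fact (1 ≤ s)] (Q : Cube d) (c : Fin n → ℝ)
    (h : Fin n → simpleSpace D E) :
    (simpleSpace_memLp (∑ i, c i • h i) s (ProbabilityTheory.cond volume Q.toSet)).toLp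
      ((∑ i, c i • h i : simpleSpace D E) : EuclideanSpace ℝ (Fin d) → E) =
    ∑ i, c i • (simpleSpace_memLp (h i) s (ProbabilityTheory.cond volume Q.toSet)).toLp
      (h i : EuclideanSpace ℝ (Fin d) → E) := by
  let T : simpleSpace D E →ₗ[ℝ] Lp E s (ProbabilityTheory.cond volume Q.toSet) :=
    { toFun := fun f => (simpleSpace_memLp f s _).toLp (f : EuclideanSpace ℝ (Fin d) → E)
      map_add' := fun f g => rfl
      map_smul' := fun c f => rfl }
  change T (∑ i, c i • h i) = ∑ i, c i • T (h i)
  rw [map_sum]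
  simp_rw [map_smul]

theorem bodyDot_avgConvexBody_nonneg {n : ℕ} {p r : ℝ} (hp : 1 < p) (hr : 1 < r) (Q : Cube d)
    (f : Fin n → simpleSpace D E) (g : Fin n → simpleSpace D F) :
    0 ≤ bodyDot (avgConvexBody hp Q f) (avgConvexBody hr Q g) := by
  have : Fact (1 ≤ ENNReal.ofReal p) := ⟨ENNReal.one_le_ofReal.2 hp.le⟩
  have : Fact (1 ≤ ENNReal.ofReal r) := ⟨ENNReal.one_le_ofReal.2 hr.le⟩
  exact bodyDot_nonneg _ _

theorem exists_change_of_variables_avgConvexBody {n : ℕ} {p r : ℝ} (hp : 1 < p) (hr : 1 < r)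
    (Q : Cube d) (f : Fin n → simpleSpace D E) (g : Fin n → simpleSpace D F) :
    ∃ A B : Fin n → Fin n → ℝ, (∀ i j, ∑ a, A a i * B a j = if i = j then 1 else 0) ∧
      ∀ a, ((volume.real Q.toSet)⁻¹ * ∫ x in Q.toSet,
          ‖((∑ i, A a i • f i : simpleSpace D E) : EuclideanSpace ℝ (Fin d) → E) x‖ ^ p) ^
          (1 / p) *
        ((volume.real Q.toSet)⁻¹ * ∫ x in Q.toSet,
          ‖((∑ i, B a i • g i : simpleSpace D F) : EuclideanSpace ℝ (Fin d) → F) x‖ ^ r) ^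
          (1 / r) ≤
        2 * bodyDot (avgConvexBody hp Q f) (avgConvexBody hr Q g) := by
  have : Fact (1 ≤ ENNReal.ofReal p) := ⟨ENNReal.one_le_ofReal.2 hp.le⟩
  have : Fact (1 ≤ ENNReal.ofReal r) := ⟨ENNReal.one_le_ofReal.2 hr.le⟩
  obtain ⟨A, B, hAB, hle⟩ := exists_change_of_variables
    (fun i => (simpleSpace_memLp (f i) (ENNReal.ofReal p)
      (ProbabilityTheory.cond volume Q.toSet)).toLp (f i : EuclideanSpace ℝ (Fin d) → E))
    (fun i => (simpleSpace_memLp (g i) (ENNReal.ofReal r)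
      (ProbabilityTheory.cond volume Q.toSet)).toLp (g i : EuclideanSpace ℝ (Fin d) → F))
  refine ⟨A, B, hAB, fun a => ?_⟩
  rw [← norm_toLp_cond hp.le, ← norm_toLp_cond hr.le]
  refine le_of_eq_of_le ?_ (hle a)
  rw [toLp_sum_smul, toLp_sum_smul]

end AverageBody

/-! ### One step of the recursion -/

section Step

/-- The coefficient of `L (f i) (g j)` on the left is `∑ a, A a i * B a j`. -/
theorem sum_change_of_variables {n : ℕ} {M₁ M₂ : Type*} [AddCommGroup M₁] [Module ℝ M₁]
    [AddCommGroup M₂] [Module ℝ M₂] (L : M₁ →ₗ[ℝ] M₂ →ₗ[ℝ] ℝ) {A B : Fin n → Fin n → ℝ}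
    (hAB : ∀ i j, ∑ a, A a i * B a j = if i = j then 1 else 0) (f : Fin n → M₁) (g : Fin n → M₂) :
    ∑ a, L (∑ i, A a i • f i) (∑ i, B a i • g i) = ∑ i, L (f i) (g i) := by
  have h1 : ∀ a, L (∑ i, A a i • f i) (∑ i, B a i • g i) =
      ∑ i, ∑ j, A a i * B a j * L (f i) (g j) := by
    intro a
    rw [map_sum L, LinearMap.sum_apply]
    refine Finset.sum_congr rfl fun i _ => ?_
    rw [map_sum]
    refine Finset.sum_congr rfl fun j _ => ?_
    rw [map_smul, map_smul, LinearMap.smul_apply, smul_eq_mul, smul_eq_mul]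
    ring
  simp_rw [h1]
  rw [Finset.sum_comm]
  refine Finset.sum_congr rfl fun i _ => ?_
  rw [Finset.sum_comm]
  simp_rw [← Finset.sum_mul, hAB]
  simp

variable {d : ℕ} {D : Set (Cube d)}

/-- The level of a cube of side length `2 ^ k` is `k`. -/
noncomputable def Cube.level (Q : Cube d) : ℤ := Int.log 2 Q.side

theorem Cube.level_eq {Q : Cube d} {k : ℤ} (h : Q.side = 2 ^ k) : Q.level = k := by
  rw [Cube.level, h]
  exact_mod_cast Int.log_zpow (R := ℝ) (b := 2) one_lt_two k

variable [NeZero d] [hD : Fact (IsDyadicLattice D)]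
  {E₁ E₂ : Type*} [NormedAddCommGroup E₁] [NormedSpace ℝ E₁] [NormedAddCommGroup E₂]
  [NormedSpace ℝ E₂]
  {Λ : ℤ → simpleSpace D E₁ →ₗ[ℝ] simpleSpace D E₂ →ₗ[ℝ] ℝ} {p r κ a₁ a₂ a₀ b : ℝ}

theorem simpleSpace_isStep {E : Type*} [NormedAddCommGroup E] [NormedSpace ℝ E]
    (f : simpleSpace D E) {k : ℤ} (hf : ∀ x, ∀ y ∈ cell D k x, f y = f x) : IsStep D k f := by
  obtain ⟨l, hl⟩ := exists_isStep f.2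
  exact ⟨hf, (hl l le_rfl).2⟩

theorem isStep_sum_smul {E : Type*} [NormedAddCommGroup E] [NormedSpace ℝ E] {n : ℕ} {k : ℤ}
    (c : Fin n → ℝ) {f : Fin n → simpleSpace D E} (hf : ∀ i, IsStep D k (f i)) :
    IsStep D k (∑ i, c i • f i : simpleSpace D E) := by
  refine simpleSpace_isStep _ fun x y hy => ?_
  rw [AddSubmonoidClass.coe_finsetSum, Finset.sum_apply, Finset.sum_apply]
  refine Finset.sum_congr rfl fun i _ => ?_
  rw [Submodule.coe_smul, Pi.smul_apply, Pi.smul_apply, (hf i).1 x y hy]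

/-- The sum over `i` of the forms at scales `2 ^ N₁, …` up to the scale of `Q`, applied to the part
of `f i` on `Q` and to `g i`. -/
noncomputable def cubeForm (Λ : ℤ → simpleSpace D E₁ →ₗ[ℝ] simpleSpace D E₂ →ₗ[ℝ] ℝ) (N₁ : ℤ)
    {n : ℕ} (f : Fin n → simpleSpace D E₁) (g : Fin n → simpleSpace D E₂) (Q : Cube d) : ℝ :=
  ∑ i, ∑ j ∈ Finset.Icc N₁ Q.level, Λ j (cut D E₁ Q.toSet (f i)) (g i)

/-- The children of a cube determined by stopping sets. -/
noncomputable def children (D : Set (Cube d)) (k₀ N : ℤ) (U : ℤ → Set (EuclideanSpace ℝ (Fin d)))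
    (Q : Cube d) : Finset (Cube d) := by
  classical
  exact (Finset.Ico k₀ N).biUnion fun k => grid D k (U k ∩ Q.toSet)

theorem mem_children {k₀ N : ℤ} {U : ℤ → Set (EuclideanSpace ℝ (Fin d))} {Q R : Cube d} :
    R ∈ children D k₀ N U Q ↔ ∃ k ∈ Finset.Ico k₀ N, R ∈ grid D k (U k ∩ Q.toSet) := by
  classical
  rw [children, Finset.mem_biUnion]

theorem sum_children {k₀ N : ℤ} (U : ℤ → Set (EuclideanSpace ℝ (Fin d))) (Q : Cube d)
    (φ : Cube d → ℝ) : ∑ R ∈ children D k₀ N U Q, φ R =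
      ∑ k ∈ Finset.Ico k₀ N, ∑ R ∈ grid D k (U k ∩ Q.toSet), φ R := by
  classical
  rw [children, Finset.sum_biUnion]
  intro k _ l _ hkl
  refine Finset.disjoint_left.2 fun R hR hR' => hkl ?_
  rw [← Cube.level_eq (of_mem_grid hR).2.1, Cube.level_eq (of_mem_grid hR').2.1]

theorem StoppingSets.children_spec {k₀ N : ℤ} {U : ℤ → Set (EuclideanSpace ℝ (Fin d))}
    (hU : StoppingSets D k₀ N U) {Q : Cube d} (hQ : Q ∈ D) (hN : Q.side = 2 ^ N) :
    (∀ R ∈ children D k₀ N U Q, R ∈ D ∧ R.toSet ⊆ Q.toSet ∧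
      ∃ k, k₀ ≤ k ∧ k < N ∧ R.side = 2 ^ k) ∧
    (children D k₀ N U Q : Set (Cube d)).PairwiseDisjoint Cube.toSet ∧
    ∑ R ∈ children D k₀ N U Q, volume.real R.toSet ≤ stopVol k₀ N U := by
  have hsat : ∀ k ∈ Finset.Ico k₀ N, Saturated D k (U k ∩ Q.toSet) := fun k hk =>
    (hU.saturated k).inter ((saturated_of_mem hQ hN).mono (Finset.mem_Ico.1 hk).2.le)
  have hfin : ∀ k, volume (U k ∩ Q.toSet) ≠ ∞ := fun k =>
    ne_top_of_le_ne_top (hU.volume_ne_top k) (measure_mono Set.inter_subset_left)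
  refine ⟨fun R hR => ?_, ?_, ?_⟩
  · obtain ⟨k, hk, hR⟩ := mem_children.1 hR
    obtain ⟨h1, h2, h3⟩ := of_mem_grid hR
    obtain ⟨h4, h5⟩ := Finset.mem_Ico.1 hk
    exact ⟨h1, h3.trans Set.inter_subset_right, k, h4, h5, h2⟩
  · intro R hR R' hR' hne
    obtain ⟨k, hk, hR⟩ := mem_children.1 hR
    obtain ⟨l, hl, hR'⟩ := mem_children.1 hR'
    by_cases hkl : k = l
    · subst hkl
      exact pairwiseDisjoint_grid k _ hR hR' hne
    · exact (hU.disjoint k l hkl).mono ((of_mem_grid hR).2.2.trans Set.inter_subset_left)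
        ((of_mem_grid hR').2.2.trans Set.inter_subset_left)
  · rw [sum_children, stopVol]
    refine Finset.sum_le_sum fun k hk => ?_
    rw [Finset.sum_congr rfl fun R hR => volume_real_of_mem_grid hR,
      sum_grid_volume (hfin k) (hsat k hk)]
    exact measureReal_mono Set.inter_subset_left (hU.volume_ne_top k)

/-- The form of a cube is the sum of the forms of its children and of a form for which the
estimate for one stopping step applies. -/
theorem cubeForm_sub_sum_children (N₁ : ℤ) {n : ℕ} (f : Fin n → simpleSpace D E₁)
    (g : Fin n → simpleSpace D E₂) {k₀ N : ℤ} {U : ℤ → Set (EuclideanSpace ℝ (Fin d))}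
    (hU : StoppingSets D k₀ N U) {Q : Cube d} (hQ : Q ∈ D) (hN : Q.side = 2 ^ N) :
    cubeForm Λ N₁ f g Q - ∑ R ∈ children D k₀ N U Q, cubeForm Λ N₁ f g R =
      ∑ i, ∑ j ∈ Finset.Icc N₁ N,
        Λ j (aboveScale D E₁ k₀ N U j (cut D E₁ Q.toSet (f i))) (g i) := by
  have hsat : ∀ k ∈ Finset.Ico k₀ N, Saturated D k (U k ∩ Q.toSet) := fun k hk =>
    (hU.saturated k).inter ((saturated_of_mem hQ hN).mono (Finset.mem_Ico.1 hk).2.le)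
  have hfin : ∀ k, volume (U k ∩ Q.toSet) ≠ ∞ := fun k =>
    ne_top_of_le_ne_top (hU.volume_ne_top k) (measure_mono Set.inter_subset_left)
  -- A child of level `k` only carries scales `j ≤ k`. In exchanged order, scale `j` sees exactly
  -- the stopping sets of level at least `j`, which are those removed by `aboveScale`.
  have h1 : ∑ R ∈ children D k₀ N U Q, cubeForm Λ N₁ f g R =
      ∑ i, ∑ j ∈ Finset.Icc N₁ N, ∑ k ∈ (Finset.Ico k₀ N).filter (j ≤ ·),
        Λ j (cut D E₁ (U k) (cut D E₁ Q.toSet (f i))) (g i) := by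
    simp_rw [sum_scale_level_comm]
    rw [sum_children, Finset.sum_comm (s := Finset.univ)]
    refine Finset.sum_congr rfl fun k hk => ?_
    unfold cubeForm
    rw [Finset.sum_comm]
    refine Finset.sum_congr rfl fun i _ => ?_
    have h2 : ∀ R ∈ grid D k (U k ∩ Q.toSet),
        ∑ j ∈ Finset.Icc N₁ R.level, Λ j (cut D E₁ R.toSet (f i)) (g i) =
        ∑ j ∈ Finset.Icc N₁ k, Λ j (cut D E₁ R.toSet (f i)) (g i) := fun R hR => by
      rw [Cube.level_eq (of_mem_grid hR).2.1]
    rw [Finset.sum_congr rfl h2, Finset.sum_comm]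
    refine Finset.sum_congr rfl fun j _ => ?_
    have h3 : cut D E₁ (U k) (cut D E₁ Q.toSet (f i)) =
        ∑ R ∈ grid D k (U k ∩ Q.toSet), cut D E₁ R.toSet (f i) := by
      rw [sum_cut_grid (hsat k hk) (hfin k)]
      refine Subtype.ext ?_
      rw [coe_cut (hU.saturated k), coe_cut (saturated_of_mem hQ hN), coe_cut (hsat k hk),
        Set.indicator_indicator]
    rw [h3, map_sum, LinearMap.sum_apply]
  rw [h1, cubeForm, Cube.level_eq hN, ← Finset.sum_sub_distrib]
  refine Finset.sum_congr rfl fun i _ => ?_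
  rw [← Finset.sum_sub_distrib]
  refine Finset.sum_congr rfl fun j _ => ?_
  rw [aboveScale, LinearMap.sub_apply, LinearMap.sum_apply, LinearMap.id_apply, map_sub,
    LinearMap.sub_apply, map_sum, LinearMap.sum_apply]

/-- Only the part of `g` close to the cube matters. -/
theorem FormBounds.apply_cut_quintuple (h : FormBounds Λ p r κ a₁ a₂ a₀ b) {j N : ℤ} (hj : j ≤ N)
    {Q : Cube d} (hQ : Q ∈ D) (hN : Q.side = 2 ^ N) {u : simpleSpace D E₁}
    (hu : ∀ x, x ∉ Q.toSet → u x = 0) (v : simpleSpace D E₂) :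
    Λ j u (cut D E₂ Q.quintuple.toSet v) = Λ j u v := by
  have h5 : Saturated D N Q.quintuple.toSet := by
    rw [← bigCell_corner hQ hN]
    exact saturated_bigCell N _
  symm
  rw [← sub_eq_zero, ← map_sub]
  refine h.local_zero j N hj Q.corner _ _ (fun y hy => ?_) (fun y hy => ?_)
  · rw [cell_corner hQ hN] at hy
    exact hu y hy
  · rw [bigCell_corner hQ hN] at hy
    rw [Submodule.coe_sub, Pi.sub_apply, coe_cut h5, Set.indicator_of_mem hy, sub_self]

theorem aboveScale_eq_zero_of_notMem {k₀ N : ℤ} {U : ℤ → Set (EuclideanSpace ℝ (Fin d))}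
    (hU : StoppingSets D k₀ N U) (j : ℤ) {u : simpleSpace D E₁} {x : EuclideanSpace ℝ (Fin d)}
    (hx : u x = 0) : aboveScale D E₁ k₀ N U j u x = 0 := by
  have h1 : aboveScale D E₁ k₀ N U j u =
      u - ∑ k ∈ (Finset.Ico k₀ N).filter (j ≤ ·), cut D E₁ (U k) u := by
    rw [aboveScale, LinearMap.sub_apply, LinearMap.sum_apply, LinearMap.id_apply]
  rw [h1, Submodule.coe_sub, Pi.sub_apply, hx, AddSubmonoidClass.coe_finsetSum, Finset.sum_apply,
    Finset.sum_eq_zero, sub_zero]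
  intro k _
  rw [coe_cut (hU.saturated k)]
  by_cases hxk : x ∈ U k
  · rw [Set.indicator_of_mem hxk, hx]
  · rw [Set.indicator_of_notMem hxk]

/-- The constant in the estimate for one step of the recursion. -/
noncomputable def stepConst (d : ℕ) (p r κ : ℝ) : ℝ :=
  coreConst d p r κ * (4 * (4 * 400 ^ d) ^ (1 / p + 1 / r))

theorem stepConst_nonneg (d : ℕ) {p r κ : ℝ} (hp : 0 ≤ p) (hr : 0 ≤ r) (hκ : 0 < κ) :
    0 ≤ stepConst d p r κ := by
  have := coreConst_nonneg d hp hr hκ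
  unfold stepConst
  positivity

/-- The coordinates are changed by the basis adapted to `P`, and the scalar estimate is applied to
each new component with common stopping sets. The exponent of `n` is `1 / p + 1 / r` from the
thresholds plus `1` from the number of components. -/
theorem exists_children [CompleteSpace E₁] [CompleteSpace E₂]
    (h : FormBounds Λ p r κ a₁ a₂ a₀ b) (hp : 1 < p) (hr : 1 < r) (hpr : 1 ≤ 1 / p + 1 / r)
    (hκ : 0 < κ) (ha₁ : 0 ≤ a₁) (ha₂ : 0 ≤ a₂) (ha₀ : 0 ≤ a₀) (hb0 : 0 ≤ b)
    {ℓ : ℕ} (hℓ : d ≤ ℓ) (hb : b * 2 ^ (-κ * ℓ / 2) ≤ a₀) (N₁ : ℤ)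
    {n : ℕ} (f : Fin n → simpleSpace D E₁) (g : Fin n → simpleSpace D E₂) {k₀ N : ℤ}
    (hf : ∀ i, IsStep D k₀ (f i)) (hg : ∀ i, IsStep D k₀ (g i)) (hle : k₀ ≤ N)
    {Q P : Cube d} (hQ : Q ∈ D) (hN : Q.side = 2 ^ N) (hQP : Q.quintuple.toSet ⊆ P.toSet)
    (hP : volume.real P.toSet = 16 ^ d * volume.real Q.toSet) :
    ∃ 𝒢 : Finset (Cube d), (∀ R ∈ 𝒢, R ∈ D ∧ R.toSet ⊆ Q.toSet ∧
        ∃ k, k₀ ≤ k ∧ k < N ∧ R.side = 2 ^ k) ∧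
      (𝒢 : Set (Cube d)).PairwiseDisjoint Cube.toSet ∧
      2 * ∑ R ∈ 𝒢, volume.real R.toSet ≤ volume.real Q.toSet ∧
      |cubeForm Λ N₁ f g Q - ∑ R ∈ 𝒢, cubeForm Λ N₁ f g R| ≤
        stepConst d p r κ * (a₁ + a₂ + a₀ * (1 + ℓ)) * (n : ℝ) ^ (1 + 1 / p + 1 / r) *
          (volume.real P.toSet * bodyDot (avgConvexBody hp P f) (avgConvexBody hr P g)) := by
  have hp0 : 0 < p := by linarith
  have hr0 : 0 < r := by linarith
  have hC := coreConst_nonneg d hp0.le hr0.le hκ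
  have hv := cellVol_pos d N
  have hQv : volume.real Q.toSet = cellVol d N := by rw [Cube.volume_real, hN, cellVol]
  have hsat := saturated_of_mem hQ hN
  have hsat5 : Saturated D N Q.quintuple.toSet := by
    rw [← bigCell_corner hQ hN]
    exact saturated_bigCell N _
  -- The basis is adapted to `P`, because `g` has to be controlled on the dilate of `Q`.
  obtain ⟨A, B, hAB, hnorm⟩ := exists_change_of_variables_avgConvexBody hp hr P f g
  let F : Fin n → simpleSpace D E₁ := fun a => cut D E₁ Q.toSet (∑ i, A a i • f i)
  let G : Fin n → simpleSpace D E₂ := fun a => cut D E₂ Q.quintuple.toSet (∑ i, B a i • g i)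
  have hF : ∀ a, IsStep D k₀ (F a) := fun a => by
    simp only [F]
    rw [coe_cut hsat]
    exact (isStep_sum_smul (A a) hf).indicator (hsat.mono hle)
  have hG : ∀ a, IsStep D k₀ (G a) := fun a => by
    simp only [G]
    rw [coe_cut hsat5]
    exact (isStep_sum_smul (B a) hg).indicator (hsat5.mono hle)
  -- The product of the number `2 * n` of functions, the constant `2 * 25 ^ d` of the stopping
  -- construction, and the ratio `16 ^ d` of the volumes of `P` and `Q`.
  set M : ℝ := 4 * n * 400 ^ d with hM
  have hM0 : 0 ≤ M := by positivity
  set s : Fin n → ℝ := fun a => (volume.real P.toSet)⁻¹ * ∫ x in P.toSet,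
    ‖(∑ i, A a i • f i : simpleSpace D E₁) x‖ ^ p with hs
  set t : Fin n → ℝ := fun a => (volume.real P.toSet)⁻¹ * ∫ x in P.toSet,
    ‖(∑ i, B a i • g i : simpleSpace D E₂) x‖ ^ r with ht
  have hs0 : ∀ a, 0 ≤ s a := fun a =>
    mul_nonneg (inv_nonneg.2 measureReal_nonneg) (integral_norm_rpow_nonneg _ _ _)
  have ht0 : ∀ a, 0 ≤ t a := fun a =>
    mul_nonneg (inv_nonneg.2 measureReal_nonneg) (integral_norm_rpow_nonneg _ _ _)
  have hPv := P.volume_real_pos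
  have hFs : ∀ a, ∫ x, ‖F a x‖ ^ p ≤ 16 ^ d * cellVol d N * s a := by
    intro a
    have e1 : ∫ x, ‖F a x‖ ^ p = ∫ x in Q.toSet, ‖(∑ i, A a i • f i : simpleSpace D E₁) x‖ ^ p := by
      rw [← lpn_rpow hp0, lpn_cut hp0 hsat Q.measurableSet_toSet,
        ← Real.rpow_mul (integral_norm_rpow_nonneg _ _ _), one_div, inv_mul_cancel₀ hp0.ne',
        Real.rpow_one]
    rw [e1, ← hQv, ← hP, hs]
    simp only
    rw [mul_inv_cancel_left₀ hPv.ne']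
    exact setIntegral_mono_set (integrable_norm_rpow _ hp0).integrableOn
      (ae_of_all _ fun y => Real.rpow_nonneg (norm_nonneg _) _)
      (Q.subset_quintuple.trans hQP).eventuallyLE
  have hGt : ∀ a, ∫ x, ‖G a x‖ ^ r ≤ 16 ^ d * cellVol d N * t a := by
    intro a
    have e1 : ∫ x, ‖G a x‖ ^ r =
        ∫ x in Q.quintuple.toSet, ‖(∑ i, B a i • g i : simpleSpace D E₂) x‖ ^ r := by
      rw [← lpn_rpow hr0, lpn_cut hr0 hsat5 (Cube.measurableSet_toSet _),
        ← Real.rpow_mul (integral_norm_rpow_nonneg _ _ _), one_div, inv_mul_cancel₀ hr0.ne',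
        Real.rpow_one]
    rw [e1, ← hQv, ← hP, ht]
    simp only
    rw [mul_inv_cancel_left₀ hPv.ne']
    exact setIntegral_mono_set (integrable_norm_rpow _ hr0).integrableOn
      (ae_of_all _ fun y => Real.rpow_nonneg (norm_nonneg _) _) hQP.eventuallyLE
  have hcount : ∀ I w : ℝ, I ≤ 16 ^ d * cellVol d N * w →
      Fintype.card (Fin n ⊕ Fin n) * (2 * 25 ^ d) * I ≤ M * w * cellVol d N := by
    intro I w hI
    have h400 : (400 : ℝ) ^ d = 25 ^ d * 16 ^ d := by rw [← mul_pow]; norm_num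
    rw [Fintype.card_sum, Fintype.card_fin]
    push_cast
    calc ((n : ℝ) + n) * (2 * 25 ^ d) * I ≤ (n + n) * (2 * 25 ^ d) * (16 ^ d * cellVol d N * w) := by
          gcongr
      _ = _ := by rw [hM, h400]; ring
  obtain ⟨U, hU, hUv, hUc⟩ := exists_stoppingSets (D := D) (ι := Fin n ⊕ Fin n) hle
    (φ := Sum.elim (fun a x => ‖F a x‖ ^ p) (fun a x => ‖G a x‖ ^ r))
    (by
      rintro (a | a)
      · exact (hF a).comp (fun z => ‖z‖ ^ p) (by simp [hp0.ne'])
      · exact (hG a).comp (fun z => ‖z‖ ^ r) (by simp [hr0.ne']))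
    (by
      rintro (a | a) x
      · exact Real.rpow_nonneg (norm_nonneg _) _
      · exact Real.rpow_nonneg (norm_nonneg _) _)
    (c := Sum.elim (fun a => M * s a) (fun a => M * t a))
    (by
      rintro (a | a)
      · exact mul_nonneg hM0 (hs0 a)
      · exact mul_nonneg hM0 (ht0 a))
    (by
      rintro (a | a)
      · exact hcount _ _ (hFs a)
      · exact hcount _ _ (hGt a))
  obtain ⟨c1, c2, c3⟩ := hU.children_spec hQ hN
  refine ⟨children D k₀ N U Q, c1, c2, by rw [hQv]; linarith, ?_⟩
  rw [cubeForm_sub_sum_children N₁ f g hU hQ hN]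
  let L : simpleSpace D E₁ →ₗ[ℝ] simpleSpace D E₂ →ₗ[ℝ] ℝ := ∑ j ∈ Finset.Icc N₁ N,
    (Λ j) ∘ₗ (aboveScale D E₁ k₀ N U j) ∘ₗ (cut D E₁ Q.toSet)
  have hL : ∀ u v, L u v = ∑ j ∈ Finset.Icc N₁ N,
      Λ j (aboveScale D E₁ k₀ N U j (cut D E₁ Q.toSet u)) v := by
    intro u v
    simp only [L]
    rw [LinearMap.sum_apply, LinearMap.sum_apply]
    rfl
  have hsumL : ∑ i, ∑ j ∈ Finset.Icc N₁ N,
      Λ j (aboveScale D E₁ k₀ N U j (cut D E₁ Q.toSet (f i))) (g i) =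
      ∑ a, ∑ j ∈ Finset.Icc N₁ N, Λ j (aboveScale D E₁ k₀ N U j (F a)) (G a) := by
    have e1 := sum_change_of_variables L hAB f g
    simp_rw [hL] at e1
    rw [← e1]
    refine Finset.sum_congr rfl fun a _ => Finset.sum_congr rfl fun j hj => ?_
    refine (h.apply_cut_quintuple (Finset.mem_Icc.1 hj).2 hQ hN (fun x hx => ?_) _).symm
    refine aboveScale_eq_zero_of_notMem hU j ?_
    rw [coe_cut hsat, Set.indicator_of_notMem hx]
  rw [hsumL]
  have hrp : ∀ (q w : ℝ), 0 < q → 0 ≤ w → ((M * w) ^ (1 / q)) ^ q = M * w := by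
    intro q w hq hw
    rw [← Real.rpow_mul (mul_nonneg hM0 hw), one_div, inv_mul_cancel₀ hq.ne', Real.rpow_one]
  have hcore : ∀ a, CoreData Λ p r κ a₁ a₂ a₀ b k₀ N U Q.corner (F a) (G a)
      ((M * s a) ^ (1 / p)) ((M * t a) ^ (1 / r)) := by
    intro a
    have hGa : ∀ j, k₀ ≤ j → j ≤ N → ∀ x, (∀ k, j ≤ k → x ∉ U k) →
        ∫ y in bigCell D j x, ‖G a y‖ ^ r ≤ ((M * t a) ^ (1 / r)) ^ r * cellVol d j := by
      intro j hj hjN x hx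
      rw [hrp r _ hr0 (ht0 a)]
      exact hUc (Sum.inr a) j hj hjN x hx
    refine
      { forms := h, one_lt_p := hp, one_lt_r := hr, one_le_add := hpr, κ_pos := hκ,
        a₁_nonneg := ha₁, a₂_nonneg := ha₂, a₀_nonneg := ha₀, b_nonneg := hb0, sets := hU,
        left := ⟨Real.rpow_nonneg (mul_nonneg hM0 (hs0 a)) _, hF a, fun j hj hjN x hx => ?_⟩,
        right := ⟨Real.rpow_nonneg (mul_nonneg hM0 (ht0 a)) _, hG a, fun j hj hjN x hx => ?_⟩,
        bigAverage_le := hGa, support_left := fun x hx => ?_, support_right := fun x hx => ?_ }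
    · rw [hrp p _ hp0 (hs0 a)]
      exact (setIntegral_mono_set (integrable_norm_rpow _ hp0).integrableOn
        (ae_of_all _ fun y => Real.rpow_nonneg (norm_nonneg _) _)
        (cell_subset_bigCell j x).eventuallyLE).trans (hUc (Sum.inl a) j hj hjN x hx)
    · exact (setIntegral_mono_set (integrable_norm_rpow _ hr0).integrableOn
        (ae_of_all _ fun y => Real.rpow_nonneg (norm_nonneg _) _)
        (cell_subset_bigCell j x).eventuallyLE).trans (hGa j hj hjN x hx)
    · rw [cell_corner hQ hN] at hx
      simp only [F]
      rw [coe_cut hsat, Set.indicator_of_notMem hx]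
    · rw [bigCell_corner hQ hN] at hx
      simp only [G]
      rw [coe_cut hsat5, Set.indicator_of_notMem hx]
  set W := bodyDot (avgConvexBody hp P f) (avgConvexBody hr P g) with hW
  have hW0 : 0 ≤ W := bodyDot_avgConvexBody_nonneg hp hr P f g
  have hA0 : 0 ≤ a₁ + a₂ + a₀ * (1 + ℓ) := by positivity
  refine (Finset.abs_sum_le_sum_abs _ _).trans ?_
  have hterm : ∀ a ∈ Finset.univ, |∑ j ∈ Finset.Icc N₁ N,
      Λ j (aboveScale D E₁ k₀ N U j (F a)) (G a)| ≤
      coreConst d p r κ * (a₁ + a₂ + a₀ * (1 + ℓ)) * (M ^ (1 / p + 1 / r) * (2 * W)) *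
        (2 * volume.real P.toSet) := by
    intro a _
    refine ((hcore a).abs_sum_le hℓ hb N₁).trans ?_
    -- Here the product of the averages of the two components is replaced by the pairing of convex
    -- bodies.
    have hαβ : (M * s a) ^ (1 / p) * (M * t a) ^ (1 / r) ≤ M ^ (1 / p + 1 / r) * (2 * W) := by
      rw [Real.mul_rpow hM0 (hs0 a), Real.mul_rpow hM0 (ht0 a),
        Real.rpow_add_of_nonneg hM0 (by positivity) (by positivity)]
      have := hnorm a
      calc M ^ (1 / p) * s a ^ (1 / p) * (M ^ (1 / r) * t a ^ (1 / r)) =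
            M ^ (1 / p) * M ^ (1 / r) * (s a ^ (1 / p) * t a ^ (1 / r)) := by ring
        _ ≤ _ := mul_le_mul_of_nonneg_left this (by positivity)
    have hvol : cellVol d N + stopVol k₀ N U ≤ 2 * volume.real P.toSet := by
      rw [hP, hQv]
      have : (1 : ℝ) ≤ 16 ^ d := one_le_pow₀ (by norm_num)
      nlinarith
    have hst := stopVol_nonneg k₀ N U
    gcongr
  refine (Finset.sum_le_sum hterm).trans (le_of_eq ?_)
  rw [Finset.sum_const, Finset.card_univ, Fintype.card_fin, nsmul_eq_mul, stepConst, hM,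
    show (4 : ℝ) * n * 400 ^ d = (4 * 400 ^ d) * n by ring,
    Real.mul_rpow (by positivity) (by positivity), add_assoc 1,
    Real.rpow_add_of_nonneg (Nat.cast_nonneg n) zero_le_one (by positivity), Real.rpow_one]
  ring

end Step

/-! ### Domination by a family with the Carleson property -/

section Recursion

variable {d : ℕ} {D : Set (Cube d)} [NeZero d] [hD : Fact (IsDyadicLattice D)]
  {E₁ E₂ : Type*} [NormedAddCommGroup E₁] [NormedSpace ℝ E₁] [NormedAddCommGroup E₂]
  [NormedSpace ℝ E₂]
  {Λ : ℤ → simpleSpace D E₁ →ₗ[ℝ] simpleSpace D E₂ →ₗ[ℝ] ℝ} {p r κ a₁ a₂ a₀ b : ℝ}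

open Classical in
/-- If a functional of cubes can be estimated up to its values on children, then it is dominated
by a sum over a family of cubes with the Carleson property. -/
theorem exists_carleson_of_children {k₀ : ℤ} (T ω : Cube d → ℝ)
    (hstep : ∀ Q ∈ D, ∀ N, k₀ ≤ N → Q.side = 2 ^ N →
      ∃ 𝒢 : Finset (Cube d), (∀ R ∈ 𝒢, R ∈ D ∧ R.toSet ⊆ Q.toSet ∧
        ∃ k, k₀ ≤ k ∧ k < N ∧ R.side = 2 ^ k) ∧
      (𝒢 : Set (Cube d)).PairwiseDisjoint Cube.toSet ∧
      2 * ∑ R ∈ 𝒢, volume.real R.toSet ≤ volume.real Q.toSet ∧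
      |T Q - ∑ R ∈ 𝒢, T R| ≤ ω Q) (m : ℕ) :
    ∀ Q ∈ D, Q.side = 2 ^ (k₀ + m) → ∃ ℱ : Finset (Cube d),
      (∀ R ∈ ℱ, R ∈ D ∧ R.toSet ⊆ Q.toSet ∧ ∃ k, k ≤ k₀ + m ∧ R.side = 2 ^ k) ∧
      (∀ A : Set (EuclideanSpace ℝ (Fin d)), MeasurableSet A →
        ∑ R ∈ ℱ with R.toSet ⊆ A, volume.real R.toSet ≤ 2 * volume.real (A ∩ Q.toSet)) ∧
      |T Q| ≤ ∑ R ∈ ℱ, ω R := by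
  induction m using Nat.strong_induction_on with
  | _ m ih =>
  intro Q hQ hm
  obtain ⟨𝒢, h1, h2, h3, h4⟩ := hstep Q hQ (k₀ + m) (by omega) hm
  have hch : ∀ R : Cube d, ∃ ℱ : Finset (Cube d), R ∈ 𝒢 →
      (∀ S ∈ ℱ, S ∈ D ∧ S.toSet ⊆ R.toSet ∧ ∃ k, k ≤ k₀ + m ∧ S.side = 2 ^ k) ∧
      (∀ A : Set (EuclideanSpace ℝ (Fin d)), MeasurableSet A →
        ∑ S ∈ ℱ with S.toSet ⊆ A, volume.real S.toSet ≤ 2 * volume.real (A ∩ R.toSet)) ∧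
      |T R| ≤ ∑ S ∈ ℱ, ω S := by
    intro R
    by_cases hR : R ∈ 𝒢
    · obtain ⟨hRD, hRQ, k, hk1, hk2, hk3⟩ := h1 R hR
      obtain ⟨ℱ, hℱ⟩ := ih (k - k₀).toNat (by omega) R hRD (by
        rw [hk3]
        congr 1
        omega)
      refine ⟨ℱ, fun _ => ⟨fun S hS => ?_, hℱ.2⟩⟩
      obtain ⟨e1, e2, l, e3, e4⟩ := hℱ.1 S hS
      exact ⟨e1, e2, l, by omega, e4⟩
    · exact ⟨∅, fun h => absurd h hR⟩
  choose ℱ hℱ using hch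
  have hQv := Q.volume_real_pos
  have hdisj : (𝒢 : Set (Cube d)).PairwiseDisjoint ℱ := by
    intro R hR R' hR' hne
    refine Finset.disjoint_left.2 fun S hS hS' => ?_
    exact Set.disjoint_left.1 (h2 hR hR' hne) (((hℱ R hR).1 S hS).2.1 S.corner_mem)
      (((hℱ R' hR').1 S hS').2.1 S.corner_mem)
  -- A descendant equal to `Q` would be contained in a child, but the children fill at most half of
  -- `Q`.
  have hnot : Q ∉ 𝒢.biUnion ℱ := by
    intro hmem
    obtain ⟨R, hR, hQR⟩ := Finset.mem_biUnion.1 hmem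
    have e1 := measureReal_mono ((hℱ R hR).1 Q hQR).2.1 R.volume_ne_top
    have e2 := Finset.single_le_sum (f := fun R : Cube d => volume.real R.toSet)
      (fun _ _ => measureReal_nonneg) hR
    linarith
  have hsub : ⋃ R ∈ 𝒢, R.toSet ⊆ Q.toSet := Set.iUnion₂_subset fun R hR => (h1 R hR).2.1
  have hcar : ∀ A : Set (EuclideanSpace ℝ (Fin d)), MeasurableSet A →
      ∑ R ∈ 𝒢.biUnion ℱ with R.toSet ⊆ A, volume.real R.toSet ≤
        2 * ∑ R ∈ 𝒢, volume.real (A ∩ R.toSet) := by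
    intro A hA
    rw [Finset.filter_biUnion, Finset.sum_biUnion, Finset.mul_sum]
    · exact Finset.sum_le_sum fun R hR => (hℱ R hR).2.1 A hA
    · exact fun R hR R' hR' hne => Finset.disjoint_filter_filter (hdisj hR hR' hne)
  refine ⟨insert Q (𝒢.biUnion ℱ), fun R hR => ?_, fun A hA => ?_, ?_⟩
  · rcases Finset.mem_insert.1 hR with rfl | hR
    · exact ⟨hQ, le_rfl, _, le_rfl, hm⟩
    · obtain ⟨S, hS, hRS⟩ := Finset.mem_biUnion.1 hR
      obtain ⟨e1, e2, e3⟩ := (hℱ S hS).1 R hRS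
      exact ⟨e1, e2.trans (h1 S hS).2.1, e3⟩
  · rw [Finset.filter_insert]
    split_ifs with hQA
    -- If `A` contains `Q`, the sum is at most `|Q|` plus twice the volume of the children, hence at
    -- most `2 * |Q|`.
    · rw [Finset.sum_insert fun h => hnot (Finset.mem_of_mem_filter _ h),
        Set.inter_eq_right.2 hQA]
      have e1 := hcar A hA
      have e2 : ∑ R ∈ 𝒢, volume.real (A ∩ R.toSet) ≤ ∑ R ∈ 𝒢, volume.real R.toSet :=
        Finset.sum_le_sum fun R _ => measureReal_mono Set.inter_subset_right R.volume_ne_top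
      linarith
    · refine (hcar A hA).trans (mul_le_mul_of_nonneg_left ?_ zero_le_two)
      rw [← measureReal_biUnion_finset
        (fun R hR R' hR' hne => (h2 hR hR' hne).mono Set.inter_subset_right Set.inter_subset_right)
        (fun R _ => hA.inter R.measurableSet_toSet)
        (fun R _ => ne_top_of_le_ne_top R.volume_ne_top (measure_mono Set.inter_subset_right))]
      refine measureReal_mono ?_
        (ne_top_of_le_ne_top Q.volume_ne_top (measure_mono Set.inter_subset_right))
      exact Set.iUnion₂_subset fun R hR => Set.inter_subset_inter_right _ (h1 R hR).2.1
  · rw [Finset.sum_insert hnot, Finset.sum_biUnion hdisj]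
    have e1 : |∑ R ∈ 𝒢, T R| ≤ ∑ R ∈ 𝒢, ∑ S ∈ ℱ R, ω S :=
      (Finset.abs_sum_le_sum_abs _ _).trans (Finset.sum_le_sum fun R hR => (hℱ R hR).2.2)
    calc |T Q| = |(T Q - ∑ R ∈ 𝒢, T R) + ∑ R ∈ 𝒢, T R| := by rw [sub_add_cancel]
      _ ≤ |T Q - ∑ R ∈ 𝒢, T R| + |∑ R ∈ 𝒢, T R| := abs_add_le _ _
      _ ≤ _ := add_le_add h4 e1

open Classical in
-- The functions are split along the finitely many cubes of side `2 ^ N₂` that meet their supports,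
-- and the recursion is run on each of these cubes.
theorem exists_carleson_family [CompleteSpace E₁] [CompleteSpace E₂]
    (h : FormBounds Λ p r κ a₁ a₂ a₀ b) (hp : 1 < p) (hr : 1 < r) (hpr : 1 ≤ 1 / p + 1 / r)
    (hκ : 0 < κ) (ha₁ : 0 ≤ a₁) (ha₂ : 0 ≤ a₂) (ha₀ : 0 ≤ a₀) (hb0 : 0 ≤ b)
    {ℓ : ℕ} (hℓ : d ≤ ℓ) (hb : b * 2 ^ (-κ * ℓ / 2) ≤ a₀) (N₁ N₂ : ℤ)
    {n : ℕ} (f : Fin n → simpleSpace D E₁) (g : Fin n → simpleSpace D E₂) {P : Cube d → Cube d}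
    (hP : ∀ Q ∈ D, ∀ k, k ≤ N₂ → Q.side = 2 ^ k → Q.quintuple.toSet ⊆ (P Q).toSet ∧
      volume.real (P Q).toSet = 16 ^ d * volume.real Q.toSet) :
    ∃ ℱ : Finset (Cube d), (∀ R ∈ ℱ, R ∈ D ∧ ∃ k, k ≤ N₂ ∧ R.side = 2 ^ k) ∧
      (∀ A : Set (EuclideanSpace ℝ (Fin d)), MeasurableSet A → volume A ≠ ∞ →
        ∑ R ∈ ℱ with R.toSet ⊆ A, volume.real R.toSet ≤ 2 * volume.real A) ∧
      |∑ i, ∑ j ∈ Finset.Icc N₁ N₂, Λ j (f i) (g i)| ≤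
        stepConst d p r κ * (a₁ + a₂ + a₀ * (1 + ℓ)) * (n : ℝ) ^ (1 + 1 / p + 1 / r) *
          ∑ Q ∈ ℱ, (volume.real (P Q).toSet *
            bodyDot (avgConvexBody hp (P Q) f) (avgConvexBody hr (P Q) g)) := by
  obtain ⟨k₀, hk₀, hf, hg⟩ : ∃ k₀ ≤ N₂, (∀ i, IsStep D k₀ (f i)) ∧ ∀ i, IsStep D k₀ (g i) := by
    choose k hk using fun i => exists_isStep (f i).2
    choose l hl using fun i => exists_isStep (g i).2
    obtain ⟨m, hm⟩ := (Set.finite_range k).bddBelow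
    obtain ⟨m', hm'⟩ := (Set.finite_range l).bddBelow
    exact ⟨min N₂ (min m m'), min_le_left _ _,
      fun i => hk i _ ((min_le_right _ _).trans ((min_le_left _ _).trans (hm ⟨i, rfl⟩))),
      fun i => hl i _ ((min_le_right _ _).trans ((min_le_right _ _).trans (hm' ⟨i, rfl⟩)))⟩
  set C := stepConst d p r κ * (a₁ + a₂ + a₀ * (1 + ℓ)) * (n : ℝ) ^ (1 + 1 / p + 1 / r) with hC
  have hex := exists_carleson_of_children (D := D) (k₀ := k₀) (cubeForm Λ N₁ f g)
    -- On cubes of side larger than `2 ^ N₂` nothing is known about `P`. With this default the step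
    -- is trivial there, without children; such cubes do not occur in the families used below.
    (fun Q => if Q.level ≤ N₂ then C * (volume.real (P Q).toSet *
      bodyDot (avgConvexBody hp (P Q) f) (avgConvexBody hr (P Q) g)) else |cubeForm Λ N₁ f g Q|)
    (by
      intro Q hQ N hkN hN
      rw [Cube.level_eq hN]
      split_ifs with hle
      · obtain ⟨h1, h2⟩ := hP Q hQ N hle hN
        exact exists_children h hp hr hpr hκ ha₁ ha₂ ha₀ hb0 hℓ hb N₁ f g hf hg hkN hQ hN h1 h2
      · exact ⟨∅, by simp, by simp, by simp, by simp⟩) (N₂ - k₀).toNat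
  rw [show k₀ + ((N₂ - k₀).toNat : ℤ) = N₂ by omega] at hex
  choose ℱ hℱ using hex
  let s : Set (EuclideanSpace ℝ (Fin d)) :=
    ⋃ i, {x | (cell D N₂ x ∩ Function.support (f i)).Nonempty}
  have hs : Saturated D N₂ s := Saturated.iUnion fun i x hx y hy => by
    change (cell D N₂ y ∩ _).Nonempty
    rw [cell_eq hy]
    exact hx
  have hsv : volume s ≠ ∞ := ((measure_iUnion_fintype_le _ _).trans_lt (ENNReal.sum_lt_top.2
    fun i _ => (volume_hull_ne_top hk₀ (hf i).2 (hf i).saturated_support).lt_top)).ne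
  have hgrid : ∀ R ∈ grid D N₂ s, R ∈ D ∧ R.side = 2 ^ N₂ := fun R hR =>
    ⟨(of_mem_grid hR).1, (of_mem_grid hR).2.1⟩
  have htotal : ∑ i, ∑ j ∈ Finset.Icc N₁ N₂, Λ j (f i) (g i) =
      ∑ R ∈ grid D N₂ s, cubeForm Λ N₁ f g R := by
    unfold cubeForm
    rw [Finset.sum_comm (s := grid D N₂ s)]
    refine Finset.sum_congr rfl fun i _ => ?_
    have e1 : ∀ R ∈ grid D N₂ s,
        ∑ j ∈ Finset.Icc N₁ R.level, Λ j (cut D E₁ R.toSet (f i)) (g i) =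
        ∑ j ∈ Finset.Icc N₁ N₂, Λ j (cut D E₁ R.toSet (f i)) (g i) := fun R hR => by
      rw [Cube.level_eq (hgrid R hR).2]
    rw [Finset.sum_congr rfl e1, Finset.sum_comm]
    refine Finset.sum_congr rfl fun j _ => ?_
    have hsupp : ∀ x, x ∉ s → f i x = 0 := fun x hx => by
      by_contra h0
      exact hx (Set.mem_iUnion.2 ⟨i, x, mem_cell_self N₂ x, h0⟩)
    conv_lhs => rw [← cut_eq_self hs hsupp, ← sum_cut_grid hs hsv, map_sum, LinearMap.sum_apply]
  let ℱ' : Cube d → Finset (Cube d) := fun R =>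
    if hR : R ∈ grid D N₂ s then ℱ R (hgrid R hR).1 (hgrid R hR).2 else ∅
  have hℱ' : ∀ R ∈ grid D N₂ s,
      (∀ S ∈ ℱ' R, S ∈ D ∧ S.toSet ⊆ R.toSet ∧ ∃ k, k ≤ N₂ ∧ S.side = 2 ^ k) ∧
      (∀ A : Set (EuclideanSpace ℝ (Fin d)), MeasurableSet A →
        ∑ S ∈ ℱ' R with S.toSet ⊆ A, volume.real S.toSet ≤ 2 * volume.real (A ∩ R.toSet)) ∧
      |cubeForm Λ N₁ f g R| ≤ ∑ S ∈ ℱ' R, C * (volume.real (P S).toSet *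
        bodyDot (avgConvexBody hp (P S) f) (avgConvexBody hr (P S) g)) := by
    intro R hR
    have h1 := hℱ R (hgrid R hR).1 (hgrid R hR).2
    simp only [ℱ', dif_pos hR]
    refine ⟨h1.1, h1.2.1, h1.2.2.trans (le_of_eq (Finset.sum_congr rfl fun S hS => ?_))⟩
    obtain ⟨-, -, k, hk, hSk⟩ := h1.1 S hS
    rw [Cube.level_eq hSk, if_pos hk]
  have hdisj : (grid D N₂ s : Set (Cube d)).PairwiseDisjoint ℱ' := by
    intro R hR R' hR' hne
    refine Finset.disjoint_left.2 fun S hS hS' => ?_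
    exact Set.disjoint_left.1 (pairwiseDisjoint_grid N₂ s hR hR' hne)
      (((hℱ' R hR).1 S hS).2.1 S.corner_mem) (((hℱ' R' hR').1 S hS').2.1 S.corner_mem)
  refine ⟨(grid D N₂ s).biUnion ℱ', fun S hS => ?_, fun A hA hAv => ?_, ?_⟩
  · obtain ⟨R, hR, hSR⟩ := Finset.mem_biUnion.1 hS
    obtain ⟨e1, -, e3⟩ := (hℱ' R hR).1 S hSR
    exact ⟨e1, e3⟩
  · rw [Finset.filter_biUnion, Finset.sum_biUnion
      fun R hR R' hR' hne => Finset.disjoint_filter_filter (hdisj hR hR' hne)]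
    refine (Finset.sum_le_sum fun R hR => (hℱ' R hR).2.1 A hA).trans ?_
    rw [← Finset.mul_sum, ← measureReal_biUnion_finset
      (fun R hR R' hR' hne => (pairwiseDisjoint_grid N₂ s hR hR' hne).mono
        Set.inter_subset_right Set.inter_subset_right)
      (fun R _ => hA.inter R.measurableSet_toSet)
      (fun R _ => ne_top_of_le_ne_top R.volume_ne_top (measure_mono Set.inter_subset_right))]
    refine mul_le_mul_of_nonneg_left (measureReal_mono ?_ hAv) zero_le_two
    exact Set.iUnion₂_subset fun R _ => Set.inter_subset_left
  · rw [htotal, Finset.sum_biUnion hdisj, Finset.mul_sum]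
    refine (Finset.abs_sum_le_sum_abs _ _).trans (Finset.sum_le_sum fun R hR => ?_)
    rw [Finset.mul_sum]
    exact (hℱ' R hR).2.2

end Recursion

/-! ### Translates of dyadic lattices -/

section Translate

variable {d : ℕ}

/-- The translate of a cube. -/
def Cube.translate (v : EuclideanSpace ℝ (Fin d)) (Q : Cube d) : Cube d where
  corner := Q.corner + v
  side := Q.side
  side_pos := Q.side_pos

theorem Cube.mem_translate {v x : EuclideanSpace ℝ (Fin d)} {Q : Cube d} :
    x ∈ (Q.translate v).toSet ↔ x - v ∈ Q.toSet := by
  simp only [toSet, translate, Set.mem_ofPred_eq, PiLp.add_apply, PiLp.sub_apply]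
  refine forall_congr' fun i => ?_
  constructor <;> rintro ⟨h1, h2⟩ <;> constructor <;> linarith

theorem Cube.translate_translate_neg (v : EuclideanSpace ℝ (Fin d)) (Q : Cube d) :
    (Q.translate (-v)).translate v = Q :=
  Cube.ext_iff'.2 ⟨rfl, fun i => by simp [translate]⟩

theorem Cube.translate_mem_dyadicSubcubes {v : EuclideanSpace ℝ (Fin d)} {Q R : Cube d}
    (h : R ∈ Q.dyadicSubcubes) : R.translate v ∈ (Q.translate v).dyadicSubcubes := by
  obtain ⟨k, hk, hc⟩ := h
  refine ⟨k, hk, fun i => ?_⟩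
  obtain ⟨m, hm, hmc⟩ := hc i
  refine ⟨m, hm, ?_⟩
  simp only [translate, PiLp.add_apply, hmc]
  ring

theorem IsDyadicLattice.translate {D : Set (Cube d)} (hD : IsDyadicLattice D)
    (v : EuclideanSpace ℝ (Fin d)) : IsDyadicLattice (Cube.translate v '' D) where
  side_eq := by
    rintro _ ⟨Q, hQ, rfl⟩
    exact hD.side_eq Q hQ
  subcube_mem := by
    rintro _ ⟨Q, hQ, rfl⟩ R hR
    refine ⟨R.translate (-v), hD.subcube_mem Q hQ ?_, Cube.translate_translate_neg v R⟩
    have := Cube.translate_mem_dyadicSubcubes (v := -v) hR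
    have e : (Q.translate v).translate (-v) = Q := by
      have := Cube.translate_translate_neg (-v) Q
      rwa [neg_neg] at this
    rwa [e] at this
  common_ancestor := by
    rintro _ ⟨Q, hQ, rfl⟩ _ ⟨R, hR, rfl⟩
    obtain ⟨P, hP, h1, h2⟩ := hD.common_ancestor Q hQ R hR
    exact ⟨_, ⟨P, hP, rfl⟩, Cube.translate_mem_dyadicSubcubes h1,
      Cube.translate_mem_dyadicSubcubes h2⟩
  compact_subset := by
    intro K hK
    obtain ⟨Q, hQ, hKQ⟩ := hD.compact_subset _ (hK.image (continuous_id.sub (continuous_const (y := v))))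
    exact ⟨_, ⟨Q, hQ, rfl⟩, fun x hx => Cube.mem_translate.2 (hKQ ⟨x, hx, rfl⟩)⟩

/-- The cube of the lattice that contains the prescribed grid point is aligned with `S`, so this
point must be its corner. -/
theorem IsDyadicLattice.exists_grid_cube [NeZero d] {D : Set (Cube d)} (hD : IsDyadicLattice D)
    {S : Cube d} (hS : S ∈ D) {m : ℤ} (hm : S.side = 2 ^ m) (z : Fin d → ℤ) :
    ∃ R ∈ D, R.side = 2 ^ m ∧ ∀ i, R.corner i = S.corner i + z i * 2 ^ m := by
  obtain ⟨R, hR, hRm, hx⟩ := hD.exists_mem m (WithLp.toLp 2 fun i => S.corner i + z i * 2 ^ m)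
  refine ⟨R, hR, hRm, fun i => ?_⟩
  obtain ⟨-, -, hc⟩ := hD.aligned hS hR (by rw [hm, hRm])
  obtain ⟨w, hw⟩ := hc i
  have h1 := hx i
  simp only [hw, hRm, hm] at h1
  have hs : (0 : ℝ) < 2 ^ m := by positivity
  have a1 : (w : ℝ) < z i + 1 := by
    by_contra hcon; push Not at hcon; nlinarith [h1.1]
  have a2 : (z i : ℝ) < w + 1 := by
    by_contra hcon; push Not at hcon; nlinarith [h1.2]
  have b1 : w < z i + 1 := by exact_mod_cast a1
  have b2 : z i < w + 1 := by exact_mod_cast a2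
  rw [hw, hm, show w = z i by omega]

/-- The one third trick: one of two shifted grids of unit intervals has an interval that contains
a given interval of length `5 / 16`. -/
theorem exists_interval_of_third (y : ℝ) (e : ℕ) :
    ∃ u : Bool, ∃ z : ℤ, (z : ℝ) ≤ y - (if u then 2 ^ e / 3 else 0) ∧
      y - (if u then 2 ^ e / 3 else 0) + 5 / 16 ≤ z + 1 := by
  -- If both grids fail, `y` and `y - 2 ^ e / 3` have fractional parts above `11 / 16`. Then `2 ^ e
  -- / 3` is within `5 / 16` of an integer, and `2 ^ e` is within `15 / 16` of a multiple of `3`, so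
  -- it is one.
  by_contra! hcon
  have h1 := hcon false ⌊y⌋ (by simpa using Int.floor_le y)
  have h2 := hcon true ⌊y - 2 ^ e / 3⌋ (by simpa using Int.floor_le _)
  simp only [Bool.false_eq_true, if_false, if_true, sub_zero] at h1 h2
  have h3 := Int.lt_floor_add_one y
  have h4 := Int.lt_floor_add_one (y - 2 ^ e / 3)
  set a := ⌊y⌋
  set b := ⌊y - 2 ^ e / 3⌋
  have h5 : (2 : ℝ) ^ e < 3 * (a - b) + 1 := by linarith
  have h6 : 3 * ((a : ℝ) - b) < 2 ^ e + 1 := by linarith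
  have h7 : (2 : ℤ) ^ e < 3 * (a - b) + 1 := by exact_mod_cast h5
  have h8 : 3 * (a - b) < (2 : ℤ) ^ e + 1 := by exact_mod_cast h6
  have h9 : (3 : ℤ) ∣ 2 ^ e := ⟨a - b, by omega⟩
  have h10 : (3 : ℤ) ∣ 2 := Int.prime_three.dvd_of_dvd_pow h9
  omega

/-- The translation vectors of the one third trick. -/
noncomputable def thirdShift (K : ℤ) (u : Fin d → Bool) : EuclideanSpace ℝ (Fin d) :=
  WithLp.toLp 2 fun i => if u i then 2 ^ K / 3 else 0

/-- In units of `16 * 2 ^ k` the dilate of `Q` has side `5 / 16` and the shift `2 ^ (N + 4) / 3` is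
a power of two over three. Therefore the same `2 ^ d` shifts work for all levels `k ≤ N`. -/
theorem IsDyadicLattice.exists_translate_cube [NeZero d] {D : Set (Cube d)}
    (hD : IsDyadicLattice D) {N k : ℤ} (hk : k ≤ N) {Q : Cube d} (hQk : Q.side = 2 ^ k) :
    ∃ (u : Fin d → Bool) (P : Cube d), P ∈ Cube.translate (thirdShift (N + 4) u) '' D ∧
      Q.quintuple.toSet ⊆ P.toSet ∧ P.side = 16 * Q.side := by
  obtain ⟨S, hS, hSm, -⟩ := hD.exists_mem (k + 4) 0
  obtain ⟨e, rfl⟩ : ∃ e : ℕ, N = k + e := ⟨(N - k).toNat, by omega⟩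
  have hs : (0 : ℝ) < 2 ^ k := by positivity
  have h16 : (2 : ℝ) ^ (k + 4) = 16 * 2 ^ k := by
    rw [zpow_add₀ (by norm_num)]; norm_num; ring
  have hK : (2 : ℝ) ^ (k + e + 4) = 16 * 2 ^ k * 2 ^ e := by
    rw [zpow_add₀ (by norm_num), zpow_add₀ (by norm_num), zpow_natCast]; norm_num; ring
  choose u z hz1 hz2 using fun i => exists_interval_of_third
    ((Q.corner i - 2 * 2 ^ k - S.corner i) / (16 * 2 ^ k)) e
  obtain ⟨R, hR, hRm, hRc⟩ := hD.exists_grid_cube hS hSm z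
  refine ⟨u, _, ⟨R, hR, rfl⟩, fun x hx => ?_, ?_⟩
  · rw [Cube.mem_quintuple] at hx
    rw [Cube.mem_translate]
    intro i
    have h1 := hx i
    have h2 := hz1 i
    have h3 := hz2 i
    rw [hQk] at h1
    rw [hRc, hRm, h16, PiLp.sub_apply]
    have h4 : thirdShift (k + e + 4) u i = 16 * 2 ^ k * (if u i then 2 ^ e / 3 else 0) := by
      simp only [thirdShift, hK]
      split_ifs <;> ring
    rw [h4]
    set w : ℝ := if u i then 2 ^ e / 3 else 0
    have h5 : (Q.corner i - 2 * 2 ^ k - S.corner i) / (16 * 2 ^ k) * (16 * 2 ^ k) =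
        Q.corner i - 2 * 2 ^ k - S.corner i := by field_simp
    set y := (Q.corner i - 2 * 2 ^ k - S.corner i) / (16 * 2 ^ k)
    constructor
    · nlinarith [h1.1]
    · nlinarith [h1.2]
  · change R.side = _
    rw [hRm, hQk, h16]

end Translate

/-! ### Sparse families -/

section Sparse

theorem exists_sum_le_card_mul_sum_fiber {ι κ : Type*} [DecidableEq κ] (s : Finset ι) (t : Finset κ)
    (ht : t.Nonempty) (φ : ι → κ) (hφ : ∀ i ∈ s, φ i ∈ t) (a : ι → ℝ) :
    ∃ c ∈ t, ∑ i ∈ s, a i ≤ t.card * ∑ i ∈ s with φ i = c, a i := by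
  by_contra! hcon
  have h1 : ∑ i ∈ s, a i = ∑ c ∈ t, ∑ i ∈ s with φ i = c, a i :=
    (Finset.sum_fiberwise_of_maps_to hφ a).symm
  have h2 := Finset.sum_lt_sum_of_nonempty ht hcon
  rw [← Finset.mul_sum, ← h1, Finset.sum_const, nsmul_eq_mul] at h2
  exact lt_irrefl _ h2

variable {d : ℕ}

open Classical in
/-- The number of cubes in the family that strictly contain a given cube. -/
noncomputable def cubeDepth (𝒜 : Finset (Cube d)) (P : Cube d) : ℕ :=
  (𝒜.filter fun S => P.toSet ⊂ S.toSet).card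

variable {D : Set (Cube d)} [NeZero d]

open Classical in
theorem cubeDepth_lt {𝒜 : Finset (Cube d)} {P R : Cube d} (hP : P ∈ 𝒜) (h : R.toSet ⊂ P.toSet) :
    cubeDepth 𝒜 P < cubeDepth 𝒜 R := by
  refine Finset.card_lt_card (Finset.ssubset_iff_subset_ne.2 ⟨fun S hS => ?_, fun heq => ?_⟩)
  · obtain ⟨h1, h2⟩ := Finset.mem_filter.1 hS
    exact Finset.mem_filter.2 ⟨h1, h.trans h2⟩
  · have : P ∈ 𝒜.filter fun S => P.toSet ⊂ S.toSet := by
      rw [heq]; exact Finset.mem_filter.2 ⟨hP, h⟩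
    exact (ssubset_irrefl _) (Finset.mem_filter.1 this).2

open Classical in
-- By nestedness, a cube that strictly contains `R` either strictly contains `P` or lies in `P`, and
-- in both cases it contains `x`.
theorem IsDyadicLattice.cubeDepth_le (hD : IsDyadicLattice D) {𝒜 : Finset (Cube d)}
    (h𝒜 : ∀ P ∈ 𝒜, P ∈ D) {P R : Cube d} (hP : P ∈ 𝒜) (h : R.toSet ⊂ P.toSet)
    {x : EuclideanSpace ℝ (Fin d)} (hx : x ∈ R.toSet) :
    cubeDepth 𝒜 R ≤ cubeDepth 𝒜 P +
      (𝒜.filter fun S => S.toSet ⊆ P.toSet ∧ x ∈ S.toSet).card := by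
  refine (Finset.card_le_card fun S hS => ?_).trans (Finset.card_union_le _ _)
  obtain ⟨h1, h2⟩ := Finset.mem_filter.1 hS
  rw [Finset.mem_union, Finset.mem_filter, Finset.mem_filter]
  rcases le_total S.side P.side with hle | hle
  · exact Or.inr ⟨h1, hD.subset_of_mem (h𝒜 S h1) (h𝒜 P hP) hle (h2.subset hx) (h.subset hx),
      h2.subset hx⟩
  · have h3 := hD.subset_of_mem (h𝒜 P hP) (h𝒜 S h1) hle (h.subset hx) (h2.subset hx)
    by_cases h4 : S.toSet ⊆ P.toSet
    · exact Or.inr ⟨h1, h4, h2.subset hx⟩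
    · exact Or.inl ⟨h1, h3, h4⟩

open Classical in
/-- A family with the Carleson property is a union of few sparse families; one of them carries a
large part of a given sum. -/
theorem IsDyadicLattice.exists_isSparse (hD : IsDyadicLattice D) {𝒜 : Finset (Cube d)}
    (h𝒜 : ∀ P ∈ 𝒜, P ∈ D) {M γ : ℝ} {m : ℕ} (hm : 0 < m) (hMm : M ≤ (1 - γ) * m)
    (hcar : ∀ P ∈ 𝒜, ∑ R ∈ 𝒜 with R.toSet ⊆ P.toSet, volume.real R.toSet ≤
      M * volume.real P.toSet) (ω : Cube d → ℝ) :
    ∃ 𝒬 ⊆ 𝒜, IsSparse γ (𝒬 : Set (Cube d)) ∧ ∑ P ∈ 𝒜, ω P ≤ m * ∑ P ∈ 𝒬, ω P := by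
  -- Nested cubes with the same depth modulo `m` are separated by at least `m` generations.
  obtain ⟨c, -, hc⟩ := exists_sum_le_card_mul_sum_fiber 𝒜 (Finset.range m)
    (Finset.nonempty_range_iff.2 hm.ne') (fun P => cubeDepth 𝒜 P % m)
    (fun P _ => Finset.mem_range.2 (Nat.mod_lt _ hm)) ω
  rw [Finset.card_range] at hc
  set 𝒬 := 𝒜.filter fun P => cubeDepth 𝒜 P % m = c with h𝒬
  have h𝒬𝒜 : 𝒬 ⊆ 𝒜 := Finset.filter_subset _ _
  refine ⟨𝒬, h𝒬𝒜, ⟨fun P => P.toSet \ ⋃ R ∈ 𝒬.filter fun R => R.toSet ⊂ P.toSet, R.toSet,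
    fun P hP => ⟨?_, Set.sdiff_subset, ?_⟩, fun P hP P' hP' hne => ?_⟩, hc⟩
  · exact P.measurableSet_toSet.diff
      (Finset.measurableSet_biUnion _ fun R _ => R.measurableSet_toSet)
  · have hP : P ∈ 𝒬 := hP
    set V := ⋃ R ∈ 𝒬.filter fun R => R.toSet ⊂ P.toSet, R.toSet with hV
    have hVm : MeasurableSet V :=
      Finset.measurableSet_biUnion _ fun R _ => R.measurableSet_toSet
    have hVP : V ⊆ P.toSet := Set.iUnion₂_subset fun R hR => (Finset.mem_filter.1 hR).2.subset
    have hVfin : volume V ≠ ∞ := ne_top_of_le_ne_top P.volume_ne_top (measure_mono hVP)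
    -- A point of `P` covered by a smaller selected cube lies in at least `m` cubes of `𝒜` inside
    -- `P`. Integration and the Carleson property then bound the volume of the covered part `V`.
    have hcount : ∀ x ∈ V, (m : ℝ) ≤ ∑ S ∈ 𝒜 with S.toSet ⊆ P.toSet,
        S.toSet.indicator (fun _ => (1 : ℝ)) x := by
      intro x hx
      obtain ⟨R, hR, hxR⟩ := Set.mem_iUnion₂.1 hx
      obtain ⟨hR𝒬, hRP⟩ := Finset.mem_filter.1 hR
      have e1 := hD.cubeDepth_le h𝒜 (h𝒬𝒜 hP) hRP hxR
      have e2 := cubeDepth_lt (h𝒬𝒜 hP) hRP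
      have e3 : cubeDepth 𝒜 P ≡ cubeDepth 𝒜 R [MOD m] :=
        (Finset.mem_filter.1 hP).2.trans (Finset.mem_filter.1 hR𝒬).2.symm
      have e4 := Nat.le_of_dvd (Nat.sub_pos_of_lt e2) ((Nat.modEq_iff_dvd' e2.le).1 e3)
      have e5 : m ≤ (𝒜.filter fun S => S.toSet ⊆ P.toSet ∧ x ∈ S.toSet).card := by omega
      simp only [Set.indicator_apply, Finset.sum_boole, Finset.filter_filter]
      exact_mod_cast e5
    have hint : ∀ S ∈ 𝒜.filter fun S => S.toSet ⊆ P.toSet,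
        IntegrableOn (S.toSet.indicator fun _ => (1 : ℝ)) V volume := fun S _ =>
      IntegrableOn.indicator (integrableOn_const hVfin) S.measurableSet_toSet
    have h1 : m * volume.real V ≤ M * volume.real P.toSet := by
      refine le_trans ?_ (hcar P (h𝒬𝒜 hP))
      calc m * volume.real V = ∫ x in V, (m : ℝ) := by
            rw [setIntegral_const, smul_eq_mul, mul_comm]
        _ ≤ ∫ x in V, ∑ S ∈ 𝒜 with S.toSet ⊆ P.toSet, S.toSet.indicator (fun _ => (1 : ℝ)) x :=
            setIntegral_mono_on (integrableOn_const hVfin) (integrable_finsetSum _ hint) hVm hcount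
        _ ≤ _ := by
            rw [integral_finsetSum _ hint]
            refine Finset.sum_le_sum fun S _ => ?_
            rw [integral_indicator S.measurableSet_toSet, setIntegral_const, smul_eq_mul, mul_one,
              measureReal_restrict_apply S.measurableSet_toSet]
            exact measureReal_mono Set.inter_subset_left S.volume_ne_top
    have hm0 : (0 : ℝ) < m := by exact_mod_cast hm
    have hPv := P.volume_real_pos
    have h2 : volume.real V ≤ (1 - γ) * volume.real P.toSet := by
      have : m * volume.real V ≤ m * ((1 - γ) * volume.real P.toSet) := by nlinarith
      exact le_of_mul_le_mul_left this hm0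
    rw [measureReal_sdiff hVP hVm P.volume_ne_top]
    linarith
  · refine Set.disjoint_left.2 fun x hx hx' => ?_
    have key : ∀ P ∈ 𝒬, ∀ P' ∈ 𝒬, P ≠ P' → P.side ≤ P'.side → x ∈ P.toSet →
        x ∈ P'.toSet → x ∈ ⋃ R ∈ 𝒬.filter fun R => R.toSet ⊂ P'.toSet, R.toSet := by
      intro P hP P' hP' hne hle h1 h2
      refine Set.mem_iUnion₂.2 ⟨P, Finset.mem_filter.2 ⟨hP, ?_⟩, h1⟩
      have h3 := hD.subset_of_mem (h𝒜 P (h𝒬𝒜 hP)) (h𝒜 P' (h𝒬𝒜 hP')) hle h1 h2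
      exact Set.ssubset_iff_subset_ne.2 ⟨h3, fun heq => hne (Cube.eq_of_toSet_eq heq)⟩
    rcases le_total P.side P'.side with hle | hle
    · exact hx'.2 (key P hP P' hP' hne hle hx.1 hx'.1)
    · exact hx.2 (key P' hP' P hP hne.symm hle hx'.1 hx.1)

open Classical in
/-- A Carleson family is dominated by a sparse family of larger cubes in a translated lattice. -/
theorem IsDyadicLattice.exists_sparse_translate (hD : IsDyadicLattice D) {ℱ : Finset (Cube d)}
    {v : (Fin d → Bool) → EuclideanSpace ℝ (Fin d)} {u : Cube d → Fin d → Bool}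
    {P : Cube d → Cube d} (hP : ∀ Q ∈ ℱ, P Q ∈ Cube.translate (v (u Q)) '' D)
    (hQP : ∀ Q ∈ ℱ, Q.toSet ⊆ (P Q).toSet)
    (hvol : ∀ Q ∈ ℱ, volume.real (P Q).toSet = 16 ^ d * volume.real Q.toSet)
    (hcar : ∀ A : Set (EuclideanSpace ℝ (Fin d)), MeasurableSet A → volume A ≠ ∞ →
        ∑ R ∈ ℱ with R.toSet ⊆ A, volume.real R.toSet ≤ 2 * volume.real A)
    {γ : ℝ} {m : ℕ} (hm : 0 < m) (hMm : 2 * 16 ^ d ≤ (1 - γ) * m) (ω : Cube d → ℝ)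
    (hω : ∀ Q, 0 ≤ ω Q) :
    ∃ D' : Set (Cube d), IsDyadicLattice D' ∧ ∃ 𝒬 : Finset (Cube d), (∀ R ∈ 𝒬, R ∈ D') ∧
      IsSparse γ (𝒬 : Set (Cube d)) ∧
      ∑ Q ∈ ℱ, ω (P Q) ≤ 2 ^ d * (2 * 16 ^ d) * m * ∑ R ∈ 𝒬, ω R := by
  -- The translate that carries the largest part of the sum, at the cost of `2 ^ d`.
  obtain ⟨c, -, hc⟩ := exists_sum_le_card_mul_sum_fiber ℱ Finset.univ
    (Finset.univ_nonempty (α := Fin d → Bool)) u (fun _ _ => Finset.mem_univ _) fun Q => ω (P Q)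
  rw [Finset.card_univ, Fintype.card_fun, Fintype.card_bool, Fintype.card_fin] at hc
  set ℱc := ℱ.filter fun Q => u Q = c with hℱc
  have hℱcℱ : ℱc ⊆ ℱ := Finset.filter_subset _ _
  set 𝒜 := ℱc.image P with h𝒜
  have hsum : ∀ A : Set (EuclideanSpace ℝ (Fin d)), MeasurableSet A → volume A ≠ ∞ →
      ∑ Q ∈ ℱc with (P Q).toSet ⊆ A, volume.real (P Q).toSet ≤ 2 * 16 ^ d * volume.real A := by
    intro A hA hAv
    calc ∑ Q ∈ ℱc with (P Q).toSet ⊆ A, volume.real (P Q).toSet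
        = ∑ Q ∈ ℱc with (P Q).toSet ⊆ A, 16 ^ d * volume.real Q.toSet :=
          Finset.sum_congr rfl fun Q hQ => hvol Q (hℱcℱ (Finset.mem_filter.1 hQ).1)
      _ ≤ ∑ Q ∈ ℱ with Q.toSet ⊆ A, 16 ^ d * volume.real Q.toSet := by
          refine Finset.sum_le_sum_of_subset_of_nonneg (fun Q hQ => ?_) fun _ _ _ => by positivity
          obtain ⟨h1, h2⟩ := Finset.mem_filter.1 hQ
          exact Finset.mem_filter.2 ⟨hℱcℱ h1, (hQP Q (hℱcℱ h1)).trans h2⟩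
      _ ≤ 16 ^ d * (2 * volume.real A) := by
          rw [← Finset.mul_sum]
          exact mul_le_mul_of_nonneg_left (hcar A hA hAv) (by positivity)
      _ = _ := by ring
  have h𝒜D : ∀ R ∈ 𝒜, R ∈ Cube.translate (v c) '' D := by
    intro R hR
    obtain ⟨Q, hQ, rfl⟩ := Finset.mem_image.1 hR
    have := hP Q (hℱcℱ hQ)
    rwa [(Finset.mem_filter.1 hQ).2] at this
  have hD' := hD.translate (v c)
  have hcar' : ∀ R ∈ 𝒜, ∑ S ∈ 𝒜 with S.toSet ⊆ R.toSet, volume.real S.toSet ≤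
      2 * 16 ^ d * volume.real R.toSet := by
    intro R _
    refine le_trans ?_ (hsum R.toSet R.measurableSet_toSet R.volume_ne_top)
    rw [h𝒜, Finset.filter_image]
    exact Finset.sum_image_le_of_nonneg fun _ _ => measureReal_nonneg
  obtain ⟨𝒬, h𝒬, hsp, hle⟩ := hD'.exists_isSparse h𝒜D hm hMm hcar' ω
  refine ⟨_, hD', 𝒬, fun R hR => h𝒜D R (h𝒬 hR), hsp, ?_⟩
  -- Different cubes `Q` may have the same `P Q`. The Carleson property bounds this multiplicity by
  -- `2 * 16 ^ d`.
  have hmult : ∑ Q ∈ ℱc, ω (P Q) ≤ 2 * 16 ^ d * ∑ R ∈ 𝒜, ω R := by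
    rw [← Finset.sum_fiberwise_of_maps_to (g := P) (t := 𝒜)
      fun Q hQ => Finset.mem_image_of_mem P hQ, Finset.mul_sum]
    refine Finset.sum_le_sum fun R hR => ?_
    have e1 : ∑ Q ∈ ℱc with P Q = R, ω (P Q) = ((ℱc.filter fun Q => P Q = R).card : ℝ) * ω R := by
      rw [Finset.sum_congr rfl fun Q hQ => by rw [(Finset.mem_filter.1 hQ).2], Finset.sum_const,
        nsmul_eq_mul]
    have e2 : ((ℱc.filter fun Q => P Q = R).card : ℝ) * volume.real R.toSet ≤
        2 * 16 ^ d * volume.real R.toSet := by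
      refine le_trans ?_ (hsum R.toSet R.measurableSet_toSet R.volume_ne_top)
      rw [← nsmul_eq_mul, ← Finset.sum_const]
      calc ∑ Q ∈ ℱc with P Q = R, volume.real R.toSet
          = ∑ Q ∈ ℱc with P Q = R, volume.real (P Q).toSet :=
            Finset.sum_congr rfl fun Q hQ => by rw [(Finset.mem_filter.1 hQ).2]
        _ ≤ _ := by
            refine Finset.sum_le_sum_of_subset_of_nonneg (fun Q hQ => ?_) fun _ _ _ => by positivity
            obtain ⟨h1, h2⟩ := Finset.mem_filter.1 hQ
            exact Finset.mem_filter.2 ⟨h1, by rw [h2]⟩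
    rw [e1]
    exact mul_le_mul_of_nonneg_right (le_of_mul_le_mul_right e2 R.volume_real_pos) (hω R)
  calc ∑ Q ∈ ℱ, ω (P Q) ≤ 2 ^ d * ∑ Q ∈ ℱc, ω (P Q) := by exact_mod_cast hc
    _ ≤ 2 ^ d * (2 * 16 ^ d * (m * ∑ R ∈ 𝒬, ω R)) := by
        refine mul_le_mul_of_nonneg_left (hmult.trans ?_) (by positivity)
        exact mul_le_mul_of_nonneg_left hle (by positivity)
    _ = _ := by ring

end Sparse

/-! ### The sparse bound -/

section Main

/-- The number of scales for which the single scale bound is used without decay. -/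
noncomputable def windowLength (d : ℕ) (κ A B : ℝ) : ℕ :=
  d + ⌈2 / κ * Real.logb 2 (1 + B / A)⌉₊

/-- The ceiling in `windowLength` makes `2 ^ (κ * ℓ / 2)` at least `1 + B / A`. The additional `d`
levels in its definition are those needed for the estimate of functions with vanishing averages. -/
theorem mul_two_rpow_windowLength_le (d : ℕ) {κ A B : ℝ} (hκ : 0 < κ) (hA : 0 < A) (hB : 0 ≤ B) :
    B * 2 ^ (-κ * windowLength d κ A B / 2) ≤ A := by
  have hx : 0 < 1 + B / A := by positivity
  have h1 : Real.logb 2 (1 + B / A) ≤ κ * windowLength d κ A B / 2 := by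
    have h2 := Nat.le_ceil (2 / κ * Real.logb 2 (1 + B / A))
    have h3 : (windowLength d κ A B : ℝ) = d + ⌈2 / κ * Real.logb 2 (1 + B / A)⌉₊ := by
      rw [windowLength, Nat.cast_add]
    have h4 : 2 / κ * Real.logb 2 (1 + B / A) ≤ windowLength d κ A B := by
      have : (0 : ℝ) ≤ d := Nat.cast_nonneg d
      linarith
    rw [div_mul_eq_mul_div, div_le_iff₀ hκ] at h4
    linarith
  have h2 : 1 + B / A ≤ 2 ^ (κ * windowLength d κ A B / 2) := by
    rw [← Real.logb_le_iff_le_rpow one_lt_two hx]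
    exact h1
  have h3 : -κ * windowLength d κ A B / 2 = -(κ * windowLength d κ A B / 2) := by ring
  rw [h3, Real.rpow_neg (by norm_num), ← div_eq_mul_inv, div_le_iff₀ (by positivity)]
  calc B ≤ A * (1 + B / A) := by
        rw [mul_add, mul_one, mul_div_cancel₀ _ hA.ne']
        linarith
    _ ≤ _ := mul_le_mul_of_nonneg_left h2 hA.le

/-- The additive constants are absorbed because `log (2 + B / A) ≥ log 2`. -/
theorem one_add_windowLength_le (d : ℕ) {κ A B : ℝ} (hκ : 0 < κ) (hA : 0 < A) (hB : 0 ≤ B) :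
    1 + (windowLength d κ A B : ℝ) ≤ (d + 2 + 2 / κ) / Real.log 2 * Real.log (2 + B / A) := by
  have hl := Real.log_pos one_lt_two
  have hBA : 0 ≤ B / A := by positivity
  have h1 : Real.log 2 ≤ Real.log (2 + B / A) := Real.log_le_log two_pos (by linarith)
  have h2 : Real.log (1 + B / A) ≤ Real.log (2 + B / A) :=
    Real.log_le_log (by linarith) (by linarith)
  have h3 : 0 ≤ 2 / κ * Real.logb 2 (1 + B / A) :=
    mul_nonneg (by positivity) (Real.logb_nonneg one_lt_two (by linarith))
  have h4 := (Nat.ceil_lt_add_one h3).le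
  rw [windowLength, Nat.cast_add, div_mul_eq_mul_div ((d : ℝ) + 2 + 2 / κ) (Real.log 2), le_div_iff₀ hl]
  have h5 : 2 / κ * Real.logb 2 (1 + B / A) * Real.log 2 = 2 / κ * Real.log (1 + B / A) := by
    rw [Real.logb]
    field_simp
  have hd : (0 : ℝ) ≤ d + 2 := by positivity
  have hk : 0 ≤ 2 / κ := by positivity
  calc (1 + (d + ⌈2 / κ * Real.logb 2 (1 + B / A)⌉₊ : ℝ)) * Real.log 2
      ≤ (1 + (d + (2 / κ * Real.logb 2 (1 + B / A) + 1))) * Real.log 2 := by gcongr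
    _ = (d + 2) * Real.log 2 + 2 / κ * Real.logb 2 (1 + B / A) * Real.log 2 := by ring
    _ ≤ (d + 2) * Real.log (2 + B / A) + 2 / κ * Real.log (2 + B / A) := by rw [h5]; gcongr
    _ = _ := by ring

variable {d : ℕ} {D : Set (Cube d)} {B₁ B₂ : Type*} [NormedAddCommGroup B₁] [NormedSpace ℝ B₁]
  [NormedAddCommGroup B₂] [NormedSpace ℝ B₂]

theorem vectorForm_sum {T : ℤ → simpleSpace D B₁ →ₗ[ℝ] (EuclideanSpace ℝ (Fin d) → B₂)}
    {Λ : ℤ → simpleSpace D B₁ →ₗ[ℝ] simpleSpace D (StrongDual ℝ B₂) →ₗ[ℝ] ℝ}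
    (hΛ : ∀ j f g, Λ j f g = ∫ x, g x (T j f x))
    (hint : ∀ j f (g : simpleSpace D (StrongDual ℝ B₂)),
      Integrable (fun x => g x (T j f x)) volume)
    (s : Finset ℤ) {n : ℕ} (f : Fin n → simpleSpace D B₁)
    (g : Fin n → simpleSpace D (StrongDual ℝ B₂)) :
    vectorForm (∑ j ∈ s, T j) f g = ∑ i, ∑ j ∈ s, Λ j (f i) (g i) := by
  refine Finset.sum_congr rfl fun i _ => ?_
  simp_rw [LinearMap.sum_apply, Finset.sum_apply, map_sum]
  rw [integral_finsetSum _ fun j _ => hint j (f i) (g i)]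
  exact Finset.sum_congr rfl fun j _ => (hΛ j (f i) (g i)).symm

theorem natCast_rpow_le_rpow (n : ℕ) {s t : ℝ} (hs : 0 < s) (hst : s ≤ t) :
    (n : ℝ) ^ s ≤ (n : ℝ) ^ t := by
  rcases Nat.eq_zero_or_pos n with rfl | hn
  · rw [Nat.cast_zero, Real.zero_rpow hs.ne', Real.zero_rpow (hs.trans_le hst).ne']
  · exact Real.rpow_le_rpow_of_exponent_le (by exact_mod_cast hn) hst

theorem FormBounds.apply_eq_zero {E₁ E₂ : Type*} [NormedAddCommGroup E₁] [NormedSpace ℝ E₁]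
    [NormedAddCommGroup E₂] [NormedSpace ℝ E₂]
    {Λ : ℤ → simpleSpace D E₁ →ₗ[ℝ] simpleSpace D E₂ →ₗ[ℝ] ℝ} {p r κ a₁ a₂ b : ℝ}
    (h : FormBounds Λ p r κ a₁ a₂ 0 b) (j : ℤ) (f : simpleSpace D E₁) (g : simpleSpace D E₂) :
    Λ j f g = 0 := by
  have := h.single j f g
  rw [zero_mul, zero_mul, zero_mul] at this
  exact abs_nonpos_iff.1 this

open Classical in
/-- The sparse bound for forms. -/
theorem FormBounds.exists_sparse [NeZero d] [hD : Fact (IsDyadicLattice D)] {E₁ E₂ : Type*}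
    [NormedAddCommGroup E₁] [NormedSpace ℝ E₁] [NormedAddCommGroup E₂] [NormedSpace ℝ E₂]
    [CompleteSpace E₁] [CompleteSpace E₂]
    {Λ : ℤ → simpleSpace D E₁ →ₗ[ℝ] simpleSpace D E₂ →ₗ[ℝ] ℝ} {p r κ a₁ a₂ a₀ b : ℝ}
    (h : FormBounds Λ p r κ a₁ a₂ a₀ b) (hp : 1 < p) (hr : 1 < r) (hpr : 1 ≤ 1 / p + 1 / r)
    (hκ : 0 < κ) (ha₁ : 0 ≤ a₁) (ha₂ : 0 ≤ a₂) (ha₀ : 0 ≤ a₀) (hb0 : 0 ≤ b)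
    {ℓ : ℕ} (hℓ : d ≤ ℓ) (hb : b * 2 ^ (-κ * ℓ / 2) ≤ a₀) {γ : ℝ} {m : ℕ} (hm : 0 < m)
    (hMm : 2 * 16 ^ d ≤ (1 - γ) * m) (N₁ N₂ : ℤ)
    {n : ℕ} (f : Fin n → simpleSpace D E₁) (g : Fin n → simpleSpace D E₂) :
    ∃ D' : Set (Cube d), IsDyadicLattice D' ∧ ∃ 𝒬 : Finset (Cube d), (∀ R ∈ 𝒬, R ∈ D') ∧
      IsSparse γ (𝒬 : Set (Cube d)) ∧ |∑ i, ∑ j ∈ Finset.Icc N₁ N₂, Λ j (f i) (g i)| ≤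
        stepConst d p r κ * (a₁ + a₂ + a₀ * (1 + ℓ)) * (n : ℝ) ^ (1 + 1 / p + 1 / r) *
          (2 ^ d * (2 * 16 ^ d) * m * ∑ Q ∈ 𝒬, volume.real Q.toSet *
            bodyDot (avgConvexBody hp Q f) (avgConvexBody hr Q g)) := by
  have hex : ∀ Q : Cube d, ∃ uP : (Fin d → Bool) × Cube d, ∀ k, k ≤ N₂ → Q.side = 2 ^ k →
      uP.2 ∈ Cube.translate (thirdShift (N₂ + 4) uP.1) '' D ∧
        Q.quintuple.toSet ⊆ uP.2.toSet ∧ uP.2.side = 16 * Q.side := by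
    intro Q
    by_cases hQ : ∃ k, k ≤ N₂ ∧ Q.side = 2 ^ k
    · obtain ⟨k, hk, hQk⟩ := hQ
      obtain ⟨u, P, hP⟩ := hD.out.exists_translate_cube hk hQk
      exact ⟨(u, P), fun _ _ _ => hP⟩
    -- An arbitrary value for cubes that do not belong to the levels under consideration.
    · exact ⟨(fun _ => true, Q), fun k hk hQk => absurd ⟨k, hk, hQk⟩ hQ⟩
  choose uP huP using hex
  have hvol : ∀ (Q : Cube d) (k : ℤ), k ≤ N₂ → Q.side = 2 ^ k →
      volume.real (uP Q).2.toSet = 16 ^ d * volume.real Q.toSet := fun Q k hk hQk => by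
    rw [Cube.volume_real, Cube.volume_real, (huP Q k hk hQk).2.2, mul_pow]
  obtain ⟨ℱ, h1, h2, h3⟩ := exists_carleson_family h hp hr hpr hκ ha₁ ha₂ ha₀ hb0 hℓ hb N₁ N₂ f g
    (P := fun Q => (uP Q).2) fun Q _ k hk hQk => ⟨(huP Q k hk hQk).2.1, hvol Q k hk hQk⟩
  obtain ⟨D', hD', 𝒬, h4, h5, h6⟩ := hD.out.exists_sparse_translate (ℱ := ℱ)
    (v := thirdShift (N₂ + 4)) (u := fun Q => (uP Q).1) (P := fun Q => (uP Q).2)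
    (fun Q hQ => by
      obtain ⟨-, k, hk, hQk⟩ := h1 Q hQ
      exact (huP Q k hk hQk).1)
    (fun Q hQ => by
      obtain ⟨-, k, hk, hQk⟩ := h1 Q hQ
      exact Q.subset_quintuple.trans (huP Q k hk hQk).2.1)
    (fun Q hQ => by
      obtain ⟨-, k, hk, hQk⟩ := h1 Q hQ
      exact hvol Q k hk hQk)
    h2 hm hMm
    (fun Q => volume.real Q.toSet * bodyDot (avgConvexBody hp Q f) (avgConvexBody hr Q g))
    (fun Q => mul_nonneg measureReal_nonneg (bodyDot_avgConvexBody_nonneg hp hr Q f g))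
  refine ⟨D', hD', 𝒬, h4, h5, h3.trans (mul_le_mul_of_nonneg_left h6 ?_)⟩
  have := stepConst_nonneg d (zero_le_one.trans hp.le) (zero_le_one.trans hr.le) hκ
  positivity

end Main

theorem mainTheorem1 (d : ℕ) (hd : 0 < d) (p q : ℝ) (hp : 1 < p) (hpq : p ≤ q)
    (γ : ℝ) (hγ₀ : 0 < γ) (hγ₁ : γ < 1) (κ : ℝ) (hκ : 0 < κ) :
    ∃ C : ℝ, 0 < C ∧
      ∀ (B₁ : Type*) [NormedAddCommGroup B₁] [NormedSpace ℝ B₁] [CompleteSpace B₁]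
        (B₂ : Type*) [NormedAddCommGroup B₂] [NormedSpace ℝ B₂] [CompleteSpace B₂]
        (D : Set (Cube d)) (_ : IsDyadicLattice D)
        (T : ℤ → simpleSpace D B₁ →ₗ[ℝ] (EuclideanSpace ℝ (Fin d) → B₂))
        (Ap Aq A₀ B : ℝ≥0) (_ : IsBRSFamily T p q κ Ap Aq A₀ B)
        (N₁ N₂ : ℤ) (_ : N₁ ≤ N₂) (n : ℕ)
        (f : Fin n → simpleSpace D B₁) (g : Fin n → simpleSpace D (StrongDual ℝ B₂)),
        ∃ D' : Set (Cube d), IsDyadicLattice D' ∧ ∃ 𝒬 ⊆ D', IsSparse γ 𝒬 ∧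
          Summable (fun Q : 𝒬 => volume.real Q.1.toSet *
            bodyDot (avgConvexBody hp Q.1 f)
              (avgConvexBody (one_lt_conjExponent (hp.trans_le hpq)) Q.1 g)) ∧
          |vectorForm (∑ j ∈ Finset.Icc N₁ N₂, T j) f g| ≤
            C * (Ap + Aq + A₀ * Real.log (2 + B / A₀)) *
              (n : ℝ) ^ (3 / 2 + 1 / p + 1 / q.conjExponent) *
              ∑' Q : 𝒬, volume.real Q.1.toSet *
                bodyDot (avgConvexBody hp Q.1 f)
                  (avgConvexBody (one_lt_conjExponent (hp.trans_le hpq)) Q.1 g) := by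
  have : NeZero d := ⟨hd.ne'⟩
  have hq : 1 < q := hp.trans_le hpq
  have hr := one_lt_conjExponent hq
  set r := q.conjExponent with hrdef
  have hp0 : 0 < p := by linarith
  have hq0 : 0 < q := by linarith
  have hr0 : 0 < r := by linarith
  -- The form in which `p ≤ q` enters the estimates for bad parts.
  have hpr : 1 ≤ 1 / p + 1 / r := by
    have h1 := (Real.HolderConjugate.conjExponent hq).inv_add_inv_eq_one
    rw [← hrdef, ← one_div, ← one_div] at h1
    have h2 := one_div_le_one_div_of_le hp0 hpq
    linarith
  have hp1 : 0 < p - 1 := by linarith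
  have hl2 := Real.log_pos one_lt_two
  -- The number of generations to be skipped so that the Carleson constant `2 * 16 ^ d` leaves the
  -- proportion `γ` of each cube uncovered.
  obtain ⟨m, hm⟩ := exists_nat_gt (2 * 16 ^ d / (1 - γ))
  have h1γ : 0 < 1 - γ := by linarith
  have hm0 : (0 : ℝ) < m := lt_trans (by positivity) hm
  have hMm : 2 * 16 ^ d ≤ (1 - γ) * m := by
    rw [div_lt_iff₀ h1γ] at hm
    linarith
  set c₁ : ℝ := stepConst d p r κ * (2 ^ d * (2 * 16 ^ d) * m) with hc₁
  set c₂ : ℝ := p / (p - 1) + q + (d + 2 + 2 / κ) / Real.log 2 with hc₂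
  have hc₁0 : 0 ≤ c₁ := by
    have := stepConst_nonneg d hp0.le hr0.le hκ
    positivity
  have hc₂0 : 0 ≤ c₂ := by positivity
  -- The summand `1` only serves to make the constant positive.
  refine ⟨c₁ * c₂ + 1, by positivity, ?_⟩
  intro B₁ _ _ _ B₂ _ _ _ D hD T Ap Aq A₀ B hT N₁ N₂ _ n f g
  have : Fact (IsDyadicLattice D) := ⟨hD⟩
  obtain ⟨Λ, hΛ, hint, hF⟩ := hT.exists_form hp hq
  rw [vectorForm_sum hΛ hint]
  -- For `A₀ = 0` the quotient `B / A₀` is meaningless, but the single scale bound makes all forms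
  -- vanish and the empty family suffices.
  rcases eq_or_ne A₀ 0 with h0 | h0
  · subst h0
    have hz : ∑ i, ∑ j ∈ Finset.Icc N₁ N₂, Λ j (f i) (g i) = 0 :=
      Finset.sum_eq_zero fun i _ => Finset.sum_eq_zero fun j _ =>
        FormBounds.apply_eq_zero (by simpa using hF) j _ _
    refine ⟨D, hD, ∅, Set.empty_subset _, ⟨fun _ => ∅, by simp, by simp⟩, summable_of_hasFiniteSupport
      (Set.toFinite _), ?_⟩
    rw [hz, abs_zero, tsum_empty, mul_zero]
  · have hA : (0 : ℝ) < A₀ := NNReal.coe_pos.2 (pos_iff_ne_zero.2 h0)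
    have hB : (0 : ℝ) ≤ B := B.coe_nonneg
    obtain ⟨D', hD', 𝒬, h1, h2, h3⟩ := hF.exists_sparse hp hr hpr hκ (by positivity) (by positivity)
      hA.le hB (ℓ := windowLength d κ A₀ B) (Nat.le_add_right _ _)
      (mul_two_rpow_windowLength_le d hκ hA hB) (by exact_mod_cast hm0) hMm N₁ N₂ f g
    refine ⟨D', hD', 𝒬, fun R hR => h1 R hR, h2, summable_of_hasFiniteSupport (Set.toFinite _), ?_⟩
    rw [Finset.tsum_subtype' 𝒬 fun Q => volume.real Q.toSet *
      bodyDot (avgConvexBody hp Q f) (avgConvexBody hr Q g)]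
    refine h3.trans ?_
    set S := ∑ Q ∈ 𝒬, volume.real Q.toSet *
      bodyDot (avgConvexBody hp Q f) (avgConvexBody hr Q g) with hS
    have hS0 : 0 ≤ S := Finset.sum_nonneg fun Q _ =>
      mul_nonneg measureReal_nonneg (bodyDot_avgConvexBody_nonneg hp hr Q f g)
    set L := Real.log (2 + B / A₀) with hL
    have hL0 : 0 ≤ L := Real.log_nonneg (by
      have : (0 : ℝ) ≤ B / A₀ := by positivity
      linarith)
    have h4 : p / (p - 1) * Ap + q * Aq + A₀ * (1 + windowLength d κ A₀ B) ≤
        c₂ * (Ap + Aq + A₀ * L) := by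
      have e1 := one_add_windowLength_le d hκ hA hB
      have hAp : (0 : ℝ) ≤ Ap := Ap.coe_nonneg
      have hAq : (0 : ℝ) ≤ Aq := Aq.coe_nonneg
      have e2 : p / (p - 1) ≤ c₂ := by
        have : 0 ≤ q + (d + 2 + 2 / κ) / Real.log 2 := by positivity
        linarith
      have e3 : q ≤ c₂ := by
        have : 0 ≤ p / (p - 1) + (d + 2 + 2 / κ) / Real.log 2 := by positivity
        linarith
      have e4 : (d + 2 + 2 / κ) / Real.log 2 ≤ c₂ := by
        have : 0 ≤ p / (p - 1) + q := by positivity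
        linarith
      calc _ ≤ c₂ * Ap + c₂ * Aq + A₀ * (c₂ * L) := by
            gcongr
            exact e1.trans (mul_le_mul_of_nonneg_right e4 hL0)
        _ = _ := by ring
    -- The argument yields the smaller exponent `1 + 1 / p + 1 / r`.
    have h5 := natCast_rpow_le_rpow n (s := 1 + 1 / p + 1 / r) (t := 3 / 2 + 1 / p + 1 / r)
      (by positivity) (by linarith)
    have hst := stepConst_nonneg d hp0.le hr0.le hκ
    calc _ ≤ stepConst d p r κ * (c₂ * (Ap + Aq + A₀ * L)) * (n : ℝ) ^ (3 / 2 + 1 / p + 1 / r) *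
          (2 ^ d * (2 * 16 ^ d) * m * S) := by gcongr
      _ = c₁ * c₂ * ((Ap + Aq + A₀ * L) * (n : ℝ) ^ (3 / 2 + 1 / p + 1 / r) * S) := by
          rw [hc₁]; ring
      _ ≤ (c₁ * c₂ + 1) * ((Ap + Aq + A₀ * L) * (n : ℝ) ^ (3 / 2 + 1 / p + 1 / r) * S) := by
          gcongr
          linarith
      _ = _ := by ring
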